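/- A $\theta$-curve is a spatial graph in $\mathbb{R}^3$ (piecewise linear) with two vertices $v_1,v_2$ and three edges $e_1,e_2,e_3$ joining them. It is trivial if it is ambient isotopic to a $\theta$-curve in a plane, and it is brunnian if it is non-trivial while each of its three subknots $e_i\cup e_j$ is trivial. $\theta$-curves and links are given by diagrams, and ambient isotopy is expressed by the (extended) Reidemeister moves. Let $\Theta$ be a $\theta$-curve with diagram $D$. Orient the edges from $v_1$ to $v_2$, let $\omega_{ii}$ be the sum of the signs of the self-crossings of $e_i$, let $\omega_{ij}$ ($i\ne j$) be the sum of the signs of the crossings between $e_i$ and $e_j$, and put $n_i=-\omega_{ii}+\frac{1}{2}(\omega_{ij}+\omega_{ik}-\omega_{jk})$ for $\{i,j,k\}=\{1,2,3\}$. Let $\langle\cdot\rangle$ be the Kauffman bracket in the variable $A$, with value $1$ on the circle and $\langle\text{crossing}\rangle=A\langle A\text{-smoothing}\rangle+A^{-1}\langle A^{-1}\text{-smoothing}\rangle$. The Jones polynomial of an oriented link $\mathcal{L}$ with diagram $L$ of writhe $\omega$ is $V(\mathcal{L})=(-A^3)^{-\omega}\langle L\rangle$. Let $\mathfrak{J}(D)$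 be the specialization $a=-A^3$, $t=A$ of the Jaeger polynomial: thicken $D$ to a band diagram with bars on all parts of the edges between vertices and crossings; replace each strip with a bar by $\frac{1}{t+t^{-1}}\big(\text{strip with a half twist}+t^{-1}\,\text{strip}+\frac{t-t^{-1}}{1-at}\,\text{cut strip}\big)$, where the half twist is the one whose $A$-smoothing is the strip; and take the bracket of the boundary of each band diagram so obtained. Put $\widetilde{\mathfrak{J}}(\Theta)=(-A^4)^{2(n_1+n_2+n_3)}\,\mathfrak{J}(D)$. Let $Y(D;A)=\sum_s A^{p(s)-m(s)}\,h(D_s;-1,-A-2-A^{-1})$ be the Yamada polynomial. Here $s$ runs over the states, which replace each crossing by its $A$-smoothing ($+$), its $A^{-1}$-smoothing ($-$) or a four-valent vertex ($0$); $p(s)$ and $m(s)$ are the numbers of $+$ and of $-$; $D_s$ is the resulting planar graph; and $h(G;x,y)=\sum_{F\subseteq E(G)}(-x)^{-|F|}x^{\mu(G-F)}y^{\beta(G-F)}$ with $\mu$ the number of components and $\beta$ the first Betti number. Put $\widetilde{Y}(\Theta)=(-A)^{2(n_1+n_2+n_3)}\,Y(D)$. The associated link $\mathcal{L}$ of $\Theta$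 is the boundary of a disk with two holes that has $\Theta$ as a spine and whose Seifert form is zero. It is oriented so that, for cyclic $(i,j,k)$, its $i$-th component is homologous to $e_j-e_k$ on this surface. **Corollary.** Let $\Theta$ be a brunnian $\theta$-curve with associated link $\mathcal{L}$. Then $$\widetilde{\mathfrak{J}}(\Theta)-V(\mathcal{L})=-3+\frac{2}{\varphi^2},\qquad \varphi=A^2+A^{-2}.$$ Moreover, on brunnian $\theta$-curves the normalized Yamada polynomial and the Jones polynomial of the associated link determine each other: if $\Theta,\Theta'$ are brunnian with associated links $\mathcal{L},\mathcal{L}'$, then $\widetilde{Y}(\Theta)=\widetilde{Y}(\Theta')$ if and only if $V(\mathcal{L})=V(\mathcal{L}')$. -/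

import Mathlib

/-! Diagrams of links and of spatial graphs with three-valent vertices, the bracket, Jones,
Jaeger and Yamada polynomials, and the associated link of a theta-curve.

A diagram in the plane is cut by horizontal lines into elementary pieces and is read from the
bottom to the top.  Between two pieces one sees a row of strands, numbered `0, 1, 2, …` from the
left to the right. -/

namespace ThetaCurve

/-! ### Diagrams -/

/-- A strand of an oriented diagram: the name of the edge or of the link component it belongs to,
and its direction (`true` is upward, `false` is downward). -/
abbrev Strand (C : Type) := C × Bool

/-- The same strand with the opposite direction. -/
def Strand.reverse {C : Type} (s : Strand C) : Strand C := (s.1, !s.2)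

/-- The elementary pieces; `i` is the number of strands to the left of the piece.
* `cup i s`: a local minimum, it creates the two strands `s, s.reverse`;
* `cap i`: a local maximum, it joins the strands `i` and `i + 1`;
* `cross i p`: the strands `i` and `i + 1` cross; if `p = true` then the strand from the lower left
  to the upper right is the upper one, if `p = false` then it is the lower one;
* `vertex i out a b c`: a three-valent vertex with its three legs going upward on the page, which
  are, from the left to the right, ends of the edges `a, b, c`; the edges are directed away from the
  vertex if `out = true` and toward it if `out = false`. -/
inductive Piece (C : Type) where
  | cup (i : ℕ) (s : Strand C)
  | cap (i : ℕ)
  | cross (i : ℕ) (p : Bool)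
  | vertex (i : ℕ) (out : Bool) (a b c : C)

/-- A diagram, as the list of its pieces from the bottom to the top. -/
abbrev Diagram (C : Type) := List (Piece C)

/-- The number of strands to the left of a piece. -/
def Piece.pos {C : Type} : Piece C → ℕ
  | .cup i _ => i
  | .cap i => i
  | .cross i _ => i
  | .vertex i _ _ _ _ => i

/-- The same piece at another horizontal position. -/
def Piece.moveTo {C : Type} : Piece C → ℕ → Piece C
  | .cup _ s, j => .cup j s
  | .cap _, j => .cap j
  | .cross _ p, j => .cross j p
  | .vertex _ o a b c, j => .vertex j o a b c

/-- The number of strands that enter a piece from below. -/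
def Piece.ins {C : Type} : Piece C → ℕ
  | .cup _ _ => 0
  | .cap _ => 2
  | .cross _ _ => 2
  | .vertex _ _ _ _ _ => 0

/-- The number of strands that leave a piece upward. -/
def Piece.outs {C : Type} : Piece C → ℕ
  | .cup _ _ => 2
  | .cap _ => 0
  | .cross _ _ => 2
  | .vertex _ _ _ _ _ => 3

/-- The row of strands above a piece, from the row below it (`none` if the piece does not fit:
a missing strand, or a cap whose two strands do not belong to the same oriented edge). -/
def step {C : Type} [DecidableEq C] (l : List (Strand C)) : Piece C → Option (List (Strand C))
  | .cup i s => if i ≤ l.length then some (l.take i ++ s :: s.reverse :: l.drop i) else none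
  | .cap i =>
    match l.drop i with
    | x :: y :: r => if y = x.reverse then some (l.take i ++ r) else none
    | _ => none
  | .cross i _ =>
    match l.drop i with
    | x :: y :: r => some (l.take i ++ y :: x :: r)
    | _ => none
  | .vertex i o a b c =>
    if i ≤ l.length then some (l.take i ++ (a, o) :: (b, o) :: (c, o) :: l.drop i) else none

/-- The diagram is well formed, and no strand is open at the bottom or at the top. -/
def Closed {C : Type} [DecidableEq C] (D : Diagram C) : Prop :=
  List.foldlM step [] D = some []

/-- The diagram has no crossing, that is, it shows a graph in the plane. -/
def Crossingless {C : Type} (D : Diagram C) : Prop := ∀ i p, Piece.cross i p ∉ D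

/-! ### Ambient isotopy -/

/-- The local moves: the planar isotopies of cut diagrams, the Reidemeister moves, passing a strand
over or under a vertex, and twisting two neighbouring legs of a vertex. -/
inductive LocalMove {C : Type} : Diagram C → Diagram C → Prop
  /-- two pieces side by side change their heights -/
  | exchange (g h : Piece C) (hgh : g.pos + g.ins ≤ h.pos) :
      LocalMove [h, g] [g, h.moveTo (h.pos - g.ins + g.outs)]
  /-- straightening a strand -/
  | zigzag_left (i : ℕ) (s : Strand C) : LocalMove [.cup i s, .cap (i + 1)] []
  | zigzag_right (i : ℕ) (s : Strand C) : LocalMove [.cup (i + 1) s, .cap i] []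
  /-- turning a vertex in the plane -/
  | vertex_turn (i : ℕ) (o : Bool) (a b c : C) :
      LocalMove [.cup i (a, !o), .vertex (i + 1) o a b c, .cap i] [.vertex i o b c a]
  /-- a strand is moved across a local minimum or a local maximum -/
  | cup_slide (i : ℕ) (s : Strand C) (p : Bool) :
      LocalMove [.cup i s, .cross (i + 1) p, .cross i p] [.cup (i + 1) s]
  | cap_slide (i : ℕ) (p : Bool) :
      LocalMove [.cross i p, .cross (i + 1) p, .cap i] [.cap (i + 1)]
  /-- first Reidemeister move -/
  | cup_curl (i : ℕ) (s : Strand C) (p : Bool) : LocalMove [.cup i s, .cross i p] [.cup i s.reverse]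
  | cap_curl (i : ℕ) (p : Bool) : LocalMove [.cross i p, .cap i] [.cap i]
  /-- second Reidemeister move -/
  | cancel (i : ℕ) (p : Bool) : LocalMove [.cross i p, .cross i !p] []
  /-- third Reidemeister move -/
  | braid (i : ℕ) (p : Bool) :
      LocalMove [.cross i p, .cross (i + 1) p, .cross i p]
        [.cross (i + 1) p, .cross i p, .cross (i + 1) p]
  /-- a strand passes over or under a vertex -/
  | vertex_slide (i : ℕ) (o : Bool) (a b c : C) (p : Bool) :
      LocalMove [.vertex i o a b c, .cross (i + 2) p, .cross (i + 1) p, .cross i p]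
        [.vertex (i + 1) o a b c]
  /-- two neighbouring legs of a vertex are twisted -/
  | vertex_twist_left (i : ℕ) (o : Bool) (a b c : C) (p : Bool) :
      LocalMove [.vertex i o a b c, .cross i p] [.vertex i o b a c]
  | vertex_twist_right (i : ℕ) (o : Bool) (a b c : C) (p : Bool) :
      LocalMove [.vertex i o a b c, .cross (i + 1) p] [.vertex i o a c b]

/-- One local move inside a closed diagram. -/
def Move {C : Type} [DecidableEq C] (D D' : Diagram C) : Prop :=
  Closed D ∧ Closed D' ∧
    ∃ p a b q : Diagram C, LocalMove a b ∧ D = p ++ a ++ q ∧ D' = p ++ b ++ q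

/-- The two diagrams show ambient isotopic links or spatial graphs. -/
def Isotopic {C : Type} [DecidableEq C] : Diagram C → Diagram C → Prop := Relation.EqvGen Move

/-- The diagram shows a trivial (unknotted) knot or graph: one that is ambient isotopic to a knot or
graph in the plane. -/
def IsTrivial {C : Type} [DecidableEq C] (D : Diagram C) : Prop :=
  ∃ D' : Diagram C, Isotopic D D' ∧ Crossingless D'

/-! ### Signs of crossings -/

/-- The crossings of a diagram above the row of strands `l`, from the bottom to the top, each with
its left and right strand below the crossing, and with its type. -/
def crossings {C : Type} [DecidableEq C] :
    List (Strand C) → Diagram C → List (Strand C × Strand C × Bool)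
  | _, [] => []
  | l, .cross i p :: D =>
    match l.drop i with
    | x :: y :: r => (x, y, p) :: crossings (l.take i ++ y :: x :: r) D
    | _ => []
  | l, g :: D => crossings ((step l g).getD []) D

/-- The sign of a crossing with respect to the directions of its two strands. -/
def crossingSign {C : Type} (x : Strand C × Strand C × Bool) : ℤ :=
  if (x.1.2 == x.2.1.2) = x.2.2 then 1 else -1

/-- The sum of the signs of all crossings. -/
def writhe {C : Type} [DecidableEq C] (D : Diagram C) : ℤ :=
  ((crossings [] D).map crossingSign).sum

/-- The sum of the signs of the crossings between two different components (or edges) `i` and `j`.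
For two components of a link this is twice their linking number. -/
def crossingSum {C : Type} [DecidableEq C] (i j : C) (D : Diagram C) : ℤ :=
  (((crossings [] D).filter
    (fun x => (x.1.1 = i ∧ x.2.1.1 = j) ∨ (x.1.1 = j ∧ x.2.1.1 = i))).map crossingSign).sum

/-! ### The bracket polynomial and the Jones polynomial -/

/-- The pieces of a link diagram without names and directions. -/
inductive LinkPiece where
  | cup (i : ℕ)
  | cap (i : ℕ)
  | cross (i : ℕ) (p : Bool)

/-- Forget names and directions (used for diagrams without vertices only). -/
def Piece.forget {C : Type} : Piece C → List LinkPiece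
  | .cup i _ => [.cup i]
  | .cap i => [.cap i]
  | .cross i p => [.cross i p]
  | .vertex _ _ _ _ _ => []

/-- The number of closed curves that are completed above the row `l`.  An entry of `l` is the name
of the connected curve, below the row, to which the strand belongs; `n` is the next unused name. -/
def loopsAux : List ℕ → ℕ → List LinkPiece → ℕ
  | _, _, [] => 0
  | l, n, .cup i :: w => loopsAux (l.take i ++ n :: n :: l.drop i) (n + 1) w
  | l, n, .cap i :: w =>
    match l.drop i with
    | a :: b :: r =>
      (if a = b then 1 else 0) +
        loopsAux ((l.take i ++ r).map (fun x => if x = b then a else x)) n w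
    | _ => 0
  | l, n, .cross i _ :: w =>
    match l.drop i with
    | a :: b :: r => loopsAux (l.take i ++ b :: a :: r) n w
    | _ => 0

/-- The number of components of a link diagram. -/
def loops (w : List LinkPiece) : ℕ := loopsAux [] 0 w

/-- The states of a link diagram: each crossing is replaced by one of its two smoothings.  A state
is recorded as the number of `A`-smoothings minus the number of `A⁻¹`-smoothings, together with the
resulting diagram without crossings.  The `A`-smoothing joins the two regions that the upper strand
sweeps out when it is turned counter-clockwise. -/
def bracketStates : List LinkPiece → List (ℤ × List LinkPiece)
  | [] => [(0, [])]
  | .cross i true :: w =>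
    (bracketStates w).flatMap fun s => [(s.1 + 1, s.2), (s.1 - 1, .cap i :: .cup i :: s.2)]
  | .cross i false :: w =>
    (bracketStates w).flatMap fun s => [(s.1 + 1, .cap i :: .cup i :: s.2), (s.1 - 1, s.2)]
  | g :: w => (bracketStates w).map fun s => (s.1, g :: s.2)

/-- The Kauffman bracket, with value `1` on a simple circle. -/
def bracket {K : Type} [Field K] (A : K) (w : List LinkPiece) : K :=
  ((bracketStates w).map fun s => A ^ s.1 * (-A ^ 2 - A⁻¹ ^ 2) ^ ((loops s.2 : ℤ) - 1)).sum

/-- The Jones polynomial of an oriented link diagram, in the variable `A`. -/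
def jones {K : Type} [Field K] (A : K) {C : Type} [DecidableEq C] (L : Diagram C) : K :=
  (-A ^ 3) ^ (-writhe L) * bracket A (L.flatMap Piece.forget)

/-! ### Theta-curves -/

/-- The directions of the vertices of a diagram, with the names of their legs from the left to the
right. -/
def vertexList {C : Type} (D : Diagram C) : List (Bool × List C) :=
  D.filterMap fun g =>
    match g with
    | .vertex _ o a b c => some (o, [a, b, c])
    | _ => none

/-- Apply `f` to the strands of a diagram and delete those that go to `none`.  A vertex that keeps
exactly two legs becomes an interior point of a strand. -/
def restrict {C C' : Type} [DecidableEq C] (f : Strand C → Option (Strand C')) :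
    List (Strand C) → Diagram C → Diagram C'
  | _, [] => []
  | l, g :: D =>
    let k := ((l.take g.pos).filterMap f).length
    let here : Diagram C' :=
      match g with
      | .cup _ s =>
        match f s with
        | some t => [.cup k t]
        | none => []
      | .cap i =>
        match ((l.drop i).take 2).filterMap f with
        | [_, _] => [.cap k]
        | _ => []
      | .cross i p =>
        match ((l.drop i).take 2).filterMap f with
        | [_, _] => [.cross k p]
        | _ => []
      | .vertex _ o a b c =>
        match [(a, o), (b, o), (c, o)].filterMap f with
        | [t, _] => [.cup k t]
        | _ => []
    here ++ restrict f ((step l g).getD []) D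

/-- The subknot that consists of the two edges other than `k`, directed as `k + 1` minus `k + 2`. -/
def subknot (D : Diagram (Fin 3)) (k : Fin 3) : Diagram Unit :=
  restrict
    (fun s => if s.1 = k then none else if s.1 = k + 1 then some ((), s.2) else some ((), !s.2))
    [] D

/-- A diagram of a theta-curve with edges `0, 1, 2`, directed from the first vertex to the second
one.  (The last condition says that there are no closed curves besides the theta-curve.) -/
def IsTheta (D : Diagram (Fin 3)) : Prop :=
  Closed D ∧
  (∃ r r' : List (Fin 3), r.Perm [0, 1, 2] ∧ r'.Perm [0, 1, 2] ∧
    (vertexList D).Perm [(true, r), (false, r')]) ∧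
  ∀ k : Fin 3, loops ((subknot D k).flatMap Piece.forget) = 1

/-- A theta-curve is brunnian if it is non-trivial and its three subknots are trivial. -/
def IsBrunnian (D : Diagram (Fin 3)) : Prop :=
  IsTheta D ∧ ¬ IsTrivial D ∧ ∀ k : Fin 3, IsTrivial (subknot D k)

/-- `2 (n₁ + n₂ + n₃)`, where `nᵢ = - ωᵢᵢ + (ωᵢⱼ + ωᵢₖ - ωⱼₖ) / 2` and `ωᵢⱼ` is the sum of the signs
of the crossings between the edges `i` and `j`: a crossing of an edge with itself contributes `-2`
times its sign, a crossing of two different edges contributes its sign. -/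
def twistNumber (D : Diagram (Fin 3)) : ℤ :=
  ((crossings [] D).map
    fun x => (if x.1.1 = x.2.1.1 then -2 else 1) * crossingSign x).sum

/-! ### The associated link -/

/-- In the counter-clockwise direction the edges appear in the order `(2, 1, 0)` at the first vertex
and in the order `(0, 1, 2)` at the second one, up to cyclic permutation.  (The legs of a vertex go
upward, so that they are met from the right to the left.) -/
def StandardOrder (D : Diagram (Fin 3)) : Prop :=
  ∀ i o a b c, Piece.vertex i o a b c ∈ D →
    (o = true → b = a + 1 ∧ c = a + 2) ∧ (o = false → b = a + 2 ∧ c = a + 1)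

/-- `n` full twists of the strands `j` and `j + 1`; if the strands are antiparallel and `n > 0` then
the `2 n` crossings are negative. -/
def fullTwists (j : ℕ) (n : ℤ) : Diagram (Fin 3) :=
  List.replicate (2 * n.natAbs) (.cross j (decide (0 ≤ n)))

/-- The boundary of the band surface: the edges of the diagram are thickened in the plane to bands,
and `m e` full twists are put into the band of the edge `e` (near the first vertex).  A strand
becomes the two sides of a band.  The component `k` of the boundary runs along the edge `k + 1` in
its direction, on its right side, and back along the edge `k + 2`, on its left side. -/
def boundaryPiece (m : Fin 3 → ℤ) : Piece (Fin 3) → Diagram (Fin 3)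
  | .cup i (e, true) => [.cup (2 * i) (e + 1, false), .cup (2 * i + 1) (e + 2, true)]
  | .cup i (e, false) => [.cup (2 * i) (e + 2, false), .cup (2 * i + 1) (e + 1, true)]
  | .cap i => [.cap (2 * i + 1), .cap (2 * i)]
  | .cross i p =>
    [.cross (2 * i + 1) p, .cross (2 * i) p, .cross (2 * i + 2) p, .cross (2 * i + 1) p]
  | .vertex i true a b c =>
    [.cup (2 * i) (a + 1, false), .cup (2 * i + 1) (a + 2, true), .cup (2 * i + 3) (b + 2, true)] ++
      fullTwists (2 * i) (m a) ++ fullTwists (2 * i + 2) (m b) ++ fullTwists (2 * i + 4) (m c)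
  | .vertex i false a b _ =>
    [.cup (2 * i) (a + 2, false), .cup (2 * i + 1) (a + 1, true), .cup (2 * i + 3) (b + 1, true)]

/-- The boundary link of the band surface with `m e` full twists in the band of the edge `e`. -/
def bandBoundary (m : Fin 3 → ℤ) (D : Diagram (Fin 3)) : Diagram (Fin 3) :=
  D.flatMap (boundaryPiece m)

/-- The Seifert form of the band surface vanishes.  The surface is a disk with two holes, so that
its first homology is generated by its boundary components, whose sum is zero; hence the form is
determined by the linking numbers of pairs of different boundary components. -/
def SeifertFormZero (m : Fin 3 → ℤ) (D : Diagram (Fin 3)) : Prop :=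
  ∀ i j : Fin 3, i ≠ j → crossingSum i j (bandBoundary m D) = 0

/-- `L` is a diagram of the associated link of the theta-curve shown by `D`: the boundary of a disk
with two holes that has the theta-curve as a spine and whose Seifert form is zero. -/
def IsAssociatedLink (D L : Diagram (Fin 3)) : Prop :=
  ∃ (D' : Diagram (Fin 3)) (m : Fin 3 → ℤ), Isotopic D D' ∧ StandardOrder D' ∧
    SeifertFormZero m D' ∧ Isotopic (bandBoundary m D') L

/-! ### The Jaeger polynomial -/

/-- The pieces of a band diagram with bars; `bar i` is a bar across the strip that is bounded by the
strands `i` and `i + 1`. -/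
inductive BandPiece where
  | link (g : LinkPiece)
  | bar (i : ℕ)

/-- The bar diagram of a diagram: edges are thickened to strips, and each part of an edge between
vertices and crossings gets bars. -/
def barPiece {C : Type} : Piece C → List BandPiece
  | .cup i _ => [.link (.cup (2 * i)), .link (.cup (2 * i + 1)), .bar (2 * i)]
  | .cap i => [.link (.cap (2 * i + 1)), .link (.cap (2 * i))]
  | .cross i p =>
    [.link (.cross (2 * i + 1) p), .link (.cross (2 * i) p), .link (.cross (2 * i + 2) p),
      .link (.cross (2 * i + 1) p), .bar (2 * i), .bar (2 * i + 2)]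
  | .vertex i _ _ _ _ =>
    [.link (.cup (2 * i)), .link (.cup (2 * i + 1)), .link (.cup (2 * i + 3)),
      .bar (2 * i), .bar (2 * i + 2), .bar (2 * i + 4)]

/-- Elimination of the bars: a strip with a bar is `(t + t⁻¹)⁻¹` times the sum of the strip with a
half twist, `t⁻¹` times the strip with no bar, and `(t - t⁻¹) / (1 - a t)` times the strip that is
cut.  The result is a list of coefficients and link diagrams. -/
def eliminateBars {K : Type} [Field K] (a t : K) : List BandPiece → List (K × List LinkPiece)
  | [] => [(1, [])]
  | .link g :: w => (eliminateBars a t w).map fun x => (x.1, g :: x.2)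
  | .bar i :: w =>
    (eliminateBars a t w).flatMap fun x =>
      [((t + t⁻¹)⁻¹ * x.1, .cross i true :: x.2),
        ((t + t⁻¹)⁻¹ * t⁻¹ * x.1, x.2),
        ((t + t⁻¹)⁻¹ * ((t - t⁻¹) / (1 - a * t)) * x.1, .cap i :: .cup i :: x.2)]

/-- The one-variable specialization `a = -A³`, `t = A` of the Jaeger polynomial of a diagram.  (For
these values the Dubrovnik polynomial of a link diagram is the bracket.) -/
def jaeger {K : Type} [Field K] (A : K) {C : Type} (D : Diagram C) : K :=
  ((eliminateBars (-A ^ 3) A (D.flatMap barPiece)).map fun x => x.1 * bracket A x.2).sum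

/-- The normalized Jaeger polynomial of a theta-curve. -/
def normalizedJaeger {K : Type} [Field K] (A : K) (D : Diagram (Fin 3)) : K :=
  (-A ^ 4) ^ twistNumber D * jaeger A D

/-! ### The Yamada polynomial -/

/-- The pieces of a planar graph with three- and four-valent vertices; `vertex4 i` has the two legs
`i` and `i + 1` below and two legs above it. -/
inductive GraphPiece where
  | cup (i : ℕ)
  | cap (i : ℕ)
  | vertex3 (i : ℕ)
  | vertex4 (i : ℕ)

/-- An abstract finite multigraph: the list of its vertices, each given as the list of the names of
the edges at it (a loop is listed twice). -/
abbrev Multigraph := List (List ℕ)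

/-- Read off the graph.  The entries of the row `l` are the names of the edges of its strands, `n` is
the next unused name, `G` is the graph found so far.  A circle without vertices counts as a graph
with one vertex and one edge. -/
def graphAux : List ℕ → ℕ → Multigraph → List GraphPiece → Multigraph
  | _, _, G, [] => G
  | l, n, G, .cup i :: w => graphAux (l.take i ++ n :: n :: l.drop i) (n + 1) G w
  | l, n, G, .cap i :: w =>
    match l.drop i with
    | a :: b :: r =>
      if a = b then graphAux (l.take i ++ r) n ([a, a] :: G) w
      else graphAux ((l.take i ++ r).map (fun x => if x = b then a else x)) n
        (G.map (List.map (fun x => if x = b then a else x))) w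
    | _ => G
  | l, n, G, .vertex3 i :: w =>
    graphAux (l.take i ++ n :: (n + 1) :: (n + 2) :: l.drop i) (n + 3) ([n, n + 1, n + 2] :: G) w
  | l, n, G, .vertex4 i :: w =>
    match l.drop i with
    | a :: b :: r => graphAux (l.take i ++ n :: (n + 1) :: r) (n + 2) ([a, b, n, n + 1] :: G) w
    | _ => G

/-- The abstract graph of a planar graph without crossings. -/
def graphOf (w : List GraphPiece) : Multigraph := graphAux [] 0 [] w

/-- The set of edges. -/
def Multigraph.edges (G : Multigraph) : Finset ℕ := G.flatten.toFinset

/-- The number of connected components of `G - F`. -/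
noncomputable def Multigraph.components (G : Multigraph) (F : Finset ℕ) : ℕ :=
  Nat.card (SimpleGraph.fromRel
    (fun u v : Fin G.length => ∃ e, e ∉ F ∧ e ∈ G.get u ∧ e ∈ G.get v)).ConnectedComponent

/-- The first Betti number of `G - F`, for a set `F` of edges: edges plus components minus
vertices. -/
noncomputable def Multigraph.betti (G : Multigraph) (F : Finset ℕ) : ℕ :=
  (G.edges.card - F.card) + G.components F - G.length

/-- The polynomial `h(G; x, y)`. -/
noncomputable def Multigraph.h {K : Type} [Field K] (G : Multigraph) (x y : K) : K :=
  ∑ F ∈ G.edges.powerset, (-x) ^ (-(F.card : ℤ)) * x ^ G.components F * y ^ G.betti F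

/-- The states of a diagram: each crossing is replaced by its `A`-smoothing (`+`), by its
`A⁻¹`-smoothing (`-`) or by a four-valent vertex (`0`).  A state is recorded as the number of `+`
minus the number of `-`, together with the resulting planar graph. -/
def yamadaStates {C : Type} : Diagram C → List (ℤ × List GraphPiece)
  | [] => [(0, [])]
  | .cup i _ :: D => (yamadaStates D).map fun s => (s.1, .cup i :: s.2)
  | .cap i :: D => (yamadaStates D).map fun s => (s.1, .cap i :: s.2)
  | .vertex i _ _ _ _ :: D => (yamadaStates D).map fun s => (s.1, .vertex3 i :: s.2)
  | .cross i true :: D =>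
    (yamadaStates D).flatMap fun s =>
      [(s.1 + 1, s.2), (s.1 - 1, .cap i :: .cup i :: s.2), (s.1, .vertex4 i :: s.2)]
  | .cross i false :: D =>
    (yamadaStates D).flatMap fun s =>
      [(s.1 + 1, .cap i :: .cup i :: s.2), (s.1 - 1, s.2), (s.1, .vertex4 i :: s.2)]

/-- The Yamada polynomial of a diagram. -/
noncomputable def yamada {K : Type} [Field K] (A : K) {C : Type} (D : Diagram C) : K :=
  ((yamadaStates D).map fun s => A ^ s.1 * (graphOf s.2).h (-1) (-A - 2 - A⁻¹)).sum

/-- The normalized Yamada polynomial of a theta-curve. -/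
noncomputable def normalizedYamada {K : Type} [Field K] (A : K) (D : Diagram (Fin 3)) : K :=
  (-A) ^ twistNumber D * yamada A D

end ThetaCurve

open ThetaCurve

/-! Put d = -A² - A⁻² (`loopValue`), so that d² = φ². Double every strand of a diagram and read the
result in a Temperley-Lieb algebra. On a doubled strand the identity is the sum of two orthogonal
idempotents (`TL.pr`): e/d, where e cuts the strip, and the Jones-Wenzl projector 1 - e/d. A map χ
from the edges of a theta-curve to two colours gives a value Z(χ), in which the edge i carries the
projector of the colour χ(i).

The Jaeger polynomial. For a = -A³ and t = A the elimination of a bar is the expansion of 1 - e/d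
(`TL.bar_expand`). Hence J is Z/d for the colouring with all edges non-trivial (`TL.jaeger_value`).

The associated link. The boundary of the band surface is the doubled diagram with full twists.
Writing the identity of each strip as the sum of the two projectors (`lift_sum`) expands its bracket
over the eight colourings χ. Full twists act on the projectors by scalars, and the vanishing of the
Seifert form forces nᵢ full twists in the band i (`IsThetaLike.twists`). Together with the writhe
this gives V = d⁻¹ ∑ (-A⁴)^(2 ∑ nᵢ) Z(χ), where the inner sum is over the non-trivial edges of χ
(`TL.jones_bandBoundary`). The colouring with three non-trivial edges contributes the normalized
Jaeger polynomial. Exactly one non-trivial edge contributes 0, because of what happens at a vertex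
(`TL.vert_single`). In the remaining cases the trivial edges can be deleted at the cost of a factor
1/d (`TL.restrict_closed`): no non-trivial edge gives Z = 1/d, and two of them give the normalized
value (d² - 1)/d, since the subknot is trivial (`TL.value_pair`). The sum is V = J + 3 (1 - d⁻²) +
d⁻² = J + 3 - 2 d⁻², with J normalized (`TL.jones_associatedLink`).

Invariance. The surface may be built on another diagram of the same theta-curve, so the normalized
values must be unchanged by the moves. This is proved once for abstract algebraic data
(`Ops.Laws.isotopic`); the data for doubled strands satisfy the required relations by Temperley-Lieb
calculus (`TL.cabled_laws`, `theta_laws`). That no additional closed curve can appear follows by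
counting the colourings of the strands by two colours, which is also an invariant
(`Isotopic.card_closedLifts`).

The Yamada polynomial. Between Jones-Wenzl projectors a doubled crossing satisfies Yamada's skein
relation in the variable A⁴ (`TL.cable_skein`), which reduces Z to planar graphs. For these, h(G;
-1, -d²) is a sum over the ways to cut the strips of the thickened graph (`h_eq`). Both sides are
Laurent polynomials in d, so it is enough to treat positive integers d = q; there the Temperley-Lieb
relations have a model with q² spins, in which both sides are the same sum over spins. Hence the
normalized polynomials satisfy Y(A⁴) = -d² J(A) (`TL.normalizedYamada_eq`). As A ↦ A⁴ is injective
on rational functions, Y and J determine each other, and J and V differ by a fixed function.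

All values are taken in one model (`vertexModel`); on closed crossingless words the relations alone
force the value (`TLRel.unique`). -/

set_option linter.unusedSectionVars false
set_option linter.unusedSimpArgs false
set_option linter.unnecessarySeqFocus false

namespace ThetaCurve

open List (append_assoc mem_append map_append map_cons map_congr_left mem_cons mem_of_mem_take
  mem_of_mem_drop mem_map map_map map_id length_append cons_append nil_append length_map
  length_eq_zero_iff length_eq_two drop_left flatMap_cons sum_map_mul_left mem_flatMap
  not_mem_nil sum_cons map_nil prod_cons prod_nil length_cons length_nil flatMap_nil append_nil
  sum_nil mem_toFinset take_left filterMap_cons count_append count_cons count_nil mem_map_of_mem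
  Perm mem_flatten flatten_cons count_cons_self count_eq_zero count_cons_of_ne perm_iff_count)
open Finset (sum_add_distrib mul_sum sum_comm sum_congr mem_powerset univ mem_univ card_le_card
  sum_mul sum_insert sum_eq_zero mem_sdiff)
open Function (comp_def update update_apply update_self update_of_ne update_comm update_idem)
open Option (bind_eq_some_iff bind_some)
open Nat (exists_eq_add_of_le lt_succ_self even_or_odd' le_succ)
open Bool (false_eq_true not_eq_true)

/-! ### Crossingless words are determined by the Temperley-Lieb relations -/

/-- The word can be read above a row of `n` strands and leaves no strand open at the top. -/
def Fits : ℕ → List LinkPiece → Prop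
  | n, [] => n = 0
  | n, .cup i :: w => i ≤ n ∧ Fits (n + 2) w
  | n, .cap i :: w => i + 2 ≤ n ∧ Fits (n - 2) w
  | n, .cross i _ :: w => i + 2 ≤ n ∧ Fits n w

/-- The word has no crossing. -/
def NoCross (w : List LinkPiece) : Prop := ∀ i p, LinkPiece.cross i p ∉ w

/-- A word of local minima that ends with `n` strands. -/
inductive CupWord : ℕ → List LinkPiece → Prop
  | nil : CupWord 0 []
  | snoc {n : ℕ} {u : List LinkPiece} (i : ℕ) : CupWord n u → i ≤ n → CupWord (n + 2) (u ++ [.cup i])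

theorem CupWord.fits_append {n : ℕ} {u : List LinkPiece} (hu : CupWord n u) :
    ∀ w, Fits n w → Fits 0 (u ++ w) := by
  induction hu with
  | nil => intro w hw; simpa using hw
  | snoc i hu hi ih =>
    intro w hw
    rw [append_assoc]
    exact ih _ ⟨hi, hw⟩

theorem CupWord.noCross {n : ℕ} {u : List LinkPiece} (hu : CupWord n u) : NoCross u := by
  induction hu with
  | nil => intro i p; simp
  | snoc i hu hi ih => intro j p; simpa using ih j p

/-- The Temperley-Lieb relations for a function on words. -/
structure TLRel {K : Type*} [CommMonoid K] (d : K) (E : List LinkPiece → K) : Prop where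
  nil : E [] = 1
  loop : ∀ {n u}, CupWord n u → ∀ i w, i ≤ n → E (u ++ .cup i :: .cap i :: w) = d * E (u ++ w)
  zig : ∀ {n u}, CupWord n u → ∀ i w, i < n → E (u ++ .cup i :: .cap (i + 1) :: w) = E (u ++ w)
  zag : ∀ {n u}, CupWord n u → ∀ i w, i < n → E (u ++ .cup (i + 1) :: .cap i :: w) = E (u ++ w)
  far_right : ∀ {n u}, CupWord n u → ∀ i j w, j ≤ i → i + 2 ≤ n →
    E (u ++ .cup j :: .cap (i + 2) :: w) = E (u ++ .cap i :: .cup j :: w)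
  far_left : ∀ {n u}, CupWord n u → ∀ i j w, i ≤ j → j + 2 ≤ n →
    E (u ++ .cup (j + 2) :: .cap i :: w) = E (u ++ .cap i :: .cup j :: w)

/-- The maximum is compared with the last minimum of `u`. At the same position they form a circle,
at neighbouring positions they straighten, and otherwise the maximum moves below the minimum and
meets a shorter word of minima. The word `w'` and the exponent `k` are chosen before `E`, so one
reduction serves two functions at once. -/
theorem cupWord_cap_reduce {n : ℕ} {u : List LinkPiece} (hu : CupWord n u) :
    ∀ (i : ℕ) (w : List LinkPiece), i + 2 ≤ n → Fits (n - 2) w → NoCross w →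
    ∃ w' : List LinkPiece, w'.length + 1 = u.length + w.length ∧ Fits 0 w' ∧ NoCross w' ∧
      ∃ k : ℕ, ∀ {K : Type} [CommMonoid K] (d : K) (E : List LinkPiece → K), TLRel d E →
        E (u ++ .cap i :: w) = d ^ k * E w' := by
  induction hu with
  | nil => intro i w hi; omega
  | @snoc n u j hu hj ih =>
    intro i w hi hw hc
    have hc0 : NoCross (u ++ w) := by
      intro a p h
      rcases mem_append.1 h with h | h
      · exact hu.noCross a p h
      · exact hc a p h
    rw [Nat.add_sub_cancel] at hw
    have key : ∀ k, (∀ {K : Type} [CommMonoid K] (d : K) (E : List LinkPiece → K), TLRel d E →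
        E (u ++ .cup j :: .cap i :: w) = d ^ k * E (u ++ w)) →
        ∃ w' : List LinkPiece, w'.length + 1 = (u ++ [LinkPiece.cup j]).length + w.length ∧
          Fits 0 w' ∧ NoCross w' ∧
      ∃ k : ℕ, ∀ {K : Type} [CommMonoid K] (d : K) (E : List LinkPiece → K), TLRel d E →
        E (u ++ [.cup j] ++ .cap i :: w) = d ^ k * E w' := by
      intro k hk
      refine ⟨u ++ w, by simp; omega, hu.fits_append _ hw, hc0, k, ?_⟩
      intro K _ d E hE
      rw [← hk d E hE]; simp
    have hfar : ∀ i' j', i' + 2 ≤ n → j' + 2 ≤ n →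
        (∀ {K : Type} [CommMonoid K] (d : K) (E : List LinkPiece → K), TLRel d E →
        E (u ++ .cup j :: .cap i :: w) = E (u ++ .cap i' :: .cup j' :: w)) →
        ∃ w' : List LinkPiece, w'.length + 1 = (u ++ [LinkPiece.cup j]).length + w.length ∧
          Fits 0 w' ∧ NoCross w' ∧
      ∃ k : ℕ, ∀ {K : Type} [CommMonoid K] (d : K) (E : List LinkPiece → K), TLRel d E →
        E (u ++ [.cup j] ++ .cap i :: w) = d ^ k * E w' := by
      intro i' j' hi' hj' h
      have hc' : NoCross (.cup j' :: w) := by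
        intro a p; simpa using hc a p
      have hw' : Fits (n - 2) (.cup j' :: w) := by
        refine ⟨by omega, ?_⟩
        rwa [Nat.sub_add_cancel (by omega)]
      obtain ⟨w', h1, h2, h3, k, h4⟩ := ih i' (.cup j' :: w) hi' hw' hc'
      refine ⟨w', by simp at h1 ⊢; omega, h2, h3, k, ?_⟩
      intro K _ d E hE
      rw [← h4 d E hE, ← h d E hE]; simp
    rcases lt_trichotomy i j with h | h | h
    · rcases Nat.lt_or_ge (i + 1) j with h1 | h1
      · obtain ⟨j', rfl⟩ := exists_eq_add_of_le (show i + 2 ≤ j by omega)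
        refine hfar i (i + j') (by omega) (by omega) ?_
        intro K _ d E hE
        rw [← hE.far_left hu i (i + j') w (by omega) (by omega)]
        congr 4; omega
      · obtain rfl : j = i + 1 := by omega
        refine key 0 ?_
        intro K _ d E hE
        rw [hE.zag hu i w (by omega)]; simp
    · subst h
      refine key 1 ?_
      intro K _ d E hE
      rw [hE.loop hu i w hj]; simp
    · rcases Nat.lt_or_ge (j + 1) i with h1 | h1
      · obtain ⟨i', rfl⟩ := exists_eq_add_of_le (show j + 2 ≤ i by omega)
        rw [show j + 2 + i' = j + i' + 2 by omega] at *
        refine hfar (j + i') j (by omega) (by omega) ?_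
        intro K _ d E hE
        rw [← hE.far_right hu (j + i') j w (by omega) (by omega)]
      · obtain rfl : i = j + 1 := by omega
        refine key 0 ?_
        intro K _ d E hE
        rw [hE.zig hu j w (by omega)]; simp

/-- Minima alone leave open strands, so a nonempty closed word has a maximum; `u` collects the
minima read before it. -/
theorem exists_first_cap : ∀ (w : List LinkPiece) {n : ℕ} {u : List LinkPiece}, CupWord n u →
    Fits n w → NoCross w → u ++ w ≠ [] →
    ∃ n' u' i w', CupWord n' u' ∧ i + 2 ≤ n' ∧ Fits (n' - 2) w' ∧ NoCross w' ∧
      u ++ w = u' ++ .cap i :: w' := by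
  intro w
  induction w with
  | nil =>
    intro n u hu hn _ h
    cases hu with
    | nil => simp at h
    | snoc i hu hi => simp [Fits] at hn
  | cons g w ih =>
    intro n u hu hn hc h
    cases g with
    | cup i =>
      have := ih (hu.snoc i hn.1) hn.2 (fun a p h => hc a p (List.mem_cons_of_mem _ h)) (by simp)
      simpa using this
    | cap i => exact ⟨n, u, i, w, hu, hn.1, hn.2, fun a p h => hc a p (List.mem_cons_of_mem _ h),
        rfl⟩
    | cross i p => exact absurd List.mem_cons_self (hc i p)

/-- Two functions that satisfy the Temperley-Lieb relations agree on closed crossingless words. -/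
theorem TLRel.unique {K : Type} [CommMonoid K] {d : K} {E E' : List LinkPiece → K}
    (hE : TLRel d E) (hE' : TLRel d E') :
    ∀ w, Fits 0 w → NoCross w → E w = E' w := by
  intro w
  induction hl : w.length using Nat.strong_induction_on generalizing w with
  | _ N ih =>
    intro hf hc
    by_cases h0 : w = []
    · rw [h0, hE.nil, hE'.nil]
    · obtain ⟨n, u, i, w', hu, hi, hw, hc', rfl⟩ :=
        exists_first_cap w CupWord.nil hf hc (by simpa using h0)
      obtain ⟨w'', h1, h2, h3, k, h4⟩ := cupWord_cap_reduce hu i w' hi hw hc'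
      -- The reduced word is shorter by two pieces than the original one.
      rw [h4 d E hE, h4 d E' hE', ih w''.length (by simp at hl; omega) w'' rfl h2 h3]

/-! ### Counting loops satisfies the relations -/

/-- Counting closed curves only uses which entries of the row are equal, so an injective renaming
has no effect. This is needed because the two sides of a straightening use different names. -/
theorem loopsAux_rename : ∀ (w : List LinkPiece) (l : List ℕ) (n n' : ℕ) (σ : ℕ → ℕ),
    (∀ x ∈ l, x < n) → (∀ x ∈ l, σ x < n') → (∀ x ∈ l, ∀ y ∈ l, σ x = σ y → x = y) →
    loopsAux (l.map σ) n' w = loopsAux l n w := by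
  intro w
  induction w with
  | nil => intros; simp [loopsAux]
  | cons g w ih =>
    intro l n n' σ h1 h2 h3
    cases g with
    | cup i =>
      simp only [loopsAux]
      have h := ih (l.take i ++ n :: n :: l.drop i) (n + 1) (n' + 1) (fun x => if x = n then n' else σ x)
        ?_ ?_ ?_
      · rw [← h]
        congr 1
        simp only [map_append, map_cons, if_true, List.map_take, List.map_drop]
        have : l.map (fun x => if x = n then n' else σ x) = l.map σ := by
          apply map_congr_left
          intro x hx
          rw [if_neg (h1 x hx).ne]
        rw [this]
      · intro x hx
        simp only [mem_append, mem_cons] at hx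
        rcases hx with hx | rfl | rfl | hx
        · exact (h1 x (mem_of_mem_take hx)).trans (lt_succ_self _)
        · omega
        · omega
        · exact (h1 x (mem_of_mem_drop hx)).trans (lt_succ_self _)
      · intro x hx
        split_ifs with hn
        · omega
        · have : x ∈ l := by
            simp only [mem_append, mem_cons] at hx
            rcases hx with hx | rfl | rfl | hx
            · exact mem_of_mem_take hx
            · exact absurd rfl hn
            · exact absurd rfl hn
            · exact mem_of_mem_drop hx
          exact (h2 x this).trans (lt_succ_self _)
      · have hm : ∀ x ∈ l.take i ++ n :: n :: l.drop i, x = n ∨ x ∈ l := by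
          intro x hx
          simp only [mem_append, mem_cons] at hx
          rcases hx with hx | rfl | rfl | hx
          · exact .inr (mem_of_mem_take hx)
          · exact .inl rfl
          · exact .inl rfl
          · exact .inr (mem_of_mem_drop hx)
        intro x hx y hy hxy
        rcases hm x hx with rfl | hx' <;> rcases hm y hy with rfl | hy'
        · rfl
        · have := h2 y hy'; have := h1 y hy'
          simp only [if_true] at hxy
          split_ifs at hxy <;> omega
        · have := h2 x hx'; have := h1 x hx'
          simp only [if_true] at hxy
          split_ifs at hxy <;> omega
        · rw [if_neg (h1 x hx').ne, if_neg (h1 y hy').ne] at hxy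
          exact h3 x hx' y hy' hxy
    | cap i =>
      simp only [loopsAux, ← List.map_drop]
      rcases hd : l.drop i with _ | ⟨a, _ | ⟨b, r⟩⟩
      · simp
      · simp
      · have hm : ∀ x ∈ l.drop i, x ∈ l := fun x hx => mem_of_mem_drop hx
        rw [hd] at hm
        have ha := hm a (by simp)
        have hb := hm b (by simp)
        have hr : ∀ x ∈ l.take i ++ r, x ∈ l := by
          intro x hx
          rcases mem_append.1 hx with hx | hx
          · exact mem_of_mem_take hx
          · exact hm x (by simp [hx])
        have hm' : ∀ x ∈ (l.take i ++ r).map (fun x => if x = b then a else x), x ∈ l := by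
          intro x hx
          obtain ⟨y, hy, rfl⟩ := mem_map.1 hx
          split_ifs
          · exact ha
          · exact hr y hy
        have h := ih ((l.take i ++ r).map (fun x => if x = b then a else x)) n n' σ
          (fun x hx => h1 x (hm' x hx)) (fun x hx => h2 x (hm' x hx))
          (fun x hx y hy => h3 x (hm' x hx) y (hm' y hy))
        simp only [map_cons]
        rw [← h]
        have e1 : (σ a = σ b) = (a = b) := by
          apply propext; exact ⟨h3 a ha b hb, fun h => by rw [h]⟩
        simp only [e1]
        congr 2
        rw [← List.map_take, ← map_append, map_map, map_map]
        apply map_congr_left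
        intro x hx
        simp only [Function.comp]
        by_cases hxb : x = b
        · simp [hxb]
        · rw [if_neg hxb, if_neg]
          exact fun h => hxb (h3 x (hr x hx) b hb h)
    | cross i p =>
      simp only [loopsAux, ← List.map_drop]
      rcases hd : l.drop i with _ | ⟨a, _ | ⟨b, r⟩⟩
      · simp
      · simp
      · have hm : ∀ x ∈ l.drop i, x ∈ l := fun x hx => mem_of_mem_drop hx
        rw [hd] at hm
        have hm' : ∀ x ∈ l.take i ++ b :: a :: r, x ∈ l := by
          intro x hx
          simp only [mem_append, mem_cons] at hx
          rcases hx with hx | rfl | rfl | hx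
          · exact mem_of_mem_take hx
          · exact hm _ (by simp)
          · exact hm _ (by simp)
          · exact hm x (by simp [hx])
        have h := ih (l.take i ++ b :: a :: r) n n' σ
          (fun x hx => h1 x (hm' x hx)) (fun x hx => h2 x (hm' x hx))
          (fun x hx y hy => h3 x (hm' x hx) y (hm' y hy))
        simp only [map_cons]
        rw [← h]
        simp

/-- A word of minima is replaced by the row that it produces, so that the Temperley-Lieb relations
above it become computations with one row. -/
theorem CupWord.exists_row {n : ℕ} {u : List LinkPiece} (hu : CupWord n u) :
    ∃ (l : List ℕ) (m : ℕ), l.length = n ∧ (∀ x ∈ l, x < m) ∧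
      ∀ w, loopsAux [] 0 (u ++ w) = loopsAux l m w := by
  induction hu with
  | nil => exact ⟨[], 0, rfl, by simp, fun w => rfl⟩
  | snoc i hu hi ih =>
    obtain ⟨l, m, h1, h2, h3⟩ := ih
    refine ⟨l.take i ++ m :: m :: l.drop i, m + 1, by simp; omega, ?_, ?_⟩
    · intro x hx
      simp only [mem_append, mem_cons] at hx
      rcases hx with hx | rfl | rfl | hx
      · exact (h2 x (mem_of_mem_take hx)).trans (lt_succ_self _)
      · omega
      · omega
      · exact (h2 x (mem_of_mem_drop hx)).trans (lt_succ_self _)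
    · intro w
      rw [append_assoc, h3]
      rfl

theorem loopsAux_succ (w : List LinkPiece) (l : List ℕ) (n : ℕ) (h : ∀ x ∈ l, x < n) :
    loopsAux l (n + 1) w = loopsAux l n w := by
  have := loopsAux_rename w l n (n + 1) id h (fun x hx => (h x hx).trans (lt_succ_self _))
    (fun _ _ _ _ h => h)
  simpa using this

theorem exists_split {α : Type*} (l : List α) {i : ℕ} (h : i ≤ l.length) :
    ∃ L r, l = L ++ r ∧ L.length = i :=
  ⟨l.take i, l.drop i, (List.take_append_drop i l).symm, by simpa using h⟩

theorem exists_split_one {α : Type*} (l : List α) {i : ℕ} (h : i < l.length) :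
    ∃ L x r, l = L ++ x :: r ∧ L.length = i := by
  obtain ⟨L, r, rfl, hL⟩ := exists_split l h.le
  cases r with
  | nil => simp at h; omega
  | cons x r => exact ⟨L, x, r, rfl, hL⟩

theorem exists_split_two {α : Type*} (l : List α) {i : ℕ} (h : i + 2 ≤ l.length) :
    ∃ L x y r, l = L ++ x :: y :: r ∧ L.length = i := by
  obtain ⟨L, x, r, rfl, hL⟩ := exists_split_one l (show i < l.length by omega)
  cases r with
  | nil => simp at h; omega
  | cons y r => exact ⟨L, x, y, r, rfl, hL⟩

theorem loopsAux_cup (L r : List ℕ) (n : ℕ) (w : List LinkPiece) :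
    loopsAux (L ++ r) n (.cup L.length :: w) = loopsAux (L ++ n :: n :: r) (n + 1) w := by
  simp [loopsAux]

theorem loopsAux_cap (L r : List ℕ) (a b n : ℕ) (w : List LinkPiece) :
    loopsAux (L ++ a :: b :: r) n (.cap L.length :: w) =
      (if a = b then 1 else 0) +
        loopsAux ((L ++ r).map (fun x => if x = b then a else x)) n w := by
  simp [loopsAux]

theorem map_ite_self {l : List ℕ} {a b : ℕ} (h : b ∉ l) :
    l.map (fun x => if x = b then a else x) = l := by
  conv_rhs => rw [← map_id l]
  apply map_congr_left
  intro x hx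
  have : x ≠ b := fun e => h (e ▸ hx)
  simp [this]

theorem TLRel.loops {K : Type} [CommMonoid K] (d : K) :
    TLRel d (fun w => d ^ ThetaCurve.loops w) := by
  constructor
  · simp [ThetaCurve.loops, loopsAux]
  · intro n u hu i w hi
    obtain ⟨l, m, rfl, h2, h3⟩ := hu.exists_row
    obtain ⟨L, r, rfl, rfl⟩ := exists_split l hi
    have hm : m ∉ L ++ r := fun h => (h2 m h).ne rfl
    simp only [ThetaCurve.loops, h3]
    rw [loopsAux_cup, loopsAux_cap, if_pos rfl, map_ite_self hm, loopsAux_succ _ _ _ h2,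
      pow_add, pow_one]
  · intro n u hu i w hi
    obtain ⟨l, m, rfl, h2, h3⟩ := hu.exists_row
    obtain ⟨L, x, r, rfl, rfl⟩ := exists_split_one l hi
    have hm : m ∉ L ++ x :: r := fun h => (h2 m h).ne rfl
    have hxm : m ≠ x := (h2 x (by simp)).ne'
    simp only [ThetaCurve.loops, h3]
    congr 1
    rw [loopsAux_cup]
    have e := loopsAux_cap (L ++ [m]) r m x (m + 1) w
    simp only [length_append, List.length_singleton, append_assoc,
      cons_append, nil_append] at e
    -- Here the maximum keeps the fresh name `m` and erases the old name `x`, so the row differs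
    -- from the original one by an injective renaming.
    rw [e, if_neg hxm, zero_add,
      ← loopsAux_rename w (L ++ x :: r) m (m + 1) (fun y => if y = x then m else y) h2]
    · congr 1
      simp [hxm]
    · intro y hy; split_ifs
      · omega
      · exact (h2 y hy).trans (lt_succ_self _)
    · intro y hy z hz
      have := h2 y hy; have := h2 z hz
      split_ifs <;> omega
  · intro n u hu i w hi
    obtain ⟨l, m, rfl, h2, h3⟩ := hu.exists_row
    obtain ⟨L, x, r, rfl, rfl⟩ := exists_split_one l hi
    have hm : m ∉ L ++ x :: r := fun h => (h2 m h).ne rfl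
    have hxm : x ≠ m := (h2 x (by simp)).ne
    simp only [ThetaCurve.loops, h3]
    congr 1
    have e := loopsAux_cup (L ++ [x]) r m (.cap L.length :: w)
    simp only [length_append, List.length_singleton, append_assoc,
      cons_append, nil_append] at e
    -- In the mirror image the old name `x` survives, and the row is literally the original one.
    rw [e, loopsAux_cap, if_neg hxm, zero_add, ← loopsAux_succ _ _ _ h2]
    congr 1
    have h1 : m ∉ L := fun h => hm (by simp [h])
    have h2 : m ∉ r := fun h => hm (by simp [h])
    simp [map_ite_self h1, map_ite_self h2]
  · intro n u hu i j w hj hi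
    obtain ⟨l, m, rfl, h2, h3⟩ := hu.exists_row
    obtain ⟨L, a, b, r, rfl, rfl⟩ := exists_split_two l hi
    obtain ⟨L, M, rfl, rfl⟩ := exists_split L hj
    have hmb : m ≠ b := (h2 b (by simp)).ne'
    simp only [ThetaCurve.loops, h3]
    congr 1
    have e := loopsAux_cup L (M ++ a :: b :: r) m (.cap ((L ++ M).length + 2) :: w)
    simp only [append_assoc] at e ⊢
    rw [e]
    have e := loopsAux_cap (L ++ m :: m :: M) r a b (m + 1) w
    rw [show (L ++ m :: m :: M).length = (L ++ M).length + 2 by simp; omega] at e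
    simp only [append_assoc, cons_append] at e
    rw [e]
    have e := loopsAux_cap (L ++ M) r a b m (.cup L.length :: w)
    simp only [append_assoc] at e
    rw [e]
    have e := loopsAux_cup (L.map (fun x => if x = b then a else x))
      ((M ++ r).map (fun x => if x = b then a else x)) m w
    rw [length_map] at e
    rw [map_append (l₁ := L), map_append (l₁ := L), e]
    simp [hmb]
  · intro n u hu i j w hij hi
    obtain ⟨l, m, rfl, h2, h3⟩ := hu.exists_row
    obtain ⟨L, a, b, r, rfl, rfl⟩ := exists_split_two l (show i + 2 ≤ l.length by omega)
    obtain ⟨M, r, rfl, hM⟩ := exists_split r (show j - L.length ≤ r.length by simp at hi; omega)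
    obtain rfl : j = L.length + M.length := by omega
    have hmb : m ≠ b := (h2 b (by simp)).ne'
    simp only [ThetaCurve.loops, h3]
    congr 1
    have e := loopsAux_cup (L ++ a :: b :: M) r m (.cap L.length :: w)
    rw [show (L ++ a :: b :: M).length = L.length + M.length + 2 by simp; omega] at e
    simp only [append_assoc, cons_append] at e
    rw [e, loopsAux_cap, loopsAux_cap]
    have e := loopsAux_cup ((L ++ M).map (fun x => if x = b then a else x))
      (r.map (fun x => if x = b then a else x)) m w
    rw [length_map, length_append] at e
    rw [← append_assoc, ← append_assoc, map_append (l₁ := L ++ M),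
      map_append (l₁ := L ++ M), e]
    simp [hmb]

/-! ### Rows of strands -/

section Rows

variable {α : Type*} (L r : List α) (x : α)

theorem take_length_one : (L ++ x :: r).take (L.length + 1) = L ++ [x] := by
  rw [List.take_append]; simp
theorem drop_length_one : (L ++ x :: r).drop (L.length + 1) = r := by
  rw [List.drop_append]; simp

end Rows

variable {C : Type}

theorem Strand.reverse_reverse (s : Strand C) : s.reverse.reverse = s := by
  cases s; simp [Strand.reverse]

theorem Strand.reverse_fst (s : Strand C) : s.reverse.1 = s.1 := rfl

theorem Strand.reverse_snd (s : Strand C) : s.reverse.2 = !s.2 := rfl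

theorem Piece.pos_moveTo (g : Piece C) (j : ℕ) : (g.moveTo j).pos = j := by cases g <;> rfl
theorem Piece.ins_moveTo (g : Piece C) (j : ℕ) : (g.moveTo j).ins = g.ins := by cases g <;> rfl
theorem Piece.outs_moveTo (g : Piece C) (j : ℕ) : (g.moveTo j).outs = g.outs := by cases g <;> rfl
theorem Piece.moveTo_moveTo (g : Piece C) (i j : ℕ) : (g.moveTo i).moveTo j = g.moveTo j := by
  cases g <;> rfl

variable [DecidableEq C]

/-- The row of strands above a diagram. -/
abbrev run (l : List (Strand C)) (D : Diagram C) : Option (List (Strand C)) :=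
  List.foldlM step l D

theorem run_cons (l : List (Strand C)) (g : Piece C) (D : Diagram C) :
    run l (g :: D) = (step l g).bind (fun l' => run l' D) := rfl

theorem run_append (l : List (Strand C)) (D E : Diagram C) :
    run l (D ++ E) = (run l D).bind (fun l' => run l' E) := by
  simp [run, List.foldlM_append]

theorem step_bound {l l' : List (Strand C)} {g : Piece C} (h : step l g = some l') :
    g.pos + g.ins ≤ l.length := by
  cases g with
  | cup i s => simp only [step] at h; split_ifs at h with h1; simpa [Piece.pos, Piece.ins]
  | vertex i o a b c => simp only [step] at h; split_ifs at h with h1; simpa [Piece.pos, Piece.ins]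
  | cap i =>
    simp only [step] at h
    split at h
    · rename_i x y r hd
      have := congrArg List.length hd
      simp [Piece.pos, Piece.ins] at this ⊢; omega
    · cases h
  | cross i p =>
    simp only [step] at h
    split at h
    · rename_i x y r hd
      have := congrArg List.length hd
      simp [Piece.pos, Piece.ins] at this ⊢; omega
    · cases h

/-- With this, statements about a piece inside a long row reduce to the piece at the left end,
reading exactly the strands that enter it. -/
theorem step_local (L m r : List (Strand C)) (g : Piece C) (hL : L.length = g.pos)
    (hm : m.length = g.ins) :
    step (L ++ m ++ r) g = (step m (g.moveTo 0)).map (fun m' => L ++ m' ++ r) := by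
  cases g with
  | cup i s =>
    obtain rfl : L.length = i := hL
    obtain rfl := length_eq_zero_iff.1 hm
    simp [step, Piece.moveTo]
  | vertex i o a b c =>
    obtain rfl : L.length = i := hL
    obtain rfl := length_eq_zero_iff.1 hm
    simp [step, Piece.moveTo]
  | cap i =>
    obtain rfl : L.length = i := hL
    obtain ⟨x, y, rfl⟩ := length_eq_two.1 hm
    simp [step, Piece.moveTo]
  | cross i p =>
    obtain rfl : L.length = i := hL
    obtain ⟨x, y, rfl⟩ := length_eq_two.1 hm
    simp [step, Piece.moveTo]

theorem length_of_step_local {m m' : List (Strand C)} {g : Piece C} (hm : m.length = g.ins)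
    (h : step m (g.moveTo 0) = some m') : m'.length = g.outs := by
  cases g with
  | cup i s =>
    obtain rfl := length_eq_zero_iff.1 hm
    simp [step, Piece.moveTo] at h; simp [← h, Piece.outs]
  | vertex i o a b c =>
    obtain rfl := length_eq_zero_iff.1 hm
    simp [step, Piece.moveTo] at h; simp [← h, Piece.outs]
  | cap i =>
    obtain ⟨x, y, rfl⟩ := length_eq_two.1 hm
    simp [step, Piece.moveTo] at h; simp [h.2, Piece.outs]
  | cross i p =>
    obtain ⟨x, y, rfl⟩ := length_eq_two.1 hm
    simp [step, Piece.moveTo] at h; simp [← h, Piece.outs]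

/-- A piece that fits above a row replaces a segment of the row. -/
theorem exists_of_step {l l' : List (Strand C)} {g : Piece C} (h : step l g = some l') :
    ∃ L m m' r, l = L ++ m ++ r ∧ l' = L ++ m' ++ r ∧ L.length = g.pos ∧ m.length = g.ins ∧
      m'.length = g.outs ∧ step m (g.moveTo 0) = some m' := by
  have hb := step_bound h
  obtain ⟨L, r0, rfl, hL⟩ := exists_split l (show g.pos ≤ l.length by omega)
  obtain ⟨m, r, rfl, hm⟩ := exists_split r0 (show g.ins ≤ r0.length by simp at hb; omega)
  rw [← append_assoc, step_local L m r g hL hm] at h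
  obtain ⟨m', h1, h2⟩ := Option.map_eq_some_iff.1 h
  exact ⟨L, m, m', r, by simp, h2.symm, hL, hm, length_of_step_local hm h1, h1⟩

/-! ### Weighted sums of the signs of the crossings -/

/-- The contribution of one piece to the weighted sum of signs. -/
def pieceSum (w : C → C → ℤ) (l : List (Strand C)) : Piece C → ℤ
  | .cross i p =>
    match l.drop i with
    | x :: y :: _ => w x.1 y.1 * crossingSign (x, y, p)
    | _ => 0
  | _ => 0

/-- The sum of the signs of the crossings above the row `l`, weighted by `w`. -/
def signSum (w : C → C → ℤ) (l : List (Strand C)) (D : Diagram C) : ℤ :=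
  ((crossings l D).map fun x => w x.1.1 x.2.1.1 * crossingSign x).sum

theorem signSum_nil (w : C → C → ℤ) (l : List (Strand C)) : signSum w l [] = 0 := by
  simp [signSum, crossings]

theorem signSum_cons (w : C → C → ℤ) {l l' : List (Strand C)} {g : Piece C}
    (h : step l g = some l') (D : Diagram C) :
    signSum w l (g :: D) = pieceSum w l g + signSum w l' D := by
  cases g with
  | cross i p =>
    simp only [signSum, pieceSum, crossings, step] at *
    split at h
    · rename_i x y r hd
      simp at h
      simp [hd, h]
    · cases h
  | cup i s => simp [signSum, pieceSum, crossings, h]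
  | cap i => simp [signSum, pieceSum, crossings, h]
  | vertex i o a b c => simp [signSum, pieceSum, crossings, h]

theorem signSum_append (w : C → C → ℤ) (E : Diagram C) : ∀ (D : Diagram C)
    {l l' : List (Strand C)}, run l D = some l' →
    signSum w l (D ++ E) = signSum w l D + signSum w l' E := by
  intro D
  induction D with
  | nil => intro l l' h; cases h; simp [signSum_nil]
  | cons g D ih =>
    intro l l' h
    rw [run_cons] at h
    obtain ⟨l1, h1, h2⟩ := bind_eq_some_iff.1 h
    rw [cons_append, signSum_cons w h1, signSum_cons w h1, ih h2, add_assoc]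

theorem pieceSum_local (w : C → C → ℤ) (L m r : List (Strand C)) (g : Piece C)
    (hL : L.length = g.pos) (hm : m.length = g.ins) :
    pieceSum w (L ++ m ++ r) g = pieceSum w m (g.moveTo 0) := by
  cases g with
  | cross i p =>
    obtain rfl : L.length = i := hL
    obtain ⟨x, y, rfl⟩ := length_eq_two.1 hm
    simp [pieceSum, Piece.moveTo]
  | _ => rfl

/-! ### Evaluation of diagrams in an algebra -/

/-- Data for the evaluation of diagrams: a local minimum, a local maximum, a vertex and the two
crossings at the left end of the row, projectors for the strands, and the shift of a piece by one
strand to the right.  The product is read from the bottom to the top of a diagram. -/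
structure Ops (K C R : Type) [Field K] [Ring R] [Algebra K R] where
  s : R →ₐ[K] R
  cup : R
  cap : R
  vert : R
  cross : Bool → R
  proj : C → R

namespace Ops

variable {K R : Type} [Field K] [Ring R] [Algebra K R] (O : Ops K C R)

/-- An element moved to position `i`. -/
def sh (i : ℕ) : R →ₐ[K] R := O.s ^ i

theorem sh_zero (x : R) : O.sh 0 x = x := rfl
theorem sh_one (x : R) : O.sh 1 x = O.s x := by simp [sh]
theorem sh_add (i j : ℕ) (x : R) : O.sh (i + j) x = O.sh i (O.sh j x) := by
  simp [sh, pow_add]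
theorem sh_succ (i : ℕ) (x : R) : O.sh (i + 1) x = O.sh i (O.s x) := by
  rw [sh_add, sh_one]
theorem sh_succ' (i : ℕ) (x : R) : O.sh (i + 1) x = O.s (O.sh i x) := by
  rw [add_comm, sh_add, sh_one]

/-- The value of a piece, at the left end of the row. -/
def op (l : List (Strand C)) : Piece C → R
  | .cup _ s => O.cup * O.proj s.1
  | .cap _ => O.cap
  | .cross i p =>
    match l.drop i with
    | x :: y :: _ => O.cross p * (O.proj y.1 * O.s (O.proj x.1))
    | _ => 0
  | .vertex _ _ a b c => O.vert * (O.proj a * O.s (O.proj b) * O.s (O.s (O.proj c)))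

/-- The value of a diagram above the row `l`. -/
def ev : List (Strand C) → Diagram C → R
  | _, [] => 1
  | l, g :: D =>
    match step l g with
    | some l' => O.sh g.pos (O.op l g) * ev l' D
    | none => 0

theorem ev_cons {l l' : List (Strand C)} {g : Piece C} (h : step l g = some l') (D : Diagram C) :
    O.ev l (g :: D) = O.sh g.pos (O.op l g) * O.ev l' D := by
  simp [ev, h]

theorem ev_append (E : Diagram C) : ∀ (D : Diagram C) {l l' : List (Strand C)},
    run l D = some l' → O.ev l (D ++ E) = O.ev l D * O.ev l' E := by
  intro D
  induction D with
  | nil => intro l l' h; cases h; simp [ev]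
  | cons g D ih =>
    intro l l' h
    rw [run_cons] at h
    obtain ⟨l1, h1, h2⟩ := bind_eq_some_iff.1 h
    rw [cons_append, O.ev_cons h1, O.ev_cons h1, ih h2, mul_assoc]

theorem op_local (L m r : List (Strand C)) (g : Piece C)
    (hL : L.length = g.pos) (hm : m.length = g.ins) :
    O.op (L ++ m ++ r) g = O.op m (g.moveTo 0) := by
  cases g with
  | cross i p =>
    obtain rfl : L.length = i := hL
    obtain ⟨x, y, rfl⟩ := length_eq_two.1 hm
    simp [op, Piece.moveTo]
  | _ => rfl

/-- The far commutation relations: pieces side by side can change their heights. -/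
structure Exchange : Prop where
  cup : ∀ x, x * O.cup = O.cup * O.sh 2 x
  cap : ∀ x, O.sh 2 x * O.cap = O.cap * x
  cross : ∀ p x, O.sh 2 x * O.cross p = O.cross p * O.sh 2 x
  vert : ∀ x, x * O.vert = O.vert * O.sh 3 x
  proj : ∀ e x, O.s x * O.proj e = O.proj e * O.s x

/-- The relations among the projectors and the other pieces. -/
structure Projective : Prop extends Exchange O where
  idem : ∀ e, O.proj e * O.proj e = O.proj e
  cross_left : ∀ e p, O.proj e * O.cross p = O.cross p * O.s (O.proj e)
  cross_right : ∀ e p, O.s (O.proj e) * O.cross p = O.cross p * O.proj e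
  cup_proj : ∀ e, O.cup * O.s (O.proj e) = O.cup * O.proj e
  cap_proj : ∀ e, O.s (O.proj e) * O.cap = O.proj e * O.cap

/-- `1` or `-1`. -/
def _root_.ThetaCurve.boolSign (p : Bool) : ℤ := if p then 1 else -1

/-- The relations that correspond to the moves; the last three hold up to a power of `B`, at the
vertices with legs that satisfy `Good`. -/
structure Laws (B : K) (w : C → C → ℤ) (Good : C → C → C → Prop) : Prop extends Projective O where
  ne_zero : B ≠ 0
  symm : ∀ a b, w a b = w b a
  good_rotate : ∀ {a b c}, Good a b c → Good b c a
  good_swap : ∀ {a b c}, Good a b c → Good b a c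
  good_sum : ∀ {a b c}, Good a b c → ∀ e, w a e + w b e + w c e = 0
  zig : O.cup * O.s O.cap = 1
  zag : O.s O.cup * O.cap = 1
  cup_slide : ∀ p, O.cup * O.s (O.cross p) * O.cross p = O.s O.cup
  cap_slide : ∀ p, O.cross p * O.s (O.cross p) * O.cap = O.s O.cap
  cancel : ∀ p, O.cross p * O.cross (!p) = 1
  braid : ∀ p, O.cross p * O.s (O.cross p) * O.cross p =
    O.s (O.cross p) * O.cross p * O.s (O.cross p)
  turn : O.cup * O.s O.vert * O.cap = O.vert
  slide : ∀ p, O.vert * O.sh 2 (O.cross p) * O.s (O.cross p) * O.cross p = O.s O.vert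
  cup_curl : ∀ e p, O.cup * O.proj e * O.cross p =
    B ^ (boolSign p * w e e) • (O.cup * O.proj e)
  cap_curl : ∀ e p, O.proj e * O.cross p * O.cap =
    B ^ (boolSign p * w e e) • (O.proj e * O.cap)
  twist_left : ∀ {a b c}, Good a b c → ∀ p,
    O.vert * O.cross p * (O.proj b * O.s (O.proj a) * O.s (O.s (O.proj c))) =
      B ^ (-(boolSign p * w a b)) • (O.vert * (O.proj b * O.s (O.proj a) * O.s (O.s (O.proj c))))
  twist_right : ∀ {a b c}, Good a b c → ∀ p,
    O.vert * O.s (O.cross p) * (O.proj a * O.s (O.proj c) * O.s (O.s (O.proj b))) =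
      B ^ (-(boolSign p * w b c)) • (O.vert * (O.proj a * O.s (O.proj c) * O.s (O.s (O.proj b))))

variable {O}

theorem Exchange.sh_proj (h : O.Exchange) (e : C) {i j : ℕ} (hij : i < j) (x : R) :
    O.sh j x * O.sh i (O.proj e) = O.sh i (O.proj e) * O.sh j x := by
  obtain ⟨k, rfl⟩ := Nat.exists_eq_add_of_lt hij
  rw [show i + k + 1 = i + (1 + k) by omega, O.sh_add, O.sh_add, O.sh_one, ← map_mul, h.proj,
      map_mul]

/-- All pieces commute with what is to the right of them. -/
theorem Exchange.op (h : O.Exchange) (m : List (Strand C)) (g : Piece C) (x : R) :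
    O.sh g.ins x * O.op m g = O.op m g * O.sh g.outs x := by
  have hp : ∀ e y, O.s y * O.proj e = O.proj e * O.s y := h.proj
  cases g with
  | cup i s =>
    simp only [Ops.op, Piece.ins, Piece.outs]
    rw [← mul_assoc, O.sh_zero, h.cup, mul_assoc, mul_assoc, O.sh_succ', hp]
  | cap i => exact h.cap x
  | cross i p =>
    simp only [Ops.op, Piece.ins, Piece.outs]
    split
    · rename_i u v _ _
      have c1 : Commute (O.sh 2 x) (O.proj v.1) := hp _ _
      have c2 : Commute (O.sh 2 x) (O.s (O.proj u.1)) := by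
        have : O.sh 2 x = O.s (O.s x) := rfl
        rw [this]; exact (show Commute (O.s x) (O.proj u.1) from hp _ _).map O.s
      rw [← mul_assoc, h.cross, mul_assoc, mul_assoc, (c1.mul_right c2).eq]
    · simp
  | vertex i o a b c =>
    simp only [Ops.op, Piece.ins, Piece.outs]
    have c1 : Commute (O.sh 3 x) (O.proj a) := hp _ _
    have c2 : Commute (O.sh 3 x) (O.s (O.proj b)) :=
      (show Commute (O.s (O.s x)) (O.proj b) from hp _ _).map O.s
    have c3 : Commute (O.sh 3 x) (O.s (O.s (O.proj c))) :=
      ((show Commute (O.s x) (O.proj c) from hp _ _).map O.s).map O.s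
    rw [← mul_assoc, O.sh_zero, h.vert, mul_assoc O.vert, mul_assoc O.vert,
      ((c1.mul_right c2).mul_right c3).eq]

/-- `y` absorbs the projectors of the row `l`. -/
def Absorbs (O : Ops K C R) (l : List (Strand C)) (y : R) : Prop :=
  ∀ j x, l[j]? = some x → y * O.sh j (O.proj x.1) = y

theorem Absorbs.at {L r : List (Strand C)} {x : Strand C} {y : R}
    (h : O.Absorbs (L ++ x :: r) y) : y * O.sh L.length (O.proj x.1) = y :=
  h L.length x (by simp)

theorem Absorbs.at_one {L r : List (Strand C)} {x z : Strand C} {y : R}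
    (h : O.Absorbs (L ++ z :: x :: r) y) : y * O.sh L.length (O.s (O.proj x.1)) = y := by
  rw [← O.sh_succ]; exact h (L.length + 1) x (by simp)

theorem absorbs_nil (y : R) : O.Absorbs [] y := by
  intro j x h; simp at h

/-- The value of a piece ends with projectors on its outgoing strands, and projectors are
idempotent. A minimum has only one of them, which `cup_proj` carries over to its other end. -/
theorem Projective.op_absorb (h : O.Projective) {m m' : List (Strand C)} {g : Piece C}
    (hm : m.length = g.ins) (hs : step m (g.moveTo 0) = some m') :
    O.Absorbs m' (O.op m (g.moveTo 0)) := by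
  have hid := h.idem
  have hp : ∀ e y, O.s y * O.proj e = O.proj e * O.s y := h.proj
  intro j x hj
  cases g with
  | cup i s =>
    obtain rfl := length_eq_zero_iff.1 hm
    simp [step, Piece.moveTo] at hs; subst hs
    simp only [Piece.moveTo, Ops.op]
    match j with
    | 0 => simp at hj; subst hj; rw [O.sh_zero, mul_assoc, hid]
    | 1 =>
      simp at hj; subst hj
      rw [O.sh_one, Strand.reverse_fst, mul_assoc, ← hp, ← mul_assoc, h.cup_proj, mul_assoc, hid]
    | j + 2 => simp at hj
  | cap i =>
    obtain ⟨x, y, rfl⟩ := length_eq_two.1 hm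
    simp [step, Piece.moveTo] at hs; simp [hs.2] at hj
  | cross i p =>
    obtain ⟨x, y, rfl⟩ := length_eq_two.1 hm
    simp [step, Piece.moveTo] at hs; subst hs
    simp only [Piece.moveTo, Ops.op, List.drop_zero]
    match j with
    | 0 => simp at hj; subst hj; rw [O.sh_zero, mul_assoc, mul_assoc, hp, ← mul_assoc (O.proj y.1),
        hid]
    | 1 =>
      simp at hj; subst hj
      rw [O.sh_one, mul_assoc, mul_assoc, ← map_mul, hid]
    | j + 2 => simp at hj
  | vertex i o a b c =>
    obtain rfl := length_eq_zero_iff.1 hm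
    simp [step, Piece.moveTo] at hs; subst hs
    simp only [Piece.moveTo, Ops.op]
    match j with
    | 0 =>
      simp at hj; subst hj
      rw [O.sh_zero, mul_assoc, mul_assoc (O.proj a * _), hp, ← mul_assoc (O.proj a * _),
        mul_assoc (O.proj a), hp, ← mul_assoc (O.proj a), hid]
    | 1 =>
      simp at hj; subst hj
      rw [O.sh_one, mul_assoc, mul_assoc (O.proj a * _), ← map_mul, hp, map_mul,
        ← mul_assoc (O.proj a * _), mul_assoc (O.proj a), ← map_mul, hid]
    | 2 =>
      simp at hj; subst hj
      have e1 : ∀ z, O.sh 2 z = O.s (O.s z) := fun z => rfl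
      rw [e1, mul_assoc, mul_assoc (O.proj a * _), ← map_mul, ← map_mul, hid]
    | j + 3 => simp at hj

theorem Projective.absorbs_step (h : O.Projective) {l l' : List (Strand C)} {g : Piece C}
    (hs : step l g = some l') {y : R} (hy : O.Absorbs l y) :
    O.Absorbs l' (y * O.sh g.pos (O.op l g)) := by
  obtain ⟨L, m, m', r, rfl, rfl, hL, hm, hm', hloc⟩ := exists_of_step hs
  rw [O.op_local L m r g hL hm]
  intro j x hj
  rcases Nat.lt_or_ge j L.length with h1 | h1
  · rw [append_assoc, List.getElem?_append_left h1] at hj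
    rw [mul_assoc, h.toExchange.sh_proj _ (by omega), ← mul_assoc, hy j x]
    rw [append_assoc, List.getElem?_append_left h1, hj]
  · obtain ⟨k, rfl⟩ := exists_eq_add_of_le h1
    rw [append_assoc, List.getElem?_append_right h1, Nat.add_sub_cancel_left] at hj
    rcases Nat.lt_or_ge k m'.length with h2 | h2
    · rw [List.getElem?_append_left h2] at hj
      rw [O.sh_add, mul_assoc, hL, ← map_mul, h.op_absorb hm hloc k x hj]
    -- A strand to the right of the piece: its projector commutes past the piece, with its position
    -- changed from `g.outs` to `g.ins`, and is absorbed by `y` below.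
    · obtain ⟨k, rfl⟩ := exists_eq_add_of_le h2
      rw [List.getElem?_append_right h2, Nat.add_sub_cancel_left] at hj
      rw [O.sh_add, O.sh_add, mul_assoc, hL, ← map_mul]
      have := h.toExchange.op m (g.moveTo 0) (O.sh k (O.proj x.1))
      rw [Piece.ins_moveTo, Piece.outs_moveTo] at this
      rw [hm', ← this, map_mul, ← mul_assoc, ← O.sh_add, ← O.sh_add, hy]
      rw [← hL, ← hm, append_assoc, List.getElem?_append_right (by omega),
        List.getElem?_append_right (by omega), ← hj]
      congr 1
      omega

/-- Starting from the empty row, where nothing has to be absorbed, the value of the lower part of a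
diagram thus absorbs the projectors of all strands above it. The moves are checked under this
assumption only. -/
theorem Projective.absorbs_run (h : O.Projective) : ∀ (D : Diagram C) {l l' : List (Strand C)}
    {y : R}, run l D = some l' → O.Absorbs l y → O.Absorbs l' (y * O.ev l D) := by
  intro D
  induction D with
  | nil => intro l l' y hr hy; cases hr; simpa [ev] using hy
  | cons g D ih =>
    intro l l' y hr hy
    rw [run_cons] at hr
    obtain ⟨l1, h1, h2⟩ := bind_eq_some_iff.1 hr
    rw [O.ev_cons h1, ← mul_assoc]
    exact ih h2 (h.absorbs_step h1 hy)

end Ops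

variable {C : Type} [DecidableEq C]

/-! ### Invariance under the moves -/

/-- The sign of a crossing of type `p` of strands with directions `a` and `b`. -/
def dirSign (a b p : Bool) : ℤ := if a = b then boolSign p else -boolSign p

theorem crossingSign_mk (x y : Strand C) (p : Bool) :
    crossingSign (x, y, p) = dirSign x.2 y.2 p := by
  obtain ⟨x, a⟩ := x
  obtain ⟨y, b⟩ := y
  cases a <;> cases b <;> cases p <;> simp [crossingSign, boolSign, dirSign]

theorem dirSign_self (a p : Bool) : dirSign a a p = boolSign p := by simp [dirSign]

theorem dirSign_not_left (a b p : Bool) : dirSign (!a) b p = -dirSign a b p := by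
  cases a <;> cases b <;> simp [dirSign]

theorem dirSign_not_right (a b p : Bool) : dirSign a (!b) p = -dirSign a b p := by
  cases a <;> cases b <;> simp [dirSign]

theorem dirSign_comm (a b p : Bool) : dirSign a b p = dirSign b a p := by
  simp [dirSign, eq_comm]

theorem boolSign_not (p : Bool) : boolSign (!p) = -boolSign p := by
  cases p <;> simp [boolSign]

theorem dirSign_not (a b p : Bool) : dirSign a b (!p) = -dirSign a b p := by
  simp only [dirSign, boolSign_not]; split_ifs <;> simp

/-- The legs of a vertex satisfy `Good`. -/
def Piece.LegsGood (Good : C → C → C → Prop) : Piece C → Prop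
  | .vertex _ _ a b c => Good a b c
  | _ => True

theorem Piece.legsGood_moveTo (Good : C → C → C → Prop) (g : Piece C) (j : ℕ) :
    (g.moveTo j).LegsGood Good ↔ g.LegsGood Good := by
  cases g <;> rfl

/-- All vertices of the diagram have legs that satisfy `Good`. -/
def VertexGood (Good : C → C → C → Prop) (D : Diagram C) : Prop :=
  ∀ g ∈ D, g.LegsGood Good

namespace Ops

variable {K R : Type} [Field K] [Ring R] [Algebra K R] {O : Ops K C R}

/-- The projectors on top of the crossing slide down through it and are absorbed by `y`, so that
relations between bare crossings can be applied. -/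
theorem Projective.strip_cross (h : O.Projective) {L r : List (Strand C)} {x z : Strand C} {y : R}
    (hy : O.Absorbs (L ++ x :: z :: r) y) (p : Bool) :
    y * O.sh L.length (O.cross p * (O.proj z.1 * O.s (O.proj x.1))) =
      y * O.sh L.length (O.cross p) := by
  rw [← mul_assoc, ← h.cross_right, mul_assoc, ← h.cross_left, map_mul, map_mul, ← mul_assoc,
    hy.at_one, ← mul_assoc, hy.at]

theorem Projective.absorbs_cross (h : O.Projective) {L r : List (Strand C)} {x z : Strand C} {y : R}
    (hy : O.Absorbs (L ++ x :: z :: r) y) (p : Bool) :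
    O.Absorbs (L ++ z :: x :: r) (y * O.sh L.length (O.cross p)) := by
  have := h.absorbs_step (show step _ (.cross L.length p) = some (L ++ z :: x :: r) by simp [step]) hy
  simp only [Ops.op, drop_left, Piece.pos] at this
  rwa [h.strip_cross hy] at this

theorem Projective.absorbs_cup (h : O.Projective) {L r : List (Strand C)} {y : R}
    (hy : O.Absorbs (L ++ r) y) (s : Strand C) :
    O.Absorbs (L ++ s :: s.reverse :: r) (y * O.sh L.length (O.cup * O.proj s.1)) :=
  h.absorbs_step (g := .cup L.length s) (by simp [step]) hy

theorem Projective.absorbs_vertex (h : O.Projective) {L r : List (Strand C)} {y : R}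
    (hy : O.Absorbs (L ++ r) y) (o : Bool) (a b c : C) :
    O.Absorbs (L ++ (a, o) :: (b, o) :: (c, o) :: r)
      (y * O.sh L.length (O.vert * (O.proj a * O.s (O.proj b) * O.s (O.s (O.proj c))))) :=
  h.absorbs_step (g := .vertex L.length o a b c) (by simp [step]) hy

theorem Projective.strip_cross_one (h : O.Projective) {L r : List (Strand C)} {u x z : Strand C}
    {y : R} (hy : O.Absorbs (L ++ u :: x :: z :: r) y) (p : Bool) :
    y * O.sh (L.length + 1) (O.cross p * (O.proj z.1 * O.s (O.proj x.1))) =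
      y * O.sh (L.length + 1) (O.cross p) := by
  have := h.strip_cross (L := L ++ [u]) (r := r) (x := x) (z := z) (y := y) (by simpa using hy) p
  simpa using this

theorem Projective.absorbs_cross_one (h : O.Projective) {L r : List (Strand C)}
    {u x z : Strand C} {y : R} (hy : O.Absorbs (L ++ u :: x :: z :: r) y) (p : Bool) :
    O.Absorbs (L ++ u :: z :: x :: r) (y * O.sh (L.length + 1) (O.cross p)) := by
  have := h.absorbs_cross (L := L ++ [u]) (r := r) (x := x) (z := z) (y := y) (by simpa using hy) p
  simpa using this

theorem Projective.strip_cross_two (h : O.Projective) {L r : List (Strand C)} {u v x z : Strand C}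
    {y : R} (hy : O.Absorbs (L ++ u :: v :: x :: z :: r) y) (p : Bool) :
    y * O.sh (L.length + 2) (O.cross p * (O.proj z.1 * O.s (O.proj x.1))) =
      y * O.sh (L.length + 2) (O.cross p) := by
  have := h.strip_cross (L := L ++ [u, v]) (r := r) (x := x) (z := z) (y := y) (by simpa using hy) p
  simpa using this

theorem Projective.absorbs_cross_two (h : O.Projective) {L r : List (Strand C)}
    {u v x z : Strand C} {y : R} (hy : O.Absorbs (L ++ u :: v :: x :: z :: r) y) (p : Bool) :
    O.Absorbs (L ++ u :: v :: z :: x :: r) (y * O.sh (L.length + 2) (O.cross p)) := by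
  have := h.absorbs_cross (L := L ++ [u, v]) (r := r) (x := x) (z := z) (y := y)
    (by simpa using hy) p
  simpa using this

/-- The piece `g` turns the row `l` into `l'`, with sign sum `n` and value `x`. -/
abbrev Reads (O : Ops K C R) (w : C → C → ℤ) (l : List (Strand C)) (g : Piece C)
    (l' : List (Strand C)) (n : ℤ) (x : R) : Prop :=
  ∀ D, run l (g :: D) = run l' D ∧ signSum w l (g :: D) = n + signSum w l' D ∧
    O.ev l (g :: D) = x * O.ev l' D

theorem reads_of_step (O : Ops K C R) (w : C → C → ℤ) {l l' : List (Strand C)} {g : Piece C}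
    (h : step l g = some l') : O.Reads w l g l' (pieceSum w l g) (O.sh g.pos (O.op l g)) :=
  fun D => ⟨by rw [run_cons, h, bind_some], signSum_cons w h D, O.ev_cons h D⟩

section Reads

variable (O) (w : C → C → ℤ) (L r : List (Strand C)) (x z s : Strand C) (p : Bool)

theorem reads_cup : O.Reads w (L ++ r) (.cup L.length s) (L ++ s :: s.reverse :: r) 0
    (O.sh L.length (O.cup * O.proj s.1)) :=
  O.reads_of_step w (g := .cup L.length s) (by simp [step])

theorem reads_cap (h : z = x.reverse) :
    O.Reads w (L ++ x :: z :: r) (.cap L.length) (L ++ r) 0 (O.sh L.length O.cap) :=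
  O.reads_of_step w (g := .cap L.length) (by simp [step, h])

theorem reads_cross : O.Reads w (L ++ x :: z :: r) (.cross L.length p) (L ++ z :: x :: r)
    (w x.1 z.1 * dirSign x.2 z.2 p)
    (O.sh L.length (O.cross p * (O.proj z.1 * O.s (O.proj x.1)))) := by
  simpa [pieceSum, op, Piece.pos, crossingSign_mk] using
    O.reads_of_step w (show step (L ++ x :: z :: r) (.cross L.length p) = some _ by simp [step])

theorem reads_vertex (o : Bool) (a b c : C) :
    O.Reads w (L ++ r) (.vertex L.length o a b c) (L ++ (a, o) :: (b, o) :: (c, o) :: r) 0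
      (O.sh L.length (O.vert * (O.proj a * O.s (O.proj b) * O.s (O.s (O.proj c))))) :=
  O.reads_of_step w (g := .vertex L.length o a b c) (by simp [step])

theorem reads_cup_one : O.Reads w (L ++ x :: r) (.cup (L.length + 1) s)
    (L ++ x :: s :: s.reverse :: r) 0 (O.sh L.length (O.s (O.cup * O.proj s.1))) := by
  simpa [-map_mul, sh_succ] using O.reads_cup w (L ++ [x]) r s

theorem reads_cap_one (u : Strand C) (h : z = x.reverse) : O.Reads w (L ++ u :: x :: z :: r)
    (.cap (L.length + 1)) (L ++ u :: r) 0 (O.sh L.length (O.s O.cap)) := by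
  simpa [sh_succ] using O.reads_cap w (L ++ [u]) r x z h

theorem reads_cross_one (u : Strand C) : O.Reads w (L ++ u :: x :: z :: r)
    (.cross (L.length + 1) p) (L ++ u :: z :: x :: r) (w x.1 z.1 * dirSign x.2 z.2 p)
    (O.sh (L.length + 1) (O.cross p * (O.proj z.1 * O.s (O.proj x.1)))) := by
  simpa [-map_mul] using O.reads_cross w (L ++ [u]) r x z p

theorem reads_cross_two (u v : Strand C) : O.Reads w (L ++ u :: v :: x :: z :: r)
    (.cross (L.length + 2) p) (L ++ u :: v :: z :: x :: r) (w x.1 z.1 * dirSign x.2 z.2 p)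
    (O.sh (L.length + 2) (O.cross p * (O.proj z.1 * O.s (O.proj x.1)))) := by
  simpa [-map_mul] using O.reads_cross w (L ++ [u, v]) r x z p

theorem reads_vertex_one (o : Bool) (a b c : C) : O.Reads w (L ++ x :: r)
    (.vertex (L.length + 1) o a b c) (L ++ x :: (a, o) :: (b, o) :: (c, o) :: r) 0
    (O.sh L.length (O.s (O.vert * (O.proj a * O.s (O.proj b) * O.s (O.s (O.proj c)))))) := by
  simpa [-map_mul, sh_succ] using O.reads_vertex w (L ++ [x]) r o a b c

end Reads

theorem bound_of_run {l l' : List (Strand C)} {g : Piece C} {D : Diagram C}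
    (h : run l (g :: D) = some l') : g.pos + g.ins ≤ l.length := by
  obtain ⟨_, h, _⟩ := bind_eq_some_iff.1 (run_cons l g D ▸ h)
  exact step_bound h

/-- A relation may be applied inside longer products and after shifts. -/
theorem shifts (O : Ops K C R) {a b c d : R} (h : a * b = c * d) :
    (a * b = c * d ∧ O.s a * O.s b = O.s c * O.s d ∧
      O.s (O.s a) * O.s (O.s b) = O.s (O.s c) * O.s (O.s d)) ∧
    ∀ z, a * (b * z) = c * (d * z) ∧ O.s a * (O.s b * z) = O.s c * (O.s d * z) ∧
      O.s (O.s a) * (O.s (O.s b) * z) = O.s (O.s c) * (O.s (O.s d) * z) := by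
  simp only [← mul_assoc, ← map_mul, h, true_and, implies_true, and_self]

/-- The two diagrams have the same normalized value above the row `l`. -/
def SameValue (O : Ops K C R) (B : K) (w : C → C → ℤ) (l : List (Strand C)) (a b : Diagram C) :
    Prop :=
  ∀ l1 l2 y, O.Absorbs l y → run l a = some l1 → run l b = some l2 →
    l1 = l2 ∧ B ^ signSum w l a • (y * O.ev l a) = B ^ signSum w l b • (y * O.ev l b)

/-- By `Exchange.op` the value of `g` commutes with everything to its right, up to a shift from
`g.ins` to `g.outs`, which is exactly the change of the position of `k`. The sign sums agree because
each piece sees the same incoming strands in both orders. -/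
theorem Exchange.sameValue (h : O.Exchange) (B : K) (w : C → C → ℤ) (l : List (Strand C))
    (g k : Piece C) (hgk : g.pos + g.ins ≤ k.pos) :
    O.SameValue B w l [k, g] [g, k.moveTo (k.pos - g.ins + g.outs)] := by
  intro l1 l2 y _ h1 h2
  rw [run_cons] at h1
  obtain ⟨l', hk, h1⟩ := bind_eq_some_iff.1 h1
  rw [run_cons] at h1
  obtain ⟨l'', hg, h1⟩ := bind_eq_some_iff.1 h1
  cases h1
  obtain ⟨L0, n, n', r, rfl, rfl, hL0, hn, hn', hkl⟩ := exists_of_step hk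
  obtain ⟨L, r0, rfl, hL⟩ := exists_split L0 (show g.pos ≤ L0.length by omega)
  obtain ⟨m, M, rfl, hm⟩ := exists_split r0 (show g.ins ≤ r0.length by simp at hL0; omega)
  rw [show L ++ (m ++ M) ++ n' ++ r = L ++ m ++ (M ++ n' ++ r) by simp, step_local _ _ _ _ hL hm]
    at hg
  obtain ⟨m', hgl, rfl⟩ := Option.map_eq_some_iff.1 hg
  have hm' := length_of_step_local hm hgl
  have hlen : (L ++ m' ++ M).length = k.pos - g.ins + g.outs := by
    simp at hL0 ⊢; omega
  have s2 : step (L ++ (m ++ M) ++ n ++ r) g = some (L ++ m' ++ M ++ n ++ r) := by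
    rw [show L ++ (m ++ M) ++ n ++ r = L ++ m ++ (M ++ n ++ r) by simp, step_local _ _ _ _ hL hm,
      hgl]
    simp
  set k' := k.moveTo (k.pos - g.ins + g.outs) with hk'
  have hk'pos : (L ++ m' ++ M).length = k'.pos := by rw [hk', Piece.pos_moveTo, hlen]
  have hk'ins : n.length = k'.ins := by rw [hk', Piece.ins_moveTo, hn]
  have hk'0 : k'.moveTo 0 = k.moveTo 0 := by rw [hk', Piece.moveTo_moveTo]
  have s3 : step (L ++ m' ++ M ++ n ++ r) k' = some (L ++ m' ++ M ++ n' ++ r) := by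
    rw [step_local _ n r _ hk'pos hk'ins, hk'0, hkl]
    simp
  have s1' : step (L ++ (m ++ M) ++ n' ++ r) g = some (L ++ m' ++ M ++ n' ++ r) := by
    rw [show L ++ (m ++ M) ++ n' ++ r = L ++ m ++ (M ++ n' ++ r) by simp, step_local _ _ _ _ hL hm,
      hgl]
    simp
  rw [run_cons, s2, bind_some, run_cons, s3] at h2
  cases h2
  refine ⟨by simp, ?_⟩
  rw [signSum_cons w hk, signSum_cons w s1', signSum_nil, signSum_cons w s2, signSum_cons w s3,
    signSum_nil, O.ev_cons hk, O.ev_cons s1', O.ev_cons s2, O.ev_cons s3]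
  simp only [Ops.ev, mul_one, add_zero]
  rw [pieceSum_local w _ n r k hL0 hn, pieceSum_local w _ n r k' hk'pos hk'ins, hk'0,
    O.op_local _ n r k hL0 hn, O.op_local _ n r k' hk'pos hk'ins, hk'0,
    show L ++ (m ++ M) ++ n' ++ r = L ++ m ++ (M ++ n' ++ r) by simp,
    show L ++ (m ++ M) ++ n ++ r = L ++ m ++ (M ++ n ++ r) by simp,
    pieceSum_local w _ m _ g hL hm, pieceSum_local w _ m _ g hL hm,
    O.op_local _ m _ g hL hm, O.op_local _ m _ g hL hm, add_comm]
  congr 2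
  have e := h.op m (g.moveTo 0) (O.sh M.length (O.op n (k.moveTo 0)))
  rw [Piece.ins_moveTo, Piece.outs_moveTo] at e
  rw [← hL0, ← hk'pos]
  simp only [length_append]
  rw [O.sh_add, O.sh_add, O.sh_add, O.sh_add, hL, hm, hm', ← map_mul, e, map_mul]

variable {B : K} {w : C → C → ℤ} {Good : C → C → C → Prop}

theorem exists_split_three {α : Type*} (l : List α) {i : ℕ} (h : i + 1 + 2 ≤ l.length) :
    ∃ L x y z r, l = L ++ x :: y :: z :: r ∧ L.length = i := by
  obtain ⟨L, x, y, r, rfl, hL⟩ := exists_split_two l (show i + 2 ≤ l.length by omega)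
  cases r with
  | nil => simp at h; omega
  | cons z r => exact ⟨L, x, y, z, r, rfl, hL⟩

theorem Laws.sameValue (h : O.Laws B w Good) {a b : Diagram C} (hab : LocalMove a b)
    (hg : VertexGood Good a) (l : List (Strand C)) : O.SameValue B w l a b := by
  have hP := h.toProjective
  have hE := h.toExchange
  have m0 := fun e z => O.shifts (hE.proj e z).symm
  have m1 := fun p e => O.shifts (h.cross_left e p)
  have m2 := fun p e => O.shifts (h.cross_right e p)
  have m3 := fun p e => O.shifts (show O.s (O.s (O.proj e)) * O.cross p = O.cross p * O.s (O.s (O.proj e))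
    from hE.cross p (O.proj e))
  have m4 := fun p e => O.shifts (show O.s (O.s (O.s (O.proj e))) * O.cross p = O.cross p * O.s (O.s (O.s (O.proj e)))
    from hE.cross p (O.s (O.proj e)))
  have ev_nil : ∀ l, O.ev l [] = 1 := fun _ => by simp [ev]
  have run_nil : ∀ l : List (Strand C), run l [] = some l := fun _ => rfl
  intro l1 l2 y hy h1 h2
  cases hab with
  | exchange g k hgk => exact hE.sameValue B w l g k hgk l1 l2 y hy h1 h2
  | zigzag_left i s =>
    cases h2
    obtain ⟨L, r, rfl, rfl⟩ := exists_split l (show i ≤ _ from bound_of_run h1)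
    rcases r with _ | ⟨x, r⟩
    · simp [run_cons, step, drop_length_one] at h1
    · obtain rfl : x = s := by
        by_contra hx
        simp [run_cons, step, drop_length_one, Strand.reverse_reverse, hx] at h1
      -- What remains of a zigzag is the projector of its strand, and `y` absorbs it.
      have e : O.cup * O.proj x.1 * O.s O.cap = O.proj x.1 := by
        rw [← h.cup_proj, mul_assoc, ← map_mul, ← h.cap_proj, map_mul, ← mul_assoc]
        have := hE.cup (O.proj x.1)
        rw [show O.sh 2 (O.proj x.1) = O.s (O.s (O.proj x.1)) from rfl] at this
        rw [← this, mul_assoc, h.zig, mul_one]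
      simp only [O.reads_cup w, O.reads_cap_one w _ _ _ _ _ (Strand.reverse_reverse _).symm,
          signSum_nil, ev_nil, run_nil] at h1 ⊢
      refine ⟨(Option.some.inj h1).symm, ?_⟩
      rw [mul_one, ← map_mul, e, hy.at, add_zero, add_zero, mul_one]
  | zigzag_right i s =>
    cases h2
    obtain ⟨L, x, r, rfl, rfl⟩ := exists_split_one l (show i + 1 ≤ _ from bound_of_run h1)
    obtain rfl : s = x.reverse := by
      by_contra hx
      simp [run_cons, step, drop_length_one, take_length_one, hx] at h1
    have e : O.s (O.cup * O.proj x.1) * O.cap = O.proj x.1 := by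
      rw [map_mul, mul_assoc, h.cap_proj, ← mul_assoc, hE.proj, mul_assoc, h.zag, mul_one]
    simp only [O.reads_cup_one w, O.reads_cap w, Strand.reverse_reverse, signSum_nil, ev_nil,
        run_nil] at h1 ⊢
    refine ⟨(Option.some.inj h1).symm, ?_⟩
    rw [mul_one, ← map_mul, Strand.reverse_fst, e, hy.at, add_zero, add_zero, mul_one]
  | vertex_turn i o a b c =>
    obtain ⟨L, r, rfl, rfl⟩ := exists_split l (show i ≤ _ from bound_of_run h1)
    simp only [O.reads_cup w, O.reads_vertex w, O.reads_vertex_one w, O.reads_cap w _ _ (a, !o) (a,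
        o) (by simp [Strand.reverse]), Strand.reverse, Bool.not_not, signSum_nil, ev_nil,
            run_nil] at h1 h2 ⊢
    refine ⟨by simp_all, ?_⟩
    simp only [mul_one, add_zero, ← map_mul]
    congr 3
    have hcap : ∀ x, O.s (O.s x) * O.cap = O.cap * x := hE.cap
    have hid : ∀ e, O.proj e * O.proj e = O.proj e := h.idem
    -- The projectors of `b` and `c` move up past the maximum. The one of `a` goes through the
    -- maximum, round the minimum and through the vertex, and reappears on the last leg.
    calc O.cup * O.proj a * (O.s (O.vert * (O.proj a * O.s (O.proj b) * O.s (O.s (O.proj c)))) *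
          O.cap)
        = O.cup * (O.proj a * O.s O.vert) * O.s (O.proj a) *
            (O.s (O.s (O.proj b * O.s (O.proj c))) * O.cap) := by
          simp only [map_mul, mul_assoc]
      _ = O.cup * O.s O.vert * (O.proj a * O.s (O.proj a)) * O.cap *
            (O.proj b * O.s (O.proj c)) := by
          rw [hcap, ← hE.proj]; simp only [mul_assoc]
      _ = O.cup * O.s O.vert * (O.s (O.proj a) * O.cap) *
            (O.proj b * O.s (O.proj c)) := by
          rw [← hE.proj, mul_assoc (O.cup * O.s O.vert), mul_assoc (O.s (O.proj a)), ← h.cap_proj,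
            ← mul_assoc (O.s (O.proj a)), ← map_mul, hid]
      _ = O.cup * (O.proj a * O.s O.vert) * O.cap * (O.proj b * O.s (O.proj c)) := by
          rw [h.cap_proj, ← hE.proj a O.vert]; simp only [mul_assoc]
      _ = O.cup * O.s (O.proj a * O.vert) * O.cap * (O.proj b * O.s (O.proj c)) := by
          rw [← mul_assoc O.cup, ← h.cup_proj, map_mul]; simp only [mul_assoc]
      _ = O.cup * O.s O.vert * (O.sh 4 (O.proj a) * O.cap) * (O.proj b * O.s (O.proj c)) := by
          rw [hE.vert, map_mul, show O.sh 4 (O.proj a) = O.s (O.sh 3 (O.proj a)) from rfl]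
          simp only [mul_assoc]
      _ = O.cup * O.s O.vert * O.cap * (O.s (O.s (O.proj a)) * (O.proj b * O.s (O.proj c))) := by
          rw [show O.sh 4 (O.proj a) = O.sh 2 (O.s (O.s (O.proj a))) from rfl, hE.cap]
          simp only [mul_assoc]
      _ = O.vert * (O.proj b * O.s (O.proj c) * O.s (O.s (O.proj a))) := by
          rw [h.turn]
          have c1 : Commute (O.s (O.s (O.proj a))) (O.proj b) := hE.proj _ _
          have c2 : Commute (O.s (O.s (O.proj a))) (O.s (O.proj c)) :=
            (show Commute (O.s (O.proj a)) (O.proj c) from hE.proj _ _).map O.s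
          rw [(c1.mul_right c2).eq]
  | cup_slide i s p =>
    obtain ⟨L, x, r, rfl, rfl⟩ := exists_split_one l (show i + 1 ≤ _ from bound_of_run h2)
    simp only [O.reads_cup w, O.reads_cup_one w, O.reads_cross w, O.reads_cross_one w, signSum_nil,
        ev_nil, run_nil] at h1 h2 ⊢
    refine ⟨Option.some.inj (h1.symm.trans h2), ?_⟩
    have y1 := hP.absorbs_cup hy s
    have y2 := hP.absorbs_cross_one y1 p
    simp only [mul_one, zero_add, add_zero, Strand.reverse_snd]
    congr 1
    -- The strand crosses both branches of the minimum, which have opposite directions, so the two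
    -- signs cancel.
    · rw [Strand.reverse_fst, dirSign_not_left, mul_neg, neg_add_cancel]
    · rw [← mul_assoc, ← mul_assoc, hP.strip_cross_one y1, hP.strip_cross y2, O.sh_succ, mul_assoc,
        mul_assoc, ← map_mul, ← map_mul]
      congr 2
      have e2 : O.s (O.s (O.proj s.1)) * O.cross p = O.cross p * O.s (O.s (O.proj s.1)) :=
        hE.cross p _
      rw [← h.cup_proj, mul_assoc, ← mul_assoc (O.s _), ← map_mul, h.cross_left, map_mul, mul_assoc,
        e2, ← mul_assoc, ← mul_assoc, h.cup_slide, ← map_mul, h.cup_proj]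
  | cap_slide i p =>
    obtain ⟨L, x, u, z, r, rfl, rfl⟩ :=
        exists_split_three l (show i + 1 + 2 ≤ _ from bound_of_run h2)
    obtain rfl : z = u.reverse := by
      simp [run_cons, step, drop_length_one, take_length_one] at h2; exact h2.1
    simp only [O.reads_cap w, O.reads_cap_one w, O.reads_cross w, O.reads_cross_one w, signSum_nil,
        ev_nil, run_nil] at h1 h2 ⊢
    refine ⟨Option.some.inj (h1.symm.trans h2), ?_⟩
    have y2 := hP.absorbs_cross hy p
    simp only [mul_one, zero_add, add_zero, Strand.reverse_snd]
    congr 1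
    · rw [Strand.reverse_fst, dirSign_not_right, mul_neg, add_neg_cancel]
    · rw [← mul_assoc, ← mul_assoc, hP.strip_cross hy, hP.strip_cross_one y2, O.sh_succ, mul_assoc,
        mul_assoc, ← map_mul, ← map_mul, ← mul_assoc, h.cap_slide]
  | cup_curl i s p =>
    obtain ⟨L, r, rfl, rfl⟩ := exists_split l (show i ≤ _ from bound_of_run h2)
    simp only [O.reads_cup w, O.reads_cross w, Strand.reverse_reverse, signSum_nil, ev_nil,
        run_nil] at h1 h2 ⊢
    refine ⟨Option.some.inj (h1.symm.trans h2), ?_⟩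
    have y1 := hP.absorbs_cup hy s
    rw [mul_one, mul_one, ← mul_assoc, hP.strip_cross y1, mul_assoc, ← map_mul, h.cup_curl,
        map_smul,
      mul_smul_comm, smul_smul, ← zpow_add₀ h.ne_zero]
    -- The branches of a curl have opposite directions, so the crossing of type `p` has sign
    -- `-boolSign p`; this compensates the factor in `cup_curl`.
    congr 2
    rw [Strand.reverse_fst, Strand.reverse_snd, dirSign_not_right, dirSign_self]
    ring
  | cap_curl i p =>
    obtain ⟨L, x, z, r, rfl, rfl⟩ := exists_split_two l (show i + 2 ≤ _ from bound_of_run h2)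
    obtain rfl : z = x.reverse := by
      simp [run_cons, step] at h2; exact h2.1
    simp only [O.reads_cap w, O.reads_cross w, Strand.reverse_reverse, signSum_nil, ev_nil,
        run_nil] at h1 h2 ⊢
    refine ⟨Option.some.inj (h1.symm.trans h2), ?_⟩
    have e : y * O.sh L.length (O.cross p) * O.sh L.length O.cap =
        B ^ (boolSign p * w x.1 x.1) • (y * O.sh L.length O.cap) := by
      rw [← hy.at, mul_assoc, mul_assoc, ← map_mul, ← map_mul, ← mul_assoc, h.cap_curl, map_smul,
        mul_smul_comm, mul_assoc _ (O.sh L.length (O.proj x.1)), ← map_mul]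
    rw [mul_one, ← mul_assoc, hP.strip_cross hy, e, smul_smul, ← zpow_add₀ h.ne_zero]
    congr 2
    rw [Strand.reverse_fst, Strand.reverse_snd, dirSign_not_right, dirSign_self]
    ring
  | cancel i p =>
    cases h2
    obtain ⟨L, x, z, r, rfl, rfl⟩ := exists_split_two l (show i + 2 ≤ _ from bound_of_run h1)
    simp only [O.reads_cross w, signSum_nil, ev_nil, run_nil] at h1 ⊢
    refine ⟨(Option.some.inj h1).symm, ?_⟩
    rw [mul_one, ← mul_assoc, hP.strip_cross hy, hP.strip_cross (hP.absorbs_cross hy p), mul_assoc,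
      ← map_mul, h.cancel, map_one, mul_one, h.symm z.1 x.1, dirSign_not, dirSign_comm z.2, mul_neg,
      add_zero, add_neg_cancel]
  | braid i p =>
    obtain ⟨L, x, u, z, r, rfl, rfl⟩ :=
        exists_split_three l (show i + 1 + 2 ≤ _ from bound_of_run h2)
    simp only [O.reads_cross w, O.reads_cross_one w, signSum_nil, ev_nil, run_nil] at h1 h2 ⊢
    refine ⟨Option.some.inj (h1.symm.trans h2), ?_⟩
    have y1 := hP.absorbs_cross hy p
    have z1 := hP.absorbs_cross_one hy p
    congr 1
    · congr 1; ring
    · rw [mul_one, mul_one, ← mul_assoc y, ← mul_assoc, ← mul_assoc y, ← mul_assoc (y * _),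
        hP.strip_cross hy, hP.strip_cross_one hy, hP.strip_cross_one y1, hP.strip_cross z1,
        hP.strip_cross (hP.absorbs_cross_one y1 p), hP.strip_cross_one (hP.absorbs_cross z1 p),
        O.sh_succ, mul_assoc, mul_assoc, ← map_mul, ← map_mul, ← mul_assoc, h.braid]
      simp only [map_mul, mul_assoc]
  | vertex_slide i o a b c p =>
    have hG : Good a b c := hg (.vertex i o a b c) (by simp)
    obtain ⟨L, x, r, rfl, rfl⟩ := exists_split_one l (show i + 1 ≤ _ from bound_of_run h2)
    simp only [O.reads_vertex w, O.reads_vertex_one w, O.reads_cross w, O.reads_cross_one w,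
      O.reads_cross_two w, signSum_nil, ev_nil, run_nil] at h1 h2 ⊢
    refine ⟨Option.some.inj (h1.symm.trans h2), ?_⟩
    have y1 := hP.absorbs_vertex hy o a b c
    have y2 := hP.absorbs_cross_two y1 p
    rw [zero_add, zero_add, add_zero]
    congr 1
    -- The three legs have the same direction at the vertex, so all three crossings have the same
    -- sign, and `good_sum` makes the weights cancel.
    · rw [← add_assoc, ← add_mul, ← add_mul, add_comm (w c x.1), add_comm _ (w a x.1), ← add_assoc,
        h.good_sum hG, zero_mul]
    · rw [mul_one, mul_one, ← mul_assoc, ← mul_assoc, ← mul_assoc, hP.strip_cross_two y1,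
        hP.strip_cross_one y2, hP.strip_cross (hP.absorbs_cross_one y2 p), O.sh_succ L.length,
        O.sh_add L.length 2, mul_assoc, mul_assoc, mul_assoc, ← map_mul, ← map_mul, ← map_mul,
        show O.sh 2 (O.cross p) = O.s (O.s (O.cross p)) from rfl]
      have hs : O.vert * O.s (O.s (O.cross p)) * O.s (O.cross p) * O.cross p = O.s O.vert :=
          h.slide p
      rw [map_mul O.s O.vert, ← hs]
      congr 2
      simp only [mul_assoc, map_mul, m0, m1, m2, m3, m4]
  | vertex_twist_left i o a b c p =>
    have hG : Good a b c := hg (.vertex i o a b c) (by simp)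
    obtain ⟨L, r, rfl, rfl⟩ := exists_split l (show i ≤ _ from bound_of_run h2)
    simp only [O.reads_vertex w, O.reads_cross w, signSum_nil, ev_nil, run_nil] at h1 h2 ⊢
    refine ⟨Option.some.inj (h1.symm.trans h2), ?_⟩
    have e : O.vert * (O.proj a * O.s (O.proj b) * O.s (O.s (O.proj c))) * O.cross p =
        O.vert * O.cross p * (O.proj b * O.s (O.proj a) * O.s (O.s (O.proj c))) := by
      simp only [mul_assoc, m0, m1, m2, m3]
    rw [mul_one, mul_one, ← mul_assoc, hP.strip_cross (hP.absorbs_vertex hy o a b c), mul_assoc,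
        ← map_mul, e,
      h.twist_left hG, map_smul, mul_smul_comm, smul_smul, ← zpow_add₀ h.ne_zero, dirSign_self,
      mul_comm (w a b), zero_add, add_zero, add_neg_cancel, add_zero]
  | vertex_twist_right i o a b c p =>
    have hG : Good a b c := hg (.vertex i o a b c) (by simp)
    obtain ⟨L, r, rfl, rfl⟩ := exists_split l (show i ≤ _ from bound_of_run h2)
    simp only [O.reads_vertex w, O.reads_cross_one w, signSum_nil, ev_nil, run_nil] at h1 h2 ⊢
    refine ⟨Option.some.inj (h1.symm.trans h2), ?_⟩
    have e : O.vert * (O.proj a * O.s (O.proj b) * O.s (O.s (O.proj c))) * O.s (O.cross p) =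
        O.vert * O.s (O.cross p) * (O.proj a * O.s (O.proj c) * O.s (O.s (O.proj b))) := by
      simp only [mul_assoc, m0, m1, m2, m3]
    rw [mul_one, mul_one, ← mul_assoc, hP.strip_cross_one (hP.absorbs_vertex hy o a b c),
        O.sh_succ, mul_assoc,
      ← map_mul, e, h.twist_right hG, map_smul, mul_smul_comm, smul_smul, ← zpow_add₀ h.ne_zero,
          dirSign_self,
      mul_comm (w b c), zero_add, add_zero, add_neg_cancel, add_zero]

/-- A move changes a middle part of the diagram. The part below supplies an element that absorbs the
projectors, the part above multiplies both sides by the same factor, and signs and values are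
compatible with concatenation. -/
theorem Laws.move (h : O.Laws B w Good) {D E : Diagram C} (hm : Move D E)
    (hg : VertexGood Good D) :
    B ^ signSum w [] D • O.ev [] D = B ^ signSum w [] E • O.ev [] E := by
  obtain ⟨hD, hE, p, a, b, q, hab, rfl, rfl⟩ := hm
  change run [] _ = _ at hD hE
  rw [run_append, run_append] at hD hE
  obtain ⟨l2, hD, hq⟩ := bind_eq_some_iff.1 hD
  obtain ⟨l1, hp, ha⟩ := bind_eq_some_iff.1 hD
  obtain ⟨l3, hE, hq'⟩ := bind_eq_some_iff.1 hE
  rw [hp, bind_some] at hE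
  have hy := h.toProjective.absorbs_run p hp (O.absorbs_nil 1)
  have hga : VertexGood Good a := fun g hv => hg g (by simp [hv])
  obtain ⟨rfl, hs⟩ := h.sameValue hab hga l1 l2 l3 _ hy ha hE
  have hpa : run [] (p ++ a) = some l2 := by rw [run_append, hp]; exact ha
  have hpb : run [] (p ++ b) = some l2 := by rw [run_append, hp]; exact hE
  rw [signSum_append w _ _ hpa, signSum_append w _ _ hp, signSum_append w _ _ hpb,
    signSum_append w _ _ hp, O.ev_append _ _ hpa, O.ev_append _ _ hp, O.ev_append _ _ hpb,
    O.ev_append _ _ hp]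
  rw [one_mul] at hs
  simp only [zpow_add₀ h.ne_zero, mul_smul]
  congr 1
  rw [smul_comm _ (B ^ signSum w l2 q), smul_comm _ (B ^ signSum w l2 q), ← smul_mul_assoc, hs,
    smul_mul_assoc]

theorem Laws.vertexGood (h : O.Laws B w Good) {D E : Diagram C} (hm : Move D E) :
    VertexGood Good D ↔ VertexGood Good E := by
  obtain ⟨-, -, p, a, b, q, hab, rfl, rfl⟩ := hm
  have key : VertexGood Good a ↔ VertexGood Good b := by
    have hr := @h.good_rotate
    have hs := @h.good_swap
    cases hab with
    | exchange g k _ =>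
      simp [VertexGood, Piece.legsGood_moveTo, and_comm]
    | vertex_turn i o a b c =>
      simp [VertexGood, Piece.LegsGood]
      exact ⟨fun H => hr H, fun H => hr (hr H)⟩
    | vertex_twist_left i o a b c p =>
      simp [VertexGood, Piece.LegsGood]
      exact ⟨fun H => hs H, fun H => hs H⟩
    | vertex_twist_right i o a b c p =>
      simp [VertexGood, Piece.LegsGood]
      exact ⟨fun H => hs (hr (hr H)), fun H => hs (hr (hr H))⟩
    | _ => simp [VertexGood, Piece.LegsGood]
  have hsplit : ∀ e : Diagram C, VertexGood Good (p ++ e ++ q) ↔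
      VertexGood Good p ∧ VertexGood Good e ∧ VertexGood Good q := by
    intro e
    simp only [VertexGood, List.forall_mem_append, and_assoc]
  rw [hsplit, hsplit, key]

/-- Isotopic diagrams have the same normalized value. -/
theorem Laws.isotopic (h : O.Laws B w Good) {D E : Diagram C} (hi : Isotopic D E) :
    (VertexGood Good D ↔ VertexGood Good E) ∧ (VertexGood Good D →
    B ^ signSum w [] D • O.ev [] D = B ^ signSum w [] E • O.ev [] E) := by
  induction hi with
  | rel D E hm => exact ⟨h.vertexGood hm, h.move hm⟩
  | refl D => exact ⟨Iff.rfl, fun _ => rfl⟩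
  | symm D E _ ih => exact ⟨ih.1.symm, fun hE => (ih.2 (ih.1.2 hE)).symm⟩
  | trans D E F _ _ ih1 ih2 =>
    exact ⟨ih1.1.trans ih2.1, fun hD => (ih1.2 hD).trans (ih2.2 (ih1.1.1 hD))⟩

end Ops

/-! ### The Temperley-Lieb category -/

/-- The value of a circle. -/
def loopValue {K : Type} [Field K] (A : K) : K := -A ^ 2 - A⁻¹ ^ 2

/-- A local minimum `u` and a local maximum `n` with the shift `s` to the right by one strand. -/
structure TL {K : Type} (R : Type) [Field K] [Ring R] [Algebra K R] (A : K) where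
  s : R →ₐ[K] R
  u : R
  n : R
  exch_u : ∀ x, x * u = u * s (s x)
  exch_n : ∀ x, s (s x) * n = n * x
  loop : u * n = loopValue A • (1 : R)
  zig : u * s n = 1
  zag : s u * n = 1

namespace TL

variable {K R : Type} [Field K] [Ring R] [Algebra K R] {A : K} (T : TL R A)

/-- A crossing. -/
def cr (p : Bool) : R :=
  if p then A • (1 : R) + A⁻¹ • (T.n * T.u) else A⁻¹ • (1 : R) + A • (T.n * T.u)

/-- The factor of a curl. -/
def _root_.ThetaCurve.curl {K : Type} [Field K] (A : K) (p : Bool) : K :=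
  if p then -(A⁻¹ ^ 3) else -(A ^ 3)

/-- An element moved to position `i`. -/
def mv (i : ℕ) : R →ₐ[K] R := T.s ^ i

/-- The local minimum at position `i`. -/
def c (i : ℕ) : R := T.mv i T.u
/-- The local maximum at position `i`. -/
def a (i : ℕ) : R := T.mv i T.n
/-- The crossing at position `i`. -/
def x (p : Bool) (i : ℕ) : R := T.mv i (T.cr p)
/-- A local maximum followed by a local minimum at position `i`. -/
def e (i : ℕ) : R := T.mv i (T.n * T.u)

theorem mv_add (i j : ℕ) (y : R) : T.mv (i + j) y = T.mv i (T.mv j y) := by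
  simp [mv, pow_add]
theorem mv_succ (i : ℕ) (y : R) : T.mv (i + 1) y = T.mv i (T.s y) := by
  rw [mv_add]; simp [mv]

theorem s_c (i : ℕ) : T.s (T.c i) = T.c (i + 1) := by
  simp [c, mv, pow_succ']
theorem s_a (i : ℕ) : T.s (T.a i) = T.a (i + 1) := by
  simp [a, mv, pow_succ']
theorem s_x (p : Bool) (i : ℕ) : T.s (T.x p i) = T.x p (i + 1) := by
  simp [x, mv, pow_succ']
theorem s_e (i : ℕ) : T.s (T.e i) = T.e (i + 1) := by
  simp [e, mv, pow_succ']

theorem exch_cr (p : Bool) (y : R) : T.s (T.s y) * T.cr p = T.cr p * T.s (T.s y) := by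
  have h : T.s (T.s y) * (T.n * T.u) = T.n * T.u * T.s (T.s y) := by
    rw [← mul_assoc, T.exch_n, mul_assoc, T.exch_u, mul_assoc]
  cases p <;> simp [cr, mul_add, add_mul, h]

theorem mv_c (i k : ℕ) (y : R) : T.mv (i + k) y * T.c i = T.c i * T.mv (i + k + 2) y := by
  rw [c, mv_add, show i + k + 2 = i + (2 + k) by omega, mv_add, mv_add T 2, ← map_mul, T.exch_u,
    map_mul]
  rfl

theorem mv_a (i k : ℕ) (y : R) : T.mv (i + k + 2) y * T.a i = T.a i * T.mv (i + k) y := by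
  rw [a, mv_add T i k, show i + k + 2 = i + (2 + k) by omega, mv_add, mv_add T 2, ← map_mul,
    ← map_mul, ← T.exch_n]
  rfl

theorem mv_x (p : Bool) (i k : ℕ) (y : R) :
    T.mv (i + k + 2) y * T.x p i = T.x p i * T.mv (i + k + 2) y := by
  rw [x, show i + k + 2 = i + (2 + k) by omega, mv_add, mv_add T 2, ← map_mul, ← map_mul]
  exact congrArg _ (T.exch_cr p _)

theorem mv_e (i k : ℕ) (y : R) : T.mv (i + k + 2) y * T.e i = T.e i * T.mv (i + k + 2) y := by
  rw [e, map_mul, ← mul_assoc]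
  have := T.mv_a i k y
  rw [a] at this
  rw [this, mul_assoc]
  have := T.mv_c i k y
  rw [c] at this
  rw [this, mul_assoc]

theorem u_se : T.u * T.s (T.n * T.u) = T.s T.u := by rw [map_mul, ← mul_assoc, T.zig, one_mul]
theorem u_e : T.u * (T.n * T.u) = loopValue A • T.u := by
  rw [← mul_assoc, T.loop, smul_mul_assoc, one_mul]
theorem su_e : T.s T.u * (T.n * T.u) = T.u := by rw [← mul_assoc, T.zag, one_mul]
theorem su_se : T.s T.u * T.s (T.n * T.u) = loopValue A • T.s T.u := by
  rw [← map_mul, u_e, map_smul]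
theorem se_n : T.s (T.n * T.u) * T.n = T.s T.n := by rw [map_mul, mul_assoc, T.zag, mul_one]
theorem e_n : T.n * T.u * T.n = loopValue A • T.n := by
  rw [mul_assoc, T.loop, mul_smul_comm, mul_one]
theorem e_sn : T.n * T.u * T.s T.n = T.n := by rw [mul_assoc, T.zig, mul_one]
theorem se_sn : T.s (T.n * T.u) * T.s T.n = loopValue A • T.s T.n := by
  rw [← map_mul, e_n, map_smul]
theorem e_e : T.n * T.u * (T.n * T.u) = loopValue A • (T.n * T.u) := by
  rw [mul_assoc, u_e, mul_smul_comm]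
theorem e_se_e : T.n * T.u * T.s (T.n * T.u) * (T.n * T.u) = T.n * T.u := by
  rw [mul_assoc T.n, u_se, mul_assoc, su_e]
theorem se_e_se : T.s (T.n * T.u) * (T.n * T.u) * T.s (T.n * T.u) = T.s (T.n * T.u) := by
  rw [map_mul, mul_assoc (T.s T.n), su_e, mul_assoc, ← map_mul, u_se, ← map_mul]

section

variable (hA : A ≠ 0)
include hA

/-- The coefficient of the cut in the product is A² + A⁻² + d, and this is what determines the value
d of a circle. -/
theorem cr_cancel (p : Bool) : T.cr p * T.cr (!p) = 1 := by
  cases p <;>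
  · simp only [cr, Bool.not_true, Bool.not_false, if_true, false_eq_true, if_false, add_mul,
      mul_add, smul_mul_assoc, mul_smul_comm, one_mul, mul_one, e_e, loopValue]
    match_scalars <;> field_simp <;> ring

theorem slide_u (p : Bool) : T.u * T.s (T.cr p) * T.cr p = T.s T.u := by
  cases p <;>
  · simp only [cr, if_true, false_eq_true, if_false, map_add, map_smul, map_one, add_mul,
      mul_add, smul_mul_assoc, mul_smul_comm, one_mul, mul_one, u_se, u_e, su_e, loopValue]
    match_scalars <;> field_simp <;> ring

theorem slide_u' (p : Bool) : T.s T.u * T.cr p * T.s (T.cr p) = T.u := by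
  cases p <;>
  · simp only [cr, if_true, false_eq_true, if_false, map_add, map_smul, map_one, add_mul,
      mul_add, smul_mul_assoc, mul_smul_comm, one_mul, mul_one, u_se, su_se, su_e, loopValue]
    match_scalars <;> field_simp <;> ring

theorem slide_n (p : Bool) : T.cr p * T.s (T.cr p) * T.n = T.s T.n := by
  rw [mul_assoc]
  cases p <;>
  · simp only [cr, if_true, false_eq_true, if_false, map_add, map_smul, map_one, add_mul,
      mul_add, smul_mul_assoc, mul_smul_comm, one_mul, mul_one, se_n, e_n, e_sn, loopValue]
    match_scalars <;> field_simp <;> ring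

theorem slide_n' (p : Bool) : T.s (T.cr p) * T.cr p * T.s T.n = T.n := by
  rw [mul_assoc]
  cases p <;>
  · simp only [cr, if_true, false_eq_true, if_false, map_add, map_smul, map_one, add_mul,
      mul_add, smul_mul_assoc, mul_smul_comm, one_mul, mul_one, se_n, se_sn, e_sn, loopValue]
    match_scalars <;> field_simp <;> ring

theorem curl_u (p : Bool) : T.u * T.cr p = curl A p • T.u := by
  cases p <;>
  · simp only [cr, curl, if_true, false_eq_true, if_false, mul_add, mul_smul_comm, mul_one,
      u_e, loopValue]
    match_scalars <;> field_simp <;> ring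

theorem curl_n (p : Bool) : T.cr p * T.n = curl A p • T.n := by
  cases p <;>
  · simp only [cr, curl, if_true, false_eq_true, if_false, add_mul, smul_mul_assoc, one_mul,
      e_n, loopValue]
    match_scalars <;> field_simp <;> ring

theorem cr_braid (p : Bool) : T.cr p * T.s (T.cr p) * T.cr p =
    T.s (T.cr p) * T.cr p * T.s (T.cr p) := by
  cases p <;>
  · simp only [cr, if_true, false_eq_true, if_false, map_add, map_smul, map_one, add_mul,
      mul_add, smul_mul_assoc, mul_smul_comm, one_mul, mul_one, e_se_e, se_e_se, e_e, ← map_mul,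
      loopValue]
    match_scalars <;> field_simp <;> ring

end

theorem zig_at (i : ℕ) : T.c i * T.a (i + 1) = 1 := by
  rw [c, a, mv_succ, ← map_mul, T.zig, map_one]
theorem zag_at (i : ℕ) : T.c (i + 1) * T.a i = 1 := by
  rw [c, a, mv_succ, ← map_mul, T.zag, map_one]
theorem loop_at (i : ℕ) : T.c i * T.a i = loopValue A • 1 := by
  rw [c, a, ← map_mul, T.loop, map_smul, map_one]
theorem e_eq (i : ℕ) : T.e i = T.a i * T.c i := by
  rw [c, a, e, ← map_mul]

section

variable {T} (hA : A ≠ 0) (p : Bool) (i k : ℕ)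
include hA

theorem cxx : T.c i * T.x p (i + 1) * T.x p i = T.c (i + 1) := by
  rw [c, c, x, x, mv_succ, mv_succ, ← map_mul, ← map_mul, T.slide_u hA]
theorem cxx' : T.c (i + 1) * T.x p i * T.x p (i + 1) = T.c i := by
  rw [c, c, x, x, mv_succ, mv_succ, ← map_mul, ← map_mul, T.slide_u' hA]
theorem xxa : T.x p i * T.x p (i + 1) * T.a i = T.a (i + 1) := by
  rw [a, a, x, x, mv_succ, mv_succ, ← map_mul, ← map_mul, T.slide_n hA]
theorem xxa' : T.x p (i + 1) * T.x p i * T.a (i + 1) = T.a i := by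
  rw [a, a, x, x, mv_succ, mv_succ, ← map_mul, ← map_mul, T.slide_n' hA]
theorem cx : T.c i * T.x p i = curl A p • T.c i := by
  rw [c, x, ← map_mul, T.curl_u hA, map_smul]
theorem xa : T.x p i * T.a i = curl A p • T.a i := by
  rw [a, x, ← map_mul, T.curl_n hA, map_smul]
theorem xx_cancel : T.x p i * T.x (!p) i = 1 := by
  rw [x, x, ← map_mul, T.cr_cancel hA, map_one]
theorem xxx : T.x p i * T.x p (i + 1) * T.x p i = T.x p (i + 1) * T.x p i * T.x p (i + 1) := by
  rw [x, x, mv_succ, ← map_mul, ← map_mul, T.cr_braid hA, map_mul, map_mul]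

end

variable {T} in
theorem xx_comm (p q : Bool) (i k : ℕ) : T.x q (i + k + 2) * T.x p i = T.x p i * T.x q (i + k + 2) :=
  T.mv_x p i k _
variable {T} in
theorem cc (i k : ℕ) : T.c (i + k) * T.c i = T.c i * T.c (i + k + 2) := T.mv_c i k _
variable {T} in
theorem xc (p : Bool) (i k : ℕ) : T.x p (i + k) * T.c i = T.c i * T.x p (i + k + 2) := T.mv_c i k _
variable {T} in
theorem cx_comm (p : Bool) (i k : ℕ) : T.c (i + k + 2) * T.x p i = T.x p i * T.c (i + k + 2) :=
  T.mv_x p i k _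
variable {T} in
theorem aa (i k : ℕ) : T.a (i + k + 2) * T.a i = T.a i * T.a (i + k) := T.mv_a i k _
variable {T} in
theorem ca (i k : ℕ) : T.c (i + k + 2) * T.a i = T.a i * T.c (i + k) := T.mv_a i k _
variable {T} in
theorem xa_comm (p : Bool) (i k : ℕ) : T.x p (i + k + 2) * T.a i = T.a i * T.x p (i + k) :=
  T.mv_a i k _
variable {T} in
theorem ac (i k : ℕ) : T.a (i + k) * T.c i = T.c i * T.a (i + k + 2) := T.mv_c i k _
variable {T} in
theorem ax_comm (p : Bool) (i k : ℕ) : T.a (i + k + 2) * T.x p i = T.x p i * T.a (i + k + 2) :=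
  T.mv_x p i k _

theorem x_eq (p : Bool) (i : ℕ) :
    T.x p i = (if p then A else A⁻¹) • 1 + (if p then A⁻¹ else A) • T.e i := by
  cases p <;> simp [x, cr, e]

/-- Moving a crossing around two nested local minima. -/
theorem ccx (p : Bool) : T.c 0 * (T.c 1 * T.x p 0) = T.c 0 * (T.c 1 * T.x p 2) := by
  have h : T.c 0 * (T.c 1 * T.e 0) = T.c 0 * (T.c 1 * T.e 2) := by
    rw [e_eq, e_eq, ← mul_assoc (T.c 1), T.zag_at 0, ← mul_assoc (T.c 1), T.zig_at 1, one_mul,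
        one_mul,
      ← T.cc 0 0]
  have hx : ∀ i, T.x p i = (if p then A else A⁻¹) • 1 + (if p then A⁻¹ else A) • T.e i := by
    intro i
    cases p <;> simp [x, cr, e]
  rw [hx, hx]
  simp only [mul_add, mul_smul_comm, h]

/-- Far pieces are sorted, also inside a longer product. -/
theorem far {T : TL R A} (p : Bool) {i j : ℕ} (h : i + 2 ≤ j) :
    (T.x p j * T.x p i = T.x p i * T.x p j ∧ T.c j * T.x p i = T.x p i * T.c j) ∧
    ∀ z, T.x p j * (T.x p i * z) = T.x p i * (T.x p j * z) ∧
      T.c j * (T.x p i * z) = T.x p i * (T.c j * z) := by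
  obtain ⟨k, rfl⟩ := exists_eq_add_of_le h
  simp only [← mul_assoc, add_right_comm i 2 k, xx_comm p p i k, cx_comm p i k, and_self,
    implies_true]

/-- Local maxima are moved to the left. -/
theorem far_a {T : TL R A} (p : Bool) {i j : ℕ} (h : i + 2 ≤ j) :
    (T.x p j * T.a i = T.a i * T.x p (j - 2) ∧ T.x p i * T.a j = T.a j * T.x p i) ∧
    ∀ z, T.x p j * (T.a i * z) = T.a i * (T.x p (j - 2) * z) ∧
      T.x p i * (T.a j * z) = T.a j * (T.x p i * z) := by
  obtain ⟨k, rfl⟩ := exists_eq_add_of_le h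
  simp only [← mul_assoc, add_right_comm i 2 k, Nat.add_sub_cancel, xa_comm p i k, ← ax_comm p i k,
    and_self, implies_true]

/-! ### Doubled strands -/

section Cable

variable {T} (hA : A ≠ 0) (p : Bool)
include hA

/-- A single strand passes two nested minima: after its first crossing has been moved below the
inner minimum, `cxx` applies to the inner and then to the outer one. The two sides of a strip pass
one after the other. -/
theorem cable_cup_slide_right : T.c 0 * T.c 1 * (T.x p 3 * T.x p 2 * T.x p 1 * T.x p 0) =
    T.c 1 * T.c 2 := by
  have e1 : T.x p 1 * T.c 1 = T.c 1 * T.x p 3 := xc p 1 0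
  calc _ = T.c 0 * (T.c 1 * T.x p 3) * T.x p 2 * T.x p 1 * T.x p 0 := by simp only [mul_assoc]
    _ = T.c 0 * T.x p 1 * (T.c 1 * T.x p 2 * T.x p 1) * T.x p 0 := by rw [← e1]; simp only [mul_assoc]
    _ = (T.c 0 * T.x p 1 * T.x p 0) * T.c 2 := by rw [cxx hA]; simp (disch :=
        omega) only [mul_assoc, far p]
    _ = _ := by rw [cxx hA]

/-- Four crossings in a row. -/
theorem cable_cross_cross : T.x p 3 * T.x p 2 * T.x p 4 * T.x p 3 *
    (T.x p 1 * T.x p 0 * T.x p 2 * T.x p 1) =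
    T.x p 3 * T.x p 2 * T.x p 1 * T.x p 0 * (T.x p 4 * T.x p 3 * T.x p 2 * T.x p 1) := by
  simp (disch := omega) only [mul_assoc, far p]

theorem cable_cup_slide : T.c 0 * T.c 1 * (T.x p 3 * T.x p 2 * T.x p 4 * T.x p 3) *
    (T.x p 1 * T.x p 0 * T.x p 2 * T.x p 1) = T.c 2 * T.c 3 := by
  rw [mul_assoc, cable_cross_cross hA, ← mul_assoc, cable_cup_slide_right hA]
  simpa [s_c, s_x] using congrArg T.s (cable_cup_slide_right (T := T) hA p)

/-- The boundary of a vertex disk with three legs consists of the three arcs `T.c 0`, `T.c 1`, `T.c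
3`. The strand first passes the last one; the other two are nested minima. -/
theorem cable_vert_slide_one : T.c 0 * T.c 1 * T.c 3 *
    (T.x p 5 * T.x p 4 * T.x p 3 * T.x p 2 * T.x p 1 * T.x p 0) = T.c 1 * T.c 2 * T.c 4 := by
  have e1 : T.x p 3 * T.c 3 = T.c 3 * T.x p 5 := xc p 3 0
  calc _ = T.c 0 * T.c 1 * (T.c 3 * T.x p 5) * T.x p 4 * T.x p 3 * T.x p 2 * T.x p 1 * T.x p 0 :=
      by simp only [mul_assoc]
    _ = T.c 0 * T.c 1 * T.x p 3 * (T.c 3 * T.x p 4 * T.x p 3) * T.x p 2 * T.x p 1 * T.x p 0 := by rw [← e1]; simp only [mul_assoc]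
    _ = T.c 0 * T.c 1 * (T.x p 3 * T.x p 2 * T.x p 1 * T.x p 0) * T.c 4 := by rw [cxx hA]; simp (disch := omega) only [mul_assoc, far p]
    _ = _ := by rw [cable_cup_slide_right hA]

theorem cable_slide : T.c 0 * T.c 1 * T.c 3 * (T.x p 5 * T.x p 4 * T.x p 6 * T.x p 5) *
    (T.x p 3 * T.x p 2 * T.x p 4 * T.x p 3) * (T.x p 1 * T.x p 0 * T.x p 2 * T.x p 1) =
    T.c 2 * T.c 3 * T.c 5 := by
  have h1 := congrArg (fun y => T.s (T.s y)) (cable_cross_cross (T := T) hA p)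
  simp only [map_mul, s_x] at h1
  norm_num at h1
  have h2 := congrArg T.s (cable_vert_slide_one (T := T) hA p)
  simp only [map_mul, s_x, s_c] at h2
  norm_num at h2
  calc _ = T.c 0 * T.c 1 * T.c 3 * ((T.x p 5 * T.x p 4 * T.x p 6 * T.x p 5) *
          (T.x p 3 * T.x p 2 * T.x p 4 * T.x p 3)) * (T.x p 1 * T.x p 0) * (T.x p 2 * T.x p 1) := by
        simp only [mul_assoc]
    _ = T.c 0 * T.c 1 * T.c 3 * (T.x p 5 * T.x p 4 * T.x p 3 * T.x p 2) *
          (T.x p 6 * T.x p 5 * T.x p 4 * T.x p 3 * (T.x p 1 * T.x p 0)) * (T.x p 2 * T.x p 1) := by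
        rw [h1]; simp only [mul_assoc]
    _ = T.c 0 * T.c 1 * T.c 3 * (T.x p 5 * T.x p 4 * T.x p 3 * T.x p 2 * T.x p 1 * T.x p 0) *
          (T.x p 6 * T.x p 5 * T.x p 4 * T.x p 3 * T.x p 2 * T.x p 1) := by
        simp (disch := omega) only [mul_assoc, far p]
    _ = _ := by rw [cable_vert_slide_one hA, h2]

theorem cable_cap_slide : ∀ w, w * T.x p 1 * T.x p 0 * T.x p 2 * T.x p 1 * T.x p 3 * T.x p 2 *
    T.x p 4 * T.x p 3 * T.a 1 * T.a 0 = w * T.a 3 * T.a 2 := by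
  intro w
  have h : ∀ i z, T.x p i * (T.x p (i + 1) * (T.a i * z)) = T.a (i + 1) * z := by
    intro i z; rw [← xxa hA p i]; simp only [mul_assoc]
  have h' : ∀ i, T.x p i * (T.x p (i + 1) * T.a i) = T.a (i + 1) := by
    intro i; rw [← mul_assoc, xxa hA p i]
  trans w * T.x p 1 * T.x p 2 * T.x p 3 * T.x p 4 * T.x p 0 * T.x p 1 * T.x p 2 * T.x p 3 * T.a 1 *
    T.a 0
  · simp (disch := omega) only [mul_assoc, far p]
  simp (disch := omega) only [mul_assoc, far_a p, h 1, h 2, h' 0, h' 1, Nat.reduceSub,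
      Nat.reduceAdd,
    zero_add]

theorem cable_cancel : T.x p 1 * T.x p 0 * T.x p 2 * T.x p 1 *
    (T.x (!p) 1 * T.x (!p) 0 * T.x (!p) 2 * T.x (!p) 1) = 1 := by
  have e1 : T.x p 2 * T.x (!p) 0 = T.x (!p) 0 * T.x p 2 := xx_comm (!p) p 0 0
  calc _ = T.x p 1 * T.x p 0 * T.x p 2 * (T.x p 1 *
    T.x (!p) 1) * T.x (!p) 0 * T.x (!p) 2 * T.x (!p) 1 := by simp only [mul_assoc]
    _ = T.x p 1 * T.x p 0 * (T.x p 2 * T.x (!p) 0) * T.x (!p) 2 * T.x (!p) 1 := by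
      rw [xx_cancel hA, mul_one]; simp only [mul_assoc]
    _ = T.x p 1 * (T.x p 0 * T.x (!p) 0) * (T.x p 2 * T.x (!p) 2) * T.x (!p) 1 := by
      rw [e1]; simp only [mul_assoc]
    _ = 1 := by simp only [xx_cancel hA, mul_one]

/-- A crossing slides through a doubled crossing. -/
theorem cable_x_left : T.x p 0 * (T.x p 1 * T.x p 0 * T.x p 2 * T.x p 1) =
    T.x p 1 * T.x p 0 * T.x p 2 * T.x p 1 * T.x p 2 := by
  have e1 := xxx (T := T) hA p 0
  have e2 := xxx (T := T) hA p 1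
  calc _ = (T.x p 0 * T.x p 1 * T.x p 0) * T.x p 2 * T.x p 1 := by simp only [mul_assoc]
    _ = T.x p 1 * T.x p 0 * (T.x p 1 * T.x p 2 * T.x p 1) := by rw [e1]; simp only [mul_assoc]
    _ = _ := by rw [e2]; simp only [mul_assoc]

theorem cable_x_right : T.x p 2 * (T.x p 1 * T.x p 0 * T.x p 2 * T.x p 1) =
    T.x p 1 * T.x p 0 * T.x p 2 * T.x p 1 * T.x p 0 := by
  have e0 : T.x p 2 * T.x p 0 = T.x p 0 * T.x p 2 := xx_comm p p 0 0
  have e1 := xxx (T := T) hA p 0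
  have e2 := xxx (T := T) hA p 1
  calc _ = T.x p 2 * T.x p 1 * (T.x p 0 * T.x p 2) * T.x p 1 := by simp only [mul_assoc]
    _ = (T.x p 2 * T.x p 1 * T.x p 2) * T.x p 0 * T.x p 1 := by rw [← e0]; simp only [mul_assoc]
    _ = T.x p 1 * T.x p 2 * (T.x p 1 * T.x p 0 * T.x p 1) := by rw [← e2]; simp only [mul_assoc]
    _ = T.x p 1 * (T.x p 2 * T.x p 0) * T.x p 1 * T.x p 0 := by rw [← e1]; simp only [mul_assoc]
    _ = _ := by rw [e0]; simp only [mul_assoc]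

/-- A crossing is a combination of the identity and the cut with a nonzero coefficient at the cut,
so the relation for the cut follows from the one for the crossing. -/
theorem cable_e_left : T.e 0 * (T.x p 1 * T.x p 0 * T.x p 2 * T.x p 1) =
    T.x p 1 * T.x p 0 * T.x p 2 * T.x p 1 * T.e 2 := by
  have h := cable_x_left (T := T) hA p
  generalize T.x p 1 * T.x p 0 * T.x p 2 * T.x p 1 = X at *
  rw [x_eq, x_eq] at h
  simp only [add_mul, mul_add, smul_mul_assoc, mul_smul_comm, one_mul, mul_one,
    add_right_inj] at h
  refine smul_right_injective _ (?_ : (if p then A⁻¹ else A) ≠ 0) h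
  cases p <;> simp [hA]

theorem cable_e_right : T.e 2 * (T.x p 1 * T.x p 0 * T.x p 2 * T.x p 1) =
    T.x p 1 * T.x p 0 * T.x p 2 * T.x p 1 * T.e 0 := by
  have h := cable_x_right (T := T) hA p
  generalize T.x p 1 * T.x p 0 * T.x p 2 * T.x p 1 = X at *
  rw [x_eq, x_eq] at h
  simp only [add_mul, mul_add, smul_mul_assoc, mul_smul_comm, one_mul, mul_one,
    add_right_inj] at h
  refine smul_right_injective _ (?_ : (if p then A⁻¹ else A) ≠ 0) h
  cases p <;> simp [hA]

/-- Let Z be the product of two consecutive doubled crossings, which moves one strip over or under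
two others. Each crossing inside these two strips passes through Z with its position lowered by two,
hence so does the doubled crossing of the two. -/
theorem cable_braid : T.x p 1 * T.x p 0 * T.x p 2 * T.x p 1 *
    (T.x p 3 * T.x p 2 * T.x p 4 * T.x p 3) * (T.x p 1 * T.x p 0 * T.x p 2 * T.x p 1) =
    T.x p 3 * T.x p 2 * T.x p 4 * T.x p 3 * (T.x p 1 * T.x p 0 * T.x p 2 * T.x p 1) *
      (T.x p 3 * T.x p 2 * T.x p 4 * T.x p 3) := by
  have l0 := cable_x_left (T := T) hA p
  have r0 := cable_x_right (T := T) hA p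
  have l1 := congrArg (fun y => T.s (T.s y)) l0
  have r1 := congrArg (fun y => T.s (T.s y)) r0
  simp only [map_mul, s_x] at l1 r1
  norm_num at l1 r1
  have b2 := xxx (T := T) hA p 1
  have b3 := xxx (T := T) hA p 2
  have h3 : T.x p 3 * (T.x p 1 * T.x p 0 * T.x p 2 * T.x p 1 * (T.x p 3 * T.x p 2 * T.x p 4 * T.x p 3)) =
      T.x p 1 * T.x p 0 * T.x p 2 * T.x p 1 * (T.x p 3 * T.x p 2 * T.x p 4 * T.x p 3) * T.x p 1 := by
    calc _ = T.x p 1 * (T.x p 3 * T.x p 2 * T.x p 3) * T.x p 4 * T.x p 0 * T.x p 1 * T.x p 2 * T.x p 3 := by simp (disch := omega) only [mul_assoc, far p]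
      _ = T.x p 1 * T.x p 2 * T.x p 3 * T.x p 4 * T.x p 0 * (T.x p 2 * T.x p 1 * T.x p 2) * T.x p 3 := by rw [← b3]; simp (disch := omega) only [mul_assoc, far p]
      _ = _ := by rw [← b2]; simp (disch := omega) only [mul_assoc, far p]
  rw [mul_assoc (T.x p 3 * T.x p 2 * T.x p 4 * T.x p 3)]
  have h2 : T.x p 2 * (T.x p 1 * T.x p 0 * T.x p 2 * T.x p 1 *
      (T.x p 3 * T.x p 2 * T.x p 4 * T.x p 3)) = T.x p 1 * T.x p 0 * T.x p 2 * T.x p 1 *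
      (T.x p 3 * T.x p 2 * T.x p 4 * T.x p 3) * T.x p 0 := by
    rw [← mul_assoc, r0]; simp (disch := omega) only [mul_assoc, far p]
  have h4 : T.x p 4 * (T.x p 1 * T.x p 0 * T.x p 2 * T.x p 1 *
      (T.x p 3 * T.x p 2 * T.x p 4 * T.x p 3)) = T.x p 1 * T.x p 0 * T.x p 2 * T.x p 1 *
      (T.x p 3 * T.x p 2 * T.x p 4 * T.x p 3) * T.x p 2 := by
    calc _ = T.x p 1 * T.x p 0 * T.x p 2 * T.x p 1 * (T.x p 4 * (T.x p 3 * T.x p 2 * T.x p 4 * T.x p 3)) := by simp (disch := omega) only [mul_assoc, far p]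
      _ = _ := by rw [r1]; simp only [mul_assoc]
  generalize T.x p 1 * T.x p 0 * T.x p 2 * T.x p 1 *
      (T.x p 3 * T.x p 2 * T.x p 4 * T.x p 3) = Z at h2 h3 h4 ⊢
  rw [mul_assoc _ (T.x p 3) Z, h3, mul_assoc _ (T.x p 4), ← mul_assoc (T.x p 4), h4,
    mul_assoc (T.x p 3), ← mul_assoc (T.x p 2), ← mul_assoc (T.x p 2), h2]
  simp only [← mul_assoc, h3]

/-- A curl of a strip is a full twist of the strip, up to curls of its two sides. The half twists at
both ends undo the full twist, and the two curls remain. -/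
theorem cable_curl_u : T.c 0 * T.c 1 * (T.x p 1 * T.x p 0 * T.x p 2 * T.x p 1) *
    (T.x p 0 * T.x p 2) = (curl A p * curl A p) • (T.c 0 * T.c 1) := by
  calc _ = T.c 0 * (T.c 1 * T.x p 1) * T.x p 2 * (T.x p 0 * T.x p 1 * T.x p 0) * T.x p 2 :=
      by simp (disch := omega) only [mul_assoc, far p]
    _ = curl A p • (T.c 0 * (T.c 1 * T.x p 2 * T.x p 1) * T.x p 0 * T.x p 1 * T.x p 2) := by
        rw [cx hA, xxx hA]; simp only [mul_assoc, smul_mul_assoc, mul_smul_comm]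
    _ = curl A p • (T.c 0 * T.x p 0 * (T.c 2 * T.x p 1 * T.x p 2)) := by rw [cxx hA]; simp (disch := omega) only [mul_assoc, far p]
    _ = _ := by rw [cxx' hA, cx hA]; simp only [mul_assoc, smul_mul_assoc, smul_smul]

theorem cable_curl_n : T.x p 0 * T.x p 2 * (T.x p 1 * T.x p 0 * T.x p 2 * T.x p 1) *
    (T.a 1 * T.a 0) = (curl A p * curl A p) • (T.a 1 * T.a 0) := by
  calc _ = T.x p 2 * (T.x p 0 * T.x p 1 * T.x p 0) * T.x p 2 * (T.x p 1 * T.a 1) * T.a 0 :=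
      by simp (disch := omega) only [mul_assoc, far p]
    _ = curl A p • (T.x p 2 * T.x p 1 * T.x p 0 * (T.x p 1 * T.x p 2 * T.a 1) * T.a 0) := by
        rw [xa hA, xxx hA]; simp only [mul_assoc, smul_mul_assoc, mul_smul_comm]
    _ = curl A p • ((T.x p 2 * T.x p 1 * T.a 2) * (T.x p 0 * T.a 0)) := by
        rw [xxa hA]; simp (disch := omega) only [mul_assoc, far_a p]
    _ = _ := by rw [xxa' hA, xa hA]; simp only [mul_assoc, mul_smul_comm, smul_smul]

/-- Two crossed legs with a half twist on each arise by turning the vertex disk over, which puts a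
half twist on the third leg instead; the arc between the two legs picks up a curl. -/
theorem cable_twist_left : T.c 0 * T.c 1 * T.c 3 * (T.x p 1 * T.x p 0 * T.x p 2 * T.x p 1) *
    (T.x p 0 * T.x p 2) = curl A p • (T.c 0 * T.c 1 * T.c 3 * T.x p 4) := by
  have e2 : T.c 1 * T.c 1 = T.c 1 * T.c 3 := cc 1 0
  have e4 : T.x p 2 * T.c 1 = T.c 1 * T.x p 4 := xc p 1 1
  have b2 := T.ccx p
  calc _ = T.c 0 * (T.c 1 * T.x p 1) * T.c 3 * T.x p 2 * (T.x p 0 * T.x p 1 * T.x p 0) * T.x p 2 := by simp (disch := omega) only [mul_assoc, far p]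
    _ = curl A p • (T.c 0 * (T.c 1 * T.c 3) * T.x p 2 * (T.x p 1 * T.x p 0 * T.x p 1) * T.x p 2) := by
        rw [cx hA, xxx hA]; simp only [mul_assoc, smul_mul_assoc, mul_smul_comm]
    _ = curl A p • (T.c 0 * T.c 1 * (T.c 1 * T.x p 2 * T.x p 1) * T.x p 0 * T.x p 1 * T.x p 2) := by rw [← e2]; simp only [mul_assoc]
    _ = curl A p • (T.c 0 * (T.c 1 * T.x p 0) * (T.c 2 * T.x p 1 * T.x p 2)) := by rw [cxx hA]; simp (disch := omega) only [mul_assoc, far p]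
    _ = curl A p • (T.c 0 * T.c 1 * (T.x p 2 * T.c 1)) := by rw [cxx' hA, b2]; simp only [mul_assoc]
    _ = curl A p • (T.c 0 * (T.c 1 * T.c 1) * T.x p 4) := by rw [e4]; simp only [mul_assoc]
    _ = _ := by rw [e2]; simp only [mul_assoc]

theorem cable_twist_right : T.c 0 * T.c 1 * T.c 3 * (T.x p 3 * T.x p 2 * T.x p 4 * T.x p 3) *
    (T.x p 2 * T.x p 4) = curl A p • (T.c 0 * T.c 1 * T.c 3 * T.x p 0) := by
  have b2 := T.ccx p
  calc _ = T.c 0 * T.c 1 * (T.c 3 * T.x p 3) * T.x p 4 * (T.x p 2 * T.x p 3 * T.x p 2) * T.x p 4 := by simp (disch := omega) only [mul_assoc, far p]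
    _ = curl A p • (T.c 0 * T.c 1 * (T.c 3 * T.x p 4 * T.x p 3) * T.x p 2 * T.x p 3 * T.x p 4) := by
        rw [cx hA, xxx hA]; simp only [mul_assoc, smul_mul_assoc, mul_smul_comm]
    _ = curl A p • (T.c 0 * (T.c 1 * T.x p 2) * (T.c 4 * T.x p 3 * T.x p 4)) := by rw [cxx hA]; simp (disch := omega) only [mul_assoc, far p]
    _ = curl A p • (T.c 0 * T.c 1 * (T.x p 0 * T.c 3)) := by rw [cxx' hA, ← b2]; simp only [mul_assoc]
    _ = _ := by simp (disch := omega) only [mul_assoc, far p]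

omit hA p in
theorem cable_zig : T.c 0 * T.c 1 * (T.a 3 * T.a 2) = 1 := by
  have e1 : T.a 1 * T.c 1 = T.c 1 * T.a 3 := ac 1 0
  calc _ = T.c 0 * (T.c 1 * T.a 3) * T.a 2 := by simp only [mul_assoc]
    _ = T.c 0 * T.a 1 * (T.c 1 * T.a 2) := by rw [← e1]; simp only [mul_assoc]
    _ = 1 := by rw [T.zig_at 0, T.zig_at 1, mul_one]

omit hA p in
theorem cable_zag : T.c 2 * T.c 3 * (T.a 1 * T.a 0) = 1 := by
  have e1 : T.c 3 * T.a 1 = T.a 1 * T.c 1 := ca 1 0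
  calc _ = T.c 2 * (T.c 3 * T.a 1) * T.a 0 := by simp only [mul_assoc]
    _ = T.c 2 * T.a 1 * (T.c 1 * T.a 0) := by rw [e1]; simp only [mul_assoc]
    _ = 1 := by rw [T.zag_at 0, T.zag_at 1, mul_one]

omit hA p in
theorem cable_cup_e : T.c 0 * T.c 1 * T.e 2 = T.c 0 * T.c 1 * T.e 0 := by
  rw [e_eq, e_eq, mul_assoc, mul_assoc, ← mul_assoc (T.c 1), T.zig_at 1, ← mul_assoc (T.c 1),
    T.zag_at 0, one_mul, one_mul, ← T.cc 0 0]

omit hA p in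
theorem cable_cap_e : T.e 2 * (T.a 1 * T.a 0) = T.e 0 * (T.a 1 * T.a 0) := by
  have e1 : T.a 2 * T.a 0 = T.a 0 * T.a 0 := aa 0 0
  rw [e_eq, e_eq, mul_assoc, mul_assoc, ← mul_assoc (T.c 2), ← mul_assoc (T.c 0), T.zag_at 1,
    T.zig_at 0, one_mul, e1]

omit hA p in
theorem cable_turn : T.c 0 * T.c 1 * (T.c 2 * T.c 3 * T.c 5) * (T.a 1 * T.a 0) =
    T.c 0 * T.c 1 * T.c 3 := by
  have e1 : T.c 5 * T.a 1 = T.a 1 * T.c 3 := ca 1 2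
  have e2 : T.c 3 * T.a 1 = T.a 1 * T.c 1 := ca 1 0
  have e3 : T.c 3 * T.a 0 = T.a 0 * T.c 1 := ca 0 1
  have e4 : T.c 1 * T.c 1 = T.c 1 * T.c 3 := cc 1 0
  calc _ = T.c 0 * T.c 1 * T.c 2 * T.c 3 * (T.c 5 * T.a 1) * T.a 0 := by simp only [mul_assoc]
    _ = T.c 0 * T.c 1 * T.c 2 * (T.c 3 * T.a 1) * (T.c 3 * T.a 0) := by
        rw [e1]; simp only [mul_assoc]
    _ = T.c 0 * T.c 1 * (T.c 2 * T.a 1) * (T.c 1 * T.a 0) * T.c 1 := by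
        rw [e2, e3]; simp only [mul_assoc]
    _ = _ := by rw [T.zag_at 1, T.zag_at 0, mul_one, mul_one, mul_assoc, e4, mul_assoc]

end Cable

end TL

/-! ### Projectors on doubled strands and the laws of doubled diagrams -/

namespace TL

variable {K R C : Type} [Field K] [Ring R] [Algebra K R] {A : K} (T : TL R A)

/-- The projector onto the trivial or the adjoint part of a doubled strand. -/
def pr (b : Bool) : R :=
  if b then 1 - (loopValue A)⁻¹ • T.e 0 else (loopValue A)⁻¹ • T.e 0

/-- Every strand is doubled, and a strand with the name `c` carries the projector that belongs
to `χ c`. -/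
def cabled (χ : C → Bool) : Ops K C R where
  s := T.s.comp T.s
  cup := T.c 0 * T.c 1
  cap := T.a 1 * T.a 0
  vert := T.c 0 * T.c 1 * T.c 3
  cross p := T.x p 1 * T.x p 0 * T.x p 2 * T.x p 1
  proj c := T.pr (χ c)

/-- The eigenvalue of a crossing on a projector. -/
def _root_.ThetaCurve.eigen {K : Type} [Field K] (A : K) (b p : Bool) : K :=
  if b then (if p then A else A⁻¹) else curl A p

theorem exch_c0 (y : R) : y * T.c 0 = T.c 0 * T.s (T.s y) := T.exch_u y
theorem exch_c1 (y : R) : T.s y * T.c 1 = T.c 1 * T.s (T.s (T.s y)) := by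
  rw [← s_c T 0, ← map_mul, T.exch_c0, map_mul]
theorem exch_c3 (y : R) : T.s (T.s (T.s y)) * T.c 3 = T.c 3 * T.s (T.s (T.s (T.s (T.s y)))) := by
  rw [← s_c T 2, ← s_c T 1, ← map_mul, ← map_mul, T.exch_c1]; simp only [map_mul]

theorem exch_x (p : Bool) (y : R) : T.s (T.s y) * T.x p 0 = T.x p 0 * T.s (T.s y) := T.exch_cr p y
theorem exch_e (y : R) : T.s (T.s y) * T.e 0 = T.e 0 * T.s (T.s y) := by
  have := T.mv_e 0 0 y
  simpa [mv, pow_two] using this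

section

variable {T} (hA : A ≠ 0) (hd : loopValue A ≠ 0)

theorem e_mul_e (i : ℕ) : T.e i * T.e i = loopValue A • T.e i := by
  rw [e, ← map_mul, e_e, map_smul]

include hd in
theorem pr_idem (b : Bool) : T.pr b * T.pr b = T.pr b := by
  have h : ((loopValue A)⁻¹ • T.e 0) * ((loopValue A)⁻¹ • T.e 0) = (loopValue A)⁻¹ • T.e 0 := by
    rw [smul_mul_assoc, mul_smul_comm, e_mul_e, smul_smul, smul_smul,
      mul_assoc, inv_mul_cancel₀ hd, mul_one]
  cases b
  · simpa [pr] using h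
  · simp only [pr, if_true, sub_mul, mul_sub, one_mul, mul_one, h, sub_self, sub_zero]

/-- Statements about projectors follow from those about `e`. -/
theorem pr_induction {P : R → R → Prop} (h1 : P 1 1) (he : P (T.e 0) (T.e 2))
    (hs : ∀ (k : K) x y, P x y → P (k • x) (k • y))
    (hsub : ∀ x y x' y', P x y → P x' y' → P (x - x') (y - y')) (b : Bool) :
    P (T.pr b) (T.s (T.s (T.pr b))) := by
  have e2 : T.s (T.s (T.e 0)) = T.e 2 := by rw [s_e, s_e]
  cases b
  · simpa [pr, e2] using hs _ _ _ he
  · simpa [pr, e2] using hsub _ _ _ _ h1 (hs _ _ _ he)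

include hA hd in
-- On the image of the cut a half twist is a curl of the remaining arc. On the complementary
-- projector the cut vanishes and only the coefficient of the identity survives.
theorem x_pr (b p : Bool) : T.x p 0 * T.pr b = eigen A b p • T.pr b := by
  have h1 : T.e 0 * T.e 0 = loopValue A • T.e 0 := e_mul_e 0
  have hd' := hd
  rw [x_eq]
  cases b <;> simp only [pr, eigen, curl, add_mul, smul_mul_assoc, one_mul, mul_sub, mul_one,
    mul_smul_comm, h1, if_true, false_eq_true, if_false]
  · cases p <;> simp only [if_true, false_eq_true, if_false] <;>
    · match_scalars
      field_simp
      simp only [loopValue]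
      field_simp
      ring
  · cases p <;> simp only [if_true, false_eq_true, if_false] <;>
    · match_scalars <;> field_simp <;> simp only [loopValue] <;> field_simp <;> ring

theorem exch_pr (b : Bool) (y : R) : Commute (T.s (T.s y)) (T.pr b) := by
  have : Commute (T.s (T.s y)) (T.e 0) := T.exch_e y
  cases b
  · simpa [pr] using this.smul_right _
  · simpa [pr] using (Commute.one_right _).sub_right (this.smul_right _)

include hA hd in
theorem pr_x (b p : Bool) : T.pr b * T.x p 0 = eigen A b p • T.pr b := by
  rw [← x_pr hA hd]
  have h : Commute (T.pr b) (T.e 0) := by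
    cases b
    · simpa [pr] using (Commute.refl (T.e 0)).smul_left _
    · simpa [pr] using (Commute.one_left _).sub_left ((Commute.refl (T.e 0)).smul_left _)
  rw [x_eq]
  exact (((Commute.one_right _).smul_right _).add_right (h.smul_right _)).eq

include hA hd in
theorem xx_pr (b b' p : Bool) : T.x p 0 * T.x p 2 * (T.pr b * T.s (T.s (T.pr b'))) =
    (eigen A b p * eigen A b' p) • (T.pr b * T.s (T.s (T.pr b'))) := by
  have h : T.x p 2 * T.pr b = T.pr b * T.x p 2 := by
    rw [← s_x, ← s_x]; exact (exch_pr b _).eq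
  have h2 : T.x p 2 * T.s (T.s (T.pr b')) = eigen A b' p • T.s (T.s (T.pr b')) := by
    rw [← s_x, ← s_x, ← map_mul, ← map_mul, x_pr hA hd, map_smul, map_smul]
  rw [mul_assoc, ← mul_assoc (T.x p 2), h, mul_assoc, h2, ← mul_assoc, x_pr hA hd]
  simp only [smul_mul_assoc, mul_smul_comm, smul_smul, mul_comm]

include hA hd in
theorem pr_xx (b b' p : Bool) : T.pr b * T.s (T.s (T.pr b')) * (T.x p 0 * T.x p 2) =
    (eigen A b p * eigen A b' p) • (T.pr b * T.s (T.s (T.pr b'))) := by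
  have h : T.s (T.s (T.pr b')) * T.x p 0 = T.x p 0 * T.s (T.s (T.pr b')) := T.exch_x p _
  have h2 : T.s (T.s (T.pr b')) * T.x p 2 = eigen A b' p • T.s (T.s (T.pr b')) := by
    rw [← s_x, ← s_x, ← map_mul, ← map_mul, pr_x hA hd, map_smul, map_smul]
  rw [mul_assoc, ← mul_assoc (T.s (T.s (T.pr b'))), h, mul_assoc, h2, ← mul_assoc, pr_x hA hd]
  simp only [smul_mul_assoc, mul_smul_comm, smul_smul, mul_comm]

include hA hd in
-- The relations that slide a projector are linear in it, so by `pr_induction` they are needed only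
-- for the identity and the cut.
theorem cabled_projective (χ : C → Bool) : (T.cabled χ).Projective where
  cup y := by
    simp only [cabled, Ops.sh, pow_two, AlgHom.mul_apply, AlgHom.comp_apply]
    rw [← mul_assoc, exch_c0, mul_assoc, exch_c1, mul_assoc]
  cap y := by
    simp only [cabled, Ops.sh, pow_two, AlgHom.mul_apply, AlgHom.comp_apply]
    have h0 : T.s (T.s y) * T.a 0 = T.a 0 * y := T.exch_n y
    have h1 : T.s (T.s (T.s (T.s y))) * T.a 1 = T.a 1 * T.s (T.s y) := by
      rw [← s_a T 0, ← map_mul, show T.a 0 = T.n from rfl, T.exch_n, map_mul]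
    rw [← mul_assoc, h1, mul_assoc, h0, mul_assoc]
  cross p y := by
    simp only [cabled, Ops.sh, pow_two, AlgHom.mul_apply, AlgHom.comp_apply]
    have h0 : ∀ y, Commute (T.s (T.s y)) (T.x p 0) := T.exch_x p
    have h1 : ∀ y, Commute (T.s (T.s (T.s y))) (T.x p 1) := by
      intro y; rw [← s_x]; exact (h0 y).map T.s
    have h2 : ∀ y, Commute (T.s (T.s (T.s (T.s y)))) (T.x p 2) := by
      intro y; rw [← s_x]; exact (h1 y).map T.s
    exact ((((h1 _).mul_right (h0 _)).mul_right (h2 _)).mul_right (h1 _)).eq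
  vert y := by
    simp only [cabled, Ops.sh, pow_succ, pow_zero, AlgHom.mul_apply, AlgHom.comp_apply,
      AlgHom.one_apply]
    rw [← mul_assoc, ← mul_assoc, exch_c0, mul_assoc, mul_assoc, mul_assoc]
    rw [← mul_assoc _ (T.c 1), exch_c1, mul_assoc (T.c 1), exch_c3]
    simp only [mul_assoc]
  proj c y := by
    simp only [cabled, AlgHom.comp_apply]
    cases χ c <;> simp [pr, mul_sub, sub_mul, T.exch_e]
  idem c := pr_idem hd _
  cross_left c p := by
    simp only [cabled, AlgHom.comp_apply]
    refine pr_induction (P := fun x y => x * _ = _ * y) ?_ ?_ ?_ ?_ _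
    · simp
    · exact cable_e_left hA p
    · intro k x y h; simp only [smul_mul_assoc, mul_smul_comm, h]
    · intro x y x' y' h h'; simp only [sub_mul, mul_sub, h, h']
  cross_right c p := by
    simp only [cabled, AlgHom.comp_apply]
    refine pr_induction (P := fun x y => y * _ = _ * x) ?_ ?_ ?_ ?_ _
    · simp
    · exact cable_e_right hA p
    · intro k x y h; simp only [smul_mul_assoc, mul_smul_comm, h]
    · intro x y x' y' h h'; simp only [sub_mul, mul_sub, h, h']
  cup_proj c := by
    simp only [cabled, AlgHom.comp_apply]
    refine pr_induction (P := fun x y => _ * y = _ * x) ?_ ?_ ?_ ?_ _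
    · simp
    · exact cable_cup_e
    · intro k x y h; simp only [smul_mul_assoc, mul_smul_comm, h]
    · intro x y x' y' h h'; simp only [sub_mul, mul_sub, h, h']
  cap_proj c := by
    simp only [cabled, AlgHom.comp_apply]
    refine pr_induction (P := fun x y => y * _ = x * _) ?_ ?_ ?_ ?_ _
    · simp
    · exact cable_cap_e
    · intro k x y h; simp only [smul_mul_assoc, mul_smul_comm, h]
    · intro x y x' y' h h'; simp only [sub_mul, mul_sub, h, h']

include hA in
theorem _root_.ThetaCurve.eigen_ne_zero (b p : Bool) : eigen A b p ≠ 0 := by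
  cases b <;> cases p <;> simp [eigen, curl, hA]

include hA hd in
/-- The cabled diagrams satisfy the moves. -/
theorem cabled_laws (χ : C → Bool) {B : K} {w : C → C → ℤ} {Good : C → C → C → Prop}
    (hB : B ≠ 0) (symm : ∀ a b, w a b = w b a)
    (rotate : ∀ {a b c}, Good a b c → Good b c a) (swap : ∀ {a b c}, Good a b c → Good b a c)
    (sum : ∀ {a b c}, Good a b c → ∀ e, w a e + w b e + w c e = 0)
    (self : ∀ e p, curl A p ^ 2 = B ^ (boolSign p * w e e) * eigen A (χ e) p ^ 2)
    (twist : ∀ {a b c}, Good a b c → ∀ p, curl A p * eigen A (χ c) p =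
      B ^ (-(boolSign p * w a b)) * (eigen A (χ a) p * eigen A (χ b) p)) :
    (T.cabled χ).Laws B w Good where
  toProjective := cabled_projective hA hd χ
  ne_zero := hB
  symm := symm
  good_rotate := rotate
  good_swap := swap
  good_sum := sum
  zig := by simpa [cabled, s_a] using T.cable_zig
  zag := by simpa [cabled, s_c] using T.cable_zag
  cup_slide p := by simpa [cabled, s_c, s_x] using cable_cup_slide (T := T) hA p
  cap_slide p := by
    have := cable_cap_slide (T := T) hA p 1
    simpa [cabled, s_a, s_x, mul_assoc] using this
  cancel p := cable_cancel hA p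
  braid p := by simpa [cabled, s_x] using cable_braid (T := T) hA p
  turn := by simpa [cabled, s_c, mul_assoc] using T.cable_turn
  slide p := by
    have := cable_slide (T := T) hA p
    simpa [cabled, Ops.sh, pow_two, s_c, s_x, mul_assoc] using this
  cup_curl e p := by
    have hP := cabled_projective (T := T) hA hd χ
    have h1 := hP.cross_left e p
    have h2 := hP.cross_right e p
    have h3 := hP.cup_proj e
    have h4 : (T.cabled χ).s ((T.cabled χ).proj e) * (T.cabled χ).proj e =
        (T.cabled χ).proj e * (T.cabled χ).s ((T.cabled χ).proj e) := (exch_pr _ _).eq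
    have h5 : _ * _ = _ • _ := xx_pr (T := T) hA hd (χ e) (χ e) p
    have h6 : (T.cabled χ).cup * (T.cabled χ).cross p * _ = _ := cable_curl_u (T := T) hA p
    have h7 := hP.idem e
    change _ * ((T.cabled χ).proj e * (T.cabled χ).s ((T.cabled χ).proj e)) =
      _ • ((T.cabled χ).proj e * (T.cabled χ).s ((T.cabled χ).proj e)) at h5
    change _ = _ • (T.cabled χ).cup at h6
    have h8 := self e p
    have h9 := eigen_ne_zero hA (χ e) p
    generalize (T.cabled χ).proj e = P at *
    generalize (T.cabled χ).s P = Q at *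
    generalize (T.cabled χ).cup = U at *
    generalize (T.cabled χ).cross p = X at *
    -- The doubled curl followed by half twists on both branches is evaluated in two ways: by
    -- `cable_curl_u` it gives the square of `curl`, and on the projectors the half twists give the
    -- square of `eigen`. The hypothesis `self` compares the two, and the nonzero square of `eigen`
    -- is cancelled.
    have k1 : U * (P * Q) = U * P := by rw [← h4, ← mul_assoc, h3, mul_assoc, h7]
    have k2 : U * X * (T.x p 0 * T.x p 2) * (P * Q) =
        (eigen A (χ e) p * eigen A (χ e) p) • (U * P * X) := by
      rw [mul_assoc, h5, mul_smul_comm, mul_assoc, ← mul_assoc X, ← h2, mul_assoc, ← h1,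
        ← mul_assoc Q, h4, ← mul_assoc, k1]
    rw [h6, smul_mul_assoc, k1, ← pow_two, h8, mul_comm, mul_smul, ← pow_two] at k2
    exact (smul_right_injective _ (pow_ne_zero 2 h9) k2).symm
  cap_curl e p := by
    have hP := cabled_projective (T := T) hA hd χ
    have h1 := hP.cross_left e p
    have h2 := hP.cross_right e p
    have h3 := hP.cap_proj e
    have h4 : (T.cabled χ).s ((T.cabled χ).proj e) * (T.cabled χ).proj e =
        (T.cabled χ).proj e * (T.cabled χ).s ((T.cabled χ).proj e) := (exch_pr _ _).eq
    have h5 : _ * _ = _ • _ := pr_xx (T := T) hA hd (χ e) (χ e) p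
    have h6 : T.x p 0 * T.x p 2 * (T.cabled χ).cross p * (T.cabled χ).cap = _ :=
      cable_curl_n (T := T) hA p
    have h7 := hP.idem e
    change ((T.cabled χ).proj e * (T.cabled χ).s ((T.cabled χ).proj e)) * _ =
      _ • ((T.cabled χ).proj e * (T.cabled χ).s ((T.cabled χ).proj e)) at h5
    change _ = _ • (T.cabled χ).cap at h6
    have h8 := self e p
    have h9 := eigen_ne_zero hA (χ e) p
    generalize (T.cabled χ).proj e = P at *
    generalize (T.cabled χ).s P = Q at *
    generalize (T.cabled χ).cap = N at *
    generalize (T.cabled χ).cross p = X at *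
    have k1 : P * Q * N = P * N := by rw [mul_assoc, h3, ← mul_assoc, h7]
    have k3 : P * Q * X * N = P * X * N := by
      rw [mul_assoc P, h2, ← mul_assoc, h1, mul_assoc, mul_assoc X Q, ← mul_assoc Q, h4, k1,
        mul_assoc X, h3]
    have k2 : P * Q * (T.x p 0 * T.x p 2 * X * N) =
        (eigen A (χ e) p * eigen A (χ e) p) • (P * X * N) := by
      rw [mul_assoc _ X, ← mul_assoc, h5, smul_mul_assoc, ← mul_assoc, k3]
    rw [h6, mul_smul_comm, k1, ← pow_two, h8, mul_comm, mul_smul, ← pow_two] at k2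
    exact (smul_right_injective _ (pow_ne_zero 2 h9) k2).symm
  twist_left {a b c} h p := by
    have h0 : (T.cabled χ).vert * (T.cabled χ).cross p * (T.x p 0 * T.x p 2) = _ :=
      cable_twist_left (T := T) hA p
    change _ = _ • ((T.cabled χ).vert * _) at h0
    have h1 := xx_pr (T := T) hA hd (χ b) (χ a) p
    -- The half twist on the third leg commutes with the projectors of the first two legs and acts
    -- on its own projector by the eigenvalue.
    have h2 : Commute (T.x p 4) (T.pr (χ b)) := by
      rw [← s_x, ← s_x]; exact exch_pr _ _
    have h3 : Commute (T.x p 4) (T.s (T.s (T.pr (χ a)))) := by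
      rw [← s_x, ← s_x, ← s_x, ← s_x]
      exact ((exch_pr _ _).map T.s).map T.s
    have h4 : T.x p 4 * T.s (T.s (T.s (T.s (T.pr (χ c))))) =
        eigen A (χ c) p • T.s (T.s (T.s (T.s (T.pr (χ c))))) := by
      rw [← s_x, ← s_x, ← s_x, ← s_x, ← map_mul, ← map_mul, ← map_mul, ← map_mul, x_pr hA hd]
      simp only [map_smul]
    have h5 : T.x p 4 * (T.pr (χ b) * T.s (T.s (T.pr (χ a))) * T.s (T.s (T.s (T.s (T.pr (χ c)))))) =
        eigen A (χ c) p • (T.pr (χ b) * T.s (T.s (T.pr (χ a))) *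
          T.s (T.s (T.s (T.s (T.pr (χ c)))))) := by
      rw [← mul_assoc, (h2.mul_right h3).eq, mul_assoc, h4, mul_smul_comm]
    change _ * _ * (T.pr (χ b) * T.s (T.s (T.pr (χ a))) * T.s (T.s (T.s (T.s (T.pr (χ c)))))) =
      _ • (_ * (T.pr (χ b) * T.s (T.s (T.pr (χ a))) * T.s (T.s (T.s (T.s (T.pr (χ c)))))))
    have h6 := congrArg (fun y => y * (T.pr (χ b) * T.s (T.s (T.pr (χ a))) *
      T.s (T.s (T.s (T.s (T.pr (χ c))))))) h0
    beta_reduce at h6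
    rw [mul_assoc _ (_ * _) (_ * _ * _), ← mul_assoc (T.x p 0 * T.x p 2), h1, smul_mul_assoc,
      smul_mul_assoc, mul_assoc _ (T.x p 4), h5, mul_smul_comm, mul_smul_comm, smul_smul, twist h p,
      mul_comm (B ^ _), mul_comm (eigen A (χ b) p), mul_smul _ (B ^ _)] at h6
    exact smul_right_injective _ (mul_ne_zero (eigen_ne_zero hA _ _) (eigen_ne_zero hA _ _)) h6
  twist_right {a b c} h p := by
    have h0 : (T.cabled χ).vert * (T.cabled χ).s ((T.cabled χ).cross p) * (T.x p 2 * T.x p 4) =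
        curl A p • ((T.cabled χ).vert * T.x p 0) := by
      simpa [cabled, s_x] using cable_twist_right (T := T) hA p
    have h1 := congrArg (fun y => T.s (T.s y)) (xx_pr (T := T) hA hd (χ c) (χ b) p)
    simp only [map_mul, map_smul, s_x] at h1
    have h2 : Commute (T.x p 2 * T.x p 4) (T.pr (χ a)) := by
      refine Commute.mul_left ?_ ?_ <;> rw [← s_x, ← s_x] <;> exact exch_pr _ _
    change _ * _ * (T.pr (χ a) * T.s (T.s (T.pr (χ c))) * T.s (T.s (T.s (T.s (T.pr (χ b)))))) =
      _ • (_ * (T.pr (χ a) * T.s (T.s (T.pr (χ c))) * T.s (T.s (T.s (T.s (T.pr (χ b)))))))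
    have h6 := congrArg (fun y => y * (T.pr (χ a) * (T.s (T.s (T.pr (χ c))) *
      T.s (T.s (T.s (T.s (T.pr (χ b)))))))) h0
    beta_reduce at h6
    rw [mul_assoc _ (_ * _) (_ * _), ← mul_assoc (T.x p 2 * T.x p 4), h2.eq, mul_assoc (T.pr (χ a)),
      h1, smul_mul_assoc, mul_assoc _ (T.x p 0), ← mul_assoc (T.x p 0), x_pr hA hd] at h6
    simp only [smul_mul_assoc, mul_smul_comm, smul_smul] at h6
    rw [twist (rotate h) p, mul_comm (B ^ _), mul_comm (eigen A (χ c) p), mul_smul _ (B ^ _)] at h6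
    rw [mul_assoc (T.pr (χ a))]
    exact smul_right_injective _ (mul_ne_zero (eigen_ne_zero hA _ _) (eigen_ne_zero hA _ _)) h6

end

end TL

/-! ### Values of words without names -/

namespace Ops

variable {K R C : Type} [Field K] [Ring R] [Algebra K R] [DecidableEq C] {O : Ops K C R}

variable (O) in
/-- The value of a piece without names if all strands carry the projector `P`. -/
def piece (P : R) : LinkPiece → R
  | .cup i => O.sh i (O.cup * P)
  | .cap i => O.sh i O.cap
  | .cross i p => O.sh i (O.cross p * (P * O.s P))

variable (O) in
/-- The value of a word of pieces without names. -/
def word (P : R) (w : List LinkPiece) : R := (w.map (O.piece P)).prod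

theorem word_nil (P : R) : O.word P [] = 1 := rfl
theorem word_cons (P : R) (g : LinkPiece) (w : List LinkPiece) :
    O.word P (g :: w) = O.piece P g * O.word P w := by simp [word]
theorem word_append (P : R) (v w : List LinkPiece) :
    O.word P (v ++ w) = O.word P v * O.word P w := by simp [word]

theorem Exchange.sh_cup (h : O.Exchange) {i k : ℕ} (hik : i ≤ k) (x : R) (e : C) :
    O.sh k x * O.sh i (O.cup * O.proj e) = O.sh i (O.cup * O.proj e) * O.sh (k + 2) x := by
  obtain ⟨j, rfl⟩ := exists_eq_add_of_le hik
  have hp : Commute (O.sh (2 + j) x) (O.proj e) := by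
    rw [show 2 + j = (1 + j) + 1 by omega, O.sh_succ']; exact h.proj e _
  rw [show i + j + 2 = i + (2 + j) by omega, O.sh_add, O.sh_add, ← map_mul, ← map_mul,
    ← mul_assoc, h.cup, mul_assoc, mul_assoc, ← O.sh_add, hp.eq]

theorem Exchange.sh_cap (h : O.Exchange) {i k : ℕ} (hik : i ≤ k) (x : R) :
    O.sh (k + 2) x * O.sh i O.cap = O.sh i O.cap * O.sh k x := by
  obtain ⟨j, rfl⟩ := exists_eq_add_of_le hik
  rw [show i + j + 2 = i + (2 + j) by omega, O.sh_add i j, O.sh_add i, O.sh_add 2, ← map_mul,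
      ← map_mul,
    h.cap]

/-- A straightened zigzag leaves a projector behind. Above a word of minima it disappears, which is
why `TLRel` only asks for the relations there. -/
theorem word_absorb (h : O.Projective) (c : C) {n : ℕ} {u : List LinkPiece} (hu : CupWord n u) :
    ∀ j < n, O.word (O.proj c) u * O.sh j (O.proj c) = O.word (O.proj c) u := by
  induction hu with
  | nil => intro j hj; omega
  | @snoc n u i hu hi ih =>
    intro j hj
    rw [word_append, word_cons, word_nil, mul_one, mul_assoc]
    simp only [piece]
    rcases lt_trichotomy j i with hji | rfl | hji
    · rw [h.toExchange.sh_proj _ hji, ← mul_assoc, ih j (by omega)]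
    · rw [← map_mul, mul_assoc, h.idem]
    · obtain rfl | hji := eq_or_lt_of_le (Nat.succ_le_of_lt hji)
      · rw [Nat.succ_eq_add_one, O.sh_succ, ← map_mul, mul_assoc, ← h.proj, ← mul_assoc, h.cup_proj,
          mul_assoc, h.idem]
      · obtain ⟨k, rfl⟩ : ∃ k, j = k + 2 := ⟨j - 2, by omega⟩
        rw [← h.toExchange.sh_cup (by omega), ← mul_assoc, ih k (by omega)]

/-- Functionals on words with the projector `proj c` satisfy the Temperley-Lieb relations. -/
theorem tlRel_word (h : O.Projective) (c : C) (hzig : O.cup * O.s O.cap = 1)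
    (hzag : O.s O.cup * O.cap = 1) {δ : K} (hloop : O.cup * O.proj c * O.cap = δ • 1)
    (f : R →ₗ[K] K) (hf : f 1 = 1) : TLRel δ (fun w => f (O.word (O.proj c) w)) where
  nil := by simp [word_nil, hf]
  loop {n u} hu i w hi := by
    have : O.sh i (O.cup * O.proj c) * (O.sh i O.cap * O.word (O.proj c) w) =
        δ • O.word (O.proj c) w := by
      rw [← mul_assoc, ← map_mul, hloop, map_smul, map_one, smul_mul_assoc, one_mul]
    simp only [word_append, word_cons, piece, this, mul_smul_comm, map_smul, smul_eq_mul]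
  zig {n u} hu i w hi := by
    have : O.sh i (O.cup * O.proj c) * O.sh (i + 1) O.cap = O.sh i (O.proj c) := by
      rw [O.sh_succ, ← map_mul, mul_assoc, ← h.proj, ← mul_assoc, hzig, one_mul]
    simp only [word_append, word_cons, piece]
    rw [← mul_assoc (O.sh i _), this, ← mul_assoc, word_absorb h c hu i hi]
  zag {n u} hu i w hi := by
    have : O.sh (i + 1) (O.cup * O.proj c) * O.sh i O.cap = O.sh i (O.proj c) := by
      rw [O.sh_succ, ← map_mul]
      congr 1
      have h2 : O.s O.cup * O.proj c = O.proj c * O.s O.cup := h.proj c O.cup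
      rw [map_mul, mul_assoc, h.cap_proj, ← mul_assoc, h2, mul_assoc, hzag, mul_one]
    simp only [word_append, word_cons, piece]
    rw [← mul_assoc (O.sh (i + 1) _), this, ← mul_assoc, word_absorb h c hu i hi]
  far_right {n u} hu i j w hj hi := by
    simp only [word_append, word_cons, piece]
    rw [← mul_assoc (O.sh j _), ← h.toExchange.sh_cup hj, mul_assoc (O.sh i _)]
  far_left {n u} hu i j w hj hi := by
    simp only [word_append, word_cons, piece]
    rw [← mul_assoc (O.sh (j + 2) _), h.toExchange.sh_cap hj, mul_assoc (O.sh i _)]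

/-- The value of a crossingless word. -/
theorem word_value (h : O.Projective) (c : C) (hzig : O.cup * O.s O.cap = 1)
    (hzag : O.s O.cup * O.cap = 1) {δ : K} (hloop : O.cup * O.proj c * O.cap = δ • 1)
    (f : R →ₗ[K] K) (hf : f 1 = 1) {w : List LinkPiece} (hw : Fits 0 w) (hc : NoCross w) :
    f (O.word (O.proj c) w) = δ ^ loops w :=
  (tlRel_word h c hzig hzag hloop f hf).unique (TLRel.loops δ) w hw hc

/-- Diagrams without vertices whose strands all carry the same projector. -/
theorem ev_eq_word {P : R} (hP : ∀ c, O.proj c = P) : ∀ (D : Diagram C) (l l' : List (Strand C)),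
    run l D = some l' → (∀ i o a b c, Piece.vertex i o a b c ∉ D) →
    O.ev l D = O.word P (D.flatMap Piece.forget) := by
  intro D
  induction D with
  | nil => intros; rfl
  | cons g D ih =>
    intro l l' hr hv
    rw [run_cons] at hr
    obtain ⟨l1, h1, h2⟩ := bind_eq_some_iff.1 hr
    have hv' : ∀ i o a b c, Piece.vertex i o a b c ∉ D := fun i o a b c hm =>
      hv i o a b c (List.mem_cons_of_mem _ hm)
    rw [ev_cons _ h1, ih _ _ h2 hv']
    cases g with
    | cup i s => simp [Piece.forget, word_cons, piece, op, hP, Piece.pos]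
    | cap i => simp [Piece.forget, word_cons, piece, op, hP, Piece.pos]
    | cross i p =>
      obtain ⟨L, m, m', r, rfl, -, hL, hm, -, -⟩ := exists_of_step h1
      obtain ⟨x, y, rfl⟩ := length_eq_two.1 hm
      obtain rfl : L.length = i := hL
      simp [Piece.forget, word_cons, piece, op, hP, Piece.pos]
    | vertex i o a b c => exact absurd List.mem_cons_self (hv i o a b c)

end Ops

section

variable {C : Type} [DecidableEq C]

theorem step_length {l l' : List (Strand C)} {g : Piece C} (h : step l g = some l') :
    l'.length + g.ins = l.length + g.outs := by
  obtain ⟨L, m, m', r, rfl, rfl, hL, hm, hm', -⟩ := exists_of_step h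
  simp only [length_append]
  omega

/-- The word of a diagram fits if the diagram is well formed and has no vertices. -/
theorem fits_forget : ∀ (D : Diagram C) (l : List (Strand C)),
    run l D = some [] → (∀ i o a b c, Piece.vertex i o a b c ∉ D) →
    Fits l.length (D.flatMap Piece.forget) := by
  intro D
  induction D with
  | nil => intro l h _; cases h; rfl
  | cons g D ih =>
    intro l hr hv
    rw [run_cons] at hr
    obtain ⟨l1, h1, h2⟩ := bind_eq_some_iff.1 hr
    have hv' : ∀ i o a b c, Piece.vertex i o a b c ∉ D := fun i o a b c hm =>
      hv i o a b c (List.mem_cons_of_mem _ hm)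
    have h3 := ih _ h2 hv'
    have h4 := step_bound h1
    have h5 := step_length h1
    cases g with
    | cup i s =>
      simp only [Piece.pos, Piece.ins, Piece.outs] at h4 h5
      simp only [flatMap_cons, Piece.forget, List.singleton_append, Fits]
      exact ⟨by omega, by rwa [show l.length + 2 = l1.length by omega]⟩
    | cap i =>
      simp only [Piece.pos, Piece.ins, Piece.outs] at h4 h5
      simp only [flatMap_cons, Piece.forget, List.singleton_append, Fits]
      exact ⟨by omega, by rwa [show l.length - 2 = l1.length by omega]⟩
    | cross i p =>
      simp only [Piece.pos, Piece.ins, Piece.outs] at h4 h5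
      simp only [flatMap_cons, Piece.forget, List.singleton_append, Fits]
      exact ⟨by omega, by rwa [show l.length = l1.length by omega]⟩
    | vertex i o a b c => exact absurd List.mem_cons_self (hv i o a b c)

end

/-! ### The bracket as a value -/

namespace TL

variable {K R C : Type} [Field K] [Ring R] [Algebra K R] {A : K} (T : TL R A)

/-- Undoubled strands. -/
def single (C : Type) : Ops K C R where
  s := T.s
  cup := T.u
  cap := T.n
  vert := 0
  cross := T.cr
  proj _ := 1

variable {T}

theorem single_projective : (T.single C).Projective where
  cup x := by simp [single, Ops.sh, pow_two, T.exch_u]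
  cap x := by simp [single, Ops.sh, pow_two, T.exch_n]
  cross p x := by simp [single, Ops.sh, pow_two, T.exch_cr]
  vert x := by simp [single]
  proj e x := by simp [single]
  idem e := by simp [single]
  cross_left e p := by simp [single]
  cross_right e p := by simp [single]
  cup_proj e := by simp [single]
  cap_proj e := by simp [single]

theorem single_laws (hA : A ≠ 0) :
    (T.single C).Laws (-A ^ 3) (fun _ _ => -1) (fun _ _ _ => False) where
  toProjective := single_projective
  ne_zero := by simpa using hA
  symm _ _ := rfl
  good_rotate h := h
  good_swap h := h
  good_sum h := h.elim
  zig := T.zig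
  zag := T.zag
  cup_slide := T.slide_u hA
  cap_slide p := T.slide_n hA p
  cancel := T.cr_cancel hA
  braid := T.cr_braid hA
  turn := by simp [single]
  slide := by simp [single]
  cup_curl e p := by
    simp only [single, mul_one, T.curl_u hA]
    have : ∀ x : K, (-x)⁻¹ = -x⁻¹ := fun x => inv_neg
    cases p <;> simp [curl, boolSign, this]
  cap_curl e p := by
    simp only [single, one_mul, T.curl_n hA]
    have : ∀ x : K, (-x)⁻¹ = -x⁻¹ := fun x => inv_neg
    cases p <;> simp [curl, boolSign, this]
  twist_left h := h.elim
  twist_right h := h.elim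

theorem single_sh_cross (i : ℕ) (p : Bool) :
    (T.single Unit).piece 1 (.cross i p) = (if p then A else A⁻¹) • 1 +
      (if p then A⁻¹ else A) •
        ((T.single Unit).piece 1 (.cap i) * (T.single Unit).piece 1 (.cup i)) := by
  cases p <;> simp [Ops.piece, single, Ops.sh, cr, -AlgHom.coe_pow]

theorem sum_flatMap_two {α β : Type} (l : List α) (a b : α → β) (g : β → K) :
    ((l.flatMap fun s => [a s, b s]).map g).sum = (l.map fun s => g (a s) + g (b s)).sum := by
  induction l with
  | nil => rfl
  | cons x l ih => simp [ih, add_assoc]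

theorem sum_flatMap_three {α β M : Type} [AddCommMonoid M] (l : List α) (a b c : α → β)
    (g : β → M) :
    ((l.flatMap fun s => [a s, b s, c s]).map g).sum =
      (l.map fun s => g (a s) + g (b s) + g (c s)).sum := by
  induction l with
  | nil => rfl
  | cons x l ih => simp [ih, add_assoc]

/-- The state sum is what one gets by multiplying out the two-term operators of the crossings. The
prefix `v` is arbitrary because the pieces already read accumulate in it during the induction. -/
theorem bracketStates_spec (hA : A ≠ 0) (f : R →ₗ[K] K) : ∀ (w : List LinkPiece) (v : R),
    f (v * (T.single Unit).word 1 w) =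
      ((bracketStates w).map fun s => A ^ s.1 * f (v * (T.single Unit).word 1 s.2)).sum := by
  intro w
  induction w with
  | nil => intro v; simp [bracketStates, Ops.word_nil]
  | cons g w ih =>
    intro v
    rw [Ops.word_cons, ← mul_assoc]
    cases g with
    | cup i =>
      rw [ih]
      simp only [bracketStates, map_map, comp_def, Ops.word_cons, mul_assoc]
    | cap i =>
      rw [ih]
      simp only [bracketStates, map_map, comp_def, Ops.word_cons, mul_assoc]
    | cross i p =>
      rw [single_sh_cross, mul_add, mul_smul_comm, mul_smul_comm, mul_one, add_mul, smul_mul_assoc,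
        smul_mul_assoc, map_add, map_smul, map_smul, ih v, ih]
      cases p <;> simp only [bracketStates]
      · rw [sum_flatMap_two]
        simp only [smul_eq_mul, ← sum_map_mul_left, ← List.sum_map_add, Ops.word_cons,
          false_eq_true, if_false]
        congr 1
        apply map_congr_left
        intro s _
        rw [zpow_add₀ hA, zpow_sub₀ hA]
        simp only [zpow_one, mul_assoc]
        ring
      · rw [sum_flatMap_two]
        simp only [smul_eq_mul, ← sum_map_mul_left, ← List.sum_map_add, Ops.word_cons,
          if_true]
        congr 1
        apply map_congr_left
        intro s _
        rw [zpow_add₀ hA, zpow_sub₀ hA]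
        simp only [zpow_one, mul_assoc]
        ring

theorem _root_.ThetaCurve.bracketStates_fits : ∀ (w : List LinkPiece) {n : ℕ}, Fits n w →
    ∀ s ∈ bracketStates w, Fits n s.2 ∧ NoCross s.2 := by
  intro w
  induction w with
  | nil =>
    intro n h s hs
    obtain rfl : s = (0, []) := by simpa [bracketStates] using hs
    exact ⟨h, by intro i p; simp⟩
  | cons g w ih =>
    intro n h s hs
    cases g with
    | cup i =>
      simp only [bracketStates, mem_map] at hs
      obtain ⟨s, hs, rfl⟩ := hs
      obtain ⟨h1, h2⟩ := ih h.2 s hs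
      exact ⟨⟨h.1, h1⟩, by intro j p; simpa using h2 j p⟩
    | cap i =>
      simp only [bracketStates, mem_map] at hs
      obtain ⟨s, hs, rfl⟩ := hs
      obtain ⟨h1, h2⟩ := ih h.2 s hs
      exact ⟨⟨h.1, h1⟩, by intro j p; simpa using h2 j p⟩
    | cross i p =>
      have key : ∀ s : ℤ × List LinkPiece, Fits n s.2 ∧ NoCross s.2 →
          Fits n (.cap i :: .cup i :: s.2) ∧ NoCross (.cap i :: .cup i :: s.2) := by
        intro s hs
        have := h.1
        refine ⟨⟨h.1, by omega, ?_⟩, by intro j p; simpa using hs.2 j p⟩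
        rw [show n - 2 + 2 = n by omega]; exact hs.1
      cases p <;>
      · simp only [bracketStates, mem_flatMap, mem_cons, not_mem_nil, or_false] at hs
        obtain ⟨s, hs, rfl | rfl⟩ := hs
        · first | exact ih h.2 s hs | exact key s (ih h.2 s hs)
        · first | exact ih h.2 s hs | exact key s (ih h.2 s hs)

variable (hA : A ≠ 0) (hd : loopValue A ≠ 0) (f : R →ₗ[K] K) (hf : f 1 = 1)
include hA hd hf

/-- A state with k circles has the value d^k, whereas the bracket gives it d^(k - 1); this is the
factor d⁻¹. -/
theorem bracket_value {w : List LinkPiece} (hw : Fits 0 w) :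
    bracket A w = (loopValue A)⁻¹ * f ((T.single Unit).word 1 w) := by
  have h := bracketStates_spec (T := T) hA f w 1
  rw [one_mul] at h
  rw [h, bracket, ← sum_map_mul_left]
  congr 1
  apply map_congr_left
  intro s hs
  obtain ⟨h1, h2⟩ := bracketStates_fits w hw s hs
  have h3 : f ((T.single Unit).word 1 s.2) = loopValue A ^ loops s.2 :=
    Ops.word_value (O := T.single Unit) single_projective () T.zig T.zag
      (by simpa [single] using T.loop) f hf h1 h2
  rw [one_mul, h3, zpow_sub₀ (show -A ^ 2 - A⁻¹ ^ 2 ≠ 0 from hd), zpow_one, zpow_natCast,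
    show -A ^ 2 - A⁻¹ ^ 2 = loopValue A from rfl]
  ring

theorem jones_value [DecidableEq C] {L : Diagram C} (hL : Closed L)
    (hv : ∀ i o a b c, Piece.vertex i o a b c ∉ L) :
    jones A L = (-A ^ 3) ^ (-writhe L) * ((loopValue A)⁻¹ * f ((T.single C).ev [] L)) := by
  rw [jones, bracket_value (T := T) hA hd f hf (fits_forget L [] hL hv),
    Ops.ev_eq_word (O := T.single C) (P := 1) (fun _ => rfl) L [] [] hL hv]
  rfl

end TL

theorem signSum_neg_one {C : Type} [DecidableEq C] (D : Diagram C) :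
    signSum (fun _ _ => -1) [] D = -writhe D := by
  simp only [signSum, writhe, neg_one_mul]
  induction crossings [] D with
  | nil => rfl
  | cons x l ih => simp only [map_cons, sum_cons, ih]; ring

/-- Isotopies keep diagrams closed. -/
theorem Isotopic.closed {C : Type} [DecidableEq C] {D E : Diagram C} (h : Isotopic D E) :
    Closed D ↔ Closed E := by
  induction h with
  | rel _ _ h => exact ⟨fun _ => h.2.1, fun _ => h.1⟩
  | refl => rfl
  | symm _ _ _ ih => exact ih.symm
  | trans _ _ _ _ _ ih1 ih2 => exact ih1.trans ih2

/-! ### The Jaeger polynomial as a value -/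

/-- The word of a band diagram fits above a row of `n` strands. -/
def BandFits : ℕ → List BandPiece → Prop
  | n, [] => n = 0
  | n, .link (.cup i) :: w => i ≤ n ∧ BandFits (n + 2) w
  | n, .link (.cap i) :: w => i + 2 ≤ n ∧ BandFits (n - 2) w
  | n, .link (.cross i _) :: w => i + 2 ≤ n ∧ BandFits n w
  | n, .bar i :: w => i + 2 ≤ n ∧ BandFits n w

theorem eliminateBars_fits {K : Type} [Field K] (a t : K) : ∀ (w : List BandPiece) {n : ℕ},
    BandFits n w → ∀ x ∈ eliminateBars a t w, Fits n x.2 := by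
  intro w
  induction w with
  | nil =>
    intro n h x hx
    obtain rfl : x = (1, []) := by simpa [eliminateBars] using hx
    exact h
  | cons g w ih =>
    intro n h x hx
    cases g with
    | link g =>
      simp only [eliminateBars, mem_map] at hx
      obtain ⟨x, hx, rfl⟩ := hx
      cases g with
      | cup i => exact ⟨h.1, ih h.2 x hx⟩
      | cap i => exact ⟨h.1, ih h.2 x hx⟩
      | cross i p => exact ⟨h.1, ih h.2 x hx⟩
    | bar i =>
      simp only [eliminateBars, mem_flatMap, mem_cons, not_mem_nil, or_false] at hx
      obtain ⟨x, hx, rfl | rfl | rfl⟩ := hx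
      · exact ⟨h.1, ih h.2 x hx⟩
      · exact ih h.2 x hx
      · have := h.1
        refine ⟨h.1, by omega, ?_⟩
        rw [show n - 2 + 2 = n by omega]; exact ih h.2 x hx

section

variable {C : Type} [DecidableEq C]

theorem bandFits_barPiece : ∀ (D : Diagram C) (l : List (Strand C)), run l D = some [] →
    BandFits (2 * l.length) (D.flatMap barPiece) := by
  intro D
  induction D with
  | nil => intro l h; cases h; rfl
  | cons g D ih =>
    intro l hr
    rw [run_cons] at hr
    obtain ⟨l1, h1, h2⟩ := bind_eq_some_iff.1 hr
    have h3 := ih _ h2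
    have h4 := step_bound h1
    have h5 := step_length h1
    cases g with
    | cup i s =>
      simp only [Piece.pos, Piece.ins, Piece.outs] at h4 h5
      simp only [flatMap_cons, barPiece, cons_append, nil_append, BandFits]
      refine ⟨by omega, by omega, by omega, ?_⟩
      rwa [show 2 * l.length + 2 + 2 = 2 * l1.length by omega]
    | cap i =>
      simp only [Piece.pos, Piece.ins, Piece.outs] at h4 h5
      simp only [flatMap_cons, barPiece, cons_append, nil_append, BandFits]
      refine ⟨by omega, by omega, ?_⟩
      rwa [show 2 * l.length - 2 - 2 = 2 * l1.length by omega]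
    | cross i p =>
      simp only [Piece.pos, Piece.ins, Piece.outs] at h4 h5
      simp only [flatMap_cons, barPiece, cons_append, nil_append, BandFits]
      refine ⟨by omega, by omega, by omega, by omega, by omega, by omega, ?_⟩
      rwa [show 2 * l.length = 2 * l1.length by omega]
    | vertex i o a b c =>
      simp only [Piece.pos, Piece.ins, Piece.outs] at h4 h5
      simp only [flatMap_cons, barPiece, cons_append, nil_append, BandFits]
      refine ⟨by omega, by omega, by omega, by omega, by omega, by omega, ?_⟩
      rwa [show 2 * l.length + 2 + 2 + 2 = 2 * l1.length by omega]

end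

namespace TL

variable {K R C : Type} [Field K] [Ring R] [Algebra K R] {A : K} {T : TL R A}

variable (T) in
/-- The value of a piece of a band diagram. -/
def bandPiece : BandPiece → R
  | .link g => (T.single Unit).piece 1 g
  | .bar i => T.mv i (T.pr true)

variable (T) in
/-- The value of a band diagram. -/
def bandWord (w : List BandPiece) : R := (w.map T.bandPiece).prod

theorem bandWord_cons (g : BandPiece) (w : List BandPiece) :
    T.bandWord (g :: w) = T.bandPiece g * T.bandWord w := by simp [bandWord]

theorem bandWord_append (v w : List BandPiece) :
    T.bandWord (v ++ w) = T.bandWord v * T.bandWord w := by simp [bandWord]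

/-- A half twist is A times the strip plus A⁻¹ times the cut. Together with the untwisted strip the
coefficient of the identity becomes 1, and that of the cut is (A + A⁻¹)⁻¹ (A⁻¹ + (A - A⁻¹)/(1 + A⁴))
= -1/d. So a bar is the Jones-Wenzl projector. -/
theorem bar_expand (hA : A ≠ 0) (h2 : A + A⁻¹ ≠ 0) (h4 : 1 + A ^ 4 ≠ 0) (i : ℕ) :
    T.mv i (T.pr true) = (A + A⁻¹)⁻¹ • T.x true i + ((A + A⁻¹)⁻¹ * A⁻¹) • 1 +
      ((A + A⁻¹)⁻¹ * ((A - A⁻¹) / (1 - -A ^ 3 * A))) • (T.a i * T.c i) := by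
  have h4' : 1 - -A ^ 3 * A ≠ 0 := by convert h4 using 1; ring
  have hd : loopValue A ≠ 0 := by
    intro h
    apply h4
    have : A ^ 2 * loopValue A = -(1 + A ^ 4) := by simp only [loopValue]; field_simp; ring
    rw [h, mul_zero] at this
    exact neg_eq_zero.1 this.symm
  have e0 : (A + A⁻¹)⁻¹ * (A + A⁻¹) = 1 := inv_mul_cancel₀ h2
  have e1 : -(loopValue A)⁻¹ = (A + A⁻¹)⁻¹ * A⁻¹ + (A + A⁻¹)⁻¹ * ((A - A⁻¹) / (1 - -A ^ 3 * A)) := by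
    have h5 : A ^ 2 + 1 ≠ 0 := by
      intro h
      apply h2
      field_simp
      simpa using h
    have : loopValue A = -(1 + A ^ 4) / A ^ 2 := by simp only [loopValue]; field_simp; ring
    rw [this, show 1 - -A ^ 3 * A = 1 + A ^ 4 by ring]
    field_simp
    ring
  have e2 : T.mv i (T.pr true) = 1 - (loopValue A)⁻¹ • (T.a i * T.c i) := by
    rw [← e_eq]
    simp only [pr, if_true, map_sub, map_one, map_smul]
    congr 2
  rw [e2, x_eq, e_eq, sub_eq_add_neg, ← neg_smul, e1]
  simp only [if_true, smul_add, smul_smul, add_smul]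
  have e3 : (1 : R) = ((A + A⁻¹)⁻¹ * A) • 1 + ((A + A⁻¹)⁻¹ * A⁻¹) • 1 := by
    rw [← add_smul, ← mul_add, e0, one_smul]
  nth_rewrite 1 [e3]
  abel

theorem eliminateBars_spec (hA : A ≠ 0) (h2 : A + A⁻¹ ≠ 0) (h4 : 1 + A ^ 4 ≠ 0) (f : R →ₗ[K] K) :
    ∀ (w : List BandPiece) (v : R), f (v * T.bandWord w) =
      ((eliminateBars (-A ^ 3) A w).map fun x => x.1 * f (v * (T.single Unit).word 1 x.2)).sum := by
  intro w
  induction w with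
  | nil => intro v; simp [eliminateBars, bandWord, Ops.word]
  | cons g w ih =>
    intro v
    rw [bandWord_cons, ← mul_assoc]
    cases g with
    | link g =>
      rw [ih]
      simp only [eliminateBars, map_map, comp_def, Ops.word_cons, mul_assoc, bandPiece]
    | bar i =>
      have e1 : T.x true i = (T.single Unit).piece 1 (.cross i true) := by
        simp [Ops.piece, single, Ops.sh, x, mv]
      have e2 : T.c i = (T.single Unit).piece 1 (.cup i) := by
        simp [Ops.piece, single, Ops.sh, c, mv]
      have e3 : T.a i = (T.single Unit).piece 1 (.cap i) := rfl
      simp only [bandPiece]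
      rw [bar_expand hA h2 h4, e1, e2, e3]
      simp only [mul_add, mul_smul_comm, mul_one, add_mul, smul_mul_assoc, map_add, map_smul, ih]
      rw [eliminateBars, sum_flatMap_three]
      simp only [smul_eq_mul, ← sum_map_mul_left, ← List.sum_map_add, Ops.word_cons]
      congr 1
      apply map_congr_left
      intro s _
      simp only [mul_assoc]

theorem cabled_sh (χ : C → Bool) (i : ℕ) (y : R) : (T.cabled χ).sh i y = T.mv (2 * i) y := by
  simp only [Ops.sh, mv, pow_mul, cabled]
  congr 1
variable [DecidableEq C]

/-- The bars of `barPiece` sit exactly where `op` puts its projectors: on the outgoing strips,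
except that a minimum has one on its left end only. -/
theorem bandWord_bar : ∀ (D : Diagram C) (l l' : List (Strand C)), run l D = some l' →
    T.bandWord (D.flatMap barPiece) = (T.cabled (fun _ => true)).ev l D := by
  intro D
  induction D with
  | nil => intros; rfl
  | cons g D ih =>
    intro l l' hr
    rw [run_cons] at hr
    obtain ⟨l1, h1, h2⟩ := bind_eq_some_iff.1 hr
    rw [Ops.ev_cons _ h1, ← ih _ _ h2, flatMap_cons, bandWord_append]
    congr 1
    have e2 : ∀ i, (T.single Unit).piece 1 (.cup i) = T.mv i T.u := by
      intro i; simp [Ops.piece, single, Ops.sh, mv]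
    have e3 : ∀ i, (T.single Unit).piece 1 (.cap i) = T.mv i T.n := by
      intro i; simp [Ops.piece, single, Ops.sh, mv]
    have e4 : ∀ i p, (T.single Unit).piece 1 (.cross i p) = T.mv i (T.cr p) := by
      intro i p; simp [Ops.piece, single, Ops.sh, mv]
    have e5 : ∀ y, T.s (T.s y) = T.mv 2 y := by intro y; simp [mv, pow_two]
    have e6 : ∀ y, T.s (T.s (T.s (T.s y))) = T.mv 4 y := by intro y; simp [mv, pow_succ]
    rw [cabled_sh]
    cases g with
    | cup i s =>
      simp only [barPiece, bandWord, map_cons, map_nil, prod_cons, prod_nil,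
        mul_one, bandPiece, e2, Piece.pos, Ops.op, cabled, c, map_mul, mv_add, mul_assoc]
      rfl
    | cap i =>
      simp only [barPiece, bandWord, map_cons, map_nil, prod_cons, prod_nil,
        mul_one, bandPiece, e3, Piece.pos, Ops.op, cabled, a, map_mul, mv_add, mul_assoc]
      rfl
    | cross i p =>
      obtain ⟨L, m, m', r, rfl, -, hL, hm, -, -⟩ := exists_of_step h1
      obtain ⟨x, y, rfl⟩ := length_eq_two.1 hm
      obtain rfl : L.length = i := hL
      have e7 : (T.cabled (fun _ => true)).op (L ++ [x, y] ++ r) (Piece.cross L.length p) =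
        T.x p 1 * T.x p 0 * T.x p 2 * T.x p 1 * (T.pr true * T.s (T.s (T.pr true))) := by
        simp [Ops.op, cabled]
      rw [e7]
      simp only [barPiece, bandWord, map_cons, map_nil, prod_cons, prod_nil,
        mul_one, bandPiece, e4, Piece.pos, e5, TL.x, map_mul, mv_add, mul_assoc]
      rfl
    | vertex i o a b c =>
      simp only [barPiece, bandWord, map_cons, map_nil, prod_cons, prod_nil,
        mul_one, bandPiece, e2, Piece.pos, Ops.op, cabled, TL.c, map_mul, mv_add, mul_assoc,
        AlgHom.comp_apply, e5, e6]

      rfl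

theorem jaeger_value (hA : A ≠ 0) (h2 : A + A⁻¹ ≠ 0) (h4 : 1 + A ^ 4 ≠ 0) (hd : loopValue A ≠ 0)
    (f : R →ₗ[K] K) (hf : f 1 = 1) {D : Diagram C} (hD : Closed D) :
    jaeger A D = (loopValue A)⁻¹ * f ((T.cabled (fun _ => true)).ev [] D) := by
  have h := eliminateBars_spec (T := T) hA h2 h4 f (D.flatMap barPiece) 1
  rw [one_mul] at h
  rw [← bandWord_bar D [] [] hD, h, jaeger, ← sum_map_mul_left]
  congr 1
  apply map_congr_left
  intro x hx
  have := eliminateBars_fits _ _ _ (bandFits_barPiece D [] hD) x hx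
  rw [one_mul, bracket_value (T := T) hA hd f hf this]
  ring

end TL

/-! ### Operators on functions of streams -/

section Stream

variable {K ι : Type} [Field K]

/-- Put an entry in front of a stream. -/
def push (a : ι) (x : ℕ → ι) : ℕ → ι
  | 0 => a
  | n + 1 => x n

/-- Remove the first entry of a stream. -/
def drop1 (x : ℕ → ι) : ℕ → ι := fun n => x (n + 1)

theorem push_drop1 (x : ℕ → ι) : push (x 0) (drop1 x) = x := by
  funext n; cases n <;> rfl
theorem drop1_push (a : ι) (x : ℕ → ι) : drop1 (push a x) = x := rfl
theorem push_zero (a : ι) (x : ℕ → ι) : push a x 0 = a := rfl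

/-- Fix the first entry. -/
def fixFirst (a : ι) : ((ℕ → ι) → K) →ₗ[K] ((ℕ → ι) → K) where
  toFun Φ x := Φ (push a x)
  map_add' _ _ := rfl
  map_smul' _ _ := rfl

/-- An operator is shifted by one place. -/
def streamShift : Module.End K ((ℕ → ι) → K) →ₐ[K] Module.End K ((ℕ → ι) → K) :=
  AlgHom.ofLinearMap
    { toFun := fun X =>
        { toFun := fun Φ x => X (fixFirst (x 0) Φ) (drop1 x)
          map_add' := fun Φ Ψ => by funext x; simp
          map_smul' := fun k Φ => by funext x; simp }
      map_add' := fun X Y => rfl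
      map_smul' := fun k X => rfl }
    (by ext Φ x; simp [fixFirst, push_drop1])
    (by intro X Y; rfl)

theorem streamShift_apply (X : Module.End K ((ℕ → ι) → K)) (Φ : (ℕ → ι) → K) (x : ℕ → ι) :
    streamShift X Φ x = X (fixFirst (x 0) Φ) (drop1 x) := rfl

/-- The value of a constant function at a constant stream. -/
def streamValue (i : ι) : Module.End K ((ℕ → ι) → K) →ₗ[K] K where
  toFun X := X 1 (fun _ => i)
  map_add' _ _ := rfl
  map_smul' _ _ := rfl

theorem streamValue_one (i : ι) : streamValue (K := K) i 1 = 1 := rfl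

end Stream

section

variable {K : Type} [Field K] {A : K}

/-- The operators of the Temperley-Lieb category on functions of binary streams. -/
def vertexModel (hA : A ≠ 0) : TL (Module.End K ((ℕ → Bool) → K)) A where
  s := streamShift
  u :=
    -- The weights -A, A⁻¹ of a minimum and A, -A⁻¹ of a maximum multiply to -A² and -A⁻² on the two
    -- orientations of a circle, and to 1 along every zigzag.
    { toFun := fun Φ x => -A * Φ (push false (push true x)) + A⁻¹ * Φ (push true (push false x))
      map_add' := fun Φ Ψ => by funext x; simp; ring
      map_smul' := fun k Φ => by funext x; simp; ring }
  n :=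
    { toFun := fun Φ x => (if x 0 = x 1 then 0 else if x 1 then A else -A⁻¹) * Φ (drop1 (drop1 x))
      map_add' := fun Φ Ψ => by funext x; simp [mul_add]
      map_smul' := fun k Φ => by funext x; simp; ring }
  exch_u X := by
    ext Φ x
    have h : ∀ a b, fixFirst b (fixFirst a Φ) = fun y => Φ (push a (push b y)) := fun a b => rfl
    simp only [Module.End.mul_apply, LinearMap.coe_mk, AddHom.coe_mk, streamShift_apply, push_zero,
      drop1_push]
    have : (fun y => -A * Φ (push false (push true y)) + A⁻¹ * Φ (push true (push false y))) =
        (-A) • fixFirst true (fixFirst false Φ) + A⁻¹ • fixFirst false (fixFirst true Φ) := rfl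
    rw [this, map_add, map_smul, map_smul]
    rfl
  exch_n X := by
    ext Φ x
    simp only [Module.End.mul_apply, LinearMap.coe_mk, AddHom.coe_mk, streamShift_apply]
    have : fixFirst (drop1 x 0) (fixFirst (x 0) (fun x => (if x 0 = x 1 then 0 else
        if x 1 then A else -A⁻¹) * Φ (drop1 (drop1 x)))) =
        (if x 0 = x 1 then 0 else if x 1 then A else -A⁻¹) • Φ := rfl
    rw [this, map_smul]
    rfl
  loop := by
    ext Φ x
    simp [Module.End.mul_apply, push, drop1_push, loopValue]
    ring_nf
  zig := by
    ext Φ x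
    simp [Module.End.mul_apply, push, drop1_push, streamShift_apply, fixFirst]
    have := push_drop1 x
    by_cases h : x 0 = true
    · rw [h] at this; simp [h, hA, this]
    · rw [not_eq_true] at h; rw [h] at this; simp [h, hA, this]
  zag := by
    ext Φ x
    simp [Module.End.mul_apply, push, drop1_push, streamShift_apply, fixFirst]

    have := push_drop1 x
    by_cases h : x 0 = true
    · rw [h] at this; simp [h, hA, this, drop1, push]
    · rw [not_eq_true] at h; rw [h] at this; simp [h, hA, this, drop1, push]

end

/-! ### Counting colourings -/

/-- Operators that count the colourings of a diagram by two colours; the strands with the name `c`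
have the colour `b` if `g c = some b`. -/
def colour {C : Type} (g : C → Option Bool) : Ops ℚ C (Module.End ℚ ((ℕ → Bool) → ℚ)) where
  s := streamShift
  cup :=
    { toFun := fun Φ x => Φ (push false (push false x)) + Φ (push true (push true x))
      map_add' := fun Φ Ψ => by funext x; simp; ring
      map_smul' := fun k Φ => by funext x; simp; ring }
  cap :=
    { toFun := fun Φ x => (if x 0 = x 1 then 1 else 0) * Φ (drop1 (drop1 x))
      map_add' := fun Φ Ψ => by funext x; simp [mul_add]
      map_smul' := fun k Φ => by funext x; simp }
  vert :=
    { toFun := fun Φ x => ∑ a : Bool, ∑ b : Bool, ∑ c : Bool, Φ (push a (push b (push c x)))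
      map_add' := fun Φ Ψ => by funext x; simp [sum_add_distrib]
      map_smul' := fun k Φ => by funext x; simp [mul_sum]; ring }
  cross _ :=
    { toFun := fun Φ x => Φ (push (x 1) (push (x 0) (drop1 (drop1 x))))
      map_add' := fun Φ Ψ => rfl
      map_smul' := fun k Φ => rfl }
  proj c :=
    { toFun := fun Φ x => if g c = some (!(x 0)) then 0 else Φ x
      map_add' := fun Φ Ψ => by funext x; simp only [Pi.add_apply]; split_ifs <;> simp
      map_smul' := fun k Φ => by funext x; simp only [Pi.smul_apply]; split_ifs <;> simp }

namespace colour

variable {C : Type} (g : C → Option Bool) (Φ : (ℕ → Bool) → ℚ) (x : ℕ → Bool)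

theorem cup_apply : (colour g).cup Φ x = Φ (push false (push false x)) + Φ (push true (push true x)) :=
  rfl
theorem cap_apply : (colour g).cap Φ x = (if x 0 = x 1 then 1 else 0) * Φ (drop1 (drop1 x)) := rfl
theorem vert_apply : (colour g).vert Φ x =
  ∑ a : Bool, ∑ b : Bool, ∑ c : Bool, Φ (push a (push b (push c x))) := rfl
theorem cross_apply (p : Bool) :
  (colour g).cross p Φ x = Φ (push (x 1) (push (x 0) (drop1 (drop1 x)))) := rfl
theorem proj_apply (c : C) :
  (colour g).proj c Φ x = if g c = some (!(x 0)) then 0 else Φ x := rfl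
theorem s_apply (X : Module.End ℚ ((ℕ → Bool) → ℚ)) :
  (colour g).s X Φ x = X (fixFirst (x 0) Φ) (drop1 x) := rfl
theorem sh_two (X : Module.End ℚ ((ℕ → Bool) → ℚ)) :
  (colour g).sh 2 X = (colour g).s ((colour g).s X) := rfl
theorem sh_three (X : Module.End ℚ ((ℕ → Bool) → ℚ)) :
  (colour g).sh 3 X = (colour g).s ((colour g).s ((colour g).s X)) := rfl

theorem push_push_drop : push (x 0) (push (x 1) (drop1 (drop1 x))) = x := by
  have h := push_drop1 (drop1 x)
  have h' := push_drop1 x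
  rw [← h] at h'
  exact h'

theorem push_eta (y : ℕ → Bool) (a : Bool) : (push a y) 1 = y 0 := rfl

theorem projective : (colour g).Projective where
  cup X := by
    ext Φ x
    simp only [Module.End.mul_apply, cup_apply, sh_two, s_apply]
    have : (colour g).cup Φ = fixFirst false (fixFirst false Φ) + fixFirst true (fixFirst true Φ) :=
      rfl
    rw [this, map_add]
    rfl
  cap X := by
    ext Φ x
    simp only [Module.End.mul_apply, cap_apply, sh_two, s_apply]
    have : fixFirst (drop1 x 0) (fixFirst (x 0) ((colour g).cap Φ)) =
        (if x 0 = x 1 then 1 else 0 : ℚ) • Φ := rfl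
    rw [this, map_smul]
    rfl
  cross p X := by
    ext Φ x
    rfl
  vert X := by
    ext Φ x
    simp only [Module.End.mul_apply, vert_apply, sh_three, s_apply]
    have : (colour g).vert Φ = ∑ a : Bool, ∑ b : Bool, ∑ c : Bool,
        fixFirst c (fixFirst b (fixFirst a Φ)) := by
      funext y
      simp only [Finset.sum_apply]
      rfl
    rw [this]
    simp only [map_sum, Finset.sum_apply]
    rfl
  proj e X := by
    ext Φ x
    simp only [Module.End.mul_apply, s_apply, proj_apply]
    by_cases h : g e = some (!(x 0))
    · rw [if_pos h]
      have : fixFirst (x 0) ((colour g).proj e Φ) = 0 := by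
        funext y; exact if_pos h
      rw [this, map_zero]; rfl
    · rw [if_neg h]
      have : fixFirst (x 0) ((colour g).proj e Φ) = fixFirst (x 0) Φ := by
        funext y; exact if_neg h
      rw [this]
  idem e := by
    ext Φ x
    simp only [Module.End.mul_apply, proj_apply]
    split_ifs <;> rfl
  cross_left e p := by
    ext Φ x
    rfl
  cross_right e p := by
    ext Φ x
    rfl
  cup_proj e := by
    ext Φ x
    rfl
  cap_proj e := by
    ext Φ x
    simp only [Module.End.mul_apply, cap_apply, s_apply, proj_apply, fixFirst, LinearMap.coe_mk,
      AddHom.coe_mk, push_eta, push_zero, drop1_push, push_drop1]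
    have h1 : drop1 x 0 = x 1 := rfl
    simp only [h1]
    by_cases h : x 0 = x 1 <;> simp [h]

/-- A crossing of either type only permutes the colours of its strands, and the legs of a vertex are
coloured independently. So the number of colourings is unchanged by all moves, without any
normalization. -/
theorem laws : (colour (fun _ : C => none)).Laws 1 (fun _ _ => 0) (fun _ _ _ => True) where
  toProjective := projective _
  ne_zero := one_ne_zero
  symm _ _ := rfl
  good_rotate h := h
  good_swap h := h
  good_sum _ _ := rfl
  zig := by
    ext Φ x
    simp only [Module.End.mul_apply, cap_apply, cup_apply, s_apply, fixFirst, LinearMap.coe_mk,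
      AddHom.coe_mk, push_eta, push_zero, drop1_push, Module.End.one_apply]
    have := push_drop1 x
    by_cases h : x 0 = true
    · rw [h] at this; simp [h, this]
    · rw [not_eq_true] at h; rw [h] at this; simp [h, this]
  zag := by
    ext Φ x
    simp only [Module.End.mul_apply, cap_apply, cup_apply, s_apply, fixFirst, LinearMap.coe_mk,
      AddHom.coe_mk, push_eta, push_zero, drop1_push, Module.End.one_apply]
    have := push_drop1 x
    by_cases h : x 0 = true
    · rw [h] at this; simp [h, this]
    · rw [not_eq_true] at h; rw [h] at this; simp [h, this]
  cup_slide p := by ext Φ x; rfl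
  cap_slide p := by ext Φ x; rfl
  cancel p := by ext Φ x; exact congrArg Φ (push_push_drop x)
  braid p := by ext Φ x; rfl
  turn := by
    ext Φ x
    have h : ((colour fun _ : C => none).cup * (colour fun _ : C => none).s
        (colour fun _ : C => none).vert * (colour fun _ : C => none).cap) Φ x =
        (∑ b : Bool, ∑ c : Bool, ∑ d : Bool, (if false = b then 1 else 0) *
          Φ (push c (push d (push false x)))) + (∑ b : Bool, ∑ c : Bool, ∑ d : Bool,
          (if true = b then 1 else 0) * Φ (push c (push d (push true x)))) := rfl
    rw [h, vert_apply]
    simp only [Fintype.sum_bool]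
    simp
    ring
  slide p := by ext Φ x; rfl
  cup_curl e p := by ext Φ x; simp; rfl
  cap_curl e p := by
    ext Φ x
    have h : ((colour fun _ : C => none).proj e * (colour fun _ : C => none).cross p *
        (colour fun _ : C => none).cap) Φ x =
        (if x 1 = x 0 then 1 else 0) * Φ (drop1 (drop1 x)) := rfl
    rw [h, one_zpow, one_smul]
    have h : ((colour fun _ : C => none).proj e * (colour fun _ : C => none).cap) Φ x =
        (if x 0 = x 1 then 1 else 0) * Φ (drop1 (drop1 x)) := rfl
    rw [h]
    simp only [eq_comm]
  twist_left {a b c} _ p := by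
    ext Φ x
    have h : ((colour fun _ : C => none).vert * (colour fun _ : C => none).cross p *
        ((colour fun _ : C => none).proj b * (colour fun _ : C => none).s
          ((colour fun _ : C => none).proj a) * (colour fun _ : C => none).s
          ((colour fun _ : C => none).s ((colour fun _ : C => none).proj c)))) Φ x =
        ∑ a : Bool, ∑ b : Bool, ∑ c : Bool, Φ (push b (push a (push c x))) := rfl
    have h' : ((colour fun _ : C => none).vert *
        ((colour fun _ : C => none).proj b * (colour fun _ : C => none).s
          ((colour fun _ : C => none).proj a) * (colour fun _ : C => none).s
          ((colour fun _ : C => none).s ((colour fun _ : C => none).proj c)))) Φ x =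
        ∑ a : Bool, ∑ b : Bool, ∑ c : Bool, Φ (push a (push b (push c x))) := rfl
    rw [h, one_zpow, one_smul, h', sum_comm]
  twist_right {a b c} _ p := by
    ext Φ x
    have h : ((colour fun _ : C => none).vert * (colour fun _ : C => none).s
        ((colour fun _ : C => none).cross p) *
        ((colour fun _ : C => none).proj a * (colour fun _ : C => none).s
          ((colour fun _ : C => none).proj c) * (colour fun _ : C => none).s
          ((colour fun _ : C => none).s ((colour fun _ : C => none).proj b)))) Φ x =
        ∑ a : Bool, ∑ b : Bool, ∑ c : Bool, Φ (push a (push c (push b x))) := rfl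
    have h' : ((colour fun _ : C => none).vert *
        ((colour fun _ : C => none).proj a * (colour fun _ : C => none).s
          ((colour fun _ : C => none).proj c) * (colour fun _ : C => none).s
          ((colour fun _ : C => none).s ((colour fun _ : C => none).proj b)))) Φ x =
        ∑ a : Bool, ∑ b : Bool, ∑ c : Bool, Φ (push a (push b (push c x))) := rfl
    rw [h, one_zpow, one_smul, h']
    exact sum_congr rfl fun _ _ => sum_comm

variable [DecidableEq C]

/-- Put a list in front of a stream. -/
def pushList {ι : Type} : List ι → (ℕ → ι) → (ℕ → ι)
  | [], x => x
  | a :: l, x => push a (pushList l x)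

/-- The stream that begins with a list. -/
def row (l : List Bool) : ℕ → Bool := pushList l fun _ => false

theorem sh_row (X : Module.End ℚ ((ℕ → Bool) → ℚ)) : ∀ (L r : List Bool) (Φ : (ℕ → Bool) → ℚ),
    (colour g).sh L.length X Φ (row (L ++ r)) = X (fun y => Φ (pushList L y)) (row r) := by
  intro L
  induction L with
  | nil => intro r Φ; rfl
  | cons a L ih =>
    intro r Φ
    rw [length_cons, Ops.sh_succ', s_apply]
    exact ih r _

theorem sh_row' (X : Module.End ℚ ((ℕ → Bool) → ℚ)) {α : Type} (f : α → Bool) (L r : List α)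
    (Φ : (ℕ → Bool) → ℚ) : (colour g).sh L.length X Φ (row ((L ++ r).map f)) =
      X (fun y => Φ (pushList (L.map f) y)) (row (r.map f)) := by
  rw [map_append, ← sh_row g, length_map]

theorem pushList_append {ι : Type} (L r : List ι) (x : ℕ → ι) :
    pushList (L ++ r) x = pushList L (pushList r x) := by
  induction L with
  | nil => rfl
  | cons a L ih => simp [pushList, ih]

/-- The number of colourings in terms of the number of loops. -/
theorem sum_word (w : List LinkPiece) : ∀ (l : List ℕ) (n : ℕ), (∀ y ∈ l, y < n) →
    Fits l.length w → (∑ s ∈ (Finset.range n).powerset, (colour (fun _ : Unit => none)).word 1 w 1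
      (row (l.map fun y => decide (y ∈ s)))) ^ 2 * 2 ^ l.length = 4 ^ (n + loopsAux l n w) := by
  -- The sum itself is 2 to the power n + loops - (length of `l`)/2: each name has two colours, and
  -- a maximum either closes a curve or identifies two names, while it shortens the row by two.
  -- Squaring avoids the halved length.
  induction w with
  | nil =>
    intro l n _ hf
    obtain rfl : l = [] := length_eq_zero_iff.1 hf
    have h4 : (4 : ℚ) = 2 ^ 2 := by norm_num
    simp [Ops.word_nil, loopsAux, h4, ← pow_mul, mul_comm]
  | cons g w ih =>
    intro l n hl hf
    simp only [Ops.word_cons, Module.End.mul_apply]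
    cases g with
    | cup i =>
      obtain ⟨L, r, rfl, rfl⟩ := exists_split l hf.1
      have h1 := ih (L ++ n :: n :: r) (n + 1) (by
        intro y hy
        simp only [mem_append, mem_cons] at hy
        rcases hy with hy | rfl | rfl | hy
        · have := hl y (by simp [hy]); omega
        · omega
        · omega
        · have := hl y (by simp [hy]); omega) (by
        have := hf.2
        simp only [length_append, length_cons] at this ⊢
        exact this)
      rw [Finset.range_add_one, Finset.sum_powerset_insert (by simp), ← sum_add_distrib] at h1
      have h2 : ∀ s ∈ (Finset.range n).powerset,
          (colour (fun _ : Unit => none)).piece 1 (.cup L.length)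
            ((colour (fun _ : Unit => none)).word 1 w 1)
            (row ((L ++ r).map fun y => decide (y ∈ s))) =
          (colour (fun _ : Unit => none)).word 1 w 1
            (row ((L ++ n :: n :: r).map fun y => decide (y ∈ s))) +
          (colour (fun _ : Unit => none)).word 1 w 1
            (row ((L ++ n :: n :: r).map fun y => decide (y ∈ insert n s))) := by
        intro s hs
        have hn : n ∉ s := fun h => by simpa using mem_powerset.1 hs h
        have h3 : ∀ l : List ℕ, (∀ y ∈ l, y < n) → (l.map fun y => decide (y ∈ insert n s)) =
            l.map fun y => decide (y ∈ s) := by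
          intro l hl
          apply map_congr_left
          intro y hy
          have := hl y hy
          simp [this.ne]
        simp only [Ops.piece, mul_one]
        rw [sh_row', cup_apply]
        simp only [map_append, map_cons, h3 L fun y hy => hl y (by simp [hy]),
          h3 r fun y hy => hl y (by simp [hy]), row, pushList_append, pushList]
        simp [hn]
      rw [sum_congr rfl h2]
      rw [loopsAux_cup]
      simp only [length_append, length_cons] at h1 ⊢
      rw [show L.length + (r.length + 1 + 1) = L.length + r.length + 2 by omega, pow_add 2 _ 2,
        show n + 1 + loopsAux (L ++ n :: n :: r) (n + 1) w =
          n + loopsAux (L ++ n :: n :: r) (n + 1) w + 1 by omega, pow_succ 4] at h1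
      linarith
    | cap i =>
      obtain ⟨L, a, b, r, rfl, rfl⟩ := exists_split_two l hf.1
      have hlen : (L ++ a :: b :: r).length = (L ++ r).length + 2 := by simp; omega
      have hf2 : Fits (L ++ r).length w := by
        have := hf.2
        rw [hlen] at this
        exact this
      have h2 : ∀ s : Finset ℕ,
          (colour (fun _ : Unit => none)).piece 1 (.cap L.length)
            ((colour (fun _ : Unit => none)).word 1 w 1)
            (row ((L ++ a :: b :: r).map fun y => decide (y ∈ s))) =
          if a ∈ s ↔ b ∈ s then (colour (fun _ : Unit => none)).word 1 w 1
            (row ((L ++ r).map fun y => decide (y ∈ s))) else 0 := by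
        intro s
        simp only [Ops.piece]
        rw [sh_row', cap_apply]
        simp only [map_append, map_cons, row, pushList_append, pushList, push_zero,
          push_eta, drop1_push]
        simp
      simp only [h2]
      rw [loopsAux_cap, hlen]
      by_cases hab : a = b
      · subst hab
        have h1 := ih (L ++ r) n (fun y hy => hl y (by
          simp only [mem_append, mem_cons] at hy ⊢; tauto)) hf2
        have h3 : (L ++ r).map (fun x => if x = a then a else x) = L ++ r := by
          conv_rhs => rw [← map_id (L ++ r)]
          apply map_congr_left
          intro x _
          by_cases hx : x = a <;> simp [hx]
        simp only [if_true, iff_self, h3]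
        rw [pow_add 2 _ 2, ← mul_assoc, h1, show n + (1 + loopsAux (L ++ r) n w) =
          n + loopsAux (L ++ r) n w + 1 by omega, pow_succ 4]
        norm_num
      · have hlen2 : ((L ++ r).map fun x => if x = b then a else x).length = (L ++ r).length := by
          simp
        have ha : a < n := hl a (by simp)
        have hb : b < n := hl b (by simp)
        have h1 := ih ((L ++ r).map fun x => if x = b then a else x) n (by
          intro y hy
          obtain ⟨x, hx, rfl⟩ := mem_map.1 hy
          split_ifs
          · exact ha
          · refine hl x ?_
            simp only [mem_append, mem_cons] at hx ⊢; tauto) (by rw [hlen2]; exact hf2)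
        rw [hlen2] at h1
        rw [if_neg hab, zero_add, ← h1]
        have hr : Finset.range n = insert b ((Finset.range n).erase b) :=
          (Finset.insert_erase (by simpa using hb)).symm
        have hbn : b ∉ (Finset.range n).erase b := Finset.notMem_erase b _
        rw [hr, Finset.sum_powerset_insert hbn, Finset.sum_powerset_insert hbn,
          ← sum_add_distrib, ← sum_add_distrib]
        -- The colour of `b` has to agree with that of `a`, so only one of its two colours survives
        -- on the left. In the renamed row `b` no longer occurs, so both colours give this same
        -- term; hence the factor 1/2.
        have h5 : ∀ t ∈ ((Finset.range n).erase b).powerset,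
            (if a ∈ t ↔ b ∈ t then (colour (fun _ : Unit => none)).word 1 w 1
              (row ((L ++ r).map fun y => decide (y ∈ t))) else 0) +
            (if a ∈ insert b t ↔ b ∈ insert b t then (colour (fun _ : Unit => none)).word 1 w 1
              (row ((L ++ r).map fun y => decide (y ∈ insert b t))) else 0) =
            (1 / 2) * ((colour (fun _ : Unit => none)).word 1 w 1
              (row (((L ++ r).map fun x => if x = b then a else x).map fun y => decide (y ∈ t))) +
            (colour (fun _ : Unit => none)).word 1 w 1
              (row (((L ++ r).map fun x => if x = b then a else x).map
                fun y => decide (y ∈ insert b t)))) := by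
          intro t ht
          have hbt : b ∉ t := fun h => by simpa using mem_powerset.1 ht h
          simp only [map_map, comp_def]
          have e1 : ((L ++ r).map fun x => decide ((if x = b then a else x) ∈ insert b t)) =
              (L ++ r).map fun x => decide ((if x = b then a else x) ∈ t) := by
            apply map_congr_left
            intro x _
            by_cases hx : x = b <;> simp [hx, hab]
          rw [e1]
          by_cases hat : a ∈ t
          · have e2 : ((L ++ r).map fun x => decide ((if x = b then a else x) ∈ t)) =
                (L ++ r).map fun x => decide (x ∈ insert b t) := by
              apply map_congr_left
              intro x _
              by_cases hx : x = b <;> simp [hx, hat]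
            rw [e2]
            simp [hat, hbt]
            ring
          · have e2 : ((L ++ r).map fun x => decide ((if x = b then a else x) ∈ t)) =
                (L ++ r).map fun x => decide (x ∈ t) := by
              apply map_congr_left
              intro x _
              by_cases hx : x = b <;> simp [hx, hat, hbt]
            rw [e2]
            simp [hat, hbt, hab]
            ring
        rw [sum_congr rfl h5, ← mul_sum]
        ring
    | cross i p =>
      obtain ⟨L, a, b, r, rfl, rfl⟩ := exists_split_two l hf.1
      have h1 := ih (L ++ b :: a :: r) n (fun y hy => hl y (by
        simp only [mem_append, mem_cons] at hy ⊢; tauto)) (by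
        have := hf.2
        simp only [length_append, length_cons] at this ⊢
        exact this)
      have h2 : ∀ s : Finset ℕ,
          (colour (fun _ : Unit => none)).piece 1 (.cross L.length p)
            ((colour (fun _ : Unit => none)).word 1 w 1)
            (row ((L ++ a :: b :: r).map fun y => decide (y ∈ s))) =
          (colour (fun _ : Unit => none)).word 1 w 1
            (row ((L ++ b :: a :: r).map fun y => decide (y ∈ s))) := by
        intro s
        simp only [Ops.piece, map_one, mul_one]
        rw [sh_row', cross_apply]
        simp only [map_append, map_cons, row, pushList_append, pushList, push_zero,
          push_eta, drop1_push]
      simp only [h2]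
      have h3 : (L ++ a :: b :: r).length = (L ++ b :: a :: r).length := by simp
      rw [h3, h1]
      simp [loopsAux]

/-- The operator preserves nonnegative functions. -/
def Nonneg (X : Module.End ℚ ((ℕ → Bool) → ℚ)) : Prop :=
  ∀ Φ : (ℕ → Bool) → ℚ, (∀ x, 0 ≤ Φ x) → ∀ x, 0 ≤ X Φ x

theorem Nonneg.mul {X Y : Module.End ℚ ((ℕ → Bool) → ℚ)} (hX : Nonneg X) (hY : Nonneg Y) :
    Nonneg (X * Y) := fun Φ hΦ => hX _ (hY Φ hΦ)

theorem Nonneg.sh {X : Module.End ℚ ((ℕ → Bool) → ℚ)} (hX : Nonneg X) (i : ℕ) :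
    Nonneg ((colour g).sh i X) := by
  induction i with
  | zero => exact hX
  | succ i ih =>
    intro Φ hΦ x
    rw [Ops.sh_succ', s_apply]
    exact ih _ (fun y => hΦ _) _

/-- Positivity selects the correct square root in `value_word`. -/
theorem nonneg_word (w : List LinkPiece) : Nonneg ((colour (fun _ : Unit => none)).word 1 w) := by
  induction w with
  | nil => intro Φ hΦ x; exact hΦ x
  | cons g w ih =>
    rw [Ops.word_cons]
    refine Nonneg.mul ?_ ih
    cases g with
    | cup i =>
      refine Nonneg.sh _ (fun Φ hΦ x => ?_) i
      rw [mul_one, cup_apply]; exact add_nonneg (hΦ _) (hΦ _)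
    | cap i =>
      refine Nonneg.sh _ (fun Φ hΦ x => ?_) i
      rw [cap_apply]; split_ifs <;> simp [hΦ]
    | cross i p =>
      refine Nonneg.sh _ (fun Φ hΦ x => ?_) i
      rw [map_one, mul_one, mul_one, cross_apply]; exact hΦ _

/-- A closed word has `2 ^ loops` colourings. -/
theorem value_word {w : List LinkPiece} (hw : Fits 0 w) :
    streamValue false ((colour (fun _ : Unit => none)).word 1 w) = 2 ^ loops w := by
  have h := sum_word w [] 0 (by simp) hw
  simp only [Finset.range_zero, Finset.powerset_empty, Finset.sum_singleton, map_nil,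
    length_nil, pow_zero, mul_one, zero_add] at h
  have h1 : 0 ≤ streamValue false ((colour (fun _ : Unit => none)).word 1 w) :=
    nonneg_word w 1 (fun _ => zero_le_one) _
  have h2 : streamValue false ((colour (fun _ : Unit => none)).word 1 w) ^ 2 =
      (2 ^ loops w) ^ 2 := by
    rw [← pow_mul, mul_comm, pow_mul]; norm_num; exact h
  exact (pow_left_inj₀ h1 (by positivity) two_ne_zero).1 h2

end colour

/-! ### The moves for the doubled theta-curve -/

/-- The weight of the crossings for the edge `i`; the sum of the signs of the crossings with these
weights is `2 nᵢ`. -/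
def edgeWeight (i a b : Fin 3) : ℤ :=
  if a = b then (if a = i then -2 else 0) else if a = i ∨ b = i then 1 else -1

/-- The sum of the weights of the edges in a set. -/
def setWeight (χ : Fin 3 → Bool) (a b : Fin 3) : ℤ := ∑ i, if χ i then edgeWeight i a b else 0

theorem setWeight_symm : ∀ (χ : Fin 3 → Bool) (a b : Fin 3), setWeight χ a b = setWeight χ b a := by
  decide

/-- The three legs are ends of different edges. -/
def Distinct (a b c : Fin 3) : Prop := a ≠ b ∧ b ≠ c ∧ a ≠ c

instance (a b c : Fin 3) : Decidable (Distinct a b c) := by unfold Distinct; infer_instance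

/-- A strand of the edge `e` that slides across a vertex meets all three legs with the same sign, so
this cancellation keeps the normalization unchanged. -/
theorem setWeight_sum : ∀ (χ : Fin 3 → Bool) {a b c : Fin 3}, Distinct a b c → ∀ e,
    setWeight χ a e + setWeight χ b e + setWeight χ c e = 0 := by
  decide

theorem setWeight_self : ∀ (χ : Fin 3 → Bool) (e : Fin 3),
    setWeight χ e e = if χ e then -2 else 0 := by
  decide

/-- The number of edges in the set is not one. -/
def NotSingle (χ : Fin 3 → Bool) : Prop := ∀ a b c : Fin 3, Distinct a b c → χ a = true →
  χ b = true ∨ χ c = true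

instance (χ : Fin 3 → Bool) : Decidable (NotSingle χ) := by unfold NotSingle; infer_instance

/-- These exponents compensate the twisting of two legs at a vertex. With exactly one edge in the
set the weights are different, but such colourings have the value zero anyway (`TL.value_single`).
-/
theorem setWeight_distinct : ∀ χ : Fin 3 → Bool, NotSingle χ → ∀ {a b c}, Distinct a b c →
    setWeight χ a b = if χ a && χ b then (if χ c then 1 else 2) else 0 := by
  decide

section

variable {K R : Type} [Field K] [Ring R] [Algebra K R] {A : K} {T : TL R A}
  (hA : A ≠ 0) (hd : loopValue A ≠ 0)
include hA hd

/-- The base is -A⁴ because of the following quotients, written for `p = true`. For a curl of a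
non-trivial edge, curl²/A² = A⁻⁸ = (-A⁴)⁻². For two twisted legs, curl · A/A² = -A⁻⁴ if all three
legs are non-trivial, and curl²/A² = (-A⁴)⁻² if only the third one is trivial. -/
theorem theta_laws {χ : Fin 3 → Bool} (hχ : NotSingle χ) :
    (T.cabled χ).Laws (-A ^ 4) (setWeight χ) Distinct := by
  refine TL.cabled_laws hA hd χ (by simpa using hA) (setWeight_symm χ) (fun h => ?_) (fun h => ?_)
    (fun h => setWeight_sum χ h) ?_ ?_
  · exact ⟨h.2.1, h.2.2.symm, h.1.symm⟩
  · exact ⟨h.1.symm, h.2.2, h.2.1⟩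
  · intro e p
    rw [setWeight_self]
    cases h : χ e <;> cases p <;> simp [eigen, curl, boolSign, zpow_neg] <;> field_simp
  · intro a b c h p
    rw [setWeight_distinct χ hχ h]
    have h1 := hχ c a b ⟨h.2.2.symm, h.1, h.2.1.symm⟩
    have h2 := hχ a b c h
    have h3 := hχ b c a ⟨h.2.1, h.2.2.symm, h.1.symm⟩
    cases ha : χ a <;> cases hb : χ b <;> cases hc : χ c <;> simp [ha, hb, hc] at h1 h2 h3 <;>
      cases p <;> simp [eigen, curl, boolSign, zpow_neg] <;> field_simp

theorem knot_laws : (T.cabled (fun _ : Unit => true)).Laws (-A ^ 4) (fun _ _ => -2)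
    (fun _ _ _ => False) := by
  refine TL.cabled_laws hA hd _ (by simpa using hA) (fun _ _ => rfl) (fun h => h) (fun h => h)
    (fun h => h.elim) ?_ (fun h => h.elim)
  intro e p
  cases p <;> simp [eigen, curl, boolSign, zpow_neg] <;> field_simp

end

/-! ### Renaming -/

section

variable {C C' : Type}

/-- Rename the edge of a strand. -/
def Strand.map (f : C → C') (s : Strand C) : Strand C' := (f s.1, s.2)

/-- Rename the edges of a piece. -/
def Piece.map (f : C → C') : Piece C → Piece C'
  | .cup i s => .cup i (Strand.map f s)
  | .cap i => .cap i
  | .cross i p => .cross i p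
  | .vertex i o a b c => .vertex i o (f a) (f b) (f c)

theorem Piece.map_comp {C'' : Type} (f : C → C') (f' : C' → C'') (g : Piece C) :
    (g.map f).map f' = g.map (f' ∘ f) := by
  cases g <;> rfl

theorem Strand.map_reverse (f : C → C') (s : Strand C) :
    Strand.map f s.reverse = (Strand.map f s).reverse := rfl

variable [DecidableEq C] [DecidableEq C']

theorem step_map (f : C → C') {l l' : List (Strand C)} {g : Piece C} (h : step l g = some l') :
    step (l.map (Strand.map f)) (g.map f) = some (l'.map (Strand.map f)) := by
  obtain ⟨L, m, m', r, rfl, rfl, hL, hm, hm', hloc⟩ := exists_of_step h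
  simp only [map_append]
  rw [step_local (L.map (Strand.map f)) (m.map (Strand.map f)) (r.map (Strand.map f)) (g.map f)
    (by rw [length_map]; cases g <;> exact hL) (by rw [length_map]; cases g <;> exact hm)]
  cases g with
  | cup i s =>
    obtain rfl := length_eq_zero_iff.1 hm
    simp [step, Piece.moveTo] at hloc
    simp [step, Piece.moveTo, Piece.map, ← hloc, Strand.map_reverse]
  | cap i =>
    obtain ⟨x, y, rfl⟩ := length_eq_two.1 hm
    simp [step, Piece.moveTo] at hloc
    simp [step, Piece.moveTo, Piece.map, ← hloc.2, hloc.1, Strand.map_reverse]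
  | cross i p =>
    obtain ⟨x, y, rfl⟩ := length_eq_two.1 hm
    simp [step, Piece.moveTo] at hloc
    simp [step, Piece.moveTo, Piece.map, ← hloc]
  | vertex i o a b c =>
    obtain rfl := length_eq_zero_iff.1 hm
    simp [step, Piece.moveTo] at hloc
    simp [step, Piece.moveTo, Piece.map, ← hloc, Strand.map]

theorem run_map (f : C → C') : ∀ (D : Diagram C) {l l' : List (Strand C)}, run l D = some l' →
    run (l.map (Strand.map f)) (D.map (Piece.map f)) = some (l'.map (Strand.map f)) := by
  intro D
  induction D with
  | nil => intro l l' h; cases h; rfl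
  | cons g D ih =>
    intro l l' h
    rw [run_cons] at h
    obtain ⟨l1, h1, h2⟩ := bind_eq_some_iff.1 h
    rw [map_cons, run_cons, step_map f h1]
    exact ih h2

theorem Closed.map (f : C → C') {D : Diagram C} (h : Closed D) : Closed (D.map (Piece.map f)) :=
  run_map f D h

/-- Rename the projectors. -/
def Ops.comap {K R : Type} [Field K] [Ring R] [Algebra K R] (O : Ops K C' R) (f : C → C') :
    Ops K C R where
  s := O.s
  cup := O.cup
  cap := O.cap
  vert := O.vert
  cross := O.cross
  proj c := O.proj (f c)

theorem Ops.ev_map {K R : Type} [Field K] [Ring R] [Algebra K R] (O : Ops K C' R) (f : C → C') :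
    ∀ (D : Diagram C) {l l' : List (Strand C)}, run l D = some l' →
      O.ev (l.map (Strand.map f)) (D.map (Piece.map f)) = (O.comap f).ev l D := by
  intro D
  induction D with
  | nil => intro l l' h; rfl
  | cons g D ih =>
    intro l l' h
    rw [run_cons] at h
    obtain ⟨l1, h1, h2⟩ := bind_eq_some_iff.1 h
    rw [map_cons, ev_cons _ (step_map f h1), ev_cons _ h1, ih h2]
    congr 1
    obtain ⟨L, m, m', r, rfl, rfl, hL, hm, hm', hloc⟩ := exists_of_step h1
    cases g with
    | cross i p =>
      obtain ⟨x, y, rfl⟩ := length_eq_two.1 hm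
      obtain rfl : L.length = i := hL
      have hl : L.length = (L.map (Strand.map f)).length := by simp
      simp only [Piece.map, Ops.op, Piece.pos, map_append, append_assoc, map_cons,
        map_nil, cons_append, nil_append]
      rw [drop_left, hl, drop_left, ← hl]
      rfl
    | _ => rfl

/-! ### Lifts to coloured diagrams -/

/-- The lifts of a piece. -/
def liftPiece : Piece C → List (Piece (C × Bool))
  | .cup i s => [.cup i ((s.1, false), s.2), .cup i ((s.1, true), s.2)]
  | .cap i => [.cap i]
  | .cross i p => [.cross i p]
  | .vertex i o a b c =>
    [false, true].flatMap fun x => [false, true].flatMap fun y => [false, true].map fun z =>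
      .vertex i o (a, x) (b, y) (c, z)

/-- The diagrams with coloured strands that show a given diagram. -/
def lifts : Diagram C → List (Diagram (C × Bool))
  | [] => [[]]
  | g :: D => (liftPiece g).flatMap fun g' => (lifts D).map fun D' => g' :: D'

theorem mem_liftPiece (g : Piece C) (g' : Piece (C × Bool)) :
    g' ∈ liftPiece g ↔ g'.map Prod.fst = g := by
  cases g with
  | cup i s =>
    obtain ⟨e, d⟩ := s
    cases g' with
    | cup j t =>
      obtain ⟨⟨e', b⟩, d'⟩ := t
      cases b <;> simp [liftPiece, Piece.map, Strand.map]
    | _ => simp [liftPiece, Piece.map]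
  | cap i => cases g' <;> simp [liftPiece, Piece.map]
  | cross i p => cases g' <;> simp [liftPiece, Piece.map]
  | vertex i o a b c =>
    cases g' with
    | vertex j o' a' b' c' =>
      obtain ⟨a', x⟩ := a'
      obtain ⟨b', y⟩ := b'
      obtain ⟨c', z⟩ := c'
      cases x <;> cases y <;> cases z <;> simp [liftPiece, Piece.map]
    | _ => simp [liftPiece, Piece.map]

theorem mem_lifts : ∀ (D : Diagram C) (E : Diagram (C × Bool)),
    E ∈ lifts D ↔ E.map (Piece.map Prod.fst) = D := by
  intro D
  induction D with
  | nil => intro E; simp [lifts]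
  | cons g D ih =>
    intro E
    simp only [lifts, mem_flatMap, mem_map]
    constructor
    · rintro ⟨g', hg, D', hD, rfl⟩
      simp [(mem_liftPiece g g').1 hg, (ih D').1 hD]
    · intro h
      cases E with
      | nil => simp at h
      | cons g' E =>
        simp only [map_cons, List.cons.injEq] at h
        exact ⟨g', (mem_liftPiece g g').2 h.1, E, (ih E).2 h.2, rfl⟩

theorem nodup_liftPiece (g : Piece C) : (liftPiece g).Nodup := by
  cases g <;> simp [liftPiece]

theorem nodup_lifts : ∀ D : Diagram C, (lifts D).Nodup := by
  intro D
  induction D with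
  | nil => simp [lifts]
  | cons g D ih =>
    rw [lifts, List.nodup_flatMap]
    refine ⟨fun g' _ => ih.map fun a b h => by simpa using h, ?_⟩
    refine (nodup_liftPiece g).imp ?_
    intro a b hab
    simp only [Function.onFun, List.disjoint_left, mem_map]
    rintro _ ⟨x, _, rfl⟩ ⟨y, _, h⟩
    simp only [List.cons.injEq] at h
    exact hab h.1.symm

section

variable {K R : Type} [Field K] [Ring R] [Algebra K R]

/-- The value of a piece without projectors, except at the vertices. -/
def rawPiece (O : Ops K (C × Bool) R) (wt : Piece (C × Bool) → K) : Piece C → R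
  | .cup i _ => O.sh i O.cup
  | .cap i => O.sh i O.cap
  | .cross i p => O.sh i (O.cross p)
  | .vertex i o a b c =>
    ((liftPiece (.vertex i o a b c)).map fun g => wt g • O.sh i (O.op [] g)).sum

/-- The value of a diagram without projectors. -/
def rawWord (O : Ops K (C × Bool) R) (wt : Piece (C × Bool) → K) (D : Diagram C) : R :=
  (D.map (rawPiece O wt)).prod

/-- Projectors may be inserted everywhere, which leads to a sum over the lifts. -/
theorem lift_sum {O : Ops K (C × Bool) R} (h : O.Projective) {P : Bool → R}
    (hP : ∀ e b, O.proj (e, b) = P b) (hsum : P false + P true = 1)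
    (hft : P false * P true = 0) (htf : P true * P false = 0)
    (wt : Piece (C × Bool) → K) (hcup : ∀ i s, wt (.cup i s) = 1) (hcap : ∀ i, wt (.cap i) = 1)
    (hcross : ∀ i p, wt (.cross i p) = 1) :
    ∀ (D : Diagram C) (l : List (Strand (C × Bool))) (l' : List (Strand C)) (y : R),
      O.Absorbs l y → run (l.map (Strand.map Prod.fst)) D = some l' →
      y * rawWord O wt D = ((lifts D).map fun E => (E.map wt).prod • (y * O.ev l E)).sum := by
  intro D
  induction D with
  | nil => intro l l' y _ _; simp [rawWord, lifts, Ops.ev]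
  | cons g D ih =>
    intro l l' y hy hr
    rw [run_cons] at hr
    obtain ⟨l1, h1, h2⟩ := bind_eq_some_iff.1 hr
    have hraw : rawWord O wt (g :: D) = rawPiece O wt g * rawWord O wt D := by simp [rawWord]
    rw [hraw, ← mul_assoc]
    have key : ∀ g' : Piece (C × Bool), g'.map Prod.fst = g → ∀ l1', step l g' = some l1' →
        (y * O.sh g'.pos (O.op l g')) * rawWord O wt D =
          ((lifts D).map fun E => (E.map wt).prod • (y * O.ev l (g' :: E))).sum := by
      intro g' hg' l1' hl1
      have h3 := step_map Prod.fst hl1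
      rw [hg', h1] at h3
      rw [ih l1' l' _ (h.absorbs_step hl1 hy) (by rw [← Option.some.inj h3]; exact h2)]
      congr 1
      apply map_congr_left
      intro E _
      rw [O.ev_cons hl1, mul_assoc]
    have hlen := step_bound h1
    rw [length_map] at hlen
    cases g with
    | cup i s =>
      obtain ⟨e, d⟩ := s
      have hi : i ≤ l.length := hlen
      have hstep : ∀ b, ∃ l1', step l (.cup i ((e, b), d)) = some l1' := fun b =>
        ⟨_, if_pos hi⟩
      obtain ⟨lf, hlf⟩ := hstep false
      obtain ⟨lt, hlt⟩ := hstep true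
      -- Apart from the vertices, a new colour is chosen only at a minimum, where the identity of
      -- the new strand is split into the two projectors.
      have e1 : rawPiece O wt (.cup i (e, d)) = O.sh i (O.op l (.cup i ((e, false), d))) +
          O.sh i (O.op l (.cup i ((e, true), d))) := by
        simp only [rawPiece, Ops.op, hP, ← map_add, ← mul_add, hsum, mul_one]
      rw [e1, mul_add, add_mul]
      have k1 := key (.cup i ((e, false), d)) rfl lf hlf
      have k2 := key (.cup i ((e, true), d)) rfl lt hlt
      simp only [Piece.pos] at k1 k2
      rw [k1, k2]
      simp [lifts, liftPiece, hcup, comp_def]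
    | cap i =>
      simp only [Piece.pos, Piece.ins] at hlen
      obtain ⟨L, x, z, r, rfl, rfl⟩ := exists_split_two l hlen
      simp only [lifts, liftPiece, flatMap_cons, flatMap_nil, append_nil,
        map_map, comp_def, map_cons, prod_cons, hcap, one_mul]
      by_cases hxz : z = x.reverse
      · have hs : step (L ++ x :: z :: r) (.cap L.length) = some (L ++ r) := by simp [step, hxz]
        exact key (.cap L.length) rfl _ hs
      · have hs : step (L ++ x :: z :: r) (.cap L.length) = none := by simp [step, hxz]
        have h3 : (Strand.map Prod.fst z) = (Strand.map Prod.fst x).reverse := by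
          by_contra hne
          simp [step, hne] at h1
        obtain ⟨⟨e, b⟩, d⟩ := x
        obtain ⟨⟨e', b'⟩, d'⟩ := z
        simp only [Strand.map, Strand.reverse, Prod.mk.injEq] at h3 hxz
        obtain ⟨rfl, rfl⟩ := h3
        have hb : b ≠ b' := fun hb => hxz ⟨⟨rfl, hb.symm⟩, rfl⟩
        -- Two ends of different colours meet at the maximum. The lift is then not well formed and
        -- counts as zero, and the product is zero because the projectors are orthogonal.
        have hzero : O.proj (e', b) * O.proj (e', b') = 0 := by
          rw [hP, hP]
          cases b <;> cases b' <;> simp_all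
        have h4 : y * O.sh L.length O.cap = 0 := by
          rw [← hy.at, ← hy.at_one, mul_assoc, mul_assoc, ← map_mul, ← map_mul]
          have : O.s (O.proj (e', b')) * (O.proj (e', b) * O.cap) = 0 := by
            rw [← mul_assoc, h.proj, mul_assoc, h.cap_proj, ← mul_assoc, hzero, zero_mul]
          rw [this]; simp
        simp only [rawPiece]
        rw [h4]
        simp [Ops.ev, hs]
    | cross i p =>
      simp only [Piece.pos, Piece.ins] at hlen
      obtain ⟨L, x, z, r, rfl, rfl⟩ := exists_split_two l hlen
      simp only [lifts, liftPiece, flatMap_cons, flatMap_nil, append_nil,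
        map_map, comp_def, map_cons, prod_cons, hcross, one_mul]
      have hs : step (L ++ x :: z :: r) (.cross L.length p) = some (L ++ z :: x :: r) := by
        simp [step]
      rw [← key (.cross L.length p) rfl _ hs]
      simp only [Ops.op, drop_left, Piece.pos, h.strip_cross hy]
      rfl
    | vertex i o a b c =>
      have hi : i ≤ l.length := hlen
      have hall : ∀ g' ∈ liftPiece (.vertex i o a b c),
          y * O.sh i (O.op [] g') * rawWord O wt D =
            ((lifts D).map fun E => (E.map wt).prod • (y * O.ev l (g' :: E))).sum := by
        intro g' hg'
        rw [mem_liftPiece] at hg'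
        cases g' with
        | vertex j o' a' b' c' =>
          obtain rfl : j = i := congrArg Piece.pos hg'
          exact key _ hg' _ (if_pos hi)
        | _ => simp [Piece.map] at hg'
      simp only [rawPiece, lifts]
      generalize liftPiece (.vertex i o a b c) = G at *
      clear hraw h1
      induction G with
      | nil => simp
      | cons g' G ihG =>
        rw [map_cons, sum_cons, mul_add, add_mul, ihG fun g hg => hall g (by simp [hg]),
          mul_smul_comm, smul_mul_assoc, hall g' (by simp)]
        simp only [flatMap_cons, map_append, List.sum_append, map_map,
          comp_def, map_cons, prod_cons, mul_smul, List.smul_sum]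

end

end

/-! ### The number of colourings -/

section

variable {C : Type} [DecidableEq C]

theorem Ops.ev_of_none {K R : Type} [Field K] [Ring R] [Algebra K R] (O : Ops K C R) :
    ∀ (D : Diagram C) {l : List (Strand C)}, run l D = none → O.ev l D = 0 := by
  intro D
  induction D with
  | nil => intro l h; cases h
  | cons g D ih =>
    intro l h
    rw [run_cons] at h
    cases hs : step l g with
    | none => simp [Ops.ev, hs]
    | some l1 =>
      rw [hs] at h
      rw [Ops.ev_cons _ hs, ih h, mul_zero]

namespace colour

theorem ev_row : ∀ (E : Diagram (C × Bool)) {l l' : List (Strand (C × Bool))},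
    run l E = some l' → ∀ Φ, (colour fun c : C × Bool => some c.2).ev l E Φ
      (row (l.map fun s => s.1.2)) = Φ (row (l'.map fun s => s.1.2)) := by
  intro E
  induction E with
  | nil => intro l l' h Φ; cases h; rfl
  | cons g E ih =>
    intro l l' h Φ
    rw [run_cons] at h
    obtain ⟨l1, h1, h2⟩ := bind_eq_some_iff.1 h
    rw [Ops.ev_cons _ h1, Module.End.mul_apply, ← ih h2 Φ]
    generalize (colour fun c : C × Bool => some c.2).ev l1 E Φ = Ψ
    obtain ⟨L, m, m', r, rfl, rfl, hL, hm, hm', hloc⟩ := exists_of_step h1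
    rw [Ops.op_local _ L m r g hL hm, ← hL, append_assoc, sh_row']
    cases g with
    | cup i s =>
      obtain ⟨⟨e, b⟩, d⟩ := s
      obtain rfl := length_eq_zero_iff.1 hm
      simp [step, Piece.moveTo] at hloc
      subst hloc
      simp only [Piece.moveTo, Ops.op, Module.End.mul_apply, cup_apply, proj_apply, push_zero,
        map_append, map_cons, nil_append, cons_append, row, pushList_append,
        pushList, Strand.reverse]
      cases b <;> simp <;> rfl
    | cap i =>
      obtain ⟨x, y, rfl⟩ := length_eq_two.1 hm
      simp [step, Piece.moveTo] at hloc
      obtain ⟨rfl, rfl⟩ := hloc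
      simp only [Piece.moveTo, Ops.op, Module.End.mul_apply, cap_apply, push_zero,
        map_append, map_cons, nil_append, cons_append, row, pushList_append,
        pushList, Strand.reverse, push_eta, drop1_push]
      simp
      rfl
    | cross i p =>
      obtain ⟨x, y, rfl⟩ := length_eq_two.1 hm
      simp [step, Piece.moveTo] at hloc
      subst hloc
      simp only [Piece.moveTo, Ops.op, List.drop_zero, Module.End.mul_apply, cross_apply,
        proj_apply, s_apply, fixFirst, LinearMap.coe_mk, AddHom.coe_mk, push_zero,
        map_append, map_cons, nil_append, cons_append, row, pushList_append,
        pushList, push_eta, drop1_push]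
      simp
      rfl
    | vertex i o a b c =>
      obtain ⟨a, xa⟩ := a
      obtain ⟨b, xb⟩ := b
      obtain ⟨c, xc⟩ := c
      obtain rfl := length_eq_zero_iff.1 hm
      simp [step, Piece.moveTo] at hloc
      subst hloc
      simp only [Piece.moveTo, Ops.op, Module.End.mul_apply, vert_apply, proj_apply, s_apply,
        fixFirst, LinearMap.coe_mk, AddHom.coe_mk, push_zero, drop1_push,
        map_append, map_cons, nil_append, cons_append, row, pushList_append,
        pushList, Fintype.sum_bool]
      cases xa <;> cases xb <;> cases xc <;> simp <;> rfl

theorem value_closed {E : Diagram (C × Bool)} (hE : Closed E) :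
    streamValue false ((colour fun c : C × Bool => some c.2).ev [] E) = 1 := ev_row E hE 1

end colour

instance (D : Diagram C) : Decidable (Closed D) := by unfold Closed; infer_instance

/-- With all weights 1 the eight terms at a vertex add up to the bare vertex, since the two
projectors have sum 1 on each leg. -/
theorem rawWord_one {K R : Type} [Field K] [Ring R] [Algebra K R] {O : Ops K (C × Bool) R}
    {P : Bool → R} (hP : ∀ e b, O.proj (e, b) = P b) (hsum : P false + P true = 1)
    {O' : Ops K C R} (hs : O'.s = O.s) (hcup : O'.cup = O.cup) (hcap : O'.cap = O.cap)
    (hvert : O'.vert = O.vert) (hcross : O'.cross = O.cross) (hone : ∀ c, O'.proj c = 1) :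
    ∀ (D : Diagram C) {l l' : List (Strand C)}, run l D = some l' →
      rawWord O (fun _ => 1) D = O'.ev l D := by
  have hsh : ∀ i y, O'.sh i y = O.sh i y := by intro i y; simp only [Ops.sh, hs]
  intro D
  induction D with
  | nil => intro l l' h; rfl
  | cons g D ih =>
    intro l l' h
    rw [run_cons] at h
    obtain ⟨l1, h1, h2⟩ := bind_eq_some_iff.1 h
    rw [Ops.ev_cons _ h1, ← ih h2, rawWord, map_cons, prod_cons, ← rawWord]
    congr 1
    cases g with
    | cup i s => simp [rawPiece, Ops.op, hsh, hone, hcup, Piece.pos]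
    | cap i => simp [rawPiece, Ops.op, hsh, hcap, Piece.pos]
    | cross i p =>
      obtain ⟨L, m, m', r, rfl, -, hL, hm, -, -⟩ := exists_of_step h1
      obtain ⟨x, y, rfl⟩ := length_eq_two.1 hm
      obtain rfl : L.length = i := hL
      simp [rawPiece, Ops.op, hsh, hone, hcross, Piece.pos]
    | vertex i o a b c =>
      have e : O.vert = O.vert * ((P false + P true) * O.s (P false + P true) *
          O.s (O.s (P false + P true))) := by rw [hsum]; simp
      simp only [Ops.op, hone, map_one, mul_one, hsh, hvert, Piece.pos]
      rw [e]
      simp only [rawPiece, liftPiece, flatMap_cons, flatMap_nil, map_cons,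
        map_nil, append_nil, cons_append, nil_append, sum_cons,
        sum_nil, Ops.op, hP, one_smul, map_add, mul_add, add_mul, add_zero, add_assoc]
      abel

/-- The lifts of a diagram that are closed. -/
noncomputable def closedLifts (D : Diagram C) : Finset (Diagram (C × Bool)) :=
  have : DecidableEq (Diagram (C × Bool)) := Classical.decEq _
  (lifts D).toFinset.filter Closed

theorem mem_closedLifts {D : Diagram C} {E : Diagram (C × Bool)} :
    E ∈ closedLifts D ↔ E.map (Piece.map Prod.fst) = D ∧ Closed E := by
  simp only [closedLifts, Finset.mem_filter, mem_toFinset, mem_lifts]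

theorem sum_lifts {M : Type} [AddCommMonoid M] {D : Diagram C} (F : Diagram (C × Bool) → M)
    (hF : ∀ E, E.map (Piece.map Prod.fst) = D → ¬ Closed E → F E = 0) :
    ((lifts D).map F).sum = ∑ E ∈ closedLifts D, F E := by
  have : DecidableEq (Diagram (C × Bool)) := Classical.decEq _
  have h1 : ((lifts D).map F).sum = ∑ E ∈ (lifts D).toFinset, F E :=
    (List.sum_toFinset F (nodup_lifts D)).symm
  rw [h1]
  symm
  refine Finset.sum_subset ?_ ?_
  · intro E hE
    rw [mem_closedLifts] at hE
    rw [mem_toFinset, mem_lifts]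
    exact hE.1
  · intro E hE hE'
    rw [mem_toFinset, mem_lifts] at hE
    rw [mem_closedLifts] at hE'
    exact hF E hE fun h => hE' ⟨hE, h⟩

/-- A lift of a closed diagram that is not closed has the value zero. -/
theorem Ops.ev_of_not_closed {K R : Type} [Field K] [Ring R] [Algebra K R]
    (O : Ops K (C × Bool) R) {D : Diagram C} (hD : Closed D) {E : Diagram (C × Bool)}
    (hE : E.map (Piece.map Prod.fst) = D) (h : ¬ Closed E) : O.ev [] E = 0 := by
  apply O.ev_of_none
  cases hr : run [] E with
  | none => rfl
  | some l =>
    exfalso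
    have h1 := run_map Prod.fst E hr
    rw [hE] at h1
    have h2 : some [] = some (l.map (Strand.map Prod.fst)) := hD.symm.trans h1
    have h3 := (Option.some.inj h2).symm
    rw [List.map_eq_nil_iff] at h3
    subst h3
    exact h hr

/-- Inserting the colour projectors splits the count of colourings into a sum over lifts, in which a
closed lift counts once and any other lift vanishes. -/
theorem value_closedLifts {D : Diagram C} (hD : Closed D) :
    streamValue false ((colour fun _ : C => none).ev [] D) = (closedLifts D).card := by
  have hP : ∀ (e : C) b, (colour fun c : C × Bool => some c.2).proj (e, b) =
      (colour fun c : Unit × Bool => some c.2).proj ((), b) := fun e b => rfl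
  have hsum : (colour fun c : Unit × Bool => some c.2).proj ((), false) +
      (colour fun c : Unit × Bool => some c.2).proj ((), true) = 1 := by
    ext Φ x
    simp only [LinearMap.add_apply, Pi.add_apply, colour.proj_apply]
    cases x 0 <;> simp
  have hft : ∀ b, (colour fun c : Unit × Bool => some c.2).proj ((), b) *
      (colour fun c : Unit × Bool => some c.2).proj ((), !b) = 0 := by
    intro b
    ext Φ x
    simp only [Module.End.mul_apply, colour.proj_apply]
    cases x 0 <;> cases b <;> simp
  have h := lift_sum (colour.projective fun c : C × Bool => some c.2) hP hsum (hft false) (hft true)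
    (fun _ => 1) (fun _ _ => rfl) (fun _ => rfl) (fun _ _ => rfl) D [] [] 1 (Ops.absorbs_nil _) hD
  rw [one_mul, rawWord_one hP hsum (O' := colour fun _ : C => none) rfl rfl rfl rfl rfl
    (fun _ => rfl) D hD] at h
  rw [h, sum_lifts]
  · rw [map_sum, Finset.card_eq_sum_ones, Nat.cast_sum]
    refine sum_congr rfl fun E hE => ?_
    rw [mem_closedLifts] at hE
    have : (E.map fun _ => (1 : ℚ)).prod = 1 := by simp
    rw [this, one_smul, one_mul, colour.value_closed hE.2]
    simp
  · intro E hE hc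
    rw [one_mul, Ops.ev_of_not_closed _ hD hE hc, smul_zero]

end

/-- Isotopic diagrams have the same number of closed lifts. -/
theorem Isotopic.card_closedLifts {C : Type} [DecidableEq C] {D E : Diagram C} (h : Isotopic D E)
    (hD : Closed D) : (closedLifts D).card = (closedLifts E).card := by
  have h1 := (colour.laws.isotopic h).2 (fun g _ => by cases g <;> trivial)
  rw [one_zpow, one_zpow, one_smul, one_smul] at h1
  have h2 := value_closedLifts hD
  rw [h1, value_closedLifts (h.closed.1 hD)] at h2
  exact_mod_cast h2.symm

/-- A knot has two closed lifts. -/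
theorem card_closedLifts_knot {D : Diagram Unit} (hD : Closed D)
    (hv : ∀ i o a b c, Piece.vertex i o a b c ∉ D) :
    (closedLifts D).card = 2 ^ loops (D.flatMap Piece.forget) := by
  have h := value_closedLifts hD
  rw [Ops.ev_eq_word (O := colour fun _ : Unit => none) (P := 1) (fun _ => rfl) D [] [] hD hv,
    colour.value_word (fits_forget D [] hD hv)] at h
  exact_mod_cast h.symm

/-! ### Deleting edges -/

section Restrict

variable {C C' : Type} [DecidableEq C]

/-- What remains of a piece with `k` remaining strands to its left and the strands `m` below it. -/
def restrictPiece (f : Strand C → Option (Strand C')) (k : ℕ) (m : List (Strand C)) :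
    Piece C → Diagram C'
  | .cup _ s =>
    match f s with
    | some t => [.cup k t]
    | none => []
  | .cap _ =>
    match m.filterMap f with
    | [_, _] => [.cap k]
    | _ => []
  | .cross _ p =>
    match m.filterMap f with
    | [_, _] => [.cross k p]
    | _ => []
  | .vertex _ o a b c =>
    match [(a, o), (b, o), (c, o)].filterMap f with
    | [t, _] => [.cup k t]
    | _ => []

theorem restrict_cons (f : Strand C → Option (Strand C')) {L m r l1 : List (Strand C)}
    {g : Piece C} (hL : L.length = g.pos) (hm : m.length = g.ins)
    (h : step (L ++ m ++ r) g = some l1) (D : Diagram C) :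
    restrict f (L ++ m ++ r) (g :: D) =
      restrictPiece f (L.filterMap f).length m g ++ restrict f l1 D := by
  conv_lhs => unfold restrict
  rw [h, ← hL, append_assoc, take_left]
  refine congrArg₂ (· ++ ·) ?_ rfl
  cases g with
  | cup i s => rfl
  | cap i =>
    obtain ⟨x, y, rfl⟩ := length_eq_two.1 hm
    obtain rfl : L.length = i := hL
    simp only [drop_left]
    rfl
  | cross i p =>
    obtain ⟨x, y, rfl⟩ := length_eq_two.1 hm
    obtain rfl : L.length = i := hL
    simp only [drop_left]
    rfl
  | vertex i o a b c => rfl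

/-- At a vertex either all legs are deleted or two legs remain, which form a strand. -/
def Piece.Restricts (f : Strand C → Option (Strand C')) : Piece C → Prop
  | .vertex _ o a b c => [(a, o), (b, o), (c, o)].filterMap f = [] ∨
    ∃ t, [(a, o), (b, o), (c, o)].filterMap f = [t, t.reverse]
  | _ => True

variable [DecidableEq C']

theorem run_restrictPiece {f : Strand C → Option (Strand C')}
    (hf : ∀ s, f s.reverse = (f s).map Strand.reverse) {L m r l1 : List (Strand C)}
    {g : Piece C} (hL : L.length = g.pos) (hm : m.length = g.ins) (hg : g.Restricts f)
    (h : step (L ++ m ++ r) g = some l1) :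
    run ((L ++ m ++ r).filterMap f) (restrictPiece f (L.filterMap f).length m g) =
      some (l1.filterMap f) := by
  cases g with
  | cup i s =>
    obtain rfl := length_eq_zero_iff.1 hm
    obtain rfl : L.length = i := hL
    simp [step] at h
    subst h
    cases hs : f s with
    | none => simp [restrictPiece, hs, run, hf]
    | some t => simp [restrictPiece, hs, run, hf, step]
  | cap i =>
    obtain ⟨x, y, rfl⟩ := length_eq_two.1 hm
    obtain rfl : L.length = i := hL
    simp [step] at h
    obtain ⟨rfl, rfl⟩ := h
    cases hs : f x with
    | none => simp [restrictPiece, hs, run, hf]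
    | some t => simp [restrictPiece, hs, run, hf, step]
  | cross i p =>
    obtain ⟨x, y, rfl⟩ := length_eq_two.1 hm
    obtain rfl : L.length = i := hL
    simp [step] at h
    subst h
    cases hx : f x <;> cases hy : f y <;> simp [restrictPiece, hx, hy, run, step]
  | vertex i o a b c =>
    obtain rfl := length_eq_zero_iff.1 hm
    obtain rfl : L.length = i := hL
    simp [step] at h
    subst h
    have e : (L ++ (a, o) :: (b, o) :: (c, o) :: r).filterMap f =
        L.filterMap f ++ ([(a, o), (b, o), (c, o)].filterMap f ++ r.filterMap f) := by
      rw [← List.filterMap_append, ← List.filterMap_append]; rfl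
    rw [e]
    rcases hg with hg | ⟨t, hg⟩
    · simp only [restrictPiece, hg]; simp [run]
    · simp only [restrictPiece, hg]; simp [run, step]

theorem run_restrict {f : Strand C → Option (Strand C')}
    (hf : ∀ s, f s.reverse = (f s).map Strand.reverse) : ∀ (D : Diagram C) {l l' : List (Strand C)},
    (∀ g ∈ D, g.Restricts f) → run l D = some l' →
    run (l.filterMap f) (restrict f l D) = some (l'.filterMap f) := by
  intro D
  induction D with
  | nil => intro l l' _ h; cases h; rfl
  | cons g D ih =>
    intro l l' hg h
    rw [run_cons] at h
    obtain ⟨l1, h1, h2⟩ := bind_eq_some_iff.1 h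
    obtain ⟨L, m, m', r, rfl, -, hL, hm, -, -⟩ := exists_of_step h1
    rw [restrict_cons f hL hm h1, run_append,
      run_restrictPiece hf hL hm (hg g (by simp)) h1]
    exact ih (fun g hg' => hg g (by simp [hg'])) h2

theorem vertex_notMem_restrict (f : Strand C → Option (Strand C')) :
    ∀ (D : Diagram C) (l : List (Strand C)) (i : ℕ) (o : Bool) (a b c : C'),
      Piece.vertex i o a b c ∉ restrict f l D := by
  intro D
  induction D with
  | nil => intros; simp [restrict]
  | cons g D ih =>
    intro l i o a b c h
    unfold restrict at h
    rw [mem_append] at h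
    rcases h with h | h
    · cases g <;> simp only at h <;> split at h <;> simp at h
    · exact ih _ i o a b c h

/-- A minimum that is not deleted stays visible in the restricted diagram, so its colour can be
compared there with the colour of a vertex leg. -/
theorem cup_mem_restrict {f : Strand C → Option (Strand C')} {i : ℕ} {s : Strand C} {t : Strand C'}
    (ht : f s = some t) : ∀ (D : Diagram C) (l : List (Strand C)), Piece.cup i s ∈ D →
      ∃ k, Piece.cup k t ∈ restrict f l D := by
  intro D
  induction D with
  | nil => intro l h; simp at h
  | cons g D ih =>
    intro l h
    unfold restrict
    rcases mem_cons.1 h with rfl | h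
    · simp only [ht]
      exact ⟨_, List.mem_append_left _ (List.mem_singleton.2 rfl)⟩
    · obtain ⟨k, hk⟩ := ih _ h
      exact ⟨k, List.mem_append_right _ hk⟩

theorem vertex_mem_restrict {f : Strand C → Option (Strand C')} {i : ℕ} {o : Bool} {a b c : C}
    {t u : Strand C'} (ht : [(a, o), (b, o), (c, o)].filterMap f = [t, u]) :
    ∀ (D : Diagram C) (l : List (Strand C)), Piece.vertex i o a b c ∈ D →
      ∃ k, Piece.cup k t ∈ restrict f l D := by
  intro D
  induction D with
  | nil => intro l h; simp at h
  | cons g D ih =>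
    intro l h
    unfold restrict
    rcases mem_cons.1 h with rfl | h
    · simp only [ht]
      exact ⟨_, List.mem_append_left _ (List.mem_singleton.2 rfl)⟩
    · obtain ⟨k, hk⟩ := ih _ h
      exact ⟨k, List.mem_append_right _ hk⟩

theorem filterMap_map_strand {B B' : Type} {f : Strand C → Option (Strand C')}
    {g : Strand B → Option (Strand B')} {π : B → C} {π' : B' → C'}
    (hfg : ∀ s, f (Strand.map π s) = (g s).map (Strand.map π')) (l : List (Strand B)) :
    (l.map (Strand.map π)).filterMap f = (l.filterMap g).map (Strand.map π') := by
  induction l with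
  | nil => rfl
  | cons x l ih => cases h : g x <;> simp [hfg, h, ih]

/-- Deleting edges commutes with renaming. -/
theorem restrict_map {B B' : Type} [DecidableEq B] {f : Strand C → Option (Strand C')}
    {g : Strand B → Option (Strand B')} {π : B → C} {π' : B' → C'}
    (hfg : ∀ s, f (Strand.map π s) = (g s).map (Strand.map π')) :
    ∀ (D : Diagram B) {l l' : List (Strand B)}, run l D = some l' →
      restrict f (l.map (Strand.map π)) (D.map (Piece.map π)) =
        (restrict g l D).map (Piece.map π') := by
  intro D
  induction D with
  | nil => intro l l' _; rfl
  | cons p D ih =>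
    intro l l' h
    rw [run_cons] at h
    obtain ⟨l1, h1, h2⟩ := bind_eq_some_iff.1 h
    have h3 := step_map π h1
    obtain ⟨L, m, m', r, rfl, -, hL, hm, -, -⟩ := exists_of_step h1
    rw [restrict_cons g hL hm h1, map_append (f := Piece.map π'), ← ih h2, map_cons]
    simp only [map_append (f := Strand.map π)] at h3 ⊢
    rw [restrict_cons f (by rw [length_map]; cases p <;> exact hL)
      (by rw [length_map]; cases p <;> exact hm) h3]
    congr 1
    have hk : ((L.map (Strand.map π)).filterMap f).length = (L.filterMap g).length := by
      rw [filterMap_map_strand hfg, length_map]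
    rw [hk]
    cases p with
    | cup i s =>
      simp only [restrictPiece, Piece.map, hfg]
      cases g s <;> rfl
    | cap i =>
      simp only [restrictPiece, Piece.map, filterMap_map_strand hfg]
      rcases m.filterMap g with _ | ⟨x, _ | ⟨y, _ | ⟨z, w⟩⟩⟩ <;> rfl
    | cross i q =>
      simp only [restrictPiece, Piece.map, filterMap_map_strand hfg]
      rcases m.filterMap g with _ | ⟨x, _ | ⟨y, _ | ⟨z, w⟩⟩⟩ <;> rfl
    | vertex i o a b c =>
      have e : [(π a, o), (π b, o), (π c, o)].filterMap f =
          ([(a, o), (b, o), (c, o)].filterMap g).map (Strand.map π') := by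
        rw [← filterMap_map_strand hfg]; rfl
      simp only [restrictPiece, Piece.map, e]
      rcases [(a, o), (b, o), (c, o)].filterMap g with _ | ⟨x, _ | ⟨y, _ | ⟨z, w⟩⟩⟩ <;> rfl

end Restrict

/-! ### The lifts of a theta-curve -/

section

variable {C : Type} [DecidableEq C]

/-- The number of strands with the name `e` is even up to the ends at the vertices. -/
theorem count_parity [BEq C] [LawfulBEq C] (e : C) : ∀ (D : Diagram C) {l l' : List (Strand C)},
    run l D = some l' →
    ((l.map Prod.fst).count e + ((vertexList D).map fun v => v.2.count e).sum) % 2 =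
      (l'.map Prod.fst).count e % 2 := by
  intro D
  induction D with
  | nil => intro l l' h; cases h; simp [vertexList]
  | cons g D ih =>
    intro l l' h
    rw [run_cons] at h
    obtain ⟨l1, h1, h2⟩ := bind_eq_some_iff.1 h
    have h3 := ih h2
    obtain ⟨L, m, m', r, rfl, rfl, hL, hm, -, hloc⟩ := exists_of_step h1
    cases g with
    | cup i s =>
      obtain rfl := length_eq_zero_iff.1 hm
      simp [step, Piece.moveTo] at hloc
      subst hloc
      rw [← h3]
      simp only [vertexList, filterMap_cons, map_append, map_cons, map_nil,
        count_append, count_cons, count_nil, Strand.reverse]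
      split_ifs <;> omega
    | cap i =>
      obtain ⟨x, y, rfl⟩ := length_eq_two.1 hm
      simp [step, Piece.moveTo] at hloc
      obtain ⟨rfl, rfl⟩ := hloc
      rw [← h3]
      simp only [vertexList, filterMap_cons, map_append, map_cons, map_nil,
        count_append, count_cons, count_nil, Strand.reverse]
      split_ifs <;> omega
    | cross i p =>
      obtain ⟨x, y, rfl⟩ := length_eq_two.1 hm
      simp [step, Piece.moveTo] at hloc
      subst hloc
      rw [← h3]
      simp only [vertexList, filterMap_cons, map_append, map_cons, map_nil,
        count_append, count_cons, count_nil, Strand.reverse]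
      split_ifs <;> omega
    | vertex i o a b c =>
      obtain rfl := length_eq_zero_iff.1 hm
      simp [step, Piece.moveTo] at hloc
      subst hloc
      rw [← h3]
      simp only [vertexList, filterMap_cons, map_append, map_cons, map_nil,
        count_append, count_cons, count_nil, sum_cons]
      split_ifs <;> omega

theorem vertexList_map {C' : Type} (f : C → C') (D : Diagram C) :
    vertexList (D.map (Piece.map f)) = (vertexList D).map fun v => (v.1, v.2.map f) := by
  induction D with
  | nil => rfl
  | cons g D ih =>
    cases g <;> simp [vertexList, Piece.map] at ih ⊢ <;> exact ih

theorem mem_vertexList {D : Diagram C} {i : ℕ} {o : Bool} {a b c : C}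
    (h : Piece.vertex i o a b c ∈ D) : (o, [a, b, c]) ∈ vertexList D := by
  rw [vertexList, List.mem_filterMap]
  exact ⟨_, h, rfl⟩

end

/-- The deletion of the edge `k`. -/
def deleteEdge (k : Fin 3) (s : Strand (Fin 3)) : Option (Strand Unit) :=
  if s.1 = k then none else if s.1 = k + 1 then some ((), s.2) else some ((), !s.2)

/-- The deletion of the edge `k` in a coloured diagram. -/
def deleteColoured (k : Fin 3) (s : Strand (Fin 3 × Bool)) : Option (Strand (Unit × Bool)) :=
  if s.1.1 = k then none else if s.1.1 = k + 1 then some (((), s.1.2), s.2)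
  else some (((), s.1.2), !s.2)

theorem deleteEdge_reverse : ∀ (k : Fin 3) (s : Strand (Fin 3)),
    deleteEdge k s.reverse = (deleteEdge k s).map Strand.reverse := by
  decide

theorem deleteColoured_reverse : ∀ (k : Fin 3) (s : Strand (Fin 3 × Bool)),
    deleteColoured k s.reverse = (deleteColoured k s).map Strand.reverse := by
  decide

theorem deleteEdge_legs : ∀ (k a b c : Fin 3) (o : Bool), Distinct a b c →
    ∃ t, [(a, o), (b, o), (c, o)].filterMap (deleteEdge k) = [t, t.reverse] := by
  decide

theorem deleteColoured_legs : ∀ (k a b c : Fin 3) (o : Bool), Distinct a b c →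
    ∃ d, [((a, false), o), ((b, false), o), ((c, false), o)].filterMap (deleteColoured k) =
      [(((), false), d), (((), false), !d)] := by
  decide

theorem subknot_eq (D : Diagram (Fin 3)) (k : Fin 3) :
    subknot D k = restrict (deleteEdge k) [] D := rfl

/-- The legs of each vertex are ends of the three edges. -/
theorem IsTheta.vertexGood {D : Diagram (Fin 3)} (h : IsTheta D) : VertexGood Distinct D := by
  obtain ⟨-, ⟨r, r', hr, hr', hv⟩, -⟩ := h
  have key : ∀ a b c : Fin 3, [a, b, c].Perm [0, 1, 2] → Distinct a b c := by
    intro a b c h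
    have := h.nodup_iff.2 (by decide)
    simpa [Distinct, and_assoc, and_comm, and_left_comm] using this
  intro g hg
  cases g with
  | vertex i o a b c =>
    have h1 := hv.mem_iff.1 (mem_vertexList hg)
    simp only [mem_cons, Prod.mk.injEq, not_mem_nil, or_false] at h1
    rcases h1 with ⟨-, rfl⟩ | ⟨-, rfl⟩
    · exact key _ _ _ hr
    · exact key _ _ _ hr'
  | _ => trivial

theorem IsTheta.restricts {D : Diagram (Fin 3)} (h : IsTheta D) (k : Fin 3) :
    ∀ g ∈ D, g.Restricts (deleteEdge k) := by
  intro g hg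
  have h1 := h.vertexGood g hg
  cases g with
  | vertex i o a b c => exact Or.inr (deleteEdge_legs k a b c o h1)
  | _ => trivial

theorem IsTheta.closed_subknot {D : Diagram (Fin 3)} (h : IsTheta D) (k : Fin 3) :
    Closed (subknot D k) := run_restrict (deleteEdge_reverse k) D (h.restricts k) h.1

/-- The closed lifts of a knot have only one colour. -/
theorem closed_lift_knot {D : Diagram Unit} (hD : Closed D)
    (hv : ∀ i o a b c, Piece.vertex i o a b c ∉ D) (hl : loops (D.flatMap Piece.forget) = 1)
    {E : Diagram (Unit × Bool)} (hE : Closed E) (hED : E.map (Piece.map Prod.fst) = D)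
    {i : ℕ} {b d : Bool} (hi : Piece.cup i (((), b), d) ∈ E) :
    ∀ j b' d', Piece.cup j (((), b'), d') ∈ E → b' = b := by
  classical
  have hcard := card_closedLifts_knot hD hv
  rw [hl, pow_one] at hcard
  have hconst : ∀ b : Bool, D.map (Piece.map fun _ => ((), b)) ∈ closedLifts D := by
    intro b
    rw [mem_closedLifts]
    refine ⟨?_, hD.map _⟩
    rw [map_map]
    conv_rhs => rw [← map_id D]
    refine map_congr_left fun g _ => ?_
    rw [Function.comp_apply, Piece.map_comp]
    cases g <;> rfl
  have hEm : E ∈ closedLifts D := mem_closedLifts.2 ⟨hED, hE⟩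
  have hcup : Piece.cup i ((), d) ∈ D := by
    rw [← hED]; exact mem_map_of_mem (f := Piece.map Prod.fst) hi
  have hne : D.map (Piece.map fun _ => ((), false)) ≠ D.map (Piece.map fun _ => ((), true)) := by
    intro h
    rw [List.map_inj_left] at h
    simpa [Piece.map, Strand.map] using h _ hcup
  -- A knot has 2¹ closed lifts, and the two constant ones differ because there is a minimum; hence
  -- there are no others.
  have h2 : ({D.map (Piece.map fun _ => ((), false)), D.map (Piece.map fun _ => ((), true))} :
      Finset (Diagram (Unit × Bool))) = closedLifts D := by
    refine Finset.eq_of_subset_of_card_le ?_ ?_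
    · intro x hx
      simp only [Finset.mem_insert, Finset.mem_singleton] at hx
      rcases hx with rfl | rfl <;> exact hconst _
    · rw [hcard, Finset.card_pair hne]
  rw [← h2] at hEm
  have key : ∀ c : Bool, E = D.map (Piece.map fun _ => ((), c)) →
      ∀ j b' d', Piece.cup j (((), b'), d') ∈ E → b' = c := by
    rintro c rfl j b' d' hj
    obtain ⟨g, -, hg⟩ := mem_map.1 hj
    cases g <;> simp [Piece.map, Strand.map] at hg
    exact hg.2.1.symm
  simp only [Finset.mem_insert, Finset.mem_singleton] at hEm
  intro j b' d' hj
  rcases hEm with h | h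
  · rw [key false h j b' d' hj, key false h i b d hi]
  · rw [key true h j b' d' hj, key true h i b d hi]

/-- By parity both ends of an edge have the same colour, which defines χ. After recolouring by χ all
legs have the colour `false`. Any strand lies in a subknot that also passes through a vertex, and
lifts of a knot have one colour, so all strands have the colour `false`. -/
theorem closed_lift_theta {D : Diagram (Fin 3)} (hD : IsTheta D) {E : Diagram (Fin 3 × Bool)}
    (hE : Closed E) (hED : E.map (Piece.map Prod.fst) = D) :
    ∃ χ : Fin 3 → Bool, E = D.map (Piece.map fun e => (e, χ e)) := by
  obtain ⟨r, r', hr, hr', hv⟩ := hD.2.1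
  rw [← hED, vertexList_map] at hv
  have hlen := hv.length_eq
  simp only [length_map, length_cons, length_nil] at hlen
  obtain ⟨u, v, huv⟩ := length_eq_two.1 hlen
  rw [huv] at hv
  have hperm : ∀ w ∈ [u, v], (w.2.map Prod.fst).Perm [0, 1, 2] := by
    intro w hw
    have h1 := hv.mem_iff.1 (mem_map_of_mem (f := fun v => (v.1, v.2.map Prod.fst)) hw)
    simp only [mem_cons, Prod.mk.injEq, not_mem_nil, or_false] at h1
    rcases h1 with ⟨-, h⟩ | ⟨-, h⟩
    · rw [h]; exact hr
    · rw [h]; exact hr'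
  have hnodup : ∀ w ∈ [u, v], (w.2.map Prod.fst).Nodup := fun w hw =>
    (hperm w hw).nodup_iff.2 (by decide)
  -- Edge and colour together also form a name with an even number of ends, and `u`, `v` are the
  -- only vertices. A coloured name at one vertex therefore occurs at the other one as well.
  have hpar : ∀ e, (u.2.count e + v.2.count e) % 2 = 0 := by
    intro e
    have := count_parity e E (l := []) (l' := []) hE
    rw [huv] at this
    simpa using this
  obtain ⟨χ, hχ⟩ : ∃ χ : Fin 3 → Bool, ∀ e b, (e, b) ∈ u.2 → b = χ e := by
    refine ⟨fun e => decide ((e, true) ∈ u.2), fun e b hb => ?_⟩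
    cases b
    · symm
      rw [decide_eq_false_iff_not]
      intro ht
      have := List.inj_on_of_nodup_map (hnodup u (by simp)) hb ht rfl
      simp at this
    · simpa using hb
  have hχ' : ∀ w ∈ [u, v], ∀ e b, (e, b) ∈ w.2 → b = χ e := by
    intro w hw e b hb
    simp only [mem_cons, not_mem_nil, or_false] at hw
    rcases hw with rfl | rfl
    · exact hχ e b hb
    · refine hχ e b ?_
      have h1 : w.2.count (e, b) = 1 :=
        List.count_eq_one_of_mem (List.Nodup.of_map _ (hnodup w (by simp))) hb
      have h2 := hpar (e, b)
      by_contra h3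
      rw [List.count_eq_zero_of_not_mem h3, h1] at h2
      omega
  -- An involution that turns the colours of all legs into `false`; applying it again at the end
  -- recovers `E`.
  set φ : Fin 3 × Bool → Fin 3 × Bool := fun x => (x.1, xor x.2 (χ x.1)) with hφ
  set E' := E.map (Piece.map φ) with hE'
  have hcl : Closed E' := hE.map φ
  have hE'D : E'.map (Piece.map Prod.fst) = D := by
    rw [← hED, hE', map_map]
    refine map_congr_left fun g _ => ?_
    rw [Function.comp_apply, Piece.map_comp]
    rfl
  have hleg : ∀ i o a b c, Piece.vertex i o a b c ∈ E' →
      a.2 = false ∧ b.2 = false ∧ c.2 = false ∧ Distinct a.1 b.1 c.1 := by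
    intro i o a b c h
    have hd : Distinct a.1 b.1 c.1 := by
      have := mem_map_of_mem (f := Piece.map Prod.fst) h
      rw [hE'D] at this
      exact hD.vertexGood _ this
    obtain ⟨g, hg, hgE⟩ := mem_map.1 h
    cases g with
    | vertex j o' a' b' c' =>
      simp only [Piece.map, Piece.vertex.injEq] at hgE
      obtain ⟨-, -, rfl, rfl, rfl⟩ := hgE
      have h1 := mem_vertexList hg
      rw [huv] at h1
      have ha := hχ' _ h1 a'.1 a'.2 (by simp)
      have hb := hχ' _ h1 b'.1 b'.2 (by simp)
      have hc := hχ' _ h1 c'.1 c'.2 (by simp)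
      exact ⟨by simp [hφ, ← ha], by simp [hφ, ← hb], by simp [hφ, ← hc], hd⟩
    | _ => simp [Piece.map] at hgE
  have hvert : ∃ i o a b c, Piece.vertex i o a b c ∈ E' := by
    have h1 : u ∈ vertexList E := by rw [huv]; simp
    rw [vertexList, List.mem_filterMap] at h1
    obtain ⟨g, hg, hu⟩ := h1
    cases g with
    | vertex i o a b c => exact ⟨_, _, _, _, _, mem_map_of_mem (f := Piece.map φ) hg⟩
    | _ => simp at hu
  have hres : ∀ k, ∀ g ∈ E', g.Restricts (deleteColoured k) := by
    intro k g hg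
    cases g with
    | vertex i o a b c =>
      obtain ⟨a, xa⟩ := a
      obtain ⟨b, xb⟩ := b
      obtain ⟨c, xc⟩ := c
      obtain ⟨rfl, rfl, rfl, hd⟩ := hleg _ _ _ _ _ hg
      obtain ⟨d, hd⟩ := deleteColoured_legs k a b c o hd
      exact Or.inr ⟨_, hd⟩
    | _ => trivial
  have hcup : ∀ i s, Piece.cup i s ∈ E' → s.1.2 = false := by
    intro i s hs
    obtain ⟨⟨e, b⟩, d⟩ := s
    -- Any edge other than `e` could be deleted here; the strand in question then survives in the
    -- subknot.
    set k := e + 1 with hk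
    have h1 := run_restrict (deleteColoured_reverse k) E' (hres k) hcl
    have h2 : (restrict (deleteColoured k) [] E').map (Piece.map Prod.fst) = subknot D k := by
      rw [subknot_eq, ← hE'D]
      refine (restrict_map (π := Prod.fst) (π' := Prod.fst) ?_ E' (l := []) hcl).symm
      intro s
      by_cases h3 : s.1.1 = k <;> by_cases h4 : s.1.1 = k + 1 <;>
        simp [deleteEdge, deleteColoured, Strand.map, h3, h4]
    obtain ⟨i', o', a', b', c', hv'⟩ := hvert
    obtain ⟨a', xa⟩ := a'
    obtain ⟨b', xb⟩ := b'
    obtain ⟨c', xc⟩ := c'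
    obtain ⟨rfl, rfl, rfl, hdist⟩ := hleg _ _ _ _ _ hv'
    obtain ⟨d', hd'⟩ := deleteColoured_legs k a' b' c' o' hdist
    obtain ⟨j', hj'⟩ := vertex_mem_restrict hd' E' [] hv'
    have hne : e ≠ e + 1 := by
      have : ∀ e : Fin 3, e ≠ e + 1 := by decide
      exact this e
    obtain ⟨t, ht, htb⟩ : ∃ t, deleteColoured k ((e, b), d) = some t ∧ t.1.2 = b := by
      simp only [deleteColoured, hk, if_neg hne]
      split_ifs
      · exact ⟨_, rfl, rfl⟩
      · exact ⟨_, rfl, rfl⟩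
    obtain ⟨j, hj⟩ := cup_mem_restrict ht E' [] hs
    have h3 := closed_lift_knot (hD.closed_subknot k)
      (fun i o a b c => vertex_notMem_restrict _ D [] i o a b c) (hD.2.2 k) h1 h2 hj'
    obtain ⟨⟨u, b1⟩, d1⟩ := t
    rw [← htb]
    exact h3 j b1 d1 hj
  refine ⟨χ, ?_⟩
  have hback : E = E'.map (Piece.map φ) := by
    rw [hE', map_map]
    conv_lhs => rw [← map_id E]
    refine map_congr_left fun g _ => ?_
    rw [Function.comp_apply, Piece.map_comp]
    have : φ ∘ φ = id := by funext x; simp [hφ]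
    rw [this]
    cases g <;> rfl
  rw [← hE'D]
  conv_lhs => rw [hback]
  conv_rhs => rw [map_map]
  refine map_congr_left fun g hg => ?_
  rw [Function.comp_apply, Piece.map_comp]
  cases g with
  | cup i s =>
    have := hcup i s hg
    obtain ⟨⟨e, b⟩, d⟩ := s
    simp only at this
    simp [Piece.map, Strand.map, hφ, this]
  | cap i => rfl
  | cross i p => rfl
  | vertex i o a b c =>
    obtain ⟨ha, hb, hc, -⟩ := hleg i o a b c hg
    simp [Piece.map, hφ, ha, hb, hc]

/-! ### Diagrams isotopic to a theta-curve -/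

section

variable {C : Type}

theorem LocalMove.vertex_perm {D E : Diagram C} (h : LocalMove D E) :
    ((vertexList D).map Prod.fst).Perm ((vertexList E).map Prod.fst) := by
  cases h with
  | exchange g h hgh =>
    cases g <;> cases h <;> first | exact Perm.refl _ | exact Perm.swap _ _ _
  | _ => exact Perm.refl _

theorem vertexList_append (D E : Diagram C) :
    vertexList (D ++ E) = vertexList D ++ vertexList E := by
  simp [vertexList]

theorem Isotopic.vertex_perm [DecidableEq C] {D E : Diagram C} (h : Isotopic D E) :
    ((vertexList D).map Prod.fst).Perm ((vertexList E).map Prod.fst) := by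
  induction h with
  | rel D E h =>
    obtain ⟨-, -, p, a, b, q, h, rfl, rfl⟩ := h
    simp only [vertexList_append, map_append]
    exact (h.vertex_perm.append_left _).append_right _
  | refl => exact Perm.refl _
  | symm _ _ _ ih => exact ih.symm
  | trans _ _ _ _ _ h1 h2 => exact h1.trans h2

end

theorem exists_vertex_of_mem {C : Type} {D : Diagram C} {v : Bool × List C}
    (h : v ∈ vertexList D) : ∃ i o a b c, Piece.vertex i o a b c ∈ D ∧ v = (o, [a, b, c]) := by
  rw [vertexList, List.mem_filterMap] at h
  obtain ⟨g, hg, hv⟩ := h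
  cases g with
  | vertex i o a b c => exact ⟨i, o, a, b, c, hg, by simpa using hv.symm⟩
  | _ => simp at hv

/-- A closed diagram with one vertex of each direction, whose legs are ends of the three edges, and
without further closed curves (counted by the closed lifts). -/
structure IsThetaLike (D : Diagram (Fin 3)) : Prop where
  closed : Closed D
  good : VertexGood Distinct D
  vertices : ((vertexList D).map Prod.fst).Perm [true, false]
  lifts : (closedLifts D).card ≤ 8

theorem Distinct.rotate {a b c : Fin 3} (h : Distinct a b c) : Distinct b c a := by
  revert a b c; decide

theorem Distinct.exists_eq {a b c : Fin 3} (h : Distinct a b c) (e : Fin 3) :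
    e = a ∨ e = b ∨ e = c := by
  revert a b c e; decide

/-- The lift of a diagram with constant colours on the edges. -/
def edgeLift (χ : Fin 3 → Bool) (D : Diagram (Fin 3)) : Diagram (Fin 3 × Bool) :=
  D.map (Piece.map fun e => (e, χ e))

theorem edgeLift_fst (χ : Fin 3 → Bool) (D : Diagram (Fin 3)) :
    (edgeLift χ D).map (Piece.map Prod.fst) = D := by
  rw [edgeLift, map_map]
  conv_rhs => rw [← map_id D]
  refine map_congr_left fun g _ => ?_
  rw [Function.comp_apply, Piece.map_comp]
  cases g <;> rfl

/-- All three edges end at a vertex, so χ can be read off there. -/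
theorem edgeLift_injective {D : Diagram (Fin 3)} (hg : VertexGood Distinct D)
    (hv : vertexList D ≠ []) : Function.Injective fun χ => edgeLift χ D := by
  obtain ⟨v, hv⟩ := List.exists_mem_of_ne_nil _ hv
  obtain ⟨i, o, a, b, c, hm, -⟩ := exists_vertex_of_mem hv
  intro χ χ' h
  simp only [edgeLift, List.map_inj_left] at h
  have h1 := h _ hm
  simp only [Piece.map, Piece.vertex.injEq, Prod.mk.injEq, true_and] at h1
  funext e
  rcases (show Distinct a b c from hg _ hm).exists_eq e with rfl | rfl | rfl
  · exact h1.1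
  · exact h1.2.1
  · exact h1.2.2

theorem edgeLift_mem {D : Diagram (Fin 3)} (hD : Closed D) (χ : Fin 3 → Bool) :
    edgeLift χ D ∈ closedLifts D :=
  mem_closedLifts.2 ⟨edgeLift_fst χ D, hD.map _⟩

theorem IsThetaLike.vertexList_ne {D : Diagram (Fin 3)} (h : IsThetaLike D) :
    vertexList D ≠ [] := by
  intro h0
  have := h.vertices.length_eq
  simp [h0] at this

/-- The closed lifts of a theta-curve are those with constant colours on the edges. -/
theorem IsThetaLike.sum_lifts {M : Type} [AddCommMonoid M] {D : Diagram (Fin 3)}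
    (h : IsThetaLike D) (F : Diagram (Fin 3 × Bool) → M)
    (hF : ∀ E, E.map (Piece.map Prod.fst) = D → ¬ Closed E → F E = 0) :
    ((ThetaCurve.lifts D).map F).sum = ∑ χ : Fin 3 → Bool, F (edgeLift χ D) := by
  classical
  rw [ThetaCurve.sum_lifts F hF]
  have hinj := edgeLift_injective h.good h.vertexList_ne
  have h1 : univ.image (fun χ => edgeLift χ D) = closedLifts D := by
    refine Finset.eq_of_subset_of_card_le ?_ ?_
    · intro E hE
      obtain ⟨χ, -, rfl⟩ := Finset.mem_image.1 hE
      exact edgeLift_mem h.closed χ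
    -- The eight constant colourings give eight closed lifts, and by hypothesis there are at most
    -- eight.
    · rw [Finset.card_image_of_injective _ hinj]
      exact h.lifts
  rw [← h1, Finset.sum_image fun χ _ χ' _ hχ => hinj hχ]

theorem IsTheta.thetaLike {D : Diagram (Fin 3)} (h : IsTheta D) : IsThetaLike D where
  closed := h.1
  good := h.vertexGood
  vertices := by
    obtain ⟨r, r', -, -, hv⟩ := h.2.1
    exact hv.map Prod.fst
  lifts := by
    classical
    have h1 : closedLifts D ⊆ univ.image (fun χ => edgeLift χ D) := by
      intro E hE
      rw [mem_closedLifts] at hE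
      obtain ⟨χ, rfl⟩ := closed_lift_theta h hE.2 hE.1
      exact Finset.mem_image_of_mem _ (mem_univ χ)
    exact (card_le_card h1).trans Finset.card_image_le

/-- The condition on the legs is narrowed to `Distinct` so that the invariance theorem also
transports this condition along isotopies. -/
theorem distinct_laws : (colour (fun _ : Fin 3 => none)).Laws 1 (fun _ _ => 0) Distinct :=
  { colour.laws (C := Fin 3) with
    good_rotate := Distinct.rotate
    good_swap := by decide
    good_sum := fun _ _ => rfl
    twist_left := fun _ p => colour.laws.twist_left trivial p
    twist_right := fun _ p => colour.laws.twist_right trivial p }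

/-- The subknots in the definition of a theta-curve are not followed through the moves. Instead, the
absence of further closed curves is encoded in the number of closed lifts, which is an invariant. -/
theorem IsThetaLike.isotopic {D E : Diagram (Fin 3)} (h : IsThetaLike D) (hi : Isotopic D E) :
    IsThetaLike E where
  closed := hi.closed.1 h.closed
  good := (distinct_laws.isotopic hi).1.1 h.good
  vertices := hi.vertex_perm.symm.trans h.vertices
  lifts := (hi.card_closedLifts h.closed).symm.le.trans h.lifts

/-- A sum over the vertices directed away from the vertex has one term. -/
theorem IsThetaLike.exists_first {D : Diagram (Fin 3)} (h : IsThetaLike D) :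
    ∃ a b c, Distinct a b c ∧ (vertexList D).filter (fun v => v.1) = [(true, [a, b, c])] := by
  have hp : (((vertexList D).filter (fun v => v.1)).map Prod.fst).Perm [true] := by
    have := h.vertices.filter (fun b => b)
    rw [List.filter_map] at this
    exact this
  have hl := hp.length_eq
  simp only [length_map, length_cons, length_nil] at hl
  obtain ⟨v, hv⟩ := List.length_eq_one_iff.1 hl
  have hm : v ∈ (vertexList D).filter (fun v => v.1) := by rw [hv]; simp
  rw [List.mem_filter] at hm
  obtain ⟨i, o, a, b, c, hD, rfl⟩ := exists_vertex_of_mem hm.1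
  obtain rfl : o = true := by simpa using hm.2
  exact ⟨a, b, c, h.good _ hD, hv⟩

/-! ### The boundary of the band surface -/

section

variable {C : Type} [DecidableEq C]

/-- A piece moved to the right by `k` strands. -/
def Piece.moveBy (k : ℕ) (g : Piece C) : Piece C := g.moveTo (g.pos + k)

theorem step_moveBy {l l' : List (Strand C)} {g : Piece C} (h : step l g = some l')
    (L r : List (Strand C)) :
    step (L ++ l ++ r) (g.moveBy L.length) = some (L ++ l' ++ r) ∧
      ∀ w, pieceSum w (L ++ l ++ r) (g.moveBy L.length) = pieceSum w l g := by
  obtain ⟨L', m, m', r', rfl, rfl, hL, hm, -, hloc⟩ := exists_of_step h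
  have e1 : L ++ (L' ++ m ++ r') ++ r = (L ++ L') ++ m ++ (r' ++ r) := by simp
  have e2 : (L ++ L').length = (g.moveBy L.length).pos := by
    rw [Piece.moveBy, Piece.pos_moveTo, length_append, hL, add_comm]
  have e3 : m.length = (g.moveBy L.length).ins := by rw [Piece.moveBy, Piece.ins_moveTo, hm]
  have e4 : (g.moveBy L.length).moveTo 0 = g.moveTo 0 := Piece.moveTo_moveTo _ _ _
  rw [e1]
  refine ⟨?_, fun w => ?_⟩
  · rw [step_local _ _ _ _ e2 e3, e4, hloc]
    simp
  · rw [pieceSum_local w _ _ _ _ e2 e3, pieceSum_local w _ _ _ _ hL hm, e4]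

theorem run_moveBy : ∀ (D : Diagram C) {l l' : List (Strand C)}, run l D = some l' →
    ∀ L r : List (Strand C),
    run (L ++ l ++ r) (D.map (Piece.moveBy L.length)) = some (L ++ l' ++ r) ∧
      ∀ w, signSum w (L ++ l ++ r) (D.map (Piece.moveBy L.length)) = signSum w l D := by
  intro D
  induction D with
  | nil => intro l l' h L r; cases h; exact ⟨rfl, fun w => by simp [signSum_nil]⟩
  | cons g D ih =>
    intro l l' h L r
    rw [run_cons] at h
    obtain ⟨l1, h1, h2⟩ := bind_eq_some_iff.1 h
    obtain ⟨k1, k2⟩ := step_moveBy h1 L r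
    obtain ⟨k3, k4⟩ := ih h2 L r
    refine ⟨?_, fun w => ?_⟩
    · rw [map_cons, run_cons, k1]; exact k3
    · rw [map_cons, signSum_cons w k1, signSum_cons w h1, k2, k4]

end

/-- The two sides of the band of a strand. -/
def sides : Strand (Fin 3) → List (Strand (Fin 3))
  | (e, true) => [(e + 1, false), (e + 2, true)]
  | (e, false) => [(e + 2, false), (e + 1, true)]

theorem length_sides (l : List (Strand (Fin 3))) : (l.flatMap sides).length = 2 * l.length := by
  induction l with
  | nil => rfl
  | cons s l ih =>
    obtain ⟨e, b⟩ := s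
    cases b <;> simp [sides] at ih ⊢ <;> omega

/-- The induced weight of the crossings of bands. -/
def bandWeight (w : Fin 3 → Fin 3 → ℤ) (e f : Fin 3) : ℤ :=
  w (e + 1) (f + 1) + w (e + 2) (f + 2) - w (e + 1) (f + 2) - w (e + 2) (f + 1)

/-- The two strands are antiparallel, so each of the 2 |n| crossings has the sign opposite to n;
their number is even, so the row is restored. -/
theorem fullTwists_spec {w : Fin 3 → Fin 3 → ℤ} (hw : ∀ a b, w a b = w b a)
    (L r : List (Strand (Fin 3))) (e f : Fin 3) (n : ℤ) :
    run (L ++ (e, false) :: (f, true) :: r) (fullTwists L.length n) =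
        some (L ++ (e, false) :: (f, true) :: r) ∧
      signSum w (L ++ (e, false) :: (f, true) :: r) (fullTwists L.length n) = -2 * n * w e f := by
  have key : ∀ (p : Bool) (k : ℕ),
      run (L ++ (e, false) :: (f, true) :: r) (List.replicate (2 * k) (.cross L.length p)) =
        some (L ++ (e, false) :: (f, true) :: r) ∧
      signSum w (L ++ (e, false) :: (f, true) :: r) (List.replicate (2 * k) (.cross L.length p)) =
        -2 * (k * boolSign p) * w e f := by
    intro p k
    induction k with
    | zero => simp [signSum_nil]
    | succ k ih =>
      have h1 : ∀ x y : Strand (Fin 3), step (L ++ x :: y :: r) (.cross L.length p) =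
          some (L ++ y :: x :: r) := by intro x y; simp [step]
      have h2 : ∀ x y : Strand (Fin 3), pieceSum w (L ++ x :: y :: r) (.cross L.length p) =
          w x.1 y.1 * crossingSign (x, y, p) := by intro x y; simp [pieceSum]
      rw [show 2 * (k + 1) = 2 * k + 1 + 1 by ring, List.replicate_succ, List.replicate_succ]
      constructor
      · rw [run_cons, h1, bind_some, run_cons, h1]
        exact ih.1
      · rw [signSum_cons w (h1 _ _), signSum_cons w (h1 _ _), ih.2, h2, h2, hw f e]
        cases p <;> simp [crossingSign, boolSign] <;> ring
  obtain ⟨h1, h2⟩ := key (decide (0 ≤ n)) n.natAbs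
  refine ⟨h1, h2.trans ?_⟩
  have : (n.natAbs : ℤ) * boolSign (decide (0 ≤ n)) = n := by
    unfold boolSign
    by_cases hn : 0 ≤ n
    · rw [if_pos (by simpa using hn)]; omega
    · rw [if_neg (by simpa using hn)]; omega
  rw [this]

/-- The contribution of the full twists at a vertex. -/
def twistTerm (m : Fin 3 → ℤ) (w : Fin 3 → Fin 3 → ℤ) (e : Fin 3) : ℤ :=
  -2 * m e * w (e + 1) (e + 2)

/-- The contribution of the full twists. -/
def twistSum (m : Fin 3 → ℤ) (w : Fin 3 → Fin 3 → ℤ) (D : Diagram (Fin 3)) : ℤ :=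
  (((vertexList D).filter fun v => v.1).map fun v => (v.2.map (twistTerm m w)).sum).sum

theorem twistSum_append (m : Fin 3 → ℤ) (w : Fin 3 → Fin 3 → ℤ) (D E : Diagram (Fin 3)) :
    twistSum m w (D ++ E) = twistSum m w D + twistSum m w E := by
  simp [twistSum, vertexList_append]

theorem boundaryPiece_moveTo (m : Fin 3 → ℤ) (g : Piece (Fin 3)) :
    boundaryPiece m g = (boundaryPiece m (g.moveTo 0)).map (Piece.moveBy (2 * g.pos)) := by
  cases g with
  | cup i s =>
    obtain ⟨e, b⟩ := s
    cases b <;> simp [boundaryPiece, Piece.moveTo, Piece.moveBy, Piece.pos, add_comm]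
  | cap i => simp [boundaryPiece, Piece.moveTo, Piece.moveBy, Piece.pos, add_comm]
  | cross i p => simp [boundaryPiece, Piece.moveTo, Piece.moveBy, Piece.pos, add_comm]
  | vertex i o a b c =>
    cases o <;>
      simp [boundaryPiece, Piece.moveTo, Piece.moveBy, Piece.pos, fullTwists, add_comm]

/-- Two crossing bands produce four crossings of their sides. Left and right sides have opposite
directions, which gives the alternating signs in `bandWeight`. The remaining crossings come from the
full twists at a first vertex. -/
theorem boundaryPiece_local (m : Fin 3 → ℤ) {w : Fin 3 → Fin 3 → ℤ} (hw : ∀ a b, w a b = w b a)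
    {l l' : List (Strand (Fin 3))} {g : Piece (Fin 3)} (hg : StandardOrder [g])
    (hl : l.length = g.ins) (h : step l (g.moveTo 0) = some l') :
    run (l.flatMap sides) (boundaryPiece m (g.moveTo 0)) = some (l'.flatMap sides) ∧
      signSum w (l.flatMap sides) (boundaryPiece m (g.moveTo 0)) =
        pieceSum (bandWeight w) l (g.moveTo 0) + twistSum m w [g] := by
  cases g with
  | cup i s =>
    obtain rfl := length_eq_zero_iff.1 hl
    simp [step, Piece.moveTo] at h
    subst h
    obtain ⟨e, b⟩ := s
    cases b <;>
      simp [boundaryPiece, Piece.moveTo, sides, run_cons, step, Strand.reverse, signSum, crossings,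
        pieceSum, twistSum, vertexList]
  | cap i =>
    obtain ⟨x, y, rfl⟩ := length_eq_two.1 hl
    simp [step, Piece.moveTo] at h
    obtain ⟨rfl, rfl⟩ := h
    obtain ⟨e, b⟩ := x
    cases b <;>
      simp [boundaryPiece, Piece.moveTo, sides, run_cons, step, Strand.reverse, signSum, crossings,
        pieceSum, twistSum, vertexList]
  | cross i p =>
    obtain ⟨x, y, rfl⟩ := length_eq_two.1 hl
    simp [step, Piece.moveTo] at h
    subst h
    have k1 : ∀ x y z u : Strand (Fin 3), run [x, y, z, u] (boundaryPiece m (.cross 0 p)) =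
        some [z, u, x, y] := fun _ _ _ _ => rfl
    have k2 : ∀ x y z u : Strand (Fin 3), signSum w [x, y, z, u] (boundaryPiece m (.cross 0 p)) =
        w y.1 z.1 * crossingSign (y, z, p) + (w x.1 z.1 * crossingSign (x, z, p) +
          (w y.1 u.1 * crossingSign (y, u, p) + (w x.1 u.1 * crossingSign (x, u, p) + 0))) :=
      fun _ _ _ _ => rfl
    have k3 : ∀ x y : Strand (Fin 3), pieceSum (bandWeight w) [x, y] (.cross 0 p) =
      bandWeight w x.1 y.1 * crossingSign (x, y, p) := fun _ _ => rfl
    have k4 : twistSum m w [.cross i p] = 0 := rfl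
    obtain ⟨e, b⟩ := x
    obtain ⟨e', b'⟩ := y
    simp only [Piece.moveTo, k3, k4, bandWeight]
    cases b <;> cases b' <;>
      simp only [flatMap_cons, flatMap_nil, sides, append_nil, cons_append,
        nil_append, k1, k2, true_and] <;>
      cases p <;> simp [crossingSign] <;> ring
  | vertex i o a b c =>
    obtain rfl := length_eq_zero_iff.1 hl
    simp [step, Piece.moveTo] at h
    subst h
    have h3 : ∀ x : Fin 3,
        x + 1 + 1 = x + 2 ∧ x + 1 + 2 = x ∧ x + 2 + 1 = x ∧ x + 2 + 2 = x + 1 := by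
      decide
    cases o with
    | false =>
      -- In the standard order the facing sides of neighbouring legs belong to the same boundary
      -- component, so that the arcs around the vertex disk are consistently named and directed.
      obtain ⟨rfl, rfl⟩ := (hg i false a b c (by simp)).2 rfl
      simp [boundaryPiece, Piece.moveTo, sides, run_cons, step, Strand.reverse, signSum, crossings,
        pieceSum, twistSum, vertexList, h3 a]
    | true =>
      obtain ⟨rfl, rfl⟩ := (hg i true a b c (by simp)).1 rfl
      have h0 : run [] [.cup 0 (a + 1, false), .cup 1 (a + 2, true), .cup 3 (a, true)] =
          some ((a + 1, false) :: (a + 2, true) :: (a + 2, false) :: (a, true) ::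
            (a, false) :: [(a + 1, true)]) := by
        simp [run_cons, step, Strand.reverse]
      have h0' : signSum w []
          [.cup 0 (a + 1, false), .cup 1 (a + 2, true), .cup 3 (a, true)] = 0 := by
        simp [signSum, crossings, step]
      obtain ⟨k1, s1⟩ := fullTwists_spec hw []
        ((a + 2, false) :: (a, true) :: (a, false) :: [(a + 1, true)]) (a + 1) (a + 2) (m a)
      obtain ⟨k2, s2⟩ := fullTwists_spec hw [(a + 1, false), (a + 2, true)]
        ((a, false) :: [(a + 1, true)]) (a + 2) a (m (a + 1))
      obtain ⟨k3, s3⟩ := fullTwists_spec hw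
        [(a + 1, false), (a + 2, true), (a + 2, false), (a, true)] [] a (a + 1) (m (a + 2))
      simp only [length_nil, length_cons, nil_append, cons_append, zero_add,
        Nat.reduceAdd] at k1 k2 k3 s1 s2 s3
      simp only [boundaryPiece, Piece.moveTo, mul_zero, zero_add, h3 a, flatMap_nil]
      have r1 := run_append [] [.cup 0 (a + 1, false), .cup 1 (a + 2, true), .cup 3 (a, true)]
        (fullTwists 0 (m a))
      rw [h0, bind_some, k1] at r1
      have r2 := run_append [] ([.cup 0 (a + 1, false), .cup 1 (a + 2, true), .cup 3 (a, true)] ++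
        fullTwists 0 (m a)) (fullTwists 2 (m (a + 1)))
      rw [r1, bind_some, k2] at r2
      constructor
      · rw [run_append, r2, bind_some, k3]
        simp [sides, h3 a]
      · rw [signSum_append w _ _ r2, signSum_append w _ _ r1, signSum_append w _ _ h0, h0', s1, s2,
          s3]
        simp [pieceSum, twistSum, vertexList, twistTerm, h3 a]
        ring

theorem boundaryPiece_spec (m : Fin 3 → ℤ) {w : Fin 3 → Fin 3 → ℤ} (hw : ∀ a b, w a b = w b a)
    {l l' : List (Strand (Fin 3))} {g : Piece (Fin 3)} (hg : StandardOrder [g])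
    (h : step l g = some l') :
    run (l.flatMap sides) (boundaryPiece m g) = some (l'.flatMap sides) ∧
      signSum w (l.flatMap sides) (boundaryPiece m g) =
        pieceSum (bandWeight w) l g + twistSum m w [g] := by
  obtain ⟨L, x, x', r, rfl, rfl, hL, hx, -, hloc⟩ := exists_of_step h
  obtain ⟨h1, h2⟩ := boundaryPiece_local m hw hg hx hloc
  obtain ⟨h3, h4⟩ := run_moveBy _ h1 (L.flatMap sides) (r.flatMap sides)
  rw [length_sides, hL, ← boundaryPiece_moveTo] at h3 h4
  simp only [List.flatMap_append]
  exact ⟨h3, by rw [h4, h2, pieceSum_local _ _ _ _ _ hL hx]⟩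

theorem bandBoundary_spec (m : Fin 3 → ℤ) {w : Fin 3 → Fin 3 → ℤ} (hw : ∀ a b, w a b = w b a) :
    ∀ (D : Diagram (Fin 3)), StandardOrder D → ∀ {l l' : List (Strand (Fin 3))},
    run l D = some l' →
    run (l.flatMap sides) (bandBoundary m D) = some (l'.flatMap sides) ∧
      signSum w (l.flatMap sides) (bandBoundary m D) =
        signSum (bandWeight w) l D + twistSum m w D := by
  intro D
  induction D with
  | nil => intro _ l l' h; cases h; simp [bandBoundary, signSum_nil, twistSum, vertexList]
  | cons g D ih =>
    intro hD l l' h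
    rw [run_cons] at h
    obtain ⟨l1, h1, h2⟩ := bind_eq_some_iff.1 h
    obtain ⟨k1, k2⟩ := boundaryPiece_spec m hw (g := g)
      (fun i o a b c hm => hD i o a b c (by simp at hm; simp [hm])) h1
    obtain ⟨k3, k4⟩ := ih (fun i o a b c hm => hD i o a b c (by simp [hm])) h2
    have e1 : bandBoundary m (g :: D) = boundaryPiece m g ++ bandBoundary m D := rfl
    have e2 : twistSum m w (g :: D) = twistSum m w [g] + twistSum m w D :=
      twistSum_append m w [g] D
    rw [e1]
    constructor
    · rw [run_append, k1, bind_some, k3]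
    · rw [signSum_append w _ _ k1, k2, k4, signSum_cons _ h1, e2]
      ring

/-- There is exactly one vertex directed outward and its legs belong to the three edges, so every
band is twisted exactly once. -/
theorem IsThetaLike.twistSum {D : Diagram (Fin 3)} (h : IsThetaLike D) (m : Fin 3 → ℤ)
    (w : Fin 3 → Fin 3 → ℤ) : ThetaCurve.twistSum m w D = ∑ e, twistTerm m w e := by
  obtain ⟨a, b, c, hd, hv⟩ := h.exists_first
  rw [ThetaCurve.twistSum, hv]
  simp only [map_cons, map_nil, sum_cons, sum_nil, add_zero]
  rw [Fin.sum_univ_three]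
  have : ∀ (F : Fin 3 → ℤ) (a b c : Fin 3),
      Distinct a b c → F a + (F b + F c) = F 0 + F 1 + F 2 := by
    intro F a b c h
    fin_cases a <;> fin_cases b <;> fin_cases c <;> first | (exact absurd h (by decide)) | skip
    all_goals simp; try ring
  exact this _ _ _ _ hd

theorem bandBoundary_vertexFree (m : Fin 3 → ℤ) (D : Diagram (Fin 3)) (i o a b c) :
    Piece.vertex i o a b c ∉ bandBoundary m D := by
  rw [bandBoundary, mem_flatMap]
  rintro ⟨g, -, h⟩
  cases g with
  | cup i s => obtain ⟨e, b⟩ := s; cases b <;> simp [boundaryPiece] at h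
  | cap i => simp [boundaryPiece] at h
  | cross i p => simp [boundaryPiece] at h
  | vertex i o a b c => cases o <;> simp [boundaryPiece, fullTwists, List.mem_replicate] at h

section

variable {D : Diagram (Fin 3)} {m : Fin 3 → ℤ} (h : IsThetaLike D) (hs : StandardOrder D)
include h hs

theorem IsThetaLike.closed_bandBoundary : Closed (bandBoundary m D) :=
  (bandBoundary_spec m (w := fun _ _ => 0) (fun _ _ => rfl) D hs h.closed).1

/-- The four crossings of two bands cancel in the writhe because the sides of a band are
antiparallel; only the full twists count. -/
theorem IsThetaLike.writhe_bandBoundary : -writhe (bandBoundary m D) = 2 * ∑ e, m e := by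
  have h1 := (bandBoundary_spec m (w := fun _ _ => -1) (fun _ _ => rfl) D hs h.closed).2
  rw [h.twistSum] at h1
  have h2 : bandWeight (fun _ _ => -1) = fun _ _ => 0 := by funext e f; simp [bandWeight]
  have h3 : ∀ l, signSum (fun _ _ : Fin 3 => (0 : ℤ)) l D = 0 := by intro l; simp [signSum]
  rw [h2, h3] at h1
  rw [← signSum_neg_one, mul_sum]
  simpa [twistTerm] using h1

/-- For a vanishing Seifert form, the number of twists of the bands is determined by the diagram. -/
theorem IsThetaLike.twists (hm : SeifertFormZero m D) (k : Fin 3) :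
    2 * m k = signSum (edgeWeight k) [] D := by
  have h5 : ∀ k : Fin 3, (bandWeight fun a b =>
      if (a = k + 1 ∧ b = k + 2) ∨ (a = k + 2 ∧ b = k + 1) then 1 else 0) = edgeWeight k := by
    decide
  have h6 : ∀ k : Fin 3, k + 1 ≠ k + 2 := by decide
  -- This weight selects the crossings between the components `k + 1` and `k + 2`, whose signs add
  -- up to zero by hypothesis. The weight it induces on crossings of bands is `edgeWeight k`, and
  -- only the twists in the band `k` contribute to it.
  set w : Fin 3 → Fin 3 → ℤ := fun a b =>
    if (a = k + 1 ∧ b = k + 2) ∨ (a = k + 2 ∧ b = k + 1) then 1 else 0 with hw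
  have h1 := (bandBoundary_spec m (w := w) (by rw [hw]; revert k; decide) D hs h.closed).2
  have h2 : bandWeight w = edgeWeight k := h5 k
  have h3 : ∑ e, twistTerm m w e = -2 * m k := by
    rw [Fin.sum_univ_three, hw]
    fin_cases k <;> simp [twistTerm]
  have h4 : signSum w [] (bandBoundary m D) = crossingSum (k + 1) (k + 2) (bandBoundary m D) := by
    simp only [signSum, crossingSum, hw]
    induction crossings [] (bandBoundary m D) with
    | nil => rfl
    | cons x l ih =>
      rw [map_cons, sum_cons, ih, List.filter_cons]
      by_cases c : (x.1.1 = k + 1 ∧ x.2.1.1 = k + 2) ∨ (x.1.1 = k + 2 ∧ x.2.1.1 = k + 1)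
      · rw [if_pos c, if_pos (decide_eq_true c), map_cons, sum_cons, one_mul]
      · rw [if_neg c, if_neg (by rw [decide_eq_true_eq]; exact c), zero_mul, zero_add]
  rw [h.twistSum, h2, h3] at h1
  simp only [flatMap_nil] at h1
  rw [h4, hm _ _ (h6 k)] at h1
  linarith

end

/-! ### The Jones polynomial of the boundary of the band surface -/

namespace TL

variable {K R : Type} [Field K] [Ring R] [Algebra K R] {A : K} (T : TL R A)

/-- The eigenvalue of `n` full twists on a projector. -/
def _root_.ThetaCurve.twistEigen {K : Type} [Field K] (A : K) (n : ℤ) (b : Bool) : K :=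
  eigen A b (decide (0 ≤ n)) ^ (2 * n.natAbs)

/-- The eigenvalue of the full twists at a vertex. -/
def _root_.ThetaCurve.twistFactor {K : Type} [Field K] (A : K) (m : Fin 3 → ℤ) :
    Piece (Fin 3 × Bool) → K
  | .vertex _ true a b c =>
    twistEigen A (m a.1) a.2 * twistEigen A (m b.1) b.2 * twistEigen A (m c.1) c.2
  | _ => 1

theorem pr_add : T.pr false + T.pr true = 1 := by simp [pr]

variable {T} (hA : A ≠ 0) (hd : loopValue A ≠ 0)
include hA hd

theorem x_pow (p : Bool) (n : ℕ) : T.x p 0 ^ n =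
    eigen A false p ^ n • T.pr false + eigen A true p ^ n • T.pr true := by
  induction n with
  | zero => simp [pr_add]
  | succ n ih =>
    rw [pow_succ', ih, mul_add, mul_smul_comm, mul_smul_comm, x_pr hA hd, x_pr hA hd, smul_smul,
      smul_smul, pow_succ, pow_succ]

theorem word_fullTwists (j : ℕ) (n : ℤ) :
    (T.single Unit).word 1 ((fullTwists j n).flatMap Piece.forget) = T.mv j
      (twistEigen A n false • T.pr false + twistEigen A n true • T.pr true) := by
  have h : ∀ (p : Bool) (k : ℕ), (T.single Unit).word 1
      ((List.replicate k (Piece.cross j p : Piece (Fin 3))).flatMap Piece.forget) =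
      T.mv j (T.x p 0 ^ k) := by
    intro p k
    induction k with
    | zero => simp [Ops.word_nil]
    | succ k ih =>
      rw [List.replicate_succ, flatMap_cons, Ops.word_append, ih, pow_succ', map_mul]
      congr 1
      simp [Piece.forget, Ops.word, Ops.piece]
      rfl
  rw [fullTwists, h, x_pow hA hd]
  rfl

/-- Without names and directions the boundary of a band is just the doubled strand, still without
projectors. At a vertex each full twist is written in terms of the two projectors, which produces
the weighted sum over the lifts of the vertex. -/
theorem word_boundaryPiece (m : Fin 3 → ℤ) (g : Piece (Fin 3)) :
    (T.single Unit).word 1 ((boundaryPiece m g).flatMap Piece.forget) =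
      rawPiece (T.cabled Prod.snd) (twistFactor A m) g := by
  have hc : ∀ i k, T.c (i + k) = T.mv i (T.c k) := fun i k => T.mv_add i k _
  have ha : ∀ i k, T.a (i + k) = T.mv i (T.a k) := fun i k => T.mv_add i k _
  have hx : ∀ p i k, T.x p (i + k) = T.mv i (T.x p k) := fun p i k => T.mv_add i k _
  have pc : ∀ i, (T.single Unit).piece 1 (.cup i) = T.c i := fun i => by simp [Ops.piece]; rfl
  have pa : ∀ i, (T.single Unit).piece 1 (.cap i) = T.a i := fun i => rfl
  have px : ∀ i p, (T.single Unit).piece 1 (.cross i p) = T.x p i :=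
    fun i p => by simp [Ops.piece]; rfl
  cases g with
  | cup i s =>
    have : (T.single Unit).word 1 [.cup (2 * i), .cup (2 * i + 1)] =
        T.mv (2 * i) (T.c 0 * T.c 1) := by
      simp only [Ops.word, map_cons, map_nil, prod_cons, prod_nil, pc, mul_one,
        map_mul, ← hc, add_zero]
    simp only [rawPiece, cabled_sh]
    obtain ⟨e, b⟩ := s
    cases b <;> exact this
  | cap i =>
    have : (T.single Unit).word 1 [.cap (2 * i + 1), .cap (2 * i)] =
        T.mv (2 * i) (T.a 1 * T.a 0) := by
      simp only [Ops.word, map_cons, map_nil, prod_cons, prod_nil, pa, mul_one,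
        map_mul, ← ha, add_zero]
    simp only [rawPiece, cabled_sh]
    exact this
  | cross i p =>
    have : (T.single Unit).word 1 [.cross (2 * i + 1) p, .cross (2 * i) p, .cross (2 * i + 2) p,
        .cross (2 * i + 1) p] = T.mv (2 * i) (T.x p 1 * T.x p 0 * T.x p 2 * T.x p 1) := by
      simp only [Ops.word, map_cons, map_nil, prod_cons, prod_nil, px, mul_one,
        map_mul, ← hx, add_zero, mul_assoc]
    simp only [rawPiece, cabled_sh]
    exact this
  | vertex i o a b c =>
    have h3 : (T.single Unit).word 1 [.cup (2 * i), .cup (2 * i + 1), .cup (2 * i + 3)] =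
        T.mv (2 * i) (T.c 0 * T.c 1 * T.c 3) := by
      simp only [Ops.word, map_cons, map_nil, prod_cons, prod_nil, pc, mul_one,
        map_mul, ← hc, add_zero, mul_assoc]
    have expand : ∀ u v w : Bool → K, T.mv (2 * i) (T.c 0 * T.c 1 * T.c 3 *
        ((u false • T.pr false + u true • T.pr true) *
          T.s (T.s (v false • T.pr false + v true • T.pr true)) *
          T.s (T.s (T.s (T.s (w false • T.pr false + w true • T.pr true)))))) =
        ((liftPiece (.vertex i o a b c)).map fun g =>
          (match g with
            | .vertex _ _ a b c => u a.2 * v b.2 * w c.2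
            | _ => 1 : K) • T.mv (2 * i) ((T.cabled Prod.snd).op [] g)).sum := by
      intro u v w
      simp only [liftPiece, flatMap_cons, flatMap_nil, map_cons, map_nil,
        append_nil, cons_append, nil_append, sum_cons, sum_nil, Ops.op,
        cabled, AlgHom.comp_apply, map_add, map_smul, map_mul, mul_add, add_mul, mul_smul_comm,
        smul_mul_assoc, smul_add]
      module
    have h2 : ∀ y, T.mv 2 y = T.s (T.s y) := fun y => rfl
    have h4 : ∀ y, T.mv 4 y = T.s (T.s (T.s (T.s y))) := fun y => rfl
    simp only [rawPiece, cabled_sh]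
    cases o with
    | true =>
      have e1 : (boundaryPiece m (.vertex i true a b c)).flatMap Piece.forget =
          [.cup (2 * i), .cup (2 * i + 1), .cup (2 * i + 3)] ++
          (fullTwists (2 * i) (m a)).flatMap Piece.forget ++
          (fullTwists (2 * i + 2) (m b)).flatMap Piece.forget ++
          (fullTwists (2 * i + 4) (m c)).flatMap Piece.forget := by
        simp [boundaryPiece, Piece.forget]
      rw [e1, Ops.word_append, Ops.word_append, Ops.word_append, h3, word_fullTwists hA hd,
        word_fullTwists hA hd, word_fullTwists hA hd, mv_add, mv_add, ← map_mul, ← map_mul,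
        ← map_mul, h2, h4, mul_assoc, mul_assoc, ← mul_assoc (_ + _), expand]
      congr 1
    | false =>
      have e1 : (boundaryPiece m (.vertex i false a b c)).flatMap Piece.forget =
          [.cup (2 * i), .cup (2 * i + 1), .cup (2 * i + 3)] := by
        simp [boundaryPiece, Piece.forget]
      have e2 := expand (fun _ => 1) (fun _ => 1) (fun _ => 1)
      simp only [one_smul, pr_add, map_one, mul_one] at e2
      rw [e1, h3, e2]
      congr 1

theorem word_bandBoundary (m : Fin 3 → ℤ) (D : Diagram (Fin 3)) :
    (T.single Unit).word 1 ((bandBoundary m D).flatMap Piece.forget) =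
      rawWord (T.cabled Prod.snd) (twistFactor A m) D := by
  induction D with
  | nil => rfl
  | cons g D ih =>
    have e1 : bandBoundary m (g :: D) = boundaryPiece m g ++ bandBoundary m D := rfl
    rw [e1, List.flatMap_append, Ops.word_append, ih, word_boundaryPiece hA hd]
    simp [rawWord]

omit hd in
-- A full twist consists of two half twists, so the sign of `curl` disappears and both eigenvalues
-- are powers of A.
theorem _root_.ThetaCurve.twistEigen_eq (n : ℤ) (b : Bool) :
    twistEigen A n b = if b then A ^ (2 * n) else A ^ (-6 * n) := by
  have h1 : ∀ p, eigen A b p ^ 2 =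
      if b then A ^ (2 * boolSign p) else A ^ (-6 * boolSign p) := by
    intro p
    cases b <;> cases p <;> simp [eigen, curl, boolSign, zpow_neg] <;> ring
  have h2 : boolSign (decide (0 ≤ n)) * (n.natAbs : ℤ) = n := by
    unfold boolSign
    by_cases hn : 0 ≤ n
    · rw [if_pos (by simpa using hn)]; omega
    · rw [if_neg (by simpa using hn)]; omega
  rw [twistEigen, pow_mul, h1]
  cases b
  · simp only [false_eq_true, if_false]
    rw [← zpow_natCast, ← zpow_mul, mul_assoc, h2]
  · simp only [if_true]
    rw [← zpow_natCast, ← zpow_mul, mul_assoc, h2]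

/-- The projectors are inserted on all strands by `lift_sum`; lifts that are not closed vanish, and
the closed ones have one colour on each edge. -/
theorem cabled_lift_value (m : Fin 3 → ℤ) {D : Diagram (Fin 3)} (h : IsThetaLike D)
    (f : R →ₗ[K] K) :
    f (rawWord (T.cabled Prod.snd) (twistFactor A m) D) =
      ∑ χ : Fin 3 → Bool, (∏ e, twistEigen A (m e) (χ e)) * f ((T.cabled χ).ev [] D) := by
  have hP := cabled_projective hA hd (T := T) (Prod.snd : Fin 3 × Bool → Bool)
  have hft : ∀ b, T.pr b * T.pr (!b) = 0 := by
    intro b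
    have h1 := pr_idem hd (T := T) b
    have h2 : T.pr (!b) = 1 - T.pr b := by
      rw [← pr_add T]; cases b <;> simp
    rw [h2, mul_sub, mul_one, h1, sub_self]
  have h1 := lift_sum hP (P := T.pr) (fun _ _ => rfl) (pr_add T) (hft false) (hft true)
    (twistFactor A m) (fun _ _ => rfl) (fun _ => rfl) (fun _ _ => rfl) D [] [] 1
    (Ops.absorbs_nil _) h.closed
  rw [one_mul, h.sum_lifts] at h1
  · rw [h1, map_sum]
    refine sum_congr rfl fun χ _ => ?_
    rw [one_mul, map_smul, smul_eq_mul]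
    congr 1
    -- The weight of a lift comes only from the single vertex directed outward, which meets each
    -- edge once.
    · obtain ⟨a, b, c, hdist, hv⟩ := h.exists_first
      have key : ∀ E : Diagram (Fin 3), ((edgeLift χ E).map (twistFactor A m)).prod =
          (((vertexList E).filter fun v => v.1).map fun v =>
            (v.2.map fun e => twistEigen A (m e) (χ e)).prod).prod := by
        intro E
        induction E with
        | nil => rfl
        | cons g E ih =>
          have e1 : edgeLift χ (g :: E) = g.map (fun e => (e, χ e)) :: edgeLift χ E := rfl
          have e2 : vertexList (g :: E) = vertexList [g] ++ vertexList E :=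
            vertexList_append [g] E
          rw [e1, e2, map_cons, prod_cons, ih, List.filter_append, map_append,
            List.prod_append]
          congr 1
          cases g with
          | vertex i o a b c =>
            cases o <;> simp [Piece.map, twistFactor, vertexList, mul_assoc]
          | _ => simp [Piece.map, twistFactor, vertexList]
      rw [key, hv]
      have : ∀ (F : Fin 3 → K) (a b c : Fin 3), Distinct a b c →
          F a * (F b * F c) = F 0 * F 1 * F 2 := by
        intro F a b c h
        fin_cases a <;> fin_cases b <;> fin_cases c <;>
          first | (exact absurd h (by decide)) | skip
        all_goals simp; try ring
      rw [Fin.prod_univ_three, ← this (fun e => twistEigen A (m e) (χ e)) a b c hdist]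
      simp
    · have := (T.cabled (Prod.snd : Fin 3 × Bool → Bool)).ev_map (fun e => (e, χ e)) D h.closed
      exact congrArg f this
  · intro E hE hc
    rw [one_mul, Ops.ev_of_not_closed _ h.closed hE hc, smul_zero]

/-- The Jones polynomial of the boundary of the band surface. -/
theorem jones_bandBoundary (f : R →ₗ[K] K) (hf : f 1 = 1) {m : Fin 3 → ℤ} {D : Diagram (Fin 3)}
    (h : IsThetaLike D) (hs : StandardOrder D) (hm : SeifertFormZero m D) :
    jones A (bandBoundary m D) = (loopValue A)⁻¹ * ∑ χ : Fin 3 → Bool,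
      (-A ^ 4) ^ signSum (setWeight χ) [] D * f ((T.cabled χ).ev [] D) := by
  have hfits := fits_forget (bandBoundary m D) [] (h.closed_bandBoundary hs)
    (bandBoundary_vertexFree m D)
  rw [jones, bracket_value (T := T) hA hd f hf hfits, word_bandBoundary hA hd,
    cabled_lift_value hA hd m h, h.writhe_bandBoundary hs, mul_left_comm, mul_sum]
  congr 1
  refine sum_congr rfl fun χ _ => ?_
  rw [← mul_assoc]
  congr 1
  have h1 : signSum (setWeight χ) [] D = ∑ e, if χ e then 2 * m e else 0 := by
    have : ∀ l : List (Strand (Fin 3) × Strand (Fin 3) × Bool),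
        (l.map fun x => setWeight χ x.1.1 x.2.1.1 * crossingSign x).sum = ∑ e, if χ e then
          (l.map fun x => edgeWeight e x.1.1 x.2.1.1 * crossingSign x).sum else 0 := by
      intro l
      induction l with
      | nil => simp
      | cons x l ih =>
        rw [map_cons, sum_cons, ih, setWeight, sum_mul, ← sum_add_distrib]
        refine sum_congr rfl fun e _ => ?_
        split_ifs <;> simp
    rw [signSum, this]
    refine sum_congr rfl fun e _ => ?_
    rw [h.twists hs hm e]
    rfl
  rw [h1]
  have hne : (-A ^ 4) ≠ 0 := by simpa using hA
  -- For each edge with m full twists the writhe contributes A^(6m), and the twists A^(2m) or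
  -- A^(-6m). The product is A^(8m) = (-A⁴)^(2m) for a non-trivial edge and 1 for a trivial one.
  have h2 : ∀ n : ℤ, (-A ^ 3) ^ (2 * n) = A ^ (6 * n) := by
    intro n
    rw [zpow_mul, show (-A ^ 3) ^ (2 : ℤ) = A ^ (6 : ℤ) by norm_cast; ring, ← zpow_mul]
  have h3 : ∀ (b : Bool) (n : ℤ), (-A ^ 4) ^ (if b then 2 * n else 0) =
      A ^ (if b then 8 * n else 0) := by
    intro b n
    cases b
    · simp
    · simp only [if_true]
      rw [zpow_mul, show (-A ^ 4) ^ (2 : ℤ) = A ^ (8 : ℤ) by norm_cast; ring, ← zpow_mul]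
  have h4 : ∀ (b : Bool) (n : ℤ), (if b then A ^ (2 * n) else A ^ (-6 * n)) =
      A ^ (if b then 2 * n else -6 * n) := by
    intro b n; cases b <;> rfl
  simp only [Fin.sum_univ_three, Fin.prod_univ_three, twistEigen_eq hA, h4]
  rw [h2, zpow_add₀ hne, zpow_add₀ hne, h3, h3, h3, ← zpow_add₀ hA, ← zpow_add₀ hA,
    ← zpow_add₀ hA, ← zpow_add₀ hA, ← zpow_add₀ hA]
  congr 1
  cases χ 0 <;> cases χ 1 <;> cases χ 2 <;> simp <;> ring

end TL

/-! ### Strands with the trivial colour -/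

namespace TL

variable {K R : Type} [Field K] [Ring R] [Algebra K R] {A : K} (T : TL R A)

theorem c_e (i : ℕ) : T.c i * T.e i = loopValue A • T.c i := by
  rw [c, e, ← map_mul, u_e, map_smul]

theorem c_succ_e (i : ℕ) : T.c (i + 1) * T.e i = T.c i := by
  rw [e_eq, ← mul_assoc, zag_at, one_mul]

theorem c_e_succ (i : ℕ) : T.c i * T.e (i + 1) = T.c (i + 1) := by
  rw [e_eq, ← mul_assoc, zig_at, one_mul]

/-- The projector onto the part `b`, at position `i`. -/
def prAt (i : ℕ) (b : Bool) : R := T.mv i (T.pr b)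

theorem prAt_false (i : ℕ) : T.prAt i false = (loopValue A)⁻¹ • T.e i := by
  simp only [prAt, pr, false_eq_true, if_false, map_smul, e, ← mv_add, add_zero]

theorem prAt_comm (i k : ℕ) (b : Bool) (y : R) :
    T.mv (i + k + 2) y * T.prAt i b = T.prAt i b * T.mv (i + k + 2) y := by
  have := (T.exch_pr b (T.mv k y)).map (T.mv i)
  rw [show T.s (T.s (T.mv k y)) = T.mv (k + 2) y by
    rw [add_comm, mv_add, mv_succ, mv_succ]; rfl, ← mv_add] at this
  exact this

theorem c_prAt_far (i k : ℕ) (b : Bool) : T.c (i + k + 2) * T.prAt i b = T.prAt i b * T.c (i + k + 2) :=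
  T.prAt_comm i k b _

theorem prAt_c (i k : ℕ) (b : Bool) : T.prAt (i + k) b * T.c i = T.c i * T.prAt (i + k + 2) b :=
  T.mv_c i k _

variable {T} (hA : A ≠ 0) (hd : loopValue A ≠ 0)

include hA hd in
theorem cup_prAt (b : Bool) : T.c 0 * T.c 1 * T.prAt 2 b = T.c 0 * T.c 1 * T.prAt 0 b :=
  (cabled_projective hA hd (T := T) (fun b : Bool => b)).cup_proj b

section
include hd

theorem prAt_orth (i : ℕ) {b b' : Bool} (h : b ≠ b') : T.prAt i b * T.prAt i b' = 0 := by
  have h1 := pr_idem hd (T := T) b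
  have h2 : T.pr b' = 1 - T.pr b := by
    rw [← pr_add T]; cases b <;> cases b' <;> simp at h ⊢
  rw [prAt, prAt, ← map_mul, h2, mul_sub, mul_one, h1, sub_self, map_zero]

theorem prAt_idem (i : ℕ) (b : Bool) : T.prAt i b * T.prAt i b = T.prAt i b := by
  rw [prAt, ← map_mul, pr_idem hd]

theorem c_prAt_false (i : ℕ) : T.c i * T.prAt i false = T.c i := by
  rw [prAt_false, mul_smul_comm, c_e, smul_smul, inv_mul_cancel₀ hd, one_smul]

/-- Cutting a strip just above its minimum leaves two simple minima side by side. So each trivial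
strand begins with an arc of its own, and this arc can be removed. -/
theorem cup_prAt_false : T.c 0 * T.c 1 * T.prAt 0 false = (loopValue A)⁻¹ • (T.c 0 * T.c 2) := by
  rw [prAt_false, mul_smul_comm, mul_assoc, c_succ_e, ← T.cc 0 0]

theorem cap_deleted : T.c 0 * T.c 2 * (T.a 1 * T.a 0) = loopValue A • 1 := by
  rw [mul_assoc, ← mul_assoc (T.c 2), zag_at T 1, one_mul, loop_at]

theorem vert_prAt_zero : T.c 0 * T.c 1 * T.c 3 * T.prAt 0 false =
    (loopValue A)⁻¹ • (T.c 0 * T.c 2 * T.c 3) := by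
  have h := T.c_prAt_far 0 1 false
  rw [mul_assoc, h, ← mul_assoc, cup_prAt_false hd, smul_mul_assoc]

theorem vert_prAt_two : T.c 0 * T.c 1 * T.c 3 * T.prAt 2 false =
    (loopValue A)⁻¹ • (T.c 0 * T.c 1 * T.c 2) := by
  rw [prAt_false, mul_smul_comm, mul_assoc, c_succ_e]

theorem vert_prAt_four : T.c 0 * T.c 1 * T.c 3 * T.prAt 4 false =
    (loopValue A)⁻¹ • (T.c 0 * T.c 1 * T.c 4) := by
  rw [prAt_false, mul_smul_comm, mul_assoc, c_e_succ]

theorem vert_deleted : T.c 0 * T.c 1 * T.c 3 *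
    (T.prAt 0 false * T.prAt 2 false * T.prAt 4 false) =
      (loopValue A)⁻¹ ^ 2 • (T.c 0 * T.c 2 * T.c 4) := by
  rw [← mul_assoc, ← mul_assoc, vert_prAt_zero hd, smul_mul_assoc, mul_assoc (T.c 0 * T.c 2),
    T.prAt_false 2, mul_smul_comm, c_succ_e, mul_smul_comm, smul_smul, smul_mul_assoc,
    mul_assoc (T.c 0), T.cc 2 0, mul_assoc, mul_assoc (T.c 2), c_prAt_false hd, pow_two, mul_assoc]

include hA in
/-- At a vertex with exactly one non-trivial leg the value is zero. -/
theorem vert_single {x y z : Bool} (h : (x = true ∧ y = false ∧ z = false) ∨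
    (x = false ∧ y = true ∧ z = false) ∨ (x = false ∧ y = false ∧ z = true)) :
    T.c 0 * T.c 1 * T.c 3 * (T.prAt 0 x * T.prAt 2 y * T.prAt 4 z) = 0 := by
  -- Cutting one leg of a vertex leaves a doubled arc between the other two. A projector can be
  -- moved round this arc, so two different projectors at its ends annihilate each other.
  have h1 : ∀ y z, y ≠ z → T.c 2 * T.c 3 * (T.prAt 2 y * T.prAt 4 z) = 0 := by
    intro y z hyz
    have h2 : T.c 2 * T.c 3 * T.prAt 4 z = T.c 2 * T.c 3 * T.prAt 2 z := by
      have := congrArg (T.mv 2) (cup_prAt hA hd (T := T) z)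
      simp only [map_mul, c, prAt, ← mv_add] at this
      exact this
    have h3 : T.prAt 4 z * T.prAt 2 y = T.prAt 2 y * T.prAt 4 z := T.prAt_comm 2 0 y (T.pr z)
    rw [← h3, ← mul_assoc, h2, mul_assoc, prAt_orth hd 2 hyz.symm, mul_zero]
  have h4 : ∀ x z, x ≠ z → T.c 0 * T.c 1 * T.c 2 * (T.prAt 0 x * T.prAt 4 z) = 0 := by
    intro x z hxz
    rw [← mul_assoc, mul_assoc _ (T.c 2), T.c_prAt_far 0 0, ← mul_assoc, mul_assoc _ (T.c 2),
      ← T.prAt_c 2 0 z, ← mul_assoc, mul_assoc _ (T.prAt 0 x)]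
    have h5 : T.prAt 2 z * T.prAt 0 x = T.prAt 0 x * T.prAt 2 z := T.prAt_comm 0 0 x (T.pr z)
    rw [show T.prAt (2 + 0) z = T.prAt 2 z from rfl, ← h5, ← mul_assoc, cup_prAt hA hd,
      mul_assoc _ _ (T.prAt 0 x),
      prAt_orth hd 0 hxz.symm, mul_zero, zero_mul]
  have c1 : T.prAt 2 y * T.prAt 0 x = T.prAt 0 x * T.prAt 2 y := T.prAt_comm 0 0 x (T.pr y)
  have hx : x = false → y ≠ z → T.c 0 * T.c 1 * T.c 3 *
      (T.prAt 0 x * T.prAt 2 y * T.prAt 4 z) = 0 := by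
    rintro rfl hyz
    rw [mul_assoc (T.prAt 0 false), ← mul_assoc, vert_prAt_zero hd, smul_mul_assoc,
      mul_assoc (T.c 0), mul_assoc (T.c 0), h1 y z hyz, mul_zero, smul_zero]
  rcases h with ⟨rfl, rfl, rfl⟩ | ⟨rfl, rfl, rfl⟩ | ⟨rfl, rfl, rfl⟩
  · rw [← c1, mul_assoc (T.prAt 2 false), ← mul_assoc, vert_prAt_two hd, smul_mul_assoc,
      h4 _ _ (by decide), smul_zero]
  · exact hx rfl (by decide)
  · exact hx rfl (by decide)

end

include hA in
-- A deleted strand is represented in a row by a simple minimum, and this minimum slides across the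
-- other strip of a crossing.
theorem c_crossing (p : Bool) : T.c 0 * (T.x p 1 * T.x p 0 * T.x p 2 * T.x p 1) = T.c 2 := by
  have h1 := cxx hA (T := T) (i := 0) (p := p)
  have h2 := cxx hA (T := T) (i := 1) (p := p)
  simp only [zero_add, Nat.reduceAdd] at h1 h2
  rw [← mul_assoc, ← mul_assoc, ← mul_assoc, h1, h2]

include hA in
theorem c_crossing' (p : Bool) : T.c 2 * (T.x p 1 * T.x p 0 * T.x p 2 * T.x p 1) = T.c 0 := by
  have h1 := cxx' hA (T := T) (i := 1) (p := p)
  have h2 := cxx' hA (T := T) (i := 0) (p := p)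
  have h3 := T.xx_comm p p 0 0
  simp only [zero_add, Nat.reduceAdd] at h1 h2 h3
  rw [mul_assoc (T.x p 1), ← h3, ← mul_assoc (T.x p 1), ← mul_assoc, ← mul_assoc, ← mul_assoc, h1,
    h2]

end TL

/-! ### Deleting the strands with the trivial colour -/

namespace TL

variable {K R C C' : Type} [Field K] [Ring R] [Algebra K R] {A : K} (T : TL R A)

/-- The creation of the deleted strands of a row. -/
def inserts (f : Strand C → Option (Strand C')) : List (Strand C) → R
  | [] => 1
  | s :: l => if (f s).isSome then T.mv 2 (inserts f l) else T.c 0 * T.mv 2 (inserts f l)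

theorem inserts_append (f : Strand C → Option (Strand C')) (L l : List (Strand C)) :
    T.inserts f (L ++ l) = T.inserts f L * T.mv (2 * L.length) (T.inserts f l) := by
  induction L with
  | nil => simp [inserts, mv]
  | cons s L ih =>
    have e : ∀ y, T.mv (2 * (s :: L).length) y = T.mv 2 (T.mv (2 * L.length) y) := by
      intro y
      rw [← mv_add, length_cons]
      congr 2
      ring
    simp only [inserts, cons_append, ih, e]
    split_ifs <;> simp only [map_mul, mul_assoc]

theorem inserts_comm (f : Strand C → Option (Strand C')) (L : List (Strand C)) (z : R) :
    T.inserts f L * T.mv (2 * L.length) z =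
      T.mv (2 * (L.filterMap f).length) z * T.inserts f L := by
  induction L with
  | nil => simp [inserts, mv]
  | cons s L ih =>
    have e : ∀ (n : ℕ) y, T.mv (2 * (n + 1)) y = T.mv 2 (T.mv (2 * n) y) := by
      intro n y
      rw [← mv_add]
      congr 2
      ring
    cases h : f s with
    | some t =>
      simp only [inserts, h, filterMap_cons, length_cons, e, Option.isSome_some, if_true,
        ← map_mul, ih]
    | none =>
      have e0 : ∀ y, y * T.c 0 = T.c 0 * T.mv 2 y := fun y => T.exch_c0 y
      simp only [inserts, h, filterMap_cons, length_cons, e, Option.isSome_none,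
        false_eq_true, if_false]
      rw [mul_assoc, ← map_mul, ih, map_mul, ← mul_assoc, ← e0, mul_assoc]

variable {T} (hA : A ≠ 0) (hd : loopValue A ≠ 0) [DecidableEq C] [DecidableEq C']
include hA hd

/-- The exponent counts circles: a deleted minimum gives d⁻¹, a deleted maximum gives d, and a
vertex gives d⁻¹ for one deleted leg and d⁻² for three. All of this is half the loss of deleted
strands, less one half for each vertex. When a surviving strand crosses a deleted one, its projector
remains behind as the factor `q`. -/
theorem inserts_op {χ : C → Bool} {f : Strand C → Option (Strand C')}
    (hf : ∀ s, f s.reverse = (f s).map Strand.reverse) (hχ : ∀ s, (f s).isSome = χ s.1)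
    {m m' : List (Strand C)} {g : Piece C} (hm : m.length = g.ins)
    (hs : step m (g.moveTo 0) = some m') (hg : g.Restricts f) :
    ∃ (e : ℤ) (q : R), 2 * e = (m.length - (m.filterMap f).length) -
        (m'.length - (m'.filterMap f).length) - (vertexList [g]).length ∧
      (q = 1 ∨ q = T.pr true ∧ ∃ t, m.filterMap f = [t]) ∧
      T.inserts f m * (T.cabled χ).op m (g.moveTo 0) = loopValue A ^ e •
        (q * (T.cabled fun _ : C' => true).ev (m.filterMap f) (restrictPiece f 0 m (g.moveTo 0)) *
          T.inserts f m') := by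
  have hn : ∀ {s}, f s = none → χ s.1 = false := by intro s h; rw [← hχ, h]; rfl
  have ht : ∀ {s t}, f s = some t → χ s.1 = true := by intro s t h; rw [← hχ, h]; rfl
  have h2 : ∀ y, T.mv 2 y = T.s (T.s y) := fun y => rfl
  have hc : ∀ i k, T.mv i (T.c k) = T.c (i + k) := fun i k => (T.mv_add i k _).symm
  cases g with
  | cup i s =>
    obtain rfl := length_eq_zero_iff.1 hm
    simp [step, Piece.moveTo] at hs
    subst hs
    cases h : f s with
    | none =>
      refine ⟨-1, 1, ?_, Or.inl rfl, ?_⟩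
      · simp [h, hf, vertexList]
      · have := cup_prAt_false hd (T := T)
        simp [inserts, h, hf, restrictPiece, Piece.moveTo, Ops.op, Ops.ev, hn h, cabled, hc]
        exact this
    | some t =>
      refine ⟨0, 1, ?_, Or.inl rfl, ?_⟩
      · simp [h, hf, vertexList]
      · simp [inserts, h, hf, restrictPiece, Piece.moveTo, Ops.op, Ops.ev, ht h, cabled, step,
          Ops.sh, Piece.pos]
  | cap i =>
    obtain ⟨x, y, rfl⟩ := length_eq_two.1 hm
    simp [step, Piece.moveTo] at hs
    obtain ⟨rfl, rfl⟩ := hs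
    cases h : f x with
    | none =>
      refine ⟨1, 1, ?_, Or.inl rfl, ?_⟩
      · simp [h, hf, vertexList]
      · have := cap_deleted hd (T := T)
        simp [inserts, h, hf, restrictPiece, Piece.moveTo, Ops.op, Ops.ev, hn h, cabled, hc]
        exact this
    | some t =>
      refine ⟨0, 1, ?_, Or.inl rfl, ?_⟩
      · simp [h, hf, vertexList]
      · simp [inserts, h, hf, restrictPiece, Piece.moveTo, Ops.op, Ops.ev, ht h, cabled, step,
          Ops.sh, Piece.pos]
  | cross i p =>
    obtain ⟨x, y, rfl⟩ := length_eq_two.1 hm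
    simp [step, Piece.moveTo] at hs
    subst hs
    have hop : (T.cabled χ).op [x, y] (.cross 0 p) = (T.x p 1 * T.x p 0 * T.x p 2 * T.x p 1) *
        (T.prAt 0 (χ y.1) * T.prAt 2 (χ x.1)) := rfl
    have k1 := c_crossing hA (T := T) p
    have k2 := c_crossing' hA (T := T) p
    have k3 : T.c 2 * T.prAt 2 false = T.c 2 := c_prAt_false hd 2
    have k3' : T.c 0 * T.prAt 0 false = T.c 0 := c_prAt_false hd 0
    have k4 : T.c 2 * T.prAt 0 true = T.prAt 0 true * T.c 2 := T.c_prAt_far 0 0 true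
    have k5 : T.prAt 0 true * T.c 0 = T.c 0 * T.prAt 2 true := T.prAt_c 0 0 true
    have k6 : T.c 0 * T.c 0 = T.c 0 * T.c 2 := T.cc 0 0
    cases hx : f x with
    | none =>
      cases hy : f y with
      | none =>
        refine ⟨0, 1, ?_, Or.inl rfl, ?_⟩
        · simp [hx, hy, vertexList]
        · simp [inserts, hx, hy, restrictPiece, Piece.moveTo, Ops.ev, hop, hn hx, hn hy, hc]
          rw [← mul_assoc, mul_assoc (T.c 0), k2, k6, ← mul_assoc, mul_assoc (T.c 0),
            T.c_prAt_far 0 0 false, ← mul_assoc, k3', mul_assoc, k3]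
      | some u =>
        refine ⟨0, T.pr true, ?_, Or.inr ⟨rfl, u, by simp [hx, hy]⟩, ?_⟩
        · simp [hx, hy, vertexList]
        · simp [inserts, hx, hy, restrictPiece, Piece.moveTo, Ops.ev, hop, hn hx, ht hy, hc]
          change _ = T.prAt 0 true * T.c 2
          rw [← mul_assoc, k1, ← mul_assoc, k4, mul_assoc, k3]
    | some t =>
      cases hy : f y with
      | none =>
        refine ⟨0, T.pr true, ?_, Or.inr ⟨rfl, t, by simp [hx, hy]⟩, ?_⟩
        · simp [hx, hy, vertexList]
        · simp [inserts, hx, hy, restrictPiece, Piece.moveTo, Ops.ev, hop, ht hx, hn hy, hc]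
          change _ = T.prAt 0 true * T.c 0
          rw [← mul_assoc, k2, ← mul_assoc, k3', k5]
      | some u =>
        refine ⟨0, 1, ?_, Or.inl rfl, ?_⟩
        · simp [hx, hy, vertexList]
        · simp [inserts, hx, hy, restrictPiece, Piece.moveTo, Ops.op, Ops.ev, ht hx, ht hy, hc, step,
            Ops.sh, Piece.pos, cabled]
  | vertex i o a b c =>
    obtain rfl := length_eq_zero_iff.1 hm
    simp [step, Piece.moveTo] at hs
    subst hs
    have k0 : T.c 0 * T.c 1 * T.prAt 0 true * T.prAt 2 true = T.c 0 * T.c 1 * T.prAt 0 true := by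
      have h3 : T.prAt 2 true * T.prAt 0 true = T.prAt 0 true * T.prAt 2 true :=
        T.prAt_comm 0 0 true (T.pr true)
      rw [mul_assoc, ← h3, ← mul_assoc, cup_prAt hA hd, mul_assoc, prAt_idem hd]
    have k3 : ∀ k, T.c k * T.prAt k false = T.c k := c_prAt_false hd
    simp only [Piece.moveTo, Ops.op]
    change ∃ (e : ℤ) (q : R), _ ∧ _ ∧ T.inserts f [] * (T.c 0 * T.c 1 * T.c 3 *
      (T.prAt 0 (χ a) * T.prAt 2 (χ b) * T.prAt 4 (χ c))) = _
    have e1 : ∀ t : Strand C', (T.cabled fun _ : C' => true).ev [] [.cup 0 t] =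
        T.c 0 * T.c 1 * T.prAt 0 true := by
      intro t
      simp [Ops.ev, step, Ops.op, Ops.sh, Piece.pos]
      rfl
    have k4 : T.prAt 4 true * T.prAt 2 true = T.prAt 2 true * T.prAt 4 true :=
      T.prAt_comm 2 0 true (T.pr true)
    have k5 : T.prAt 2 true * T.prAt 0 true = T.prAt 0 true * T.prAt 2 true :=
      T.prAt_comm 0 0 true (T.pr true)
    have k6 : T.prAt 2 false * T.prAt 0 true = T.prAt 0 true * T.prAt 2 false :=
      T.prAt_comm 0 0 true (T.pr false)
    have k7 : T.prAt 4 false * T.prAt 0 true = T.prAt 0 true * T.prAt 4 false :=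
      T.prAt_comm 0 2 true (T.pr false)
    have k8 : T.prAt 4 false * T.prAt 2 true = T.prAt 2 true * T.prAt 4 false :=
      T.prAt_comm 2 0 true (T.pr false)
    cases ha : f (a, o) with
    | none =>
      cases hb : f (b, o) with
      | none =>
        cases hc' : f (c, o) with
        | none =>
          refine ⟨-2, 1, by simp [ha, hb, hc', vertexList], Or.inl rfl, ?_⟩
          simp [inserts, ha, hb, hc', restrictPiece, Ops.ev, hn ha, hn hb, hn hc', hc]
          rw [vert_deleted hd, inv_pow, mul_assoc (T.c 0)]
        | some w => simp [Piece.Restricts, ha, hb, hc'] at hg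
      | some v =>
        cases hc' : f (c, o) with
        | none => simp [Piece.Restricts, ha, hb, hc'] at hg
        | some w =>
          refine ⟨-1, 1, by simp [ha, hb, hc', vertexList], Or.inl rfl, ?_⟩
          simp [inserts, ha, hb, hc', restrictPiece, hn ha, ht hb, ht hc', hc, e1]
          have h4 : T.c 2 * T.c 3 * T.prAt 2 true * T.prAt 4 true =
              T.c 2 * T.c 3 * T.prAt 2 true := by
            have := congrArg (T.mv 2) k0
            simp only [map_mul, TL.c, prAt, ← mv_add] at this
            exact this
          rw [mul_assoc (T.prAt 0 false), ← mul_assoc, vert_prAt_zero hd, smul_mul_assoc]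
          congr 1
          rw [mul_assoc (T.c 0), mul_assoc (T.c 0), ← mul_assoc _ (T.prAt 2 true), h4]
          have := T.exch_c0 (T.c 0 * T.c 1 * T.prAt 0 true)
          rw [this]
          congr 1
          change _ = T.mv 2 (T.c 0 * T.c 1 * T.prAt 0 true)
          simp only [map_mul, hc, prAt, ← mv_add, Nat.reduceAdd]
    | some u =>
      cases hb : f (b, o) with
      | none =>
        cases hc' : f (c, o) with
        | none => simp [Piece.Restricts, ha, hb, hc'] at hg
        | some w =>
          refine ⟨-1, 1, by simp [ha, hb, hc', vertexList], Or.inl rfl, ?_⟩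
          simp [inserts, ha, hb, hc', restrictPiece, ht ha, hn hb, ht hc', hc, e1]
          have h5 : T.c 2 * T.prAt 4 true = T.prAt 2 true * T.c 2 := (T.prAt_c 2 0 true).symm
          rw [← k6, mul_assoc (T.prAt 2 false), ← mul_assoc, vert_prAt_two hd, smul_mul_assoc]
          congr 1
          rw [← mul_assoc, mul_assoc _ (T.c 2), T.c_prAt_far 0 0, ← mul_assoc,
            mul_assoc _ _ (T.prAt 4 true), show T.c (0 + 0 + 2) = T.c 2 from rfl, h5, ← mul_assoc,
            k0]
      | some v =>
        cases hc' : f (c, o) with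
        | none =>
          refine ⟨-1, 1, by simp [ha, hb, hc', vertexList], Or.inl rfl, ?_⟩
          simp [inserts, ha, hb, hc', restrictPiece, ht ha, ht hb, hn hc', hc, e1]
          have h6 : T.c 4 * T.prAt 0 true = T.prAt 0 true * T.c 4 := T.c_prAt_far 0 2 true
          have h7 : T.c 4 * T.prAt 2 true = T.prAt 2 true * T.c 4 := T.c_prAt_far 2 0 true
          rw [mul_assoc (T.prAt 0 true), ← k8, ← mul_assoc (T.prAt 0 true), ← k7,
            mul_assoc (T.prAt 4 false), ← mul_assoc, vert_prAt_four hd, smul_mul_assoc]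
          congr 1
          rw [← mul_assoc, mul_assoc _ (T.c 4), h6, ← mul_assoc, mul_assoc _ (T.c 4), h7,
            ← mul_assoc, k0]
        | some w => simp [Piece.Restricts, ha, hb, hc'] at hg

omit hA hd in
theorem _root_.ThetaCurve.Ops.ev_moveBy {O : Ops K C R} (D : Diagram C) :
    ∀ {l l' : List (Strand C)}, run l D = some l' → ∀ L r : List (Strand C),
    O.ev (L ++ l ++ r) (D.map (Piece.moveBy L.length)) = O.sh L.length (O.ev l D) := by
  induction D with
  | nil => intro l l' h L r; simp [Ops.ev]
  | cons g D ih =>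
    intro l l' h L r
    rw [run_cons] at h
    obtain ⟨l1, h1, h2⟩ := bind_eq_some_iff.1 h
    rw [map_cons, O.ev_cons (step_moveBy h1 L r).1, ih h2, O.ev_cons h1, map_mul, ← O.sh_add,
      Piece.moveBy, Piece.pos_moveTo, add_comm g.pos]
    congr 2
    obtain ⟨L', m, m', r', rfl, -, hL, hm, -, -⟩ := exists_of_step h1
    have e1 : L ++ (L' ++ m ++ r') ++ r = (L ++ L') ++ m ++ (r' ++ r) := by simp
    rw [e1, O.op_local _ m _ _ (by rw [Piece.pos_moveTo, length_append, hL])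
      (by rw [Piece.ins_moveTo, hm]), Piece.moveTo_moveTo, O.op_local _ m _ _ hL hm]

/-- Deleting the strands with the trivial colour, one piece at a time. -/
theorem restrict_step {χ : C → Bool} {f : Strand C → Option (Strand C')}
    (hf : ∀ s, f s.reverse = (f s).map Strand.reverse) (hχ : ∀ s, (f s).isSome = χ s.1)
    {L m r l1 : List (Strand C)} {g : Piece C} (hL : L.length = g.pos) (hm : m.length = g.ins)
    (hs : step (L ++ m ++ r) g = some l1) (hg : g.Restricts f) {y : R}
    (hy : (T.cabled fun _ : C' => true).Absorbs ((L ++ m ++ r).filterMap f) y) :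
    ∃ e : ℤ, 2 * e = ((L ++ m ++ r).length - ((L ++ m ++ r).filterMap f).length) -
        (l1.length - (l1.filterMap f).length) - (vertexList [g]).length ∧
      y * (T.inserts f (L ++ m ++ r) * (T.cabled χ).sh g.pos ((T.cabled χ).op (L ++ m ++ r) g)) =
        loopValue A ^ e • (y * (T.cabled fun _ : C' => true).ev ((L ++ m ++ r).filterMap f)
          (restrictPiece f (L.filterMap f).length m g) * T.inserts f l1) := by
  have h1 := hs
  rw [step_local L m r g hL hm] at h1
  obtain ⟨m', hm', rfl⟩ := Option.map_eq_some_iff.1 h1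
  obtain ⟨e, q, he, hq, h⟩ := inserts_op (T := T) hA hd hf hχ hm hm' hg
  refine ⟨e, ?_, ?_⟩
  · simp only [List.filterMap_append, length_append, Nat.cast_add]
    omega
  have hP := cabled_projective hA hd (T := T) χ
  have hlen := length_of_step_local hm hm'
  have hop : T.mv (2 * m.length) (T.inserts f r) * (T.cabled χ).op m (g.moveTo 0) =
      (T.cabled χ).op m (g.moveTo 0) * T.mv (2 * m'.length) (T.inserts f r) := by
    have := hP.toExchange.op m (g.moveTo 0) (T.inserts f r)
    rw [cabled_sh, cabled_sh, Piece.ins_moveTo, Piece.outs_moveTo, ← hm, ← hlen] at this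
    exact this
  -- The projector left over from a crossing with a deleted strand is already contained in `y`.
  have hyq : y * T.mv (2 * (L.filterMap f).length) q = y := by
    rcases hq with rfl | ⟨rfl, t, ht⟩
    · rw [map_one, mul_one]
    · have : (L ++ m ++ r).filterMap f = L.filterMap f ++ t :: r.filterMap f := by simp [ht]
      rw [this] at hy
      have h3 := hy.at
      rw [cabled_sh] at h3
      exact h3
  have hev : (T.cabled fun _ : C' => true).ev ((L ++ m ++ r).filterMap f)
      (restrictPiece f (L.filterMap f).length m g) = T.mv (2 * (L.filterMap f).length)
        ((T.cabled fun _ : C' => true).ev (m.filterMap f) (restrictPiece f 0 m (g.moveTo 0))) := by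
    have h4 := run_restrictPiece hf (L := []) (m := m) (r := []) (g := g.moveTo 0)
      (by rw [Piece.pos_moveTo]; rfl) (by rw [Piece.ins_moveTo, hm]) (by cases g <;> exact hg)
      (by simpa using hm')
    have h5 : (restrictPiece f 0 m (g.moveTo 0)).map (Piece.moveBy (L.filterMap f).length) =
        restrictPiece f (L.filterMap f).length m g := by
      cases g with
      | cup i s =>
        simp only [restrictPiece, Piece.moveTo]
        split <;> simp [Piece.moveBy, Piece.moveTo, Piece.pos]
      | _ =>
        simp only [restrictPiece, Piece.moveTo]
        split <;> simp [Piece.moveBy, Piece.moveTo, Piece.pos]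
    simp only [nil_append, append_nil, List.filterMap_nil, length_nil] at h4
    rw [← cabled_sh (fun _ : C' => true), ← Ops.ev_moveBy (O :=
        T.cabled fun _ : C' => true) _ h4 (L.filterMap f) (r.filterMap f), h5]
    simp
  have e3 : ∀ x : List (Strand C), T.inserts f (L ++ x ++ r) = T.inserts f L *
      T.mv (2 * L.length) (T.inserts f x * T.mv (2 * x.length) (T.inserts f r)) := by
    intro x
    rw [append_assoc, inserts_append, inserts_append]
  rw [(T.cabled χ).op_local L m r g hL hm, e3, e3, hev, cabled_sh, ← hL, mul_assoc, ← map_mul,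
    mul_assoc (T.inserts f m), hop, ← mul_assoc (T.inserts f m), h, smul_mul_assoc, map_smul,
    mul_smul_comm, mul_smul_comm]
  congr 1
  generalize (T.cabled fun _ : C' => true).ev _ _ = Z
  rw [mul_assoc (q * Z), map_mul, ← mul_assoc (T.inserts f L), inserts_comm, map_mul, mul_assoc,
    mul_assoc, ← mul_assoc y, hyq, mul_assoc y]

/-- Deleting the strands with the trivial colour. -/
theorem restrict_value {χ : C → Bool} {f : Strand C → Option (Strand C')}
    (hf : ∀ s, f s.reverse = (f s).map Strand.reverse) (hχ : ∀ s, (f s).isSome = χ s.1) :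
    ∀ (D : Diagram C) {l l' : List (Strand C)} {y : R}, (∀ g ∈ D, g.Restricts f) →
    run l D = some l' → (T.cabled fun _ : C' => true).Absorbs (l.filterMap f) y →
    ∃ e : ℤ, 2 * e = (l.length - (l.filterMap f).length) - (l'.length - (l'.filterMap f).length) -
        (vertexList D).length ∧
      y * (T.inserts f l * (T.cabled χ).ev l D) = loopValue A ^ e •
        (y * (T.cabled fun _ : C' => true).ev (l.filterMap f) (restrict f l D) * T.inserts f l') := by
  intro D
  induction D with
  | nil =>
    intro l l' y _ h _
    cases h
    exact ⟨0, by simp [vertexList], by simp [Ops.ev, restrict]⟩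
  | cons g D ih =>
    intro l l' y hg h hy
    rw [run_cons] at h
    obtain ⟨l1, h1, h2⟩ := bind_eq_some_iff.1 h
    obtain ⟨L, m, m', r, rfl, -, hL, hm, -, -⟩ := exists_of_step h1
    have hr := run_restrictPiece hf hL hm (hg g (by simp)) h1
    obtain ⟨e, he, k⟩ := restrict_step hA hd hf hχ hL hm h1 (hg g (by simp)) hy
    obtain ⟨e', he', k'⟩ := ih (fun g hg' => hg g (by simp [hg'])) h2
      ((cabled_projective hA hd (T := T) fun _ : C' => true).absorbs_run _ hr hy)
    refine ⟨e + e', ?_, ?_⟩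
    · have : vertexList (g :: D) = vertexList [g] ++ vertexList D := vertexList_append [g] D
      rw [this, length_append (as := vertexList [g]), Nat.cast_add]
      linarith
    · rw [restrict_cons f hL hm h1, (T.cabled χ).ev_cons h1, ← mul_assoc (T.inserts f _),
        ← mul_assoc y, k, smul_mul_assoc, mul_assoc, k', smul_smul, ← zpow_add₀ hd,
        (T.cabled fun _ : C' => true).ev_append _ _ hr]
      simp only [mul_assoc]

/-- The value of a closed diagram with two vertices. -/
theorem restrict_closed {χ : C → Bool} {f : Strand C → Option (Strand C')}
    (hf : ∀ s, f s.reverse = (f s).map Strand.reverse) (hχ : ∀ s, (f s).isSome = χ s.1)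
    {D : Diagram C} (hg : ∀ g ∈ D, g.Restricts f) (hD : Closed D)
    (hv : (vertexList D).length = 2) :
    (T.cabled χ).ev [] D =
      (loopValue A)⁻¹ • (T.cabled fun _ : C' => true).ev [] (restrict f [] D) := by
  obtain ⟨e, he, h⟩ := restrict_value (R := R) hA hd hf hχ (T := T) D (y :=
      (1 : R)) hg hD (Ops.absorbs_nil _)
  -- The rows at both ends are empty, so only the two vertices contribute to `2 * e = -2`.
  obtain rfl : e = -1 := by
    rw [hv] at he
    simp at he
    omega
  simpa [inserts] using h

end TL

/-! ### The Jones polynomial of the associated link -/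

theorem Isotopic.vertexFree {C : Type} [DecidableEq C] {D E : Diagram C} (h : Isotopic D E)
    (hD : ∀ i o a b c, Piece.vertex i o a b c ∉ D) : ∀ i o a b c, Piece.vertex i o a b c ∉ E := by
  intro i o a b c hE
  have h1 : (o, [a, b, c]) ∈ vertexList E := mem_vertexList hE
  have h2 := h.vertex_perm.symm.subset (mem_map_of_mem (f := Prod.fst) h1)
  obtain ⟨v, hv, -⟩ := mem_map.1 h2
  obtain ⟨_, _, _, _, _, h3, -⟩ := exists_vertex_of_mem hv
  exact hD _ _ _ _ _ h3

theorem signSum_crossingless {C : Type} [DecidableEq C] (w : C → C → ℤ) : ∀ (D : Diagram C)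
    {l l' : List (Strand C)}, run l D = some l' → Crossingless D → signSum w l D = 0 := by
  intro D
  induction D with
  | nil => intros; exact signSum_nil _ _
  | cons g D ih =>
    intro l l' h hD
    rw [run_cons] at h
    obtain ⟨l1, h1, h2⟩ := bind_eq_some_iff.1 h
    rw [signSum_cons w h1, ih h2 fun i p hm => hD i p (by simp [hm])]
    cases g with
    | cross i p => exact absurd (by simp) (hD i p)
    | _ => rfl

/-- Crossings with a deleted strand have weight zero, and the others are in bijection with the
crossings of the restricted diagram. -/
theorem signSum_restrict {C C' : Type} [DecidableEq C] [DecidableEq C'] {w : C → C → ℤ}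
    {w' : C' → C' → ℤ} {f : Strand C → Option (Strand C')}
    (hf : ∀ s, f s.reverse = (f s).map Strand.reverse)
    (h1 : ∀ x y p t u, f x = some t → f y = some u →
      w x.1 y.1 * crossingSign (x, y, p) = w' t.1 u.1 * crossingSign (t, u, p))
    (h2 : ∀ x y, f x = none ∨ f y = none → w x.1 y.1 = 0) :
    ∀ (D : Diagram C) {l l' : List (Strand C)}, (∀ g ∈ D, g.Restricts f) → run l D = some l' →
      signSum w l D = signSum w' (l.filterMap f) (restrict f l D) := by
  intro D
  induction D with
  | nil => intros; simp [restrict, signSum_nil]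
  | cons g D ih =>
    intro l l' hg h
    rw [run_cons] at h
    obtain ⟨l1, hs, h3⟩ := bind_eq_some_iff.1 h
    obtain ⟨L, m, m', r, rfl, -, hL, hm, -, -⟩ := exists_of_step hs
    rw [restrict_cons f hL hm hs, signSum_cons w hs, ih (fun g hg' => hg g (by simp [hg'])) h3,
      signSum_append w' _ _ (run_restrictPiece hf hL hm (hg g (by simp)) hs)]
    congr 1
    cases g with
    | cross i p =>
      obtain ⟨x, y, rfl⟩ := length_eq_two.1 hm
      obtain rfl : L.length = i := hL
      cases hx : f x with
      | none =>
        cases hy : f y <;>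
          simp [pieceSum, restrictPiece, hx, hy, h2 x y (Or.inl hx), signSum_nil]
      | some t =>
        cases hy : f y with
        | none => simp [pieceSum, restrictPiece, hx, hy, h2 x y (Or.inr hy), signSum_nil]
        | some u =>
          simp [pieceSum, restrictPiece, hx, hy, h1 x y p t u hx hy, signSum, crossings]
    | _ =>
      simp only [pieceSum, restrictPiece]
      split <;> simp [signSum, crossings]

theorem restrict_none {C C' : Type} [DecidableEq C] : ∀ (D : Diagram C) (l : List (Strand C)),
    restrict (fun _ => (none : Option (Strand C'))) l D = [] := by
  intro D
  induction D with
  | nil => intro l; rfl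
  | cons g D ih =>
    intro l
    unfold restrict
    rw [ih]
    cases g <;> simp

/-- The subknot runs backward along the edge `k + 2`. This changes the signs of its crossings with
the edge `k + 1`, so their weight 2 becomes the weight -2 of self-crossings; crossings with the edge
`k` have weight zero. -/
theorem deleteEdge_weight (k : Fin 3) (x y : Strand (Fin 3)) :
    (∀ p t u, deleteEdge k x = some t → deleteEdge k y = some u →
      setWeight (fun e => decide (e ≠ k)) x.1 y.1 * crossingSign (x, y, p) =
        -2 * crossingSign (t, u, p)) ∧
    (deleteEdge k x = none ∨ deleteEdge k y = none →
      setWeight (fun e => decide (e ≠ k)) x.1 y.1 = 0) := by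
  obtain ⟨e, b⟩ := x
  obtain ⟨e', b'⟩ := y
  revert k e e' b b'
  decide

namespace TL

variable {K R : Type} [Field K] [Ring R] [Algebra K R] {A : K} {T : TL R A}
variable (hA : A ≠ 0) (hd : loopValue A ≠ 0) (f : R →ₗ[K] K) (hf : f 1 = 1)
include hA hd

theorem ev_eq_zero {C : Type} [DecidableEq C] {O : Ops K C R} {g : Piece C}
    (hg : ∀ l, O.op l g = 0) : ∀ (D : Diagram C), g ∈ D → ∀ l, O.ev l D = 0 := by
  intro D
  induction D with
  | nil => intro h; simp at h
  | cons g' D ih =>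
    intro h l
    cases hs : step l g' with
    | none => simp [Ops.ev, hs]
    | some l1 =>
      rw [O.ev_cons hs]
      rcases mem_cons.1 h with rfl | h
      · rw [hg, map_zero, zero_mul]
      · rw [ih h, mul_zero]

/-- One vertex suffices: its three legs carry exactly one non-trivial projector, so already its own
value vanishes. -/
theorem value_single {χ : Fin 3 → Bool} (hχ : ¬ NotSingle χ) {D : Diagram (Fin 3)}
    (h : IsThetaLike D) : (T.cabled χ).ev [] D = 0 := by
  obtain ⟨v, hv⟩ := List.exists_mem_of_ne_nil _ h.vertexList_ne
  obtain ⟨i, o, a, b, c, hm, -⟩ := exists_vertex_of_mem hv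
  have hdist : Distinct a b c := h.good _ hm
  refine ev_eq_zero hA hd (g := .vertex i o a b c) (fun l => ?_) D hm []
  refine vert_single hA hd (T := T) (x := χ a) (y := χ b) (z := χ c) ?_
  have key : ∀ χ : Fin 3 → Bool, ¬ NotSingle χ → χ = ![true, false, false] ∨
      χ = ![false, true, false] ∨ χ = ![false, false, true] := by decide
  have key' : ∀ a b c : Fin 3, Distinct a b c → ∀ χ ∈ [![true, false, false],
      ![false, true, false], ![false, false, true]],
      (χ a = true ∧ χ b = false ∧ χ c = false) ∨ (χ a = false ∧ χ b = true ∧ χ c = false) ∨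
        (χ a = false ∧ χ b = false ∧ χ c = true) := by decide
  exact key' a b c hdist χ (by simpa using key χ hχ)

include hf

/-- The normalized value may be computed on a crossingless diagram of one circle, where it is the
trace of the Jones-Wenzl projector on two strands, d² - d/d. -/
theorem value_knot {D : Diagram Unit} (hD : Closed D)
    (hv : ∀ i o a b c, Piece.vertex i o a b c ∉ D) (hl : loops (D.flatMap Piece.forget) = 1)
    (ht : IsTrivial D) :
    (-A ^ 4) ^ signSum (fun _ _ => -2) [] D * f ((T.cabled fun _ : Unit => true).ev [] D) =
      loopValue A ^ 2 - 1 := by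
  obtain ⟨E, hi, hE⟩ := ht
  have hcl := hi.closed.1 hD
  have hvE := hi.vertexFree hv
  have h1 := ((knot_laws hA hd (T := T)).isotopic hi).2 (by
    intro g hg
    cases g with
    | vertex i o a b c => exact absurd hg (hv _ _ _ _ _)
    | _ => trivial)
  have h2 := congrArg f h1
  rw [map_smul, map_smul, smul_eq_mul, smul_eq_mul, signSum_crossingless _ E hcl hE, zpow_zero,
    one_mul] at h2
  rw [h2, Ops.ev_eq_word (P := T.pr true) (fun _ => rfl) E [] [] hcl hvE]
  have hP := cabled_projective hA hd (T := T) (fun _ : Unit => true)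
  have hloop : (T.cabled fun _ : Unit => true).cup * (T.cabled fun _ : Unit => true).proj () *
      (T.cabled fun _ : Unit => true).cap = (loopValue A ^ 2 - 1) • 1 := by
    have k1 : T.c 0 * T.c 1 * (T.a 1 * T.a 0) = loopValue A ^ 2 • 1 := by
      rw [mul_assoc, ← mul_assoc (T.c 1), loop_at, smul_mul_assoc, one_mul, mul_smul_comm, loop_at,
        smul_smul, pow_two]
    have k2 : T.c 0 * T.c 1 * T.e 0 * (T.a 1 * T.a 0) = loopValue A • 1 := by
      rw [mul_assoc (T.c 0), c_succ_e, mul_assoc, ← mul_assoc (T.c 0) (T.a 1), zig_at T 0, one_mul,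
        loop_at]
    change T.c 0 * T.c 1 * (1 - (loopValue A)⁻¹ • T.e 0) * (T.a 1 * T.a 0) = _
    rw [mul_sub, sub_mul, mul_one, k1, mul_smul_comm, smul_mul_assoc, k2, smul_smul,
      inv_mul_cancel₀ hd, sub_smul]
  have h3 := Ops.word_value hP () (knot_laws hA hd).zig (knot_laws hA hd).zag hloop f hf
    (fits_forget E [] hcl hvE) (by
      intro i p hm
      rw [mem_flatMap] at hm
      obtain ⟨g, hg, hm⟩ := hm
      cases g with
      | cross j q => exact hE j q hg
      | _ => simp [Piece.forget] at hm)
  -- The number of components is compared through the number 2^loops of closed lifts, which is an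
  -- isotopy invariant.
  have h4 : loops (E.flatMap Piece.forget) = 1 := by
    have e1 := hi.card_closedLifts hD
    rw [card_closedLifts_knot hD hv, card_closedLifts_knot hcl hvE, hl] at e1
    exact (Nat.pow_right_injective le_rfl e1).symm
  rw [h4, pow_one] at h3
  exact h3

/-- The value of a theta-curve for the colouring with one trivial edge. -/
theorem value_pair {D : Diagram (Fin 3)} (hD : IsTheta D) (k : Fin 3)
    (ht : IsTrivial (subknot D k)) :
    (-A ^ 4) ^ signSum (setWeight fun e => decide (e ≠ k)) [] D *
      f ((T.cabled fun e => decide (e ≠ k)).ev [] D) =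
      (loopValue A)⁻¹ * (loopValue A ^ 2 - 1) := by
  have hv : (vertexList D).length = 2 := by
    have := hD.thetaLike.vertices.length_eq
    simpa using this
  have h1 := restrict_closed hA hd (T := T) (χ := fun e => decide (e ≠ k)) (deleteEdge_reverse k)
    (by clear ht; revert k; decide) (hD.restricts k) hD.1 hv
  have h2 := signSum_restrict (w := setWeight fun e => decide (e ≠ k)) (w' := fun _ _ => -2)
    (deleteEdge_reverse k) (fun x y p t u => (deleteEdge_weight k x y).1 p t u)
    (fun x y => (deleteEdge_weight k x y).2) D (hD.restricts k) hD.1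
  have h3 := value_knot hA hd (T := T) f hf (hD.closed_subknot k)
    (fun i o a b c => vertex_notMem_restrict _ D [] i o a b c) (hD.2.2 k) ht
  rw [h1, map_smul, smul_eq_mul, mul_left_comm, h2, ← h3]
  rfl

theorem value_trivial {D : Diagram (Fin 3)} (hD : IsTheta D) :
    (-A ^ 4) ^ signSum (setWeight fun _ => false) [] D *
      f ((T.cabled fun _ : Fin 3 => false).ev [] D) = (loopValue A)⁻¹ := by
  have hv : (vertexList D).length = 2 := by
    have := hD.thetaLike.vertices.length_eq
    simpa using this
  have h1 := restrict_closed hA hd (T := T) (χ := fun _ : Fin 3 => false)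
    (f := fun _ => (none : Option (Strand Unit))) (fun _ => rfl) (fun _ => rfl)
    (fun g _ => by cases g <;> first | trivial | exact Or.inl rfl) hD.1 hv
  have h2 : setWeight (fun _ => false) = fun _ _ => 0 := by funext a b; simp [setWeight]
  have h3 : signSum (fun _ _ : Fin 3 => (0 : ℤ)) [] D = 0 := by simp [signSum]
  rw [h1, h2, h3, restrict_none]
  simp [Ops.ev, hf]

variable (h2 : A + A⁻¹ ≠ 0) (h4 : 1 + A ^ 4 ≠ 0)
include h2 h4

/-- The expansion holds for the boundary of a surface built on some isotopic diagram `D'`. The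
invariance of the Jones polynomial leads from that boundary to `L`, and the invariance of the
normalized values leads from `D'` back to `D`, whose subknots are known to be trivial. -/
theorem jones_associatedLink (T : TL R A) {D L : Diagram (Fin 3)} (hD : IsBrunnian D)
    (hL : IsAssociatedLink D L) :
    jones A L = normalizedJaeger A D + 3 - 2 / loopValue A ^ 2 := by
  obtain ⟨D', m, hi, hs, hm, hiL⟩ := hL
  have h' := hD.1.thetaLike.isotopic hi
  have e1 : jones A L = jones A (bandBoundary m D') := by
    have hv := bandBoundary_vertexFree m D'
    have k := ((single_laws hA (T := T) (C := Fin 3)).isotopic hiL).2 (by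
      intro g hg
      cases g with
      | vertex i o a b c => exact absurd hg (hv _ _ _ _ _)
      | _ => trivial)
    have k2 := congrArg f k
    simp only [map_smul, smul_eq_mul, signSum_neg_one] at k2
    have hcl := h'.closed_bandBoundary hs (m := m)
    rw [jones_value (T := T) hA hd f hf hcl hv,
      jones_value (T := T) hA hd f hf (hiL.closed.1 hcl) (hiL.vertexFree hv), mul_left_comm, ← k2,
      mul_left_comm]
  have e2 : ∀ χ, NotSingle χ → (-A ^ 4) ^ signSum (setWeight χ) [] D' *
      f ((T.cabled χ).ev [] D') = (-A ^ 4) ^ signSum (setWeight χ) [] D *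
        f ((T.cabled χ).ev [] D) := by
    intro χ hχ
    have k := ((theta_laws hA hd (T := T) hχ).isotopic hi).2 hD.1.vertexGood
    have k2 := congrArg f k
    simp only [map_smul, smul_eq_mul] at k2
    exact k2.symm
  have e3 : normalizedJaeger A D = (loopValue A)⁻¹ *
      ((-A ^ 4) ^ signSum (setWeight fun _ => true) [] D *
        f ((T.cabled fun _ : Fin 3 => true).ev [] D)) := by
    have hw : setWeight (fun _ => true) = fun a b => if a = b then -2 else 1 := by decide
    rw [normalizedJaeger, jaeger_value (T := T) hA h2 h4 hd f hf hD.1.1, hw, mul_left_comm]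
    rfl
  have e4 : ∀ k, (-A ^ 4) ^ signSum (setWeight fun e => decide (e ≠ k)) [] D' *
      f ((T.cabled fun e => decide (e ≠ k)).ev [] D') =
        (loopValue A)⁻¹ * (loopValue A ^ 2 - 1) := by
    intro k
    rw [e2 _ (by revert k; decide)]
    exact value_pair hA hd f hf hD.1 k (hD.2.2 k)
  have e5 := (e2 (fun _ => false) (by decide)).trans (value_trivial hA hd (T := T) f hf hD.1)
  have e6 := e2 (fun _ => true) (by decide)
  have e7 : ∀ χ, ¬ NotSingle χ → (-A ^ 4) ^ signSum (setWeight χ) [] D' *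
      f ((T.cabled χ).ev [] D') = 0 := by
    intro χ hχ
    rw [value_single hA hd hχ h', map_zero, mul_zero]
  rw [e1, jones_bandBoundary (T := T) hA hd f hf h' hs hm, e3, ← e6]
  generalize hF : (fun χ => (-A ^ 4) ^ signSum (setWeight χ) [] D' *
    f ((T.cabled χ).ev [] D')) = F at *
  have hF' : ∀ χ, (-A ^ 4) ^ signSum (setWeight χ) [] D' * f ((T.cabled χ).ev [] D') = F χ :=
    fun χ => congrFun hF χ
  simp only [hF'] at e4 e5 e7 ⊢
  -- The eight colourings: the first gives the Jaeger polynomial, the second 1/d, the next three (d²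
  -- - 1)/d each, and the last three 0.
  have hU : (univ : Finset (Fin 3 → Bool)) = {fun _ => true, fun _ => false,
      fun e => decide (e ≠ 0), fun e => decide (e ≠ 1), fun e => decide (e ≠ 2),
      ![true, false, false], ![false, true, false], ![false, false, true]} := by decide
  rw [hU]
  rw [sum_insert (by decide), sum_insert (by decide), sum_insert (by decide),
    sum_insert (by decide), sum_insert (by decide), sum_insert (by decide),
    sum_insert (by decide), Finset.sum_singleton, e4, e4, e4, e5,
    e7 ![true, false, false] (by decide), e7 ![false, true, false] (by decide),
    e7 ![false, false, true] (by decide)]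
  field_simp
  ring

end TL

/-! ### Planar graphs as sums of crossingless link diagrams -/

section GraphWords

variable {K R : Type} [Field K] [Ring R] [Algebra K R] (c a : ℕ → R)

/-- The product of the operators of the pieces of a word without crossings. -/
def linkProd (w : List LinkPiece) : R :=
  (w.map fun
    | .cup i => c i
    | .cap i => a i
    | .cross _ _ => 1).prod

theorem linkProd_append (v w : List LinkPiece) :
    linkProd c a (v ++ w) = linkProd c a v * linkProd c a w := by simp [linkProd]
theorem linkProd_cup (i : ℕ) (w : List LinkPiece) :
    linkProd c a (.cup i :: w) = c i * linkProd c a w := by simp [linkProd]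
theorem linkProd_cap (i : ℕ) (w : List LinkPiece) :
    linkProd c a (.cap i :: w) = a i * linkProd c a w := by simp [linkProd]
theorem linkProd_nil : linkProd c a [] = 1 := rfl

/-- Operators with the Temperley-Lieb relations count closed curves. -/
theorem linkProd_value {d : K} (f : R →ₗ[K] K) (hf : f 1 = 1)
    (loop : ∀ i, c i * a i = d • 1) (zig : ∀ i, c i * a (i + 1) = 1)
    (zag : ∀ i, c (i + 1) * a i = 1) (far_right : ∀ i j, j ≤ i → c j * a (i + 2) = a i * c j)
    (far_left : ∀ i j, i ≤ j → c (j + 2) * a i = a i * c j)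
    {w : List LinkPiece} (hw : Fits 0 w) (hc : NoCross w) : f (linkProd c a w) = d ^ loops w := by
  have h : TLRel d fun w => f (linkProd c a w) := by
    constructor
    · exact hf
    · intro n u _ i w _
      simp only [linkProd_append, linkProd_cup, linkProd_cap]
      rw [← mul_assoc (c i), loop, smul_mul_assoc, one_mul, mul_smul_comm, map_smul, smul_eq_mul]
    · intro n u _ i w _
      simp only [linkProd_append, linkProd_cup, linkProd_cap]
      rw [← mul_assoc (c i), zig, one_mul]
    · intro n u _ i w _
      simp only [linkProd_append, linkProd_cup, linkProd_cap]
      rw [← mul_assoc (c _), zag, one_mul]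
    · intro n u _ i j w hij _
      simp only [linkProd_append, linkProd_cup, linkProd_cap]
      rw [← mul_assoc (c _), far_right i j hij, mul_assoc]
    · intro n u _ i j w hij _
      simp only [linkProd_append, linkProd_cup, linkProd_cap]
      rw [← mul_assoc (c _), far_left i j hij, mul_assoc]
  exact h.unique (TLRel.loops d) w hw hc

/-- The operator of a piece of a planar graph, whose edges are thickened to strips: a bar
`1 + δ (cut strip)` is put on each leg below the piece. -/
def graphPiece (δ : K) : GraphPiece → R
  | .cup i => c (2 * i) * c (2 * i + 1)
  | .cap i => (1 + δ • (a (2 * i) * c (2 * i))) * (a (2 * i + 1) * a (2 * i))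
  | .vertex3 i => c (2 * i) * (c (2 * i + 1) * c (2 * i + 3))
  | .vertex4 i => (1 + δ • (a (2 * i) * c (2 * i))) * ((1 + δ • (a (2 * i + 2) * c (2 * i + 2))) *
      (a (2 * i + 1) * c (2 * i + 1)))

/-- The product of the operators of the pieces of a planar graph. -/
def graphProd (δ : K) (w : List GraphPiece) : R := (w.map (graphPiece c a δ)).prod

theorem graphProd_cons (δ : K) (g : GraphPiece) (w : List GraphPiece) :
    graphProd c a δ (g :: w) = graphPiece c a δ g * graphProd c a δ w := by simp [graphProd]

end GraphWords

/-- Put pieces below all words of a list. -/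
def prefixStates (v : List LinkPiece) (l : List (ℕ × List LinkPiece)) : List (ℕ × List LinkPiece) :=
  l.map fun s => (s.1, v ++ s.2)

/-- Put a bar below all words of a list; the number of cuts is recorded. -/
def barPrefix (j : ℕ) (l : List (ℕ × List LinkPiece)) : List (ℕ × List LinkPiece) :=
  l.flatMap fun s => [(s.1, s.2), (s.1 + 1, .cap j :: .cup j :: s.2)]

/-- The crossingless link diagrams that are obtained from a planar graph by thickening and by
elimination of the bars, each with its number of cuts. -/
def barStates : List GraphPiece → List (ℕ × List LinkPiece)
  | [] => [(0, [])]
  | .cup i :: w => prefixStates [.cup (2 * i), .cup (2 * i + 1)] (barStates w)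
  | .cap i :: w => barPrefix (2 * i) (prefixStates [.cap (2 * i + 1), .cap (2 * i)] (barStates w))
  | .vertex3 i :: w =>
    prefixStates [.cup (2 * i), .cup (2 * i + 1), .cup (2 * i + 3)] (barStates w)
  | .vertex4 i :: w => barPrefix (2 * i) (barPrefix (2 * i + 2)
      (prefixStates [.cap (2 * i + 1), .cup (2 * i + 1)] (barStates w)))

section GraphWords

variable {K R : Type} [Field K] [Ring R] [Algebra K R] (c a : ℕ → R)

theorem sum_prefixStates (δ : K) (v : List LinkPiece) (l : List (ℕ × List LinkPiece)) :
    ((prefixStates v l).map fun s => δ ^ s.1 • linkProd c a s.2).sum =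
      linkProd c a v * (l.map fun s => δ ^ s.1 • linkProd c a s.2).sum := by
  induction l with
  | nil => simp [prefixStates]
  | cons s l ih =>
    simp only [prefixStates, map_cons, sum_cons, mul_add] at ih ⊢
    rw [ih, linkProd_append, mul_smul_comm]

theorem sum_barPrefix (δ : K) (j : ℕ) (l : List (ℕ × List LinkPiece)) :
    ((barPrefix j l).map fun s => δ ^ s.1 • linkProd c a s.2).sum =
      (1 + δ • (a j * c j)) * (l.map fun s => δ ^ s.1 • linkProd c a s.2).sum := by
  induction l with
  | nil => simp [barPrefix]
  | cons s l ih =>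
    simp only [barPrefix, flatMap_cons, map_append, List.sum_append, map_cons,
      sum_cons, map_nil, sum_nil, mul_add] at ih ⊢
    rw [ih, linkProd_cap, linkProd_cup]
    simp only [add_mul, one_mul, smul_mul_assoc, mul_smul_comm, smul_add, smul_smul, mul_assoc,
      pow_succ]
    abel

theorem graphProd_eq_sum (δ : K) (w : List GraphPiece) :
    graphProd c a δ w = ((barStates w).map fun s => δ ^ s.1 • linkProd c a s.2).sum := by
  induction w with
  | nil => simp [graphProd, barStates, linkProd]
  | cons g w ih =>
    rw [graphProd_cons, ih]
    cases g <;>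
      simp only [barStates, sum_prefixStates, sum_barPrefix, graphPiece, linkProd_cup, linkProd_cap,
        linkProd_nil, mul_one, mul_assoc]

end GraphWords

/-- The pieces of a planar graph fit above a row of `n` strands and leave no strand open. -/
def GraphFits : ℕ → List GraphPiece → Prop
  | n, [] => n = 0
  | n, .cup i :: w => i ≤ n ∧ GraphFits (n + 2) w
  | n, .cap i :: w => i + 2 ≤ n ∧ GraphFits (n - 2) w
  | n, .vertex3 i :: w => i ≤ n ∧ GraphFits (n + 3) w
  | n, .vertex4 i :: w => i + 2 ≤ n ∧ GraphFits n w

theorem barPrefix_fits {n j : ℕ} (hj : j + 2 ≤ n) {l : List (ℕ × List LinkPiece)}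
    (h : ∀ s ∈ l, Fits n s.2 ∧ NoCross s.2) :
    ∀ s ∈ barPrefix j l, Fits n s.2 ∧ NoCross s.2 := by
  intro s hs
  simp only [barPrefix, mem_flatMap, mem_cons, not_mem_nil, or_false] at hs
  obtain ⟨s, hs, rfl | rfl⟩ := hs
  · exact h s hs
  · refine ⟨⟨hj, by omega, ?_⟩, ?_⟩
    · rw [show n - 2 + 2 = n by omega]; exact (h s hs).1
    · intro i p; simpa using (h s hs).2 i p

theorem prefixStates_fits {n m : ℕ} {v : List LinkPiece} (hv : ∀ w, Fits m w → Fits n (v ++ w))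
    (hc : NoCross v) {l : List (ℕ × List LinkPiece)} (h : ∀ s ∈ l, Fits m s.2 ∧ NoCross s.2) :
    ∀ s ∈ prefixStates v l, Fits n s.2 ∧ NoCross s.2 := by
  intro s hs
  obtain ⟨t, ht, rfl⟩ := mem_map.1 hs
  refine ⟨hv _ (h t ht).1, ?_⟩
  intro i p; simpa using ⟨hc i p, (h t ht).2 i p⟩

theorem barStates_fits : ∀ (w : List GraphPiece) {n : ℕ}, GraphFits n w →
    ∀ s ∈ barStates w, Fits (2 * n) s.2 ∧ NoCross s.2 := by
  intro w
  induction w with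
  | nil =>
    intro n h s hs
    obtain rfl : s = (0, []) := by simpa [barStates] using hs
    obtain rfl : n = 0 := h
    exact ⟨rfl, by intro i p; simp⟩
  | cons g w ih =>
    intro n h
    cases g with simp only [barStates]
    | cup i =>
      refine prefixStates_fits (n := 2 * n) (m := 2 * (n + 2)) ?_ ?_ (ih h.2)
      · intro w hw; have := h.1; exact ⟨by omega, by omega, hw⟩
      · intro i p; simp
    | cap i =>
      have := h.1
      refine barPrefix_fits (by omega) (prefixStates_fits (m := 2 * (n - 2)) ?_ ?_ (ih h.2))
      · intro w hw
        refine ⟨by omega, by omega, ?_⟩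
        rwa [show 2 * n - 2 - 2 = 2 * (n - 2) by omega]
      · intro i p; simp
    | vertex3 i =>
      refine prefixStates_fits (n := 2 * n) (m := 2 * (n + 3)) ?_ ?_ (ih h.2)
      · intro w hw; have := h.1; exact ⟨by omega, by omega, by omega, hw⟩
      · intro i p; simp
    | vertex4 i =>
      have := h.1
      refine barPrefix_fits (by omega) (barPrefix_fits (by omega)
        (prefixStates_fits (m := 2 * n) ?_ ?_ (ih h.2)))
      · intro w hw
        refine ⟨by omega, by omega, ?_⟩
        rwa [show 2 * n - 2 + 2 = 2 * n by omega]
      · intro i p; simp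

theorem graphProd_value {K R : Type} [Field K] [Ring R] [Algebra K R] {c a : ℕ → R} {d : K}
    {f : R →ₗ[K] K} (h : ∀ w, Fits 0 w → NoCross w → f (linkProd c a w) = d ^ loops w) (δ : K)
    {w : List GraphPiece} (hw : GraphFits 0 w) :
    f (graphProd c a δ w) = ((barStates w).map fun s => δ ^ s.1 * d ^ loops s.2).sum := by
  rw [graphProd_eq_sum, map_list_sum, map_map]
  congr 1
  refine map_congr_left fun s hs => ?_
  have := barStates_fits w hw s hs
  simp [h s.2 this.1 this.2]

/-! ### The spin model of the Temperley-Lieb relations -/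

section Streams

variable {ι : Type}

/-- Insert an entry into a stream. -/
def ins (k : ℕ) (a : ι) (x : ℕ → ι) : ℕ → ι := fun m =>
  if m < k then x m else if m = k then a else x (m - 1)

/-- Delete an entry of a stream. -/
def del (k : ℕ) (x : ℕ → ι) : ℕ → ι := fun m => if m < k then x m else x (m + 1)

theorem ins_self (k : ℕ) (a : ι) (x : ℕ → ι) : ins k a x k = a := by simp [ins]
theorem ins_lt {k m : ℕ} (h : m < k) (a : ι) (x : ℕ → ι) : ins k a x m = x m := by simp [ins, h]
theorem ins_succ {k m : ℕ} (h : k ≤ m) (a : ι) (x : ℕ → ι) : ins k a x (m + 1) = x m := by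
  simp [ins, show ¬ m + 1 < k by omega, show m + 1 ≠ k by omega]
theorem del_lt {k m : ℕ} (h : m < k) (x : ℕ → ι) : del k x m = x m := by simp [del, h]
theorem del_le {k m : ℕ} (h : k ≤ m) (x : ℕ → ι) : del k x m = x (m + 1) := by
  simp [del, show ¬ m < k by omega]

theorem del_ins (k : ℕ) (a : ι) (x : ℕ → ι) : del k (ins k a x) = x := by
  funext m; grind [ins, del]
theorem ins_del (k : ℕ) (a : ι) (x : ℕ → ι) : ins k a (del k x) = update x k a := by
  funext m; grind [ins, del, update_apply]
theorem del_succ_ins {k l : ℕ} (h : k ≤ l) (a : ι) (x : ℕ → ι) :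
    del (l + 1) (ins k a x) = ins k a (del l x) := by
  funext m; grind [ins, del]
theorem del_ins_succ {k l : ℕ} (h : l ≤ k) (a : ι) (x : ℕ → ι) :
    del l (ins (k + 1) a x) = ins k a (del l x) := by
  funext m; grind [ins, del]
theorem del_ins_left (k : ℕ) (x : ℕ → ι) : del k (ins (k + 1) (x k) x) = x := by
  funext m; grind [ins, del]
theorem del_ins_right (k : ℕ) (x : ℕ → ι) : del (k + 1) (ins k (x k) x) = x := by
  funext m; grind [ins, del]

variable [Fintype ι] [DecidableEq ι] (n : ℕ)

/-- A local minimum in the spin model: a new strip if `i` is even, the strip `k` is split if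
`i = 2 k + 1`. -/
def spinCup (i : ℕ) : Module.End ℚ ((ℕ → ι) → ℚ) where
  toFun Φ x := if i % 2 = 0 then (n : ℚ)⁻¹ * ∑ a, Φ (ins (i / 2) a x)
    else Φ (ins (i / 2) (x (i / 2)) x)
  map_add' Φ Ψ := by
    funext x; dsimp; split_ifs <;> simp [sum_add_distrib, mul_add]
  map_smul' k Φ := by
    funext x; dsimp; split_ifs <;> simp [← mul_sum]; ring

/-- A local maximum in the spin model: a strip ends if `i` is even, the strips `k` and `k + 1` are
merged if `i = 2 k + 1`. -/
def spinCap (i : ℕ) : Module.End ℚ ((ℕ → ι) → ℚ) where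
  toFun Φ x := if i % 2 = 0 then Φ (del (i / 2) x)
    else if x (i / 2) = x (i / 2 + 1) then n * Φ (del (i / 2) x) else 0
  map_add' Φ Ψ := by
    funext x; dsimp; split_ifs <;> simp [mul_add]
  map_smul' k Φ := by
    funext x; dsimp; split_ifs <;> first | rfl | ring

theorem spinCup_even (k : ℕ) (Φ : (ℕ → ι) → ℚ) (x : ℕ → ι) :
    spinCup n (2 * k) Φ x = (n : ℚ)⁻¹ * ∑ a, Φ (ins k a x) := by
  simp [spinCup]
theorem spinCup_odd (k : ℕ) (Φ : (ℕ → ι) → ℚ) (x : ℕ → ι) :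
    spinCup n (2 * k + 1) Φ x = Φ (ins k (x k) x) := by
  simp [spinCup, show (2 * k + 1) / 2 = k by omega]
theorem spinCap_even (k : ℕ) (Φ : (ℕ → ι) → ℚ) (x : ℕ → ι) :
    spinCap n (2 * k) Φ x = Φ (del k x) := by
  simp [spinCap]
theorem spinCap_odd (k : ℕ) (Φ : (ℕ → ι) → ℚ) (x : ℕ → ι) :
    spinCap n (2 * k + 1) Φ x = if x k = x (k + 1) then n * Φ (del k x) else 0 := by
  simp [spinCap, show (2 * k + 1) / 2 = k by omega]

variable {n} (hn : n ≠ 0) (hι : Fintype.card ι = n * n)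
include hn hι

/-- At an even position the circle bounds a strip with a free spin, which gives n⁻¹ times the number
n² of spins. At an odd position it is a hole in a strip, with the weight n of merging. -/
theorem spin_loop (i : ℕ) : spinCup (ι := ι) n i * spinCap n i = (n : ℚ) • 1 := by
  ext Φ x
  obtain ⟨k, rfl | rfl⟩ := even_or_odd' i
  · have : (n : ℚ) ≠ 0 := by exact_mod_cast hn
    simp only [Module.End.mul_apply, spinCup_even, spinCap_even, del_ins]
    simp [hι]; field_simp
  · simp only [Module.End.mul_apply, spinCup_odd, spinCap_odd, del_ins, ins_self,
      ins_succ (le_refl k)]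
    simp

theorem spin_zig (i : ℕ) : spinCup (ι := ι) n i * spinCap n (i + 1) = 1 := by
  ext Φ x
  obtain ⟨k, rfl | rfl⟩ := even_or_odd' i
  · have : (n : ℚ) ≠ 0 := by exact_mod_cast hn
    simp only [Module.End.mul_apply, spinCup_even, spinCap_odd, del_ins, ins_self,
      ins_succ (le_refl k)]
    simp; field_simp
  · simp only [Module.End.mul_apply, spinCup_odd, show 2 * k + 1 + 1 = 2 * (k + 1) by ring,
      spinCap_even, del_ins_right]
    simp

theorem spin_zag (i : ℕ) : spinCup (ι := ι) n (i + 1) * spinCap n i = 1 := by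
  ext Φ x
  obtain ⟨k, rfl | rfl⟩ := even_or_odd' i
  · simp only [Module.End.mul_apply, spinCup_odd, spinCap_even, del_ins]
    simp
  · have : (n : ℚ) ≠ 0 := by exact_mod_cast hn
    simp only [Module.End.mul_apply, spinCap_odd, show 2 * k + 1 + 1 = 2 * (k + 1) by ring,
      spinCup_even, ins_self, ins_lt (lt_succ_self k)]
    simp [del_ins_left]; field_simp

omit hn hι in
theorem spin_far_right (i j : ℕ) (h : j ≤ i) :
    spinCup (ι := ι) n j * spinCap n (i + 2) = spinCap n i * spinCup n j := by
  ext Φ x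
  obtain ⟨k, rfl | rfl⟩ := even_or_odd' j <;> obtain ⟨l, rfl | rfl⟩ := even_or_odd' i
  · simp only [Module.End.mul_apply, show 2 * l + 2 = 2 * (l + 1) by ring, spinCap_even,
      spinCup_even, del_succ_ins (show k ≤ l by omega)]
  · have hk : k ≤ l := by omega
    simp only [Module.End.mul_apply, show 2 * l + 1 + 2 = 2 * (l + 1) + 1 by ring, spinCap_odd,
      spinCup_even, del_succ_ins hk, ins_succ hk, ins_succ (hk.trans (le_succ l))]
    split_ifs
    · rw [← mul_sum]; ring
    · simp
  · have hk : k < l := by omega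
    simp only [Module.End.mul_apply, show 2 * l + 2 = 2 * (l + 1) by ring, spinCap_even,
      spinCup_odd, del_succ_ins hk.le, del_lt hk]
  · have hk : k ≤ l := by omega
    simp only [Module.End.mul_apply, show 2 * l + 1 + 2 = 2 * (l + 1) + 1 by ring, spinCap_odd,
      spinCup_odd, del_succ_ins hk, ins_succ hk, ins_succ (hk.trans (le_succ l))]
    split_ifs with h1
    · obtain rfl | hk := eq_or_lt_of_le hk
      · rw [del_le le_rfl, h1]
      · rw [del_lt hk]
    · rfl

omit hn hι in
theorem spin_far_left (i j : ℕ) (h : i ≤ j) :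
    spinCup (ι := ι) n (j + 2) * spinCap n i = spinCap n i * spinCup n j := by
  ext Φ x
  obtain ⟨k, rfl | rfl⟩ := even_or_odd' j <;> obtain ⟨l, rfl | rfl⟩ := even_or_odd' i
  · simp only [Module.End.mul_apply, show 2 * k + 2 = 2 * (k + 1) by ring, spinCap_even,
      spinCup_even, del_ins_succ (show l ≤ k by omega)]
  · have hk : l < k := by omega
    simp only [Module.End.mul_apply, show 2 * k + 2 = 2 * (k + 1) by ring, spinCap_odd,
      spinCup_even, del_ins_succ hk.le, ins_lt (show l < k + 1 by omega),
      ins_lt (show l + 1 < k + 1 by omega)]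
    split_ifs
    · rw [← mul_sum]; ring
    · simp
  · have hk : l ≤ k := by omega
    simp only [Module.End.mul_apply, show 2 * k + 1 + 2 = 2 * (k + 1) + 1 by ring, spinCap_even,
      spinCup_odd, del_ins_succ hk, del_le hk]
  · have hk : l ≤ k := by omega
    simp only [Module.End.mul_apply, show 2 * k + 1 + 2 = 2 * (k + 1) + 1 by ring, spinCap_odd,
      spinCup_odd, del_ins_succ hk, del_le hk, ins_lt (show l < k + 1 by omega)]
    obtain rfl | hk := eq_or_lt_of_le hk
    · rw [ins_self]
    · rw [ins_lt (show l + 1 < k + 1 by omega)]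

theorem spin_value (x : ι) {w : List LinkPiece} (hw : Fits 0 w) (hc : NoCross w) :
    streamValue x (linkProd (spinCup n) (spinCap n) w) = (n : ℚ) ^ loops w :=
  linkProd_value _ _ _ (streamValue_one x) (spin_loop hn hι) (spin_zig hn hι) (spin_zag hn hι)
    spin_far_right spin_far_left hw hc

end Streams

/-! ### The flow function of a planar graph in the spin model -/

section Flow

variable {ι : Type} [Fintype ι] [DecidableEq ι]

/-- The projection of functions to those with sum zero, as a matrix. -/
def zeroSum (s t : ι) : ℚ := (if s = t then 1 else 0) - (Fintype.card ι : ℚ)⁻¹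

theorem zeroSum_comm (s t : ι) : zeroSum s t = zeroSum t s := by simp [zeroSum, eq_comm]

theorem sum_zeroSum_mul (s : ι) (g : ι → ℚ) :
    ∑ t, zeroSum s t * g t = g s - (Fintype.card ι : ℚ)⁻¹ * ∑ t, g t := by
  simp [zeroSum, sub_mul, Finset.sum_sub_distrib, mul_sum]

theorem sum_zeroSum_mul_of_sum_eq_zero (s : ι) {g : ι → ℚ} (hg : ∑ t, g t = 0) :
    ∑ t, zeroSum s t * g t = g s := by
  rw [sum_zeroSum_mul, hg, mul_zero, sub_zero]

theorem sum_zeroSum (s : ι) : ∑ t, zeroSum s t = 0 := by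
  have : Nonempty ι := ⟨s⟩
  simpa using sum_zeroSum_mul s (fun _ => (1 : ℚ))

theorem sum_zeroSum' (s : ι) : ∑ t, zeroSum t s = 0 := by
  simp_rw [fun t => zeroSum_comm t s]; exact sum_zeroSum s

theorem sum_zeroSum_mul_zeroSum (s t : ι) : ∑ u, zeroSum u s * zeroSum u t = zeroSum s t := by
  rw [zeroSum_comm s t, ← sum_zeroSum_mul_of_sum_eq_zero s (g :=
      fun u => zeroSum t u) (sum_zeroSum t)]
  exact sum_congr rfl fun u _ => by rw [zeroSum_comm u s, zeroSum_comm u t]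

/-- The flow function: each edge carries the operator `zeroSum`, and each vertex sums over one
spin, that it shares with all its legs; `x` is the sequence of spins of the strands below. -/
def flow : List GraphPiece → (ℕ → ι) → ℚ
  | [], _ => 1
  | .cup i :: w, x => ∑ a, flow w (ins i a (ins i a x))
  | .cap i :: w, x => zeroSum (x i) (x (i + 1)) * flow w (del i (del i x))
  | .vertex3 i :: w, x => ∑ a, flow w (ins i a (ins i a (ins i a x)))
  | .vertex4 i :: w, x => ∑ a, zeroSum (x i) a * zeroSum (x (i + 1)) a *
      flow w (update (update x i a) (i + 1) a)

theorem del_update_self (k : ℕ) (a : ι) (x : ℕ → ι) : del k (update x k a) = del k x := by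
  funext m; grind [del, update_apply]
theorem del_update_lt {k l : ℕ} (h : l < k) (a : ι) (x : ℕ → ι) :
    del k (update x l a) = update (del k x) l a := by
  funext m; grind [del, update_apply]
theorem del_update_succ {k l : ℕ} (h : k ≤ l) (a : ι) (x : ℕ → ι) :
    del k (update x (l + 1) a) = update (del k x) l a := by
  funext m; grind [del, update_apply]
theorem ins_update_lt {k l : ℕ} (h : l < k) (a b : ι) (x : ℕ → ι) :
    ins k b (update x l a) = update (ins k b x) l a := by
  funext m; grind [ins, update_apply]
theorem ins_update_le {k l : ℕ} (h : k ≤ l) (a b : ι) (x : ℕ → ι) :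
    ins k b (update x l a) = update (ins k b x) (l + 1) a := by
  funext m; grind [ins, update_apply]
theorem ins_ins (k : ℕ) (a b : ι) (x : ℕ → ι) : ins (k + 1) b (ins k a x) = ins k a (ins k b x) := by
  funext m; grind [ins]

/-- The number of local minima and of three-valent vertices. -/
def ups : List GraphPiece → ℕ
  | [] => 0
  | .cup _ :: w => ups w + 1
  | .vertex3 _ :: w => ups w + 1
  | _ :: w => ups w

/-- The number of local maxima and of four-valent vertices. -/
def downs : List GraphPiece → ℕ
  | [] => 0
  | .cap _ :: w => downs w + 1
  | .vertex4 _ :: w => downs w + 1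
  | _ :: w => downs w

/-- Cutting a strip replaces its spin by n⁻¹ times the sum over all spins. With the coefficient -n⁻¹
this subtracts the mean, as there are n² spins. -/
theorem spin_bar {n : ℕ} (hι : Fintype.card ι = n * n) (k : ℕ)
    (Φ : (ℕ → ι) → ℚ) (x : ℕ → ι) :
    (1 + (-(n : ℚ)⁻¹) • (spinCap n (2 * k) * spinCup n (2 * k)) : Module.End ℚ ((ℕ → ι) → ℚ)) Φ x =
      ∑ a, zeroSum (x k) a * Φ (update x k a) := by
  rw [sum_zeroSum_mul, Function.update_eq_self, hι]
  simp only [LinearMap.add_apply, Module.End.one_apply, LinearMap.smul_apply, Module.End.mul_apply,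
    Pi.add_apply, Pi.smul_apply, spinCap_even, spinCup_even, ins_del, smul_eq_mul]
  push_cast
  rw [mul_inv]; ring

/-- In the spin model a vertex or an arc of the graph shares one spin, and the bars become the
matrices `zeroSum`. Each new strip costs n⁻¹ and each merging of two strips gives n; `ups` and
`downs` count them. -/
theorem spin_flow {n : ℕ} (hn : n ≠ 0) (hι : Fintype.card ι = n * n) (w : List GraphPiece) :
    ∀ x : ℕ → ι, n ^ ups w * graphProd (spinCup (ι := ι) n) (spinCap n) (-(n : ℚ)⁻¹) w 1 x =
      n ^ downs w * flow w x := by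
  have hn' : (n : ℚ) ≠ 0 := by exact_mod_cast hn
  induction w with
  | nil => intro x; simp [graphProd, flow, ups, downs]
  | cons g w ih =>
    intro x
    rw [graphProd_cons, Module.End.mul_apply]
    generalize graphProd (spinCup (ι := ι) n) (spinCap n) (-(n : ℚ)⁻¹) w 1 = Φ at ih
    cases g with
    | cup i =>
      simp only [graphPiece, ups, downs, flow, Module.End.mul_apply, spinCup_even, spinCup_odd,
        ins_self, mul_sum]
      refine sum_congr rfl fun a _ => ?_
      rw [← ih, pow_succ]; field_simp
    | vertex3 i =>
      simp only [graphPiece, ups, downs, flow, Module.End.mul_apply, spinCup_even, spinCup_odd,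
        ins_self, mul_sum, show 2 * i + 3 = 2 * (i + 1) + 1 by ring]
      refine sum_congr rfl fun a _ => ?_
      rw [← ih, ins_succ le_rfl, ins_self, ins_ins, pow_succ]; field_simp
    | cap i =>
      rw [graphPiece, Module.End.mul_apply, spin_bar hι]
      simp only [ups, downs, flow, Module.End.mul_apply, spinCap_odd, spinCap_even,
        del_update_self, update_self,
        update_of_ne (show i + 1 ≠ i by omega)]
      simp only [mul_ite, mul_zero, Finset.sum_ite_eq', mem_univ, if_true]
      rw [pow_succ]
      linear_combination (n : ℚ) * zeroSum (x i) (x (i + 1)) * ih (del i (del i x))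
    | vertex4 i =>
      rw [graphPiece, Module.End.mul_apply, Module.End.mul_apply, spin_bar hι]
      have h : ∀ a b, (spinCap n (2 * i + 1) * spinCup n (2 * i + 1) : Module.End ℚ ((ℕ → ι) → ℚ)) Φ
          (update (update x i a) (i + 1) b) =
          if b = a then n * Φ (update (update x i a) (i + 1) a) else 0 := by
        intro a b
        simp only [Module.End.mul_apply, spinCap_odd, spinCup_odd, del_le le_rfl,
          update_self, update_of_ne (show i ≠ i + 1 by omega), eq_comm (a := a)]
        split_ifs with hab
        · subst hab
          rw [ins_del, update_comm (show i ≠ i + 1 by omega), update_idem]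
        · rfl
      simp only [show 2 * i + 2 = 2 * (i + 1) by ring, spin_bar hι, h, mul_ite, mul_zero,
        Finset.sum_ite_eq', mem_univ, if_true, update_of_ne
        (show i + 1 ≠ i by omega), ups, downs, flow, mul_sum]
      refine sum_congr rfl fun a _ => ?_
      linear_combination (n : ℚ) * zeroSum (x i) a * zeroSum (x (i + 1)) a *
        ih (update (update x i a) (i + 1) a)

/-- Every strand ends at a maximum or at a four-valent vertex, where its spin enters through
`zeroSum`, whose rows and columns have sum zero. As a consequence further factors `zeroSum` on a
strand act as the identity. -/
theorem sum_flow_update (w : List GraphPiece) : ∀ {r : ℕ}, GraphFits r w → ∀ k < r, ∀ x : ℕ → ι,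
    ∑ a, flow w (update x k a) = 0 := by
  induction w with
  | nil => intro r hr k hk; obtain rfl : r = 0 := hr; omega
  | cons g w ih =>
    intro r hr k hk x
    cases g with
    | cup i =>
      simp only [flow]
      rw [sum_comm]
      refine sum_eq_zero fun b _ => ?_
      have := hr.1
      rcases lt_or_ge k i with h | h
      · simp only [ins_update_lt h]; exact ih hr.2 k (by omega) _
      · simp only [ins_update_le h, ins_update_le (h.trans (le_succ k))]
        exact ih hr.2 (k + 2) (by omega) _
    | vertex3 i =>
      simp only [flow]
      rw [sum_comm]
      refine sum_eq_zero fun b _ => ?_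
      have := hr.1
      rcases lt_or_ge k i with h | h
      · simp only [ins_update_lt h]; exact ih hr.2 k (by omega) _
      · simp only [ins_update_le h, ins_update_le (h.trans (le_succ k)),
          ins_update_le (h.trans (Nat.le_add_right k 2))]
        exact ih hr.2 (k + 3) (by omega) _
    | cap i =>
      simp only [flow]
      have := hr.1
      rcases lt_trichotomy k i with h | rfl | h
      · simp only [update_of_ne h.ne', update_of_ne (show i + 1 ≠ k by omega),
          del_update_lt h, ← mul_sum]
        rw [ih hr.2 k (by omega), mul_zero]
      · simp only [del_update_self, update_self,
          update_of_ne (show k + 1 ≠ k by omega), ← sum_mul]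
        rw [sum_zeroSum', zero_mul]
      · obtain rfl | h := eq_or_lt_of_le (Nat.succ_le_of_lt h)
        · simp only [Nat.succ_eq_add_one, del_update_succ le_rfl, del_update_self,
            update_self, update_of_ne (show i ≠ i + 1 by omega), ← sum_mul]
          rw [sum_zeroSum, zero_mul]
        · obtain ⟨l, rfl⟩ : ∃ l, k = l + 2 := ⟨k - 2, by omega⟩
          simp only [update_of_ne (show i ≠ l + 2 by omega),
            update_of_ne (show i + 1 ≠ l + 2 by omega),
            del_update_succ (show i ≤ l + 1 by omega), del_update_succ (show i ≤ l by omega),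
            ← mul_sum]
          rw [ih hr.2 l (by omega), mul_zero]
    | vertex4 i =>
      simp only [flow]
      rw [sum_comm]
      refine sum_eq_zero fun b _ => ?_
      have := hr.1
      by_cases h : k = i
      · subst h
        simp only [update_idem, update_self,
          update_of_ne (show k + 1 ≠ k by omega), ← sum_mul]
        rw [sum_zeroSum', zero_mul, zero_mul]
      · by_cases h' : k = i + 1
        · subst h'
          simp only [fun a : ι => update_comm (show i + 1 ≠ i by omega) a b x,
            update_idem, update_self,
            update_of_ne (show i ≠ i + 1 by omega), ← sum_mul, ← mul_sum]
          rw [sum_zeroSum', mul_zero, zero_mul]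
        · simp only [update_of_ne (Ne.symm h), update_of_ne (Ne.symm h'),
            ← mul_sum]
          simp only [fun a : ι => update_comm h a b x,
            fun a : ι => update_comm h' a b (update x i b)]
          rw [ih hr.2 k hk, mul_zero]

end Flow

/-! ### The flow function and the names of the edges -/

section Total

variable {ι : Type} [Fintype ι] [DecidableEq ι]

/-- The sum over all colourings of the names below `N`. -/
def total (N : ℕ) (z : ι) (M : (ℕ → ι) → ℚ) : ℚ :=
  ∑ σ : Fin N → ι, M fun m => if h : m < N then σ ⟨m, h⟩ else z

theorem total_update {N b : ℕ} (hb : b < N) (z : ι) (M : (ℕ → ι) → ℚ) :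
    total N z (fun σ => ∑ y, M (update σ b y)) = Fintype.card ι * total N z M := by
  have h : ∀ (σ : Fin N → ι) (y : ι),
      update (fun m => if h : m < N then σ ⟨m, h⟩ else z) b y =
        fun m => if h : m < N then update σ ⟨b, hb⟩ y ⟨m, h⟩ else z := by
    intro σ y
    funext m
    by_cases hm : m = b
    · subst hm; simp [hb]
    · by_cases hN : m < N
      · simp [hm, hN, update_apply, Fin.ext_iff]
      · simp [hm, hN]
  simp only [total, h]
  have h2 : ∀ G : (Fin N → ι) → ℚ, (Fintype.card ι : ℚ) * ∑ σ, G σ =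
      ∑ p : (Fin N → ι) × ι, G p.1 := by
    intro G; rw [Fintype.sum_prod_type]; simp [mul_sum]
  rw [h2, ← Fintype.sum_prod_type']
  -- Exchanging the colour of `b` with the extra colour is an involution of the pairs.
  refine Finset.sum_nbij' (fun p => (update p.1 ⟨b, hb⟩ p.2, p.1 ⟨b, hb⟩))
    (fun p => (update p.1 ⟨b, hb⟩ p.2, p.1 ⟨b, hb⟩)) ?_ ?_ ?_ ?_ ?_ <;> simp

theorem total_congr {N : ℕ} {z : ι} {M M' : (ℕ → ι) → ℚ} (h : ∀ σ, M σ = M' σ) :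
    total N z M = total N z M' := by rw [funext h]

/-- If `M` has sum zero in the colour of `b`, then the weight `zeroSum` between `a` and `b`
identifies the two colours. -/
theorem total_contract {N a b : ℕ} (hb : b < N) (hab : a ≠ b) (z : ι) {M : (ℕ → ι) → ℚ}
    (hM : ∀ σ, ∑ y, M (update σ b y) = 0) :
    Fintype.card ι * total N z (fun σ => zeroSum (σ a) (σ b) * M σ) =
      total N z fun σ => M (update σ b (σ a)) := by
  rw [← total_update hb]
  refine total_congr fun σ => ?_
  simp only [update_self, update_of_ne hab]
  exact sum_zeroSum_mul_of_sum_eq_zero (σ a) (hM σ)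

/-- The stream that starts with a list. -/
def ofList (z : ι) (l : List ι) : ℕ → ι := fun m => l.getD m z

theorem ofList_insert (z : ι) (L R : List ι) (a : ι) :
    ofList z (L ++ a :: R) = ins L.length a (ofList z (L ++ R)) := by
  funext m
  simp only [ofList, ins, List.getD_eq_getElem?_getD, List.getElem?_append]
  rcases lt_trichotomy m L.length with h | rfl | h
  · simp [h]
  · simp
  · obtain ⟨k, rfl⟩ := Nat.exists_eq_add_of_lt h
    simp [show ¬ L.length + k + 1 < L.length by omega, show ¬ L.length + k < L.length by omega,
      show L.length + k + 1 - L.length = k + 1 by omega, show L.length + k + 1 ≠ L.length by omega]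

theorem ofList_update (z : ι) (L R : List ι) (a b : ι) :
    update (ofList z (L ++ a :: R)) L.length b = ofList z (L ++ b :: R) := by
  rw [ofList_insert, ofList_insert, ← ins_del, del_ins]

theorem ofList_length (z : ι) (L R : List ι) (a : ι) : ofList z (L ++ a :: R) L.length = a := by
  rw [ofList_insert, ins_self]

theorem ofList_length_succ (z : ι) (L R : List ι) (a b : ι) :
    ofList z (L ++ a :: b :: R) (L.length + 1) = b := by
  have := ofList_length z (L ++ [a]) R b
  simpa using this

theorem ofList_update_succ (z : ι) (L R : List ι) (a b c : ι) :
    update (ofList z (L ++ a :: b :: R)) (L.length + 1) c = ofList z (L ++ a :: c :: R) := by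
  have := ofList_update z (L ++ [a]) R b c
  simpa using this

theorem map_update_of_notMem {l : List ℕ} {b : ℕ} (h : b ∉ l) (σ : ℕ → ι) (y : ι) :
    l.map (update σ b y) = l.map σ := by
  refine map_congr_left fun e he => ?_
  rw [update_of_ne]; rintro rfl; exact h he

/-- The weight of a vertex: it sums over one spin that it shares with all its legs. -/
def vertexWeight (σ : ℕ → ι) (g : List ℕ) : ℚ := ∑ s, (g.map fun e => zeroSum s (σ e)).prod

/-- The weight of a graph. -/
def weight (σ : ℕ → ι) (G : Multigraph) : ℚ := (G.map (vertexWeight σ)).prod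

theorem weight_cons (σ : ℕ → ι) (g : List ℕ) (G : Multigraph) :
    weight σ (g :: G) = vertexWeight σ g * weight σ G := by simp [weight]

theorem weight_update {G : Multigraph} {b : ℕ} (h : b ∉ G.flatten) (σ : ℕ → ι) (y : ι) :
    weight (update σ b y) G = weight σ G := by
  unfold weight
  congr 1
  refine map_congr_left fun g hg => ?_
  unfold vertexWeight
  refine sum_congr rfl fun s _ => ?_
  congr 1
  refine map_congr_left fun e he => ?_
  rw [update_of_ne]; rintro rfl; exact h (mem_flatten.2 ⟨g, hg, he⟩)

theorem weight_rename (σ : ℕ → ι) (ρ : ℕ → ℕ) (G : Multigraph) :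
    weight σ (G.map (List.map ρ)) = weight (fun e => σ (ρ e)) G := by
  simp [weight, vertexWeight, comp_def]
  rfl

theorem sum_weight_update {G : Multigraph} {b : ℕ} (h : G.flatten.count b = 1) (σ : ℕ → ι) :
    ∑ y, weight (update σ b y) G = 0 := by
  have hb : b ∈ G.flatten := List.count_pos_iff.1 (by omega)
  obtain ⟨g, hg, hbg⟩ := mem_flatten.1 hb
  obtain ⟨G1, G2, rfl⟩ := List.append_of_mem hg
  obtain ⟨u, v, rfl⟩ := List.append_of_mem hbg
  simp only [List.flatten_append, flatten_cons, count_append, count_cons_self] at h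
  have h1 : b ∉ G1.flatten := count_eq_zero.1 (by omega)
  have h2 : b ∉ G2.flatten := count_eq_zero.1 (by omega)
  have h3 : b ∉ u := count_eq_zero.1 (by omega)
  have h4 : b ∉ v := count_eq_zero.1 (by omega)
  have h5 : ∀ y, weight (update σ b y) (G1 ++ (u ++ b :: v) :: G2) =
      weight σ G1 * ((∑ s, (u.map fun e => zeroSum s (σ e)).prod * zeroSum s y *
        (v.map fun e => zeroSum s (σ e)).prod) * weight σ G2) := by
    intro y
    have hu : ∀ s, u.map (fun e => zeroSum s (update σ b y e)) =
        u.map (fun e => zeroSum s (σ e)) := fun s => by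
      simpa using congrArg (List.map (zeroSum s)) (map_update_of_notMem h3 σ y)
    have hv : ∀ s, v.map (fun e => zeroSum s (update σ b y e)) =
        v.map (fun e => zeroSum s (σ e)) := fun s => by
      simpa using congrArg (List.map (zeroSum s)) (map_update_of_notMem h4 σ y)
    rw [← weight_update h1 σ y, ← weight_update h2 σ y]
    simp [weight, vertexWeight, hu, hv, mul_assoc]
  simp only [h5]
  rw [← mul_sum, ← sum_mul, sum_comm]
  simp only [← sum_mul, ← mul_sum, sum_zeroSum]
  simp

/-- The only occurrence of `b` is either in the row or in the graph read so far, and each of the two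
factors has sum zero in such a colour. This is the hypothesis for contracting a maximum. -/
theorem sum_weight_flow_update {G : Multigraph} {l : List ℕ} {b : ℕ} {w : List GraphPiece}
    (hw : GraphFits l.length w) (h : (G.flatten ++ l).count b = 1) (z : ι) (σ : ℕ → ι) :
    ∑ y, weight (update σ b y) G *
      flow w (ofList z (l.map (update σ b y))) = 0 := by
  rw [count_append] at h
  by_cases hb : b ∈ l
  · have h0 := List.count_pos_iff.2 hb
    simp only [weight_update (count_eq_zero.1 (show G.flatten.count b = 0 by omega)),
      ← mul_sum]
    obtain ⟨L, R, rfl⟩ := List.append_of_mem hb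
    simp only [count_append, count_cons_self] at h
    have hL : b ∉ L := count_eq_zero.1 (by omega)
    have hR : b ∉ R := count_eq_zero.1 (by omega)
    have := sum_flow_update w hw L.length (by simp) (ofList z ((L ++ b :: R).map σ))
    rw [map_append, map_cons] at this
    simp only [← L.length_map (f := σ), ofList_update] at this
    simp only [map_append, map_cons, map_update_of_notMem hL, map_update_of_notMem hR,
      update_self, this, mul_zero]
  · simp only [map_update_of_notMem hb, ← sum_mul]
    rw [sum_weight_update (by have := count_eq_zero.2 hb; omega), zero_mul]

/-- All entries are below `n` and occur exactly twice. -/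
def Paired (n : ℕ) (l : List ℕ) : Prop := ∀ e ∈ l, e < n ∧ l.count e = 2

theorem Paired.perm {n : ℕ} {l l' : List ℕ} (h : Paired n l) (hl : l'.Perm l) : Paired n l' :=
  fun e he => ⟨(h e (hl.subset he)).1, by rw [hl.count_eq]; exact (h e (hl.subset he)).2⟩

theorem Paired.notMem {n : ℕ} {l : List ℕ} (h : Paired n l) : n ∉ l := fun hn => (h n hn).1.ne rfl

theorem Paired.fresh {n : ℕ} {l : List ℕ} (h : Paired n l) : Paired (n + 1) (n :: n :: l) := by
  intro e he
  by_cases hn : e = n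
  · subst hn; simp [count_eq_zero.2 h.notMem]
  · have : e ∈ l := by simpa [hn] using he
    rw [count_cons_of_ne (Ne.symm hn), count_cons_of_ne (Ne.symm hn)]
    exact ⟨(h e this).1.trans (lt_succ_self n), (h e this).2⟩

theorem Paired.rename {n a b : ℕ} {l : List ℕ} (h : Paired n (a :: b :: l)) (hab : a ≠ b) :
    Paired n (l.map fun x => if x = b then a else x) := by
  have hb := (h b (by simp)).2
  rw [count_cons_of_ne hab, count_cons_self] at hb
  have hbl : b ∈ l := List.count_pos_iff.1 (by omega)
  obtain ⟨u, v, rfl⟩ := List.append_of_mem hbl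
  simp only [count_append, count_cons_self] at hb
  have hu : b ∉ u := count_eq_zero.1 (by omega)
  have hv : b ∉ v := count_eq_zero.1 (by omega)
  rw [map_append, map_cons, map_ite_self hu, map_ite_self hv, if_pos rfl]
  have h1 : (a :: b :: (u ++ b :: v)).Perm (b :: b :: a :: (u ++ v)) := by
    refine perm_iff_count.2 fun e => ?_
    simp only [count_append, count_cons]; omega
  have h2 := h.perm h1.symm
  refine Paired.perm (l := a :: (u ++ v)) ?_ List.perm_middle
  intro e he
  have hne : b ≠ e := by rintro rfl; simp [hu, hv, hab.symm] at he
  have := h2 e (by simp at he ⊢; tauto)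
  rwa [count_cons_of_ne hne, count_cons_of_ne hne] at this

end Total

/-! ### Comparison of the flow function with the weight of the abstract graph -/

section Names

variable {ι : Type} [Fintype ι] [DecidableEq ι]

theorem sum_zeroSum_flow {w : List GraphPiece} (z : ι) (L R : List ι) (a : ι)
    (hw : GraphFits (L ++ a :: R).length w) (s : ι) :
    ∑ y, zeroSum s y * flow w (ofList z (L ++ y :: R)) = flow w (ofList z (L ++ s :: R)) := by
  refine sum_zeroSum_mul_of_sum_eq_zero s ?_
  have := sum_flow_update w hw L.length (by simp) (ofList z (L ++ a :: R))
  simpa only [ofList_update] using this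

/-- Since `zeroSum s` acts as the identity in each argument of `F`, summing over the colours of two
names sets both equal to the spin `s` of the vertex. -/
theorem sum_contract_two (f : ι → ℚ) {F : ι → ι → ℚ}
    (h1 : ∀ y s, ∑ x, zeroSum s x * F x y = F s y) (h2 : ∀ x s, ∑ y, zeroSum s y * F x y = F x s) :
    ∑ x, ∑ y, (∑ s, f s * (zeroSum s x * zeroSum s y)) * F x y = ∑ s, f s * F s s := by
  have h : ∀ s, ∑ x, ∑ y, f s * (zeroSum s x * zeroSum s y) * F x y = f s * F s s := by
    intro s
    simp only [mul_assoc, ← mul_sum, h2, h1]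
  simp only [← h, sum_mul]
  rw [Finset.sum_comm' (t' := univ) (s' := fun _ => univ) (by simp)]
  rw [sum_congr rfl fun y _ => sum_comm]
  rw [sum_comm]
  exact sum_congr rfl fun s _ => sum_comm

theorem sum_contract_three {F : ι → ι → ι → ℚ}
    (h1 : ∀ y u s, ∑ x, zeroSum s x * F x y u = F s y u)
    (h2 : ∀ x u s, ∑ y, zeroSum s y * F x y u = F x s u)
    (h3 : ∀ x y s, ∑ u, zeroSum s u * F x y u = F x y s) :
    ∑ x, ∑ y, ∑ u, (∑ s, zeroSum s x * (zeroSum s y * zeroSum s u)) * F x y u =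
      ∑ s, F s s s := by
  have h : ∀ x, ∑ y, ∑ u, (∑ s, zeroSum s x * (zeroSum s y * zeroSum s u)) * F x y u =
      ∑ s, zeroSum s x * F x s s := fun x => sum_contract_two (fun s => zeroSum s x) (h2 x) (h3 x)
  simp only [h]
  rw [sum_comm]
  exact sum_congr rfl fun s _ => h1 s s s

/-- The flow function of a planar graph is the weight of its abstract graph, up to a factor for the
names that are used. -/
theorem graphAux_weight {q N : ℕ} (hq : Fintype.card ι = q * q) (z : ι) (w : List GraphPiece) :
    ∀ (l : List ℕ) (n : ℕ) (G : Multigraph), GraphFits l.length w → n + 3 * w.length ≤ N →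
      Paired n (G.flatten ++ l) →
      q ^ (G.flatten ++ l).length *
          total N z (fun σ => weight σ G * flow w (ofList z (l.map σ))) =
        q ^ (graphAux l n G w).flatten.length *
          total N z (fun σ => weight σ (graphAux l n G w)) ∧
      Paired N (graphAux l n G w).flatten := by
  have hq' : (Fintype.card ι : ℚ) = q ^ 2 := by rw [hq]; push_cast; ring
  induction w with
  | nil =>
    intro l n G hw hN hp
    obtain rfl : l = [] := length_eq_zero_iff.1 hw
    simp only [graphAux, flow, append_nil, mul_one, true_and] at *
    exact fun e he => ⟨(hp e he).1.trans_le (by simpa using hN), (hp e he).2⟩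
  | cons g w ih =>
    intro l n G hw hN hp
    rw [length_cons] at hN
    cases g with
    | cup i =>
      obtain ⟨L, R, rfl, rfl⟩ := exists_split l hw.1
      have h1 : (G.flatten ++ (L ++ n :: n :: R)).Perm (n :: n :: (G.flatten ++ (L ++ R))) := by
        refine perm_iff_count.2 fun e => ?_
        simp only [count_append, count_cons]; omega
      have := ih (L ++ n :: n :: R) (n + 1) G (by simpa [add_assoc] using hw.2) (by omega)
        (hp.fresh.perm h1)
      rw [graphAux, take_left, drop_left, ← this.1, h1.length_eq]
      refine ⟨?_, this.2⟩
      rw [length_cons, length_cons, add_assoc, pow_add _ _ (1 + 1), mul_assoc]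
      congr 1
      -- The spin of the new strand becomes the colour of the fresh name `n`. On the left side this
      -- colour was free, which accounts for the factor q², the number of spins; q carries the
      -- number of edge ends because each name has two of them.
      rw [one_add_one_eq_two, ← hq', ← total_update (b := n) (by omega)]
      have h := hp.notMem
      simp only [mem_append, not_or] at h
      refine total_congr fun σ => ?_
      simp only [flow, weight_update h.1, mul_sum, map_append, map_cons,
        map_update_of_notMem h.2.1, map_update_of_notMem h.2.2, ofList_insert, length_map,
        update_self]
    | vertex3 i =>
      obtain ⟨L, R, rfl, rfl⟩ := exists_split l hw.1
      have h1 : (([n, n + 1, n + 2] :: G).flatten ++ (L ++ n :: (n + 1) :: (n + 2) :: R)).Perm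
          ((n + 2) :: (n + 2) :: (n + 1) :: (n + 1) :: n :: n :: (G.flatten ++ (L ++ R))) := by
        refine perm_iff_count.2 fun e => ?_
        simp only [flatten_cons, count_append, count_cons, count_nil]; omega
      have hw2 := hw.2
      have hlen : (L ++ n :: (n + 1) :: (n + 2) :: R).length = (L ++ R).length + 3 := by
        simp; omega
      have := ih (L ++ n :: (n + 1) :: (n + 2) :: R) (n + 3) ([n, n + 1, n + 2] :: G)
        (by rwa [hlen]) (by omega) (hp.fresh.fresh.fresh.perm h1)
      rw [graphAux, take_left, drop_left, ← this.1, h1.length_eq]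
      refine ⟨?_, this.2⟩
      simp only [length_cons, add_assoc, one_add_one_eq_two]
      rw [pow_add, mul_assoc]
      congr 1
      rw [show (q : ℚ) ^ (2 + (2 + 2)) = Fintype.card ι * (Fintype.card ι *
        Fintype.card ι) by rw [hq']; ring, mul_assoc, mul_assoc,
        ← total_update (b := n + 2) (by omega), ← total_update (b := n + 1) (by omega),
        ← total_update (b := n) (by omega)]
      have h := hp.notMem
      have h' := hp.fresh.notMem
      have h'' := hp.fresh.fresh.notMem
      simp only [mem_append, mem_cons, not_or] at h h' h''
      refine total_congr fun σ => ?_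
      have e1 : (List.map σ L).length = L.length := length_map σ
      simp only [weight_cons, weight_update h.1, weight_update h'.2.2.1,
          weight_update h''.2.2.2.2.1,
        map_append, map_cons, map_update_of_notMem h.2.1, map_update_of_notMem h.2.2,
        map_update_of_notMem h'.2.2.2.1, map_update_of_notMem h'.2.2.2.2,
        map_update_of_notMem h''.2.2.2.2.2.1, map_update_of_notMem h''.2.2.2.2.2.2,
        update_self, update_of_ne (show n ≠ n + 1 by omega),
        update_of_ne (show n ≠ n + 2 by omega), vertexWeight, map_nil, prod_cons,
        prod_nil, mul_one,
        update_of_ne (show n + 1 ≠ n + 2 by omega), mul_right_comm _ (weight σ G),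
        ← sum_mul]
      -- Summing over the colours of the three fresh names gives all three legs the spin of the
      -- vertex.
      rw [sum_contract_three, mul_comm, flow]
      · simp only [ofList_insert, e1]
      · intro y u s
        refine sum_zeroSum_flow z _ _ z ?_ s
        simpa [add_assoc] using hw2
      · intro x u s
        have := sum_zeroSum_flow (w := w) z (List.map σ L ++ [x]) (u :: List.map σ R) z
          (by simpa [add_assoc, add_comm, add_left_comm] using hw2) s
        simpa using this
      · intro x y s
        have := sum_zeroSum_flow (w := w) z (List.map σ L ++ [x, y]) (List.map σ R) z
          (by simpa [add_assoc, add_comm, add_left_comm] using hw2) s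
        simpa using this
    | cap i =>
      obtain ⟨L, a, b, R, rfl, rfl⟩ := exists_split_two l hw.1
      have hw2 : GraphFits (L ++ R).length w := by
        convert hw.2 using 1; simp; omega
      have h0 : ∀ σ : ℕ → ι, flow (.cap L.length :: w) (ofList z ((L ++ a :: b :: R).map σ)) =
          zeroSum (σ a) (σ b) * flow w (ofList z ((L ++ R).map σ)) := by
        intro σ
        rw [flow, map_append, map_cons, map_cons, ← L.length_map (f := σ),
          ofList_length, ofList_length_succ, ofList_insert, del_ins, ofList_insert, del_ins,
          map_append]
      simp only [h0]
      rw [graphAux, drop_left]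
      simp only [take_left]
      split_ifs with hab
      · subst hab
        have h1 : (([a, a] :: G).flatten ++ (L ++ R)).Perm (G.flatten ++ (L ++ a :: a :: R)) := by
          refine perm_iff_count.2 fun e => ?_
          simp only [flatten_cons, count_append, count_cons, count_nil]; omega
        have := ih (L ++ R) n ([a, a] :: G) hw2 (by omega) (hp.perm h1)
        rw [← this.1, h1.length_eq]
        refine ⟨?_, this.2⟩
        congr 1
        refine total_congr fun σ => ?_
        -- A circle is recorded as a vertex with a loop. Its weight, a sum of products of two
        -- entries of `zeroSum`, is a diagonal entry of `zeroSum`, because that matrix is a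
        -- symmetric projection.
        rw [weight_cons, vertexWeight]
        simp only [map_cons, map_nil, prod_cons, prod_nil, mul_one,
          sum_zeroSum_mul_zeroSum]
        ring
      · have h1 : (a :: b :: (G.flatten ++ (L ++ R))).Perm (G.flatten ++ (L ++ a :: b :: R)) := by
          refine perm_iff_count.2 fun e => ?_
          simp only [flatten_cons, count_append, count_cons, count_nil]; omega
        have hp1 := hp.perm h1
        have hp2 := hp1.rename hab
        have hb := hp1 b (by simp)
        rw [count_cons_of_ne hab, count_cons_self] at hb
        set ρ : ℕ → ℕ := fun x => if x = b then a else x with hρ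
        have h2 : (G.flatten ++ (L ++ R)).map ρ =
            (G.map (List.map ρ)).flatten ++ (L ++ R).map ρ := by
          rw [map_append, List.map_flatten]
        rw [h2] at hp2
        have := ih ((L ++ R).map ρ) n (G.map (List.map ρ)) (by rwa [length_map]) (by omega) hp2
        rw [← this.1, ← h1.length_eq, ← h2, length_map]
        refine ⟨?_, this.2⟩
        rw [length_cons, length_cons, add_assoc, pow_add _ _ (1 + 1), mul_assoc]
        congr 1
        -- Apart from the maximum, `b` occurs exactly once, so the rest has sum zero in its colour,
        -- and the factor `zeroSum` at the maximum identifies the colours of `a` and `b`. This is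
        -- the renaming done by `graphAux`.
        have h3 := total_contract (N := N) (a := a) (b := b) (by omega) hab z
          (M := fun σ => weight σ G * flow w (ofList z ((L ++ R).map σ)))
          (sum_weight_flow_update hw2 (by omega) z)
        rw [one_add_one_eq_two, ← hq']
        simp only [mul_left_comm (weight _ G)]
        rw [h3]
        refine total_congr fun σ => ?_
        have h4 : update σ b (σ a) = fun e => σ (ρ e) := by
          funext e
          by_cases he : e = b
          · subst he; simp [hρ]
          · simp [hρ, he]
        rw [weight_rename, map_map, h4]
        rfl
    | vertex4 i =>
      obtain ⟨L, a, b, R, rfl, rfl⟩ := exists_split_two l hw.1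
      have h1 : (([a, b, n, n + 1] :: G).flatten ++ (L ++ n :: (n + 1) :: R)).Perm
          ((n + 1) :: (n + 1) :: n :: n :: (G.flatten ++ (L ++ a :: b :: R))) := by
        refine perm_iff_count.2 fun e => ?_
        simp only [flatten_cons, count_append, count_cons, count_nil]; omega
      have hw2 := hw.2
      have hlen : (L ++ n :: (n + 1) :: R).length = (L ++ a :: b :: R).length := by simp
      have := ih (L ++ n :: (n + 1) :: R) (n + 2) ([a, b, n, n + 1] :: G)
        (by rwa [hlen]) (by omega) (hp.fresh.fresh.perm h1)
      rw [graphAux, drop_left]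
      simp only [take_left]
      rw [← this.1, h1.length_eq]
      refine ⟨?_, this.2⟩
      simp only [length_cons, add_assoc, one_add_one_eq_two]
      rw [pow_add, mul_assoc]
      congr 1
      rw [show (q : ℚ) ^ (2 + 2) = Fintype.card ι * Fintype.card ι by rw [hq']; ring,
        mul_assoc, ← total_update (b := n + 1) (by omega), ← total_update (b := n) (by omega)]
      have ha := (hp a (by simp)).1
      have hb := (hp b (by simp)).1
      have h := hp.notMem
      have h' := hp.fresh.notMem
      simp only [mem_append, mem_cons, not_or] at h h'
      refine total_congr fun σ => ?_
      have e1 : (List.map σ L).length = L.length := length_map σ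
      simp only [weight_cons, weight_update h.1, weight_update h'.2.2.1,
        map_append, map_cons, map_update_of_notMem h.2.1, map_update_of_notMem h.2.2.2.2,
        map_update_of_notMem h'.2.2.2.1, map_update_of_notMem h'.2.2.2.2.2.2,
        update_self, update_of_ne (show n ≠ n + 1 by omega),
        update_of_ne (show a ≠ n by omega), update_of_ne (show a ≠ n + 1 by omega),
        update_of_ne (show b ≠ n by omega), update_of_ne (show b ≠ n + 1 by omega),
        vertexWeight, map_nil, prod_cons,
        prod_nil, mul_one, mul_right_comm _ (weight σ G), ← sum_mul]
      simp only [← mul_assoc (zeroSum _ (σ a)) (zeroSum _ (σ b))]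
      rw [sum_contract_two (fun s => zeroSum s (σ a) * zeroSum s (σ b)), mul_comm, flow]
      · simp only [← e1, ofList_length, ofList_length_succ, ofList_update, ofList_update_succ,
          zeroSum_comm (σ _)]
      · intro y s
        refine sum_zeroSum_flow z _ _ z ?_ s
        simpa [add_assoc] using hw2
      · intro x s
        have := sum_zeroSum_flow (w := w) z (List.map σ L ++ [x]) (List.map σ R) z
          (by simpa [add_assoc, add_comm, add_left_comm] using hw2) s
        simpa using this

end Names

/-! ### Components of multigraphs and colourings -/

namespace Multigraph

variable (G : Multigraph) (F : Finset ℕ)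

/-- The vertices of a multigraph with the edges outside of `F` as a simple graph. -/
def edgeGraph : SimpleGraph (Fin G.length) :=
  SimpleGraph.fromRel fun u v : Fin G.length => ∃ e, e ∉ F ∧ e ∈ G.get u ∧ e ∈ G.get v

theorem components_eq : G.components F = Nat.card (G.edgeGraph F).ConnectedComponent := rfl

/-- A colouring of the vertices is constant along the edge `e`. -/
def ConstantOn {α : Type} (c : Fin G.length → α) (e : ℕ) : Prop :=
  ∀ u v, e ∈ G.get u → e ∈ G.get v → c u = c v

variable {G F}

theorem mem_edges_of_mem_get {e : ℕ} {u : Fin G.length} (h : e ∈ G.get u) : e ∈ G.edges :=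
  mem_toFinset.2 (mem_flatten.2 ⟨_, List.get_mem G u, h⟩)

theorem constantOn_iff {α : Type} (c : Fin G.length → α) :
    (∀ e ∈ G.edges \ F, G.ConstantOn c e) ↔
      ∃ f : (G.edgeGraph F).ConnectedComponent → α,
          f ∘ (G.edgeGraph F).connectedComponentMk = c := by
  constructor
  · intro h
    refine ⟨SimpleGraph.ConnectedComponent.lift c ?_, rfl⟩
    intro v w p hp
    clear hp
    induction p with
    | nil => rfl
    | cons hadj p ih =>
      refine Eq.trans ?_ ih
      rw [edgeGraph, SimpleGraph.fromRel_adj] at hadj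
      obtain ⟨-, ⟨e, he, h1, h2⟩ | ⟨e, he, h1, h2⟩⟩ := hadj
      · exact h e (mem_sdiff.2 ⟨mem_edges_of_mem_get h1, he⟩) _ _ h1 h2
      · exact h e (mem_sdiff.2 ⟨mem_edges_of_mem_get h1, he⟩) _ _ h2 h1
  · rintro ⟨f, rfl⟩ e he u v hu hv
    by_cases huv : u = v
    · rw [huv]
    · refine congrArg f (SimpleGraph.ConnectedComponent.sound (SimpleGraph.Adj.reachable ?_))
      rw [edgeGraph, SimpleGraph.fromRel_adj]
      exact ⟨huv, Or.inl ⟨e, (mem_sdiff.1 he).2, hu, hv⟩⟩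

theorem mk_surjective {V : Type} (H : SimpleGraph V) : Function.Surjective H.connectedComponentMk :=
  fun C => C.exists_rep

open Classical in
-- Colourings that are constant along the remaining edges are the functions on the set of
-- components.
theorem card_constant {ι : Type} [Fintype ι] :
    (univ.filter fun c : Fin G.length → ι => ∀ e ∈ G.edges \ F, G.ConstantOn c e).card =
      Fintype.card ι ^ G.components F := by
  have := Fintype.ofFinite (G.edgeGraph F).ConnectedComponent
  have h : (univ.filter fun c : Fin G.length → ι => ∀ e ∈ G.edges \ F, G.ConstantOn c e) =
      univ.image fun f : (G.edgeGraph F).ConnectedComponent → ι =>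
        f ∘ (G.edgeGraph F).connectedComponentMk := by
    ext c
    simp only [Finset.mem_filter, mem_univ, true_and, Finset.mem_image]
    exact constantOn_iff c
  rw [h, Finset.card_image_of_injective _ (mk_surjective _).injective_comp_right, Finset.card_univ,
    Fintype.card_fun, components_eq, Nat.card_eq_fintype_card]

/-- Each edge lies at two vertices `u, v` or twice at one vertex `u = v`. -/
theorem exists_ends {N : ℕ} (hG : Paired N G.flatten) {e : ℕ} (he : e ∈ G.edges) :
    ∃ u v : Fin G.length, (∀ w, e ∈ G.get w ↔ w = u ∨ w = v) ∧
      ∀ f : Fin G.length → ℚ, ∏ w, f w ^ (G.get w).count e = f u * f v := by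
  have h2 := (hG e (mem_toFinset.1 he)).2
  rw [List.count_flatten, ← List.ofFn_get G, List.map_ofFn, List.sum_ofFn] at h2
  have hm : ∀ w, Multiset.count w (∑ u : Fin G.length, (G.get u).count e • {u}) =
      (G.get w).count e := by
    intro w
    simp [Multiset.count_sum', Multiset.count_nsmul, Multiset.count_singleton]
  have hc : Multiset.card (∑ u : Fin G.length, (G.get u).count e • ({u} : Multiset _)) = 2 := by
    rw [← h2]; simp [Multiset.card_sum]
  obtain ⟨u, v, huv⟩ := Multiset.card_eq_two.1 hc
  rw [huv] at hm
  refine ⟨u, v, fun w => ?_, fun f => ?_⟩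
  · rw [← List.count_pos_iff, ← hm w, Multiset.count_pos]; simp
  · simp only [← hm]
    have := Finset.prod_multiset_map_count {u, v} f
    rw [Finset.prod_subset (Finset.subset_univ _)] at this
    · rw [← this]; simp
    · intro w _ hw
      rw [Multiset.count_eq_zero.2 (by simpa using hw), pow_zero]

/-- The coboundary map from functions on vertices to functions on the remaining edges has rank at
most the number of these edges, and its kernel consists of functions on the components. The
inequality ensures that the subtraction in `betti` is not truncated. -/
theorem length_le {N : ℕ} (hG : Paired N G.flatten) (hF : F ⊆ G.edges) :
    G.length ≤ G.edges.card - F.card + G.components F := by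
  have := Fintype.ofFinite (G.edgeGraph F).ConnectedComponent
  choose u v huv using fun e : ↥(G.edges \ F) => exists_ends hG (mem_sdiff.1 e.2).1
  let φ : (Fin G.length → ℚ) →ₗ[ℚ] (↥(G.edges \ F) → ℚ) :=
    LinearMap.pi fun e =>
      LinearMap.proj (R := ℚ) (φ := fun _ : Fin G.length => ℚ) (u e) - LinearMap.proj (v e)
  have h1 := LinearMap.finrank_range_add_finrank_ker φ
  have h2 : Module.finrank ℚ (LinearMap.range φ) ≤ (G.edges \ F).card := by
    refine (Submodule.finrank_le _).trans ?_
    simp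
  have h3 : Module.finrank ℚ (LinearMap.ker φ) ≤ G.components F := by
    have h4 : LinearMap.ker φ ≤
        LinearMap.range (LinearMap.funLeft ℚ ℚ (G.edgeGraph F).connectedComponentMk) := by
      intro c hc
      obtain ⟨f, hf⟩ := (constantOn_iff (F := F) c).1 (by
        intro e he a b ha hb
        have h5 := congrFun (LinearMap.mem_ker.1 hc) ⟨e, he⟩
        have h6 : c (u ⟨e, he⟩) = c (v ⟨e, he⟩) := sub_eq_zero.1 h5
        rcases ((huv ⟨e, he⟩).1 a).1 ha with rfl | rfl <;>
          rcases ((huv ⟨e, he⟩).1 b).1 hb with rfl | rfl <;> simp [h6])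
      exact ⟨f, hf⟩
    refine (Submodule.finrank_mono h4).trans ((LinearMap.finrank_range_le _).trans ?_)
    rw [Module.finrank_fintype_fun_eq_card, components_eq, Nat.card_eq_fintype_card]
  rw [Finset.card_sdiff_of_subset hF] at h2
  simp at h1
  omega

end Multigraph

/-! ### The weight of a multigraph as a sum over sets of edges -/

namespace Multigraph

variable {G : Multigraph} {ι : Type} [Fintype ι] [DecidableEq ι]

theorem prod_map_eq {N : ℕ} {g : List ℕ} (hg : ∀ e ∈ g, e < N) (f : ℕ → ℚ) :
    (g.map f).prod = ∏ e : Fin N, f e ^ g.count (e : ℕ) := by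
  rw [Finset.prod_list_map_count, ← Finset.prod_range fun e => f e ^ g.count e]
  refine Finset.prod_subset (fun e he => ?_) fun e _ he => ?_
  · exact Finset.mem_range.2 (hg e (mem_toFinset.1 he))
  · rw [count_eq_zero.2 fun h => he (mem_toFinset.2 h), pow_zero]

theorem weight_eq_sum (σ : ℕ → ι) : weight σ G =
    ∑ c : Fin G.length → ι, ∏ u, ((G.get u).map fun e => zeroSum (c u) (σ e)).prod := by
  have h : weight σ G = ∏ u : Fin G.length, vertexWeight σ (G.get u) := by
    conv_lhs => rw [weight, ← List.ofFn_get G, List.map_ofFn, List.prod_ofFn]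
    rfl
  rw [h]
  simp only [vertexWeight]
  rw [Finset.prod_univ_sum, Fintype.piFinset_univ]

open Classical in
/-- The sum over the colours of one edge. -/
theorem sum_edge {N : ℕ} (hG : Paired N G.flatten) (c : Fin G.length → ι) (e : ℕ) :
    ∑ y, ∏ u, zeroSum (c u) y ^ (G.get u).count e =
      if e ∈ G.edges then -(Fintype.card ι : ℚ)⁻¹ + (if G.ConstantOn c e then 1 else 0)
        else Fintype.card ι := by
  by_cases he : e ∈ G.edges
  · obtain ⟨u, v, h1, h2⟩ := exists_ends hG he
    have h3 : G.ConstantOn c e ↔ c u = c v := by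
      refine ⟨fun h => h u v ((h1 u).2 (Or.inl rfl)) ((h1 v).2 (Or.inr rfl)), fun h a b ha hb => ?_⟩
      rcases (h1 a).1 ha with rfl | rfl <;> rcases (h1 b).1 hb with rfl | rfl <;> simp [h]
    rw [sum_congr rfl fun y _ => (h2 fun w => zeroSum (c w) y).trans
      (by rw [zeroSum_comm (c u), zeroSum_comm (c v)]), sum_zeroSum_mul_zeroSum, if_pos he, zeroSum]
    simp only [h3]; ring
  · have : ∀ u, (G.get u).count e = 0 := fun u =>
      count_eq_zero.2 fun h => he (mem_edges_of_mem_get h)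
    simp only [this, pow_zero, Finset.prod_const_one]
    simp [he]

/-- With the spins of the vertices fixed, the colours of the edges are summed independently. Each
edge gives -|ι|⁻¹, plus 1 if its ends have equal spins. In the expanded product `F` is the set of
edges that contribute -|ι|⁻¹, and the other edges force equal spins on the components of G - F. -/
theorem total_weight {N : ℕ} (hG : Paired N G.flatten) (z : ι) :
    Fintype.card ι ^ G.edges.card * total N z (fun σ => weight σ G) =
      Fintype.card ι ^ N * ∑ F ∈ G.edges.powerset,
        (-(Fintype.card ι : ℚ)⁻¹) ^ F.card * Fintype.card ι ^ G.components F := by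
  classical
  have hE : G.edges ⊆ Finset.range N := fun e he =>
    Finset.mem_range.2 (hG e (mem_toFinset.1 he)).1
  have hle := card_le_card hE
  rw [Finset.card_range] at hle
  have h1 : total N z (fun σ => weight σ G) = ∑ c : Fin G.length → ι, ∏ e : Fin N, ∑ y : ι,
      ∏ u, zeroSum (c u) y ^ (G.get u).count (e : ℕ) := by
    simp only [total, weight_eq_sum]
    rw [sum_comm]
    refine sum_congr rfl fun c _ => ?_
    rw [Finset.prod_univ_sum, Fintype.piFinset_univ]
    refine sum_congr rfl fun σ _ => ?_
    rw [Finset.prod_comm]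
    refine Finset.prod_congr rfl fun u _ => ?_
    rw [prod_map_eq (N := N) fun e he => (hG e (mem_flatten.2 ⟨_, List.get_mem G u, he⟩)).1]
    refine Finset.prod_congr rfl fun e _ => ?_
    simp
  have h2 : ∀ c : Fin G.length → ι, ∏ e : Fin N, ∑ y : ι,
      ∏ u, zeroSum (c u) y ^ (G.get u).count (e : ℕ) = Fintype.card ι ^ (N - G.edges.card) *
        ∏ e ∈ G.edges, (-(Fintype.card ι : ℚ)⁻¹ + (if G.ConstantOn c e then 1 else 0)) := by
    intro c
    simp only [sum_edge hG]
    rw [← Finset.prod_range (n := N) fun e => if e ∈ G.edges then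
      -(Fintype.card ι : ℚ)⁻¹ + (if G.ConstantOn c e then 1 else 0) else (Fintype.card ι : ℚ),
      Finset.prod_ite, Finset.filter_mem_eq_inter, Finset.inter_eq_right.2 hE, Finset.prod_const,
      Finset.filter_notMem_eq_sdiff, Finset.card_sdiff_of_subset hE, Finset.card_range, mul_comm]
  simp only [h1, h2, Finset.prod_add]
  rw [← mul_sum, ← mul_assoc, ← pow_add, Nat.add_sub_cancel' hle, sum_comm]
  congr 1
  refine sum_congr rfl fun F hF => ?_
  simp only [Finset.prod_const, ← mul_sum, Finset.prod_ite_zero, Finset.prod_const_one]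
  congr 1
  rw [← Nat.cast_pow, ← card_constant]
  simp

end Multigraph

/-! ### Identities between Laurent polynomials -/

/-- The value of a Laurent polynomial that is given by its coefficients and exponents. -/
def laurentValue {K : Type} [Field K] (d : K) (l : List (ℤ × ℤ)) : K :=
  (l.map fun t => (t.1 : K) * d ^ t.2).sum

/-- After multiplication by a power of the variable the expression is a polynomial with integer
coefficients and infinitely many roots. It vanishes already over the integers, hence its value is
zero in a field of any characteristic. -/
theorem laurentValue_eq_zero {l : List (ℤ × ℤ)}
    (h : ∀ q : ℕ, q ≠ 0 → laurentValue (q : ℚ) l = 0) {K : Type} [Field K] {d : K} (hd : d ≠ 0) :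
    laurentValue d l = 0 := by
  obtain ⟨M, hM⟩ : ∃ M : ℕ, ∀ t ∈ l, 0 ≤ t.2 + M := by
    clear h
    induction l with
    | nil => exact ⟨0, by simp⟩
    | cons t l ih =>
      obtain ⟨M, hM⟩ := ih
      refine ⟨M + t.2.natAbs, fun u hu => ?_⟩
      rcases mem_cons.1 hu with rfl | hu
      · push_cast; have := neg_abs_le u.2; omega
      · have := hM u hu; push_cast; have := abs_nonneg t.2; omega
  let P : Polynomial ℤ := (l.map fun t : ℤ × ℤ =>
    Polynomial.C t.1 * Polynomial.X ^ (t.2 + M).toNat).sum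
  have hP : ∀ {K : Type} [Field K] (d : K), d ≠ 0 →
      P.eval₂ (Int.castRingHom K) d = d ^ M * laurentValue d l := by
    intro K _ d hd
    rw [laurentValue, ← sum_map_mul_left, ← Polynomial.coe_eval₂RingHom, map_list_sum, map_map]
    congr 1
    refine map_congr_left fun t ht => ?_
    have h1 : d ^ (t.2 + M).toNat = d ^ t.2 * d ^ M := by
      rw [← zpow_natCast, Int.toNat_of_nonneg (hM t ht), zpow_add₀ hd, zpow_natCast]
    simp only [Function.comp_apply, Polynomial.coe_eval₂RingHom, Polynomial.eval₂_mul,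
      Polynomial.eval₂_C, Polynomial.eval₂_X_pow, h1]
    simp only [eq_intCast]
    ring
  have hz : P.map (Int.castRingHom ℚ) = 0 := by
    refine Polynomial.eq_zero_of_infinite_isRoot _ (Set.Infinite.mono ?_
      (Set.infinite_range_of_injective (f := fun q : ℕ => ((q + 1 : ℕ) : ℚ)) fun a b hab => by
        simpa using hab))
    rintro _ ⟨q, rfl⟩
    rw [Set.mem_ofPred_eq, Polynomial.IsRoot, Polynomial.eval_map, hP _ (by positivity),
      h _ (Nat.succ_ne_zero q), mul_zero]
  have h0 : P = 0 := Polynomial.map_injective _ (RingHom.injective_int _) (by rw [hz,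
      Polynomial.map_zero])
  have := hP d hd
  rw [h0, Polynomial.eval₂_zero] at this
  exact (mul_eq_zero.1 this.symm).resolve_left (pow_ne_zero _ hd)

theorem laurentValue_eq {l l' : List (ℤ × ℤ)}
    (h : ∀ q : ℕ, q ≠ 0 → laurentValue (q : ℚ) l = laurentValue (q : ℚ) l') {K : Type} [Field K]
    {d : K} (hd : d ≠ 0) : laurentValue d l = laurentValue d l' := by
  have e : ∀ {K : Type} [Field K] (d : K), laurentValue d (l ++ l'.map fun t => (-t.1, t.2)) =
      laurentValue d l - laurentValue d l' := by
    intro K _ d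
    have : laurentValue d (l'.map fun t => (-t.1, t.2)) = -laurentValue d l' := by
      clear h
      induction l' with
      | nil => simp [laurentValue]
      | cons t l' ih =>
        simp only [laurentValue, map_cons, sum_cons] at ih ⊢
        rw [ih]; push_cast; ring
    rw [sub_eq_add_neg, ← this]
    simp [laurentValue]
  rw [← sub_eq_zero, ← e]
  exact laurentValue_eq_zero (fun q hq => by rw [e, h q hq, sub_self]) hd

/-! ### The polynomial of a planar graph -/

/-- The number of three-valent vertices. -/
def count3 : List GraphPiece → ℕ
  | [] => 0
  | .vertex3 _ :: w => count3 w + 1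
  | _ :: w => count3 w

/-- The number of four-valent vertices. -/
def count4 : List GraphPiece → ℕ
  | [] => 0
  | .vertex4 _ :: w => count4 w + 1
  | _ :: w => count4 w

theorem GraphFits.count (w : List GraphPiece) : ∀ {r : ℕ}, GraphFits r w →
    r + 2 * ups w + count3 w + 2 * count4 w = 2 * downs w := by
  induction w with
  | nil => intro r h; obtain rfl : r = 0 := h; rfl
  | cons g w ih =>
    intro r h
    cases g <;> (have h1 := h.1; have := ih h.2; simp only [ups, downs, count3, count4]; omega)

/-- The number of edge ends minus twice the number of vertices grows by 1 at a three-valent vertex,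
by 2 at a four-valent vertex, and not at all at a circle. As each edge has two ends, this determines
e - v. -/
theorem length_graphAux (w : List GraphPiece) : ∀ (l : List ℕ) (n : ℕ) (G : Multigraph),
    GraphFits l.length w → (graphAux l n G w).flatten.length + 2 * G.length =
      G.flatten.length + 2 * (graphAux l n G w).length + count3 w + 2 * count4 w := by
  induction w with
  | nil => intro l n G h; simp [graphAux, count3, count4]
  | cons g w ih =>
    intro l n G h
    cases g with
    | cup i =>
      obtain ⟨L, R, rfl, rfl⟩ := exists_split l h.1
      exact ih _ _ _ (by simpa [add_assoc] using h.2)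
    | vertex3 i =>
      obtain ⟨L, R, rfl, rfl⟩ := exists_split l h.1
      have := ih (L ++ n :: (n + 1) :: (n + 2) :: R) (n + 3) ([n, n + 1, n + 2] :: G)
        (by simpa [add_assoc] using h.2)
      rw [graphAux, take_left, drop_left]
      simp only [count3, count4, flatten_cons, length_append, length_cons,
        length_nil] at this ⊢
      omega
    | cap i =>
      obtain ⟨L, a, b, R, rfl, rfl⟩ := exists_split_two l h.1
      have h2 : GraphFits (L ++ R).length w := by
        convert h.2 using 1; simp; omega
      rw [graphAux, drop_left]
      simp only [take_left]
      split_ifs with hab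
      · have := ih (L ++ R) n ([a, a] :: G) h2
        simp only [count3, count4, flatten_cons, length_append, length_cons,
          length_nil] at this ⊢
        omega
      · have := ih ((L ++ R).map fun x => if x = b then a else x) n
          (G.map (List.map fun x => if x = b then a else x)) (by rw [length_map]; exact h2)
        rwa [← List.map_flatten, length_map, length_map] at this
    | vertex4 i =>
      obtain ⟨L, a, b, R, rfl, rfl⟩ := exists_split_two l h.1
      have := ih (L ++ n :: (n + 1) :: R) (n + 2) ([a, b, n, n + 1] :: G) (by simpa using h.2)
      rw [graphAux, drop_left]
      simp only [take_left]
      simp only [count3, count4, flatten_cons, length_append, length_cons,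
        length_nil] at this ⊢
      omega

theorem Paired.length {N : ℕ} {l : List ℕ} (h : Paired N l) : l.length = 2 * l.toFinset.card := by
  rw [← List.sum_toFinset_count_eq_length, sum_congr rfl fun e he =>
    (h e (mem_toFinset.1 he)).2]
  simp [mul_comm]

/-- The exponent `e - v` of a planar graph is determined by its vertices. -/
theorem graphOf_betti {w : List GraphPiece} (hw : GraphFits 0 w) (h3 : count3 w = 2)
    {F : Finset ℕ} (hF : F ⊆ (graphOf w).edges) :
    (graphOf w).betti F + F.card = 1 + count4 w + (graphOf w).components F := by
  obtain ⟨-, hp⟩ := graphAux_weight (ι := Fin (1 * 1)) (q := 1) (by simp) 0 w [] 0 [] hw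
    (Nat.zero_add _).le (by intro e he; simp at he)
  have e5 := length_graphAux w [] 0 [] hw
  have e7 := hp.length
  have e8 := Multigraph.length_le hp hF
  have e9 := card_le_card hF
  simp only [Multigraph.betti, Multigraph.edges, graphOf, length_nil, List.flatten_nil] at *
  omega

/-- The polynomial `h` for `x = -1` as a Laurent polynomial in a square root of `-y`. -/
theorem h_eq_laurentValue (G : Multigraph) {K : Type} [Field K] (d : K) :
    G.h (-1) (-d ^ 2) = laurentValue d
      (G.edges.powerset.toList.map fun F => ((-1) ^ (G.components F + G.betti F),
          2 * G.betti F)) := by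
  rw [laurentValue, map_map, Finset.sum_map_toList, Multigraph.h]
  refine sum_congr rfl fun F _ => ?_
  rw [neg_neg, one_zpow, one_mul, neg_pow (d ^ 2)]
  simp only [Function.comp_apply]
  rw [zpow_mul, zpow_natCast, pow_add]
  push_cast
  rw [mul_assoc]
  norm_cast

/-- The sum over the states of the thickened graph as a Laurent polynomial. -/
theorem barSum_eq_laurentValue (w : List GraphPiece) {K : Type} [Field K] {d : K} (hd : d ≠ 0) :
    (-d) ^ (1 + count4 w) * ((barStates w).map fun s => (-d⁻¹) ^ s.1 * d ^ loops s.2).sum =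
      laurentValue d ((barStates w).map fun s =>
        ((-1) ^ (1 + count4 w + s.1), (1 + count4 w : ℤ) - s.1 + loops s.2)) := by
  rw [laurentValue, map_map, ← sum_map_mul_left]
  congr 1
  refine map_congr_left fun s _ => ?_
  simp only [Function.comp_apply]
  rw [zpow_add₀ hd, zpow_sub₀ hd, neg_pow d, neg_pow d⁻¹, pow_add (-1 : ℤ)]
  push_cast
  rw [inv_pow, zpow_natCast, zpow_natCast, show (1 + (count4 w : ℤ)) = ((1 + count4 w : ℕ) : ℤ) by
    push_cast; rfl, zpow_natCast]
  ring

/-- Both sides are the flow function with q² spins: `spin_flow` evaluates the bar states by it,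
while `graphAux_weight` and `total_weight` turn it into the sum over sets of edges. Two three-valent
vertices give `downs w = ups w + 1 + count4 w`, and `graphOf_betti` matches the remaining powers of
q. -/
theorem h_nat {w : List GraphPiece} (hw : GraphFits 0 w) (h3 : count3 w = 2) {q : ℕ} (hq : q ≠ 0) :
    (graphOf w).h (-1 : ℚ) (-(q : ℚ) ^ 2) = (-q) ^ (1 + count4 w) *
      ((barStates w).map fun s => (-(q : ℚ)⁻¹) ^ s.1 * (q : ℚ) ^ loops s.2).sum := by
  have hq' : (q : ℚ) ≠ 0 := by exact_mod_cast hq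
  have hι : Fintype.card (Fin (q * q)) = q * q := Fintype.card_fin _
  have hQ : ((Fintype.card (Fin (q * q)) : ℕ) : ℚ) = q ^ 2 := by rw [hι]; push_cast; ring
  have z : Fin (q * q) := ⟨0, Nat.pos_of_ne_zero (mul_ne_zero hq hq)⟩
  have e1 := spin_flow hq hι w fun _ => z
  have e2 : graphProd (spinCup (ι :=
      Fin (q * q)) q) (spinCap q) (-(q : ℚ)⁻¹) w 1 (fun _ => z) = _ :=
    graphProd_value (f := streamValue z) (fun w => spin_value hq hι z) (-(q : ℚ)⁻¹) hw
  obtain ⟨e3, hp⟩ := graphAux_weight hι z w [] 0 [] hw (Nat.zero_add _).le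
    (by intro e he; simp at he)
  have e4 := Multigraph.total_weight hp z
  have e6 := GraphFits.count w hw
  have e7 := hp.length
  have e8 : flow w (fun _ => z) = ∑ F ∈ (graphOf w).edges.powerset,
      (-((q : ℚ) ^ 2)⁻¹) ^ F.card * ((q : ℚ) ^ 2) ^ (graphOf w).components F := by
    rw [hQ, ← pow_mul, ← pow_mul] at e4
    rw [e7, show (graphAux [] 0 [] w).flatten.toFinset = (graphAux [] 0 [] w).edges from rfl,
        e4] at e3
    refine mul_left_cancel₀ (pow_ne_zero _ hq') (e3.symm.trans ?_).symm
    simp only [List.flatten_nil, append_nil, length_nil, pow_zero, weight, map_nil,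
      prod_nil, one_mul, total, Finset.sum_const, nsmul_eq_mul, Finset.card_univ,
      Fintype.card_fun, Fintype.card_fin, Nat.cast_pow, Nat.cast_mul, pow_mul, pow_two]
    rfl
  rw [e2, e8] at e1
  have e9 : (q : ℚ) ^ downs w = q ^ ups w * q ^ (1 + count4 w) := by
    rw [← pow_add]; congr 1; omega
  rw [e9, mul_assoc] at e1
  rw [mul_left_cancel₀ (pow_ne_zero _ hq') e1, ← mul_assoc, ← mul_pow, Multigraph.h, mul_sum]
  refine sum_congr rfl fun F hF => ?_
  have e10 := graphOf_betti hw h3 (mem_powerset.1 hF)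
  rw [neg_neg, one_zpow, one_mul]
  refine mul_right_cancel₀ (pow_ne_zero F.card (neg_ne_zero.2 (pow_ne_zero 2 hq'))) ?_
  rw [mul_assoc, ← pow_add, e10, pow_add, mul_left_comm, ← mul_pow, mul_assoc, mul_right_comm,
    ← mul_pow]
  have : (-((q : ℚ) ^ 2)⁻¹) * -(q : ℚ) ^ 2 = 1 := by field_simp
  rw [this]
  ring

/-- The value of `h` for `x = -1` is a sum over the states of the thickened graph. -/
theorem h_eq {w : List GraphPiece} (hw : GraphFits 0 w) (h3 : count3 w = 2) {K : Type} [Field K]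
    {d : K} (hd : d ≠ 0) : (graphOf w).h (-1) (-d ^ 2) = (-d) ^ (1 + count4 w) *
      ((barStates w).map fun s => (-d⁻¹) ^ s.1 * d ^ loops s.2).sum := by
  rw [h_eq_laurentValue, barSum_eq_laurentValue w hd]
  refine laurentValue_eq (fun q hq => ?_) hd
  rw [← h_eq_laurentValue, ← barSum_eq_laurentValue w (by exact_mod_cast hq)]
  exact h_nat hw h3 hq

/-! ### The Yamada polynomial as a value -/

namespace TL

variable {K R C : Type} [Field K] [Ring R] [Algebra K R] {A : K} {T : TL R A}

theorem e_c_lt {m n : ℕ} (h : m + 2 ≤ n) (z : R) : T.e m * (T.c n * z) = T.c n * (T.e m * z) := by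
  obtain ⟨k, rfl⟩ := exists_eq_add_of_le h
  have := T.mv_e m k T.u
  rw [← mul_assoc, ← mul_assoc, show m + 2 + k = m + k + 2 by omega]
  exact congrArg (· * z) this.symm

theorem e_a_lt {m n : ℕ} (h : m + 2 ≤ n) (z : R) : T.e m * (T.a n * z) = T.a n * (T.e m * z) := by
  obtain ⟨k, rfl⟩ := exists_eq_add_of_le h
  have := T.mv_e m k T.n
  rw [← mul_assoc, ← mul_assoc, show m + 2 + k = m + k + 2 by omega]
  exact congrArg (· * z) this.symm

theorem e_c_le {m n : ℕ} (h : n ≤ m) (z : R) : T.e m * (T.c n * z) = T.c n * (T.e (m + 2) * z) := by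
  obtain ⟨k, rfl⟩ := exists_eq_add_of_le h
  rw [← mul_assoc, ← mul_assoc]
  exact congrArg (· * z) (T.mv_c n k _)

theorem e_a_le {m n : ℕ} (h : n ≤ m) (z : R) : T.e (m + 2) * (T.a n * z) = T.a n * (T.e m * z) := by
  obtain ⟨k, rfl⟩ := exists_eq_add_of_le h
  rw [← mul_assoc, ← mul_assoc]
  exact congrArg (· * z) (T.mv_a n k _)

theorem e_a_succ (n : ℕ) (z : R) : T.e (n + 1) * (T.a n * z) = T.a (n + 1) * z := by
  rw [e_eq, mul_assoc, ← mul_assoc (T.c (n + 1)), zag_at, one_mul]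

theorem e_a_pred (n : ℕ) (z : R) : T.e n * (T.a (n + 1) * z) = T.a n * z := by
  rw [e_eq, mul_assoc, ← mul_assoc (T.c n), zig_at, one_mul]

theorem e_e_comm {m n : ℕ} (h : m + 2 ≤ n) (z : R) : T.e m * (T.e n * z) = T.e n * (T.e m * z) := by
  rw [e_eq T n, mul_assoc, mul_assoc, e_a_lt h, e_c_lt h]

theorem a_a (n : ℕ) (z : R) : T.a (n + 2) * (T.a n * z) = T.a n * (T.a n * z) := by
  rw [← mul_assoc, ← mul_assoc]
  exact congrArg (· * z) (T.mv_a n 0 _)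

theorem e_bar (hd : loopValue A ≠ 0) (m : ℕ) (z : R) :
    T.e m * ((1 + (-(loopValue A)⁻¹) • (T.a m * T.c m)) * z) = 0 := by
  rw [← e_eq, add_mul, one_mul, mul_add, smul_mul_assoc, mul_smul_comm, ← mul_assoc (T.e m),
    e_mul_e, smul_mul_assoc, smul_smul, neg_mul, inv_mul_cancel₀ hd, neg_one_smul, add_neg_cancel]

theorem bar_e (hd : loopValue A ≠ 0) (m : ℕ) (z : R) :
    (1 + (-(loopValue A)⁻¹) • (T.a m * T.c m)) * (T.e m * z) = 0 := by
  rw [← e_eq, add_mul, one_mul, smul_mul_assoc, ← mul_assoc (T.e m),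
    e_mul_e, smul_mul_assoc, smul_smul, neg_mul, inv_mul_cancel₀ hd, neg_one_smul, add_neg_cancel]

theorem e_bar_comm {m n : ℕ} (h : m + 2 ≤ n ∨ n + 2 ≤ m) (δ : K) (z : R) :
    T.e m * ((1 + δ • (T.a n * T.c n)) * z) = (1 + δ • (T.a n * T.c n)) * (T.e m * z) := by
  rw [← e_eq, add_mul, one_mul, mul_add, smul_mul_assoc, mul_smul_comm, add_mul, one_mul,
    smul_mul_assoc]
  rcases h with h | h
  · rw [e_e_comm h]
  · rw [e_e_comm h]

/-- The value of a planar graph is killed by the cut strips below it. -/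
theorem e_graphProd (hd : loopValue A ≠ 0) (w : List GraphPiece) : ∀ {r : ℕ}, GraphFits r w →
    ∀ j < r, T.e (2 * j) * graphProd T.c T.a (-(loopValue A)⁻¹) w = 0 := by
  induction w with
  | nil => intro r h j hj; obtain rfl : r = 0 := h; omega
  | cons g w ih =>
    intro r h j hj
    rw [graphProd_cons]
    cases g with (have h1 := h.1; have hz := ih h.2; generalize graphProd T.c T.a (-(loopValue A)⁻¹) w = z at hz)
    | cup i =>
      simp only [graphPiece, mul_assoc]
      rcases lt_or_ge j i with hj | hj
      · rw [e_c_lt (by omega), e_c_lt (by omega), hz j (by omega), mul_zero, mul_zero]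
      · rw [e_c_le (by omega), e_c_le (by omega), show 2 * j + 2 + 2 = 2 * (j + 2) by ring,
          hz _ (by omega), mul_zero, mul_zero]
    | vertex3 i =>
      simp only [graphPiece, mul_assoc]
      rcases lt_or_ge j i with hj | hj
      · rw [e_c_lt (by omega), e_c_lt (by omega), e_c_lt (by omega), hz j (by omega), mul_zero,
          mul_zero, mul_zero]
      · rw [e_c_le (by omega), e_c_le (by omega), e_c_le (by omega),
          show 2 * j + 2 + 2 + 2 = 2 * (j + 3) by ring, hz _ (by omega), mul_zero, mul_zero,
              mul_zero]
    | cap i =>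
      simp only [graphPiece, mul_assoc]
      rcases lt_trichotomy j i with hj | rfl | hj
      · rw [e_bar_comm (by omega), e_a_lt (by omega), e_a_lt (by omega), hz j (by omega), mul_zero,
          mul_zero, mul_zero]
      · rw [e_bar hd]
      · rw [e_bar_comm (by omega)]
        obtain rfl | hj := eq_or_lt_of_le (Nat.succ_le_of_lt hj)
        -- A cut at the right end of the strip is moved through the maximum to its left end, where
        -- the bar annihilates it.
        · rw [Nat.succ_eq_add_one, show 2 * (i + 1) = 2 * i + 1 + 1 by ring, e_a_succ, a_a,
            ← e_a_pred (2 * i) (T.a (2 * i) * z), bar_e hd]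
        · obtain ⟨k, rfl⟩ : ∃ k, j = k + 2 := ⟨j - 2, by omega⟩
          rw [show 2 * (k + 2) = 2 * k + 2 + 2 by ring, e_a_le (by omega), e_a_le (by omega),
            hz k (by omega), mul_zero, mul_zero, mul_zero]
    | vertex4 i =>
      simp only [graphPiece, mul_assoc]
      by_cases h2 : j = i
      · subst h2; rw [e_bar hd]
      rw [e_bar_comm (by omega)]
      by_cases h3 : j = i + 1
      · subst h3; rw [show 2 * (i + 1) = 2 * i + 2 by ring, e_bar hd, mul_zero]
      rw [e_bar_comm (by omega)]
      rcases lt_or_ge j i with hj | hj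
      · rw [e_a_lt (by omega), e_c_lt (by omega), hz j (by omega)]; simp only [mul_zero]
      · obtain ⟨k, rfl⟩ : ∃ k, j = k + 1 := ⟨j - 1, by omega⟩
        rw [show 2 * (k + 1) = 2 * k + 2 by ring, e_a_le (by omega), e_c_le (by omega),
          show 2 * k + 2 = 2 * (k + 1) by ring, hz _ (by omega)]
        simp only [mul_zero]

theorem bar_mul {m : ℕ} {z : R} (h : T.e m * z = 0) (δ : K) :
    (1 + δ • (T.a m * T.c m)) * z = z := by
  rw [← e_eq, add_mul, one_mul, smul_mul_assoc, h, smul_zero, add_zero]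

theorem mul_bar {m : ℕ} {y : R} (h : y * T.e m = 0) (δ : K) (z : R) :
    y * ((1 + δ • (T.a m * T.c m)) * z) = y * z := by
  rw [← mul_assoc, ← e_eq, mul_add, mul_one, mul_smul_comm, h, smul_zero, add_zero]

/-- The skein relation of doubled strands with bars. -/
theorem cable_skein (hA : A ≠ 0) (p : Bool) (i : ℕ) {y z : R} (y0 : y * T.e i = 0)
    (y2 : y * T.e (i + 2) = 0) (z0 : T.e i * z = 0) (z2 : T.e (i + 2) * z = 0) :
    y * (T.x p (i + 1) * (T.x p i * (T.x p (i + 2) * (T.x p (i + 1) * z)))) =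
      (if p then A else A⁻¹) ^ 4 • (y * z) + (if p then A⁻¹ else A) ^ 4 •
        (y * (T.a (i + 1) * (T.a i * (T.c i * (T.c (i + 1) * z))))) +
        (-loopValue A) • (y * (T.a (i + 1) * (T.c (i + 1) * z))) := by
  simp only [x_eq]
  obtain ⟨b, hb⟩ : ∃ b, b = if p then A else A⁻¹ := ⟨_, rfl⟩
  obtain ⟨c, hc⟩ : ∃ c, c = if p then A⁻¹ else A := ⟨_, rfl⟩
  -- Both types of crossings are treated together; only b c = 1 and d = -b² - c² are used. Of the
  -- sixteen terms of the product those with a cut next to `y` or `z` vanish.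
  have hbc : b * c = 1 := by subst hb hc; cases p <;> simp [hA]
  have hd : loopValue A = -b ^ 2 - c ^ 2 := by subst hb hc; cases p <;> simp [loopValue]; ring
  rw [← hb, ← hc]
  have t0 : ∀ w, y * (T.e i * w) = 0 := fun w => by rw [← mul_assoc, y0, zero_mul]
  have t2 : ∀ w, y * (T.e (i + 2) * w) = 0 := fun w => by rw [← mul_assoc, y2, zero_mul]
  have e11 : ∀ w, T.e (i + 1) * (T.e (i + 1) * w) = loopValue A • (T.e (i + 1) * w) := fun w => by
    rw [← mul_assoc, e_mul_e, smul_mul_assoc]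
  have e101 : ∀ w, T.e (i + 1) * (T.e i * (T.e (i + 1) * w)) = T.e (i + 1) * w := fun w => by
    rw [e_eq T (i + 1)]
    simp only [mul_assoc]
    rw [e_a_pred, ← mul_assoc (T.c (i + 1)), zag_at, one_mul]
  have e121 : ∀ w, T.e (i + 1) * (T.e (i + 2) * (T.e (i + 1) * w)) = T.e (i + 1) * w := fun w => by
    rw [e_eq T (i + 1)]
    simp only [mul_assoc]
    rw [show i + 2 = i + 1 + 1 by ring, e_a_succ, ← mul_assoc (T.c (i + 1)), zig_at, one_mul]
  have e1021 : ∀ w, T.e (i + 1) * (T.e i * (T.e (i + 2) * (T.e (i + 1) * w))) =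
      T.a (i + 1) * (T.a i * (T.c i * (T.c (i + 1) * w))) := fun w => by
    have h1 : T.c i * T.a (i + 2) = T.a i * T.c i := (T.mv_c i 0 _).symm
    rw [e_eq T (i + 1), mul_assoc (T.a (i + 1)) _ w, show i + 2 = i + 1 + 1 by ring, e_a_succ,
        e_eq T i]
    simp only [mul_assoc]
    rw [← mul_assoc (T.c (i + 1)) (T.a i), zag_at, one_mul, ← mul_assoc (T.c i)]
    rw [h1, mul_assoc]
  simp only [add_mul, mul_add, smul_mul_assoc, mul_smul_comm, one_mul, z0, z2, mul_zero, smul_zero,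
    add_zero, zero_add, t0, t2, e11, e101, e121, e1021, smul_add, smul_smul]
  rw [← mul_assoc (T.a (i + 1)) (T.c (i + 1)) z, ← e_eq, hd]
  match_scalars
  · ring
  · linear_combination (2 * b ^ 2 + 2 * c ^ 2 + (-b ^ 2 - c ^ 2) * (b * c + 1)) * hbc
  · ring

/-- The states of a diagram fit above the same row as the diagram. -/
theorem _root_.ThetaCurve.yamadaStates_fits [DecidableEq C] : ∀ (D : Diagram C)
    (l : List (Strand C)), run l D = some [] → ∀ s ∈ yamadaStates D, GraphFits l.length s.2 ∧
      count3 s.2 = (vertexList D).length := by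
  intro D
  induction D with
  | nil =>
    intro l h s hs
    cases h
    obtain rfl : s = (0, []) := by simpa [yamadaStates] using hs
    exact ⟨rfl, rfl⟩
  | cons g D ih =>
    intro l hr s hs
    rw [run_cons] at hr
    obtain ⟨l1, h1, h2⟩ := bind_eq_some_iff.1 hr
    have h3 := ih _ h2
    have h4 := step_bound h1
    have h5 := step_length h1
    cases g with simp only [Piece.pos, Piece.ins, Piece.outs] at h4 h5
    | cup i t =>
      obtain ⟨t, ht, rfl⟩ := mem_map.1 hs
      have h6 := h3 t ht
      refine ⟨⟨by omega, ?_⟩, h6.2⟩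
      rw [show l.length + 2 = l1.length by omega]; exact h6.1
    | cap i =>
      obtain ⟨t, ht, rfl⟩ := mem_map.1 hs
      have h6 := h3 t ht
      refine ⟨⟨by omega, ?_⟩, h6.2⟩
      rw [show l.length - 2 = l1.length by omega]; exact h6.1
    | vertex i o a b c =>
      obtain ⟨t, ht, rfl⟩ := mem_map.1 hs
      have h6 := h3 t ht
      refine ⟨⟨by omega, ?_⟩, congrArg (· + 1) h6.2⟩
      rw [show l.length + 3 = l1.length by omega]; exact h6.1
    | cross i p =>
      have key : ∃ t ∈ yamadaStates D, s.2 = t.2 ∨ s.2 = .cap i :: .cup i :: t.2 ∨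
          s.2 = .vertex4 i :: t.2 := by
        cases p <;>
        · simp only [yamadaStates, mem_flatMap, mem_cons, not_mem_nil, or_false] at hs
          obtain ⟨t, ht, rfl | rfl | rfl⟩ := hs <;> exact ⟨t, ht, by simp⟩
      obtain ⟨t, ht, h⟩ := key
      have h6 := h3 t ht
      rw [show l1.length = l.length by omega] at h6
      rcases h with h | h | h <;> rw [h]
      · exact h6
      · refine ⟨⟨by omega, by omega, ?_⟩, h6.2⟩
        rw [show l.length - 2 + 2 = l.length by omega]; exact h6.1
      · exact ⟨⟨by omega, h6.1⟩, h6.2⟩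

theorem step_value {C : Type} [DecidableEq C] {l l1 : List (Strand C)} {g : Piece C} (h : step l g = some l1) :
    (T.cabled fun _ : C => true).sh g.pos ((T.cabled fun _ : C => true).op l g) =
      T.bandWord (barPiece g) := by
  have := T.bandWord_bar [g] l l1 (by rw [run_cons, h]; rfl)
  rw [Ops.ev_cons _ h] at this
  simpa [Ops.ev] using this.symm

theorem bar_eq (i : ℕ) : T.bandPiece (.bar i) = 1 + (-(loopValue A)⁻¹) • (T.a i * T.c i) := by
  rw [← e_eq, bandPiece, pr, if_pos rfl, map_sub, map_one, map_smul, e, e, ← mv_add, add_zero,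
    sub_eq_add_neg, neg_smul]

/-- At a crossing `cable_skein` applies because cuts are annihilated from below by the projectors in
`y` and from above by the value of the state (`e_graphProd`). For the same reason bars can be added
or dropped where `barPiece` and `graphPiece` place them differently. -/
theorem yamadaStates_spec [DecidableEq C] (hA : A ≠ 0) (hd : loopValue A ≠ 0) : ∀ (D : Diagram C)
    (l : List (Strand C)), run l D = some [] → ∀ y : R, (T.cabled fun _ => true).Absorbs l y →
      y * (T.cabled fun _ => true).ev l D = ((yamadaStates D).map fun s =>
        ((A ^ 4) ^ s.1 * (-loopValue A) ^ count4 s.2) •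
          (y * graphProd T.c T.a (-(loopValue A)⁻¹) s.2)).sum := by
  intro D
  induction D with
  | nil => intro l h y _; simp [yamadaStates, Ops.ev, graphProd, count4]
  | cons g D ih =>
    intro l hr y hy
    rw [run_cons] at hr
    obtain ⟨l1, h1, h2⟩ := bind_eq_some_iff.1 hr
    have hfit := yamadaStates_fits D l1 h2
    have h4 := step_bound h1
    have h5 := step_length h1
    have hk : ∀ s ∈ yamadaStates D, ∀ j < l1.length, T.e (2 * j) *
        graphProd T.c T.a (-(loopValue A)⁻¹) s.2 = 0 := fun s hs =>
      e_graphProd hd s.2 (hfit s hs).1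
    -- Since `y` absorbs the non-trivial projector, and this projector annihilates the cut.
    have hy' : ∀ j < l.length, y * T.e (2 * j) = 0 := by
      intro j hj
      have := hy j (l[j]) (by simp [hj])
      rw [cabled_sh] at this
      rw [← this, mul_assoc]
      have h6 := bar_e (T := T) hd (2 * j) 1
      rw [← bar_eq, mul_one] at h6
      exact (congrArg (y * ·) h6).trans (mul_zero y)
    have e2 : ∀ i, T.bandPiece (.link (.cup i)) = T.c i := by
      intro i; simp [bandPiece, Ops.piece, single, Ops.sh, TL.c, mv]
    have e3 : ∀ i, T.bandPiece (.link (.cap i)) = T.a i := by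
      intro i; simp [bandPiece, Ops.piece, single, Ops.sh, TL.a, mv]
    have e4 : ∀ i p, T.bandPiece (.link (.cross i p)) = T.x p i := by
      intro i p; simp [bandPiece, Ops.piece, single, Ops.sh, TL.x, mv]
    rw [Ops.ev_cons _ h1, ← mul_assoc,
      ih l1 h2 _ ((cabled_projective hA hd _).absorbs_step h1 hy), step_value h1]
    cases g with simp only [Piece.pos, Piece.ins, Piece.outs] at h4 h5
    | cup i t =>
      rw [yamadaStates, map_map]
      congr 1
      refine map_congr_left fun s hs => ?_
      simp only [Function.comp_apply, graphProd_cons, graphPiece, count4, barPiece, bandWord,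
        map_cons, map_nil, prod_cons, prod_nil, mul_one, e2, bar_eq, mul_assoc]
      rw [bar_mul (hk s hs i (by omega))]
    | cap i =>
      rw [yamadaStates, map_map]
      congr 1
      refine map_congr_left fun s hs => ?_
      simp only [Function.comp_apply, graphProd_cons, graphPiece, count4, barPiece, bandWord,
        map_cons, map_nil, prod_cons, prod_nil, mul_one, e3, bar_eq, mul_assoc]
      rw [mul_bar (hy' i (by omega))]
    | vertex i o a b c =>
      rw [yamadaStates, map_map]
      congr 1
      refine map_congr_left fun s hs => ?_
      simp only [Function.comp_apply, graphProd_cons, graphPiece, count4, barPiece, bandWord,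
        map_cons, map_nil, prod_cons, prod_nil, mul_one, e2, bar_eq, mul_assoc,
        cons_append, nil_append]
      rw [bar_mul (m := 2 * i + 4) (hk s hs (i + 2) (by omega)),
        bar_mul (m := 2 * i + 2) (hk s hs (i + 1) (by omega)), bar_mul (hk s hs i (by omega))]
    | cross i p =>
      have key : ∀ s ∈ yamadaStates D, y * (T.bandWord (barPiece (.cross i p : Piece C)) *
          graphProd T.c T.a (-(loopValue A)⁻¹) s.2) =
          (if p then A else A⁻¹) ^ 4 • (y * graphProd T.c T.a (-(loopValue A)⁻¹) s.2) +
          (if p then A⁻¹ else A) ^ 4 •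
            (y * graphProd T.c T.a (-(loopValue A)⁻¹) (.cap i :: .cup i :: s.2)) +
          (-loopValue A) • (y * graphProd T.c T.a (-(loopValue A)⁻¹) (.vertex4 i :: s.2)) := by
        intro s hs
        have z0 := hk s hs i (by omega)
        have z2 : T.e (2 * i + 2) * _ = 0 := hk s hs (i + 1) (by omega)
        have y0 := hy' i (by omega)
        have y2 : y * T.e (2 * i + 2) = 0 := hy' (i + 1) (by omega)
        simp only [graphProd_cons, graphPiece, count4, barPiece, bandWord,
          map_cons, map_nil, prod_cons, prod_nil, mul_one, e4, bar_eq, mul_assoc]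
        rw [bar_mul z2, bar_mul z0, mul_bar y0, mul_bar y0, mul_bar y2]
        exact cable_skein hA p (2 * i) y0 y2 z0 z2
      have hA4 : A ^ 4 ≠ 0 := pow_ne_zero 4 hA
      cases p
      · rw [yamadaStates, sum_flatMap_three]
        congr 1
        refine map_congr_left fun s hs => ?_
        rw [mul_assoc, key s hs]
        simp only [false_eq_true, if_false, count4, smul_add, smul_smul, zpow_add₀ hA4,
          zpow_sub₀ hA4, zpow_one, pow_succ (-loopValue A), inv_pow]
        rw [add_comm (_ • (y * graphProd _ _ _ s.2))]
        congr 1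
        · congr 1 <;> · congr 1; ring
        · congr 1; ring
      · rw [yamadaStates, sum_flatMap_three]
        congr 1
        refine map_congr_left fun s hs => ?_
        rw [mul_assoc, key s hs]
        simp only [if_true, count4, smul_add, smul_smul, zpow_add₀ hA4,
          zpow_sub₀ hA4, zpow_one, pow_succ (-loopValue A), inv_pow]
        congr 1
        · congr 1 <;> · congr 1; ring
        · congr 1; ring

theorem yamada_value [DecidableEq C] (hA : A ≠ 0) (hd : loopValue A ≠ 0) (f : R →ₗ[K] K)
    (hf : f 1 = 1) {D : Diagram C} (hD : Closed D) (h3 : (vertexList D).length = 2) :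
    yamada (A ^ 4) D = -loopValue A * f ((T.cabled fun _ => true).ev [] D) := by
  have h := yamadaStates_spec (T := T) hA hd D [] hD 1 (by intro j x hx; simp at hx)
  rw [one_mul] at h
  -- The skein relation has the coefficients A⁴ and A⁻⁴, and d² = A⁴ + 2 + A⁻⁴; so the Yamada
  -- polynomial is to be taken at A⁴.
  have hy : -(A ^ 4) - 2 - (A ^ 4)⁻¹ = -loopValue A ^ 2 := by
    simp only [loopValue]; field_simp; ring
  rw [h, map_list_sum, ← sum_map_mul_left, map_map, yamada]
  congr 1
  refine map_congr_left fun s hs => ?_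
  have hs' := yamadaStates_fits D [] hD s hs
  have hv : f (graphProd T.c T.a (-(loopValue A)⁻¹) s.2) = _ :=
    graphProd_value (d :=
        loopValue A) (fun w hw hc => linkProd_value _ _ f hf (fun i => T.loop_at i)
      (fun i => T.zig_at i) (fun i => T.zag_at i)
      (fun i j hij => by
        obtain ⟨k, rfl⟩ := exists_eq_add_of_le hij
        exact (T.ac j k).symm)
      (fun i j hij => by
        obtain ⟨k, rfl⟩ := exists_eq_add_of_le hij
        exact T.ca i k) hw hc) (-(loopValue A)⁻¹) hs'.1
  simp only [Function.comp_apply, one_mul, map_smul, smul_eq_mul]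
  rw [hv, hy, h_eq hs'.1 (hs'.2.trans h3) hd, pow_add, pow_one]
  ring

end TL

/-! ### The substitution of A⁴ for A and the conclusion -/

theorem Multigraph.h_map {K L : Type} [Field K] [Field L] (φ : K →+* L) (G : Multigraph) (x y : K) :
    φ (G.h x y) = G.h (φ x) (φ y) := by
  simp [Multigraph.h, map_sum, map_zpow₀]

/-- Applied to the endomorphism A ↦ A⁴, this passes from the polynomial at A to the one at A⁴, which
is the one that the doubled strands compute. -/
theorem normalizedYamada_map {K L : Type} [Field K] [Field L] (φ : K →+* L) (A : K)
    (D : Diagram (Fin 3)) : φ (normalizedYamada A D) = normalizedYamada (φ A) D := by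
  simp only [normalizedYamada, yamada, map_mul, map_zpow₀, map_list_sum, map_map, map_neg]
  congr 2
  refine map_congr_left fun s _ => ?_
  simp [Multigraph.h_map, map_zpow₀, map_ofNat φ 2]

/-- At A⁴ both normalizations are the same power of -A⁴, and the two polynomials are -d and d⁻¹
times one and the same value. -/
theorem TL.normalizedYamada_eq {K R : Type} [Field K] [Ring R] [Algebra K R] {A : K} (T : TL R A)
    (hA : A ≠ 0) (h2 : A + A⁻¹ ≠ 0) (h4 : 1 + A ^ 4 ≠ 0) (hd : loopValue A ≠ 0) (f : R →ₗ[K] K)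
    (hf : f 1 = 1) {D : Diagram (Fin 3)} (hD : IsTheta D) :
    normalizedYamada (A ^ 4) D = -loopValue A ^ 2 * normalizedJaeger A D := by
  obtain ⟨r, r', -, -, h⟩ := hD.2.1
  rw [normalizedYamada, normalizedJaeger, TL.yamada_value (T := T) hA hd f hf hD.1 (by
    rw [h.length_eq]; rfl), TL.jaeger_value (T := T) hA h2 h4 hd f hf hD.1]
  field_simp

/-- The endomorphism of the field of rational functions that maps `X` to `X ^ 4`. -/
noncomputable def expandFour : RatFunc ℚ →+* RatFunc ℚ :=
  IsFractionRing.lift (A := Polynomial ℚ)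
    (g := (algebraMap (Polynomial ℚ) (RatFunc ℚ)).comp (Polynomial.expand ℚ 4).toRingHom)
    ((RatFunc.algebraMap_injective ℚ).comp (Polynomial.expand_injective (by norm_num)))

theorem expandFour_X : expandFour RatFunc.X = RatFunc.X ^ 4 := by
  rw [expandFour, ← RatFunc.algebraMap_X, IsFractionRing.lift_algebraMap]
  simp

theorem ratFunc_ne_zero {n : ℕ} (hn : n ≠ 0) : (1 : RatFunc ℚ) + RatFunc.X ^ n ≠ 0 := by
  have h : (1 : RatFunc ℚ) + RatFunc.X ^ n =
      algebraMap (Polynomial ℚ) (RatFunc ℚ) (1 + Polynomial.X ^ n) := by simp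
  rw [h]
  refine RatFunc.algebraMap_ne_zero fun h0 => ?_
  have := congrArg (Polynomial.eval 0) h0
  simp [hn] at this

theorem loopValue_X_ne_zero : loopValue (RatFunc.X : RatFunc ℚ) ≠ 0 := by
  intro h
  have hX := RatFunc.X_ne_zero (K := ℚ)
  refine ratFunc_ne_zero (n := 4) (by norm_num) ?_
  have : RatFunc.X ^ 2 * loopValue (RatFunc.X : RatFunc ℚ) = -(1 + RatFunc.X ^ 4) := by
    simp only [loopValue]; field_simp; ring
  rw [h, mul_zero] at this
  exact neg_eq_zero.1 this.symm

theorem X_add_inv_ne_zero : (RatFunc.X : RatFunc ℚ) + RatFunc.X⁻¹ ≠ 0 := by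
  intro h
  have hX := RatFunc.X_ne_zero (K := ℚ)
  refine ratFunc_ne_zero (n := 2) (by norm_num) ?_
  have : RatFunc.X * ((RatFunc.X : RatFunc ℚ) + RatFunc.X⁻¹) = 1 + RatFunc.X ^ 2 := by
    field_simp; ring
  rw [← this, h, mul_zero]

end ThetaCurve

theorem corollary1 :
    (∀ D L : Diagram (Fin 3), IsBrunnian D → IsAssociatedLink D L →
      normalizedJaeger (RatFunc.X : RatFunc ℚ) D - jones (RatFunc.X : RatFunc ℚ) L =
        -3 + 2 / ((RatFunc.X : RatFunc ℚ) ^ 2 + (RatFunc.X : RatFunc ℚ)⁻¹ ^ 2) ^ 2) ∧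
    (∀ D L D' L' : Diagram (Fin 3), IsBrunnian D → IsAssociatedLink D L →
      IsBrunnian D' → IsAssociatedLink D' L' →
      (normalizedYamada (RatFunc.X : RatFunc ℚ) D = normalizedYamada (RatFunc.X : RatFunc ℚ) D' ↔
        jones (RatFunc.X : RatFunc ℚ) L = jones (RatFunc.X : RatFunc ℚ) L')) := by
  have hX := RatFunc.X_ne_zero (K := ℚ)
  have hd := loopValue_X_ne_zero
  have h4 := ratFunc_ne_zero (n := 4) (by norm_num)
  have key := fun D L hD hL => TL.jones_associatedLink hX hd (streamValue true)
    (streamValue_one true) X_add_inv_ne_zero h4 (vertexModel hX) (D := D) (L := L) hD hL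
  have hY := fun D (hD : IsTheta D) => TL.normalizedYamada_eq (vertexModel hX) hX
    X_add_inv_ne_zero h4 hd (streamValue true) (streamValue_one true) hD
  refine ⟨fun D L hD hL => ?_, fun D L D' L' hD hL hD' hL' => ?_⟩
  -- As φ = -d, the squares agree.
  · rw [key D L hD hL, show ((RatFunc.X : RatFunc ℚ) ^ 2 + (RatFunc.X : RatFunc ℚ)⁻¹ ^ 2) ^ 2 =
      loopValue (RatFunc.X : RatFunc ℚ) ^ 2 by simp only [loopValue]; ring]
    ring
  -- Equality of the Jones polynomials is equality of the normalized Jaeger polynomials. Equality of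
  -- the Yamada polynomials may be tested after the injective substitution A ↦ A⁴, where they are
  -- the Jaeger polynomials times the nonzero factor -d².
  · rw [key D L hD hL, key D' L' hD' hL', sub_left_inj, add_left_inj,
      ← expandFour.injective.eq_iff, normalizedYamada_map, normalizedYamada_map, expandFour_X,
      hY D hD.1, hY D' hD'.1]
    exact mul_right_inj' (neg_ne_zero.2 (pow_ne_zero 2 hd))
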